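/- Let $n\ge 1$, $s\in(0,1)$ and $\Lambda\ge\lambda>0$. Let $K\in L^1_{\rm loc}(\mathbb R^n\setminus\{0\})$ be nonnegative and positively homogeneous of degree $-n-2s$, and let $b\in\mathbb R^n$, with $$\lambda\le \inf_{\nu\in S^{n-1}}\int_{S^{n-1}}|\nu\cdot\theta|^{2s}K(\theta)\,d\theta,\qquad \int_{S^{n-1}}K(\theta)\,d\theta\le\Lambda ,$$ and, if $s=\frac12$, also $\int_{S^{n-1}}\theta\,K(\theta)\,d\theta=0$ and $|b|\le\Lambda$. Let $L$ be the operator $$Lw(x)=\begin{cases}\displaystyle\int_{\mathbb R^n}\big(w(x)-w(x+y)\big)K(y)\,dy & \text{if } s<\frac12,\\[2mm] \displaystyle\mathrm{P.V.}\!\int_{\mathbb R^n}\big(w(x)-w(x+y)\big)K(y)\,dy+b\cdot\nabla w(x) & \text{if } s=\frac12,\\[2mm] \displaystyle\int_{\mathbb R^n}\big(w(x)-w(x+y)+\nabla w(x)\cdot y\big)K(y)\,dy & \text{if } s>\frac12,\end{cases}$$ and let $L^*$ be its adjoint, which is the operator of the same form with kernel $K(-y)$ and drift $-b$. Let $u\in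 L^\infty(\mathbb R^n)$ be a weak solution of $Lu=f$ in $B_1$, with $f\in L^\infty(B_1)$; that is, $\int_{\mathbb R^n}u\,L^*\eta\,dx=\int_{B_1}f\,\eta\,dx$ for every $\eta\in C^\infty_c(B_1)$. Then the following holds. (a) If $f\in L^\infty(B_1)$, then $$\|u\|_{C^{2s}(B_{1/2})}\le C\big(\|u\|_{L^\infty(\mathbb R^n)}+\|f\|_{L^\infty(B_1)}\big)\quad\text{if } s\ne\tfrac12,$$ $$\|u\|_{\Lambda^{1}(B_{1/2})}\le C\big(\|u\|_{L^\infty(\mathbb R^n)}+\|f\|_{L^\infty(B_1)}\big)\quad\text{if } s=\tfrac12 .$$ In particular, $u\in C^{2s-\varepsilon}(B_{1/2})$ for all $\varepsilon\in(0,2s)$. (b) If $f\in C^\alpha(B_1)$ for some $\alpha>0$ such that $\alpha+2s$ is not an integer, then $$\|u\|_{C^{\alpha+2s}(B_{1/2})}\le C\big(\|u\|_{C^\alpha(\mathbb R^n)}+\|f\|_{C^\alpha(B_1)}\big).$$ (c) If $f\in C^\alpha(B_1)$ for some $\alpha>0$ such that $\alpha+2s$ is not an integer, and in addition $K\in C^\alpha(S^{n-1})$,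 then $$\|u\|_{C^{\alpha+2s}(B_{1/2})}\le C\big(\|u\|_{L^\infty(\mathbb R^n)}+\|f\|_{C^\alpha(B_1)}\big).$$ The constant $C$ depends only on $n,s,\lambda,\Lambda$ in (a), only on $n,s,\alpha,\lambda,\Lambda$ in (b), and only on $n,s,\alpha,\lambda,\Lambda$ and (an upper bound for) $\|K\|_{C^\alpha(S^{n-1})}$ in (c). Here $B_r$ is the open ball of radius $r$ centred at $0$; in (a) and (c) the function $u$ is identified in $B_{1/2}$ with a representative of its a.e. class. For $\beta>0$ with $k=\lfloor\beta\rfloor$ and $U$ open, $\|w\|_{C^\beta(U)}=\sum_{j\le k}\sup_U|D^jw|+\sup_{x\neq y\in U}\frac{|D^kw(x)-D^kw(y)|}{|x-y|^{\beta-k}}$ (equal to $\infty$ if $w\notin C^k(U)$); $\|K\|_{C^\beta(S^{n-1})}$ is the $C^\beta$ norm in $\{\frac12<|y|<2\}$ of $y\mapsto K(y/|y|)$; and $\|w\|_{\Lambda^1(U)}=\sup_{x,x\pm h\in U,\,h\ne0}\frac{|w(x+h)+w(x-h)-2w(x)|}{|h|}+\sup_U|w|$. -/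

import Mathlib

open MeasureTheory Set Filter Topology
open scoped ENNReal NNReal ContDiff

noncomputable section

/-- The full Hölder norm `‖w‖_{C^β(U)}`, with values in `[0,∞]`, of a function `w` on an open set
`U`, for a real order `β ≥ 0`. With `k = ⌊β⌋` and `γ = β - k ∈ [0,1)` it is
`∑_{j ≤ k} sup_U |D^j w| + sup_{x,y ∈ U} |D^k w(x) - D^k w(y)| / |x - y|^γ`,
and it is `∞` if `w` is not `k` times continuously differentiable in `U`. Only the values of `w`
in `U` matter, as `U` is open. For `β = k` an integer, the last term is at most twice
`sup_U |D^k w|`, so that this is (up to equivalence) the usual norm of `C^k(U)`. -/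
def holderNorm {E : Type*} [NormedAddCommGroup E] [NormedSpace ℝ E]
    (β : ℝ) (U : Set E) (w : E → ℝ) : ℝ≥0∞ :=
  open Classical in
  if ContDiffOn ℝ (⌊β⌋₊ : ℕ) w U then
    (∑ j ∈ Finset.range (⌊β⌋₊ + 1), ⨆ x ∈ U, ‖iteratedFDeriv ℝ j w x‖ₑ) +
      ⨆ x ∈ U, ⨆ y ∈ U,
        ‖iteratedFDeriv ℝ ⌊β⌋₊ w x - iteratedFDeriv ℝ ⌊β⌋₊ w y‖ₑ /
          ‖x - y‖ₑ ^ (β - (⌊β⌋₊ : ℝ))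
  else ⊤

/-- The Zygmund norm `‖w‖_{Λ^1(U)}`, the sum of
`sup |w(x+h) + w(x-h) - 2 w(x)| / |h|` over `x, x + h, x - h ∈ U` and of `sup_U |w|`. -/
def zygmundNorm {E : Type*} [NormedAddCommGroup E] [NormedSpace ℝ E]
    (U : Set E) (w : E → ℝ) : ℝ≥0∞ :=
  (⨆ (x : E) (h : E) (_ : x ∈ U) (_ : x + h ∈ U) (_ : x - h ∈ U),
      ‖w (x + h) + w (x - h) - 2 * w x‖ₑ / ‖h‖ₑ) +
    ⨆ x ∈ U, ‖w x‖ₑ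

/-- The norm `‖g‖_{C^β(S^{n-1})}` of the restriction of `g` to the unit sphere: the `C^β` norm,
in the annulus `1/2 < |y| < 2`, of the extension of that restriction which is constant along
rays. -/
def sphereHolderNorm {E : Type*} [NormedAddCommGroup E] [NormedSpace ℝ E]
    (β : ℝ) (g : E → ℝ) : ℝ≥0∞ :=
  holderNorm β {y : E | 1 / 2 < ‖y‖ ∧ ‖y‖ < 2} (fun y => g (‖y‖⁻¹ • y))

/-- The kernel `K` and the drift `b` define a stable operator of order `2s` in `ℝⁿ` with
ellipticity constants `lam` and `Lam`. The measure on the unit sphere is the surface measure (the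
counting measure if `n = 1`). -/
structure IsStableData (n : ℕ) (s lam Lam : ℝ) (K : EuclideanSpace ℝ (Fin n) → ℝ)
    (b : EuclideanSpace ℝ (Fin n)) : Prop where
  locInt : LocallyIntegrableOn K {0}ᶜ volume
  nonneg : ∀ y, y ≠ 0 → 0 ≤ K y
  homog : ∀ t : ℝ, 0 < t → ∀ y, y ≠ 0 → K (t • y) = t ^ (-(n : ℝ) - 2 * s) * K y
  lower : ∀ ν : EuclideanSpace ℝ (Fin n), ‖ν‖ = 1 →
    lam ≤ ∫ θ : Metric.sphere (0 : EuclideanSpace ℝ (Fin n)) 1,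
      |inner ℝ ν (θ : EuclideanSpace ℝ (Fin n))| ^ (2 * s) * K θ
        ∂(volume : Measure (EuclideanSpace ℝ (Fin n))).toSphere
  upper : ∫ θ : Metric.sphere (0 : EuclideanSpace ℝ (Fin n)) 1, K θ
      ∂(volume : Measure (EuclideanSpace ℝ (Fin n))).toSphere ≤ Lam
  cancel : s = 1 / 2 →
    ∫ θ : Metric.sphere (0 : EuclideanSpace ℝ (Fin n)) 1, K θ • (θ : EuclideanSpace ℝ (Fin n))
      ∂(volume : Measure (EuclideanSpace ℝ (Fin n))).toSphere = 0
  drift : s = 1 / 2 → ‖b‖ ≤ Lam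

/-- The operator `L` of order `2s` with kernel `K` and drift `b`, evaluated at a regular function
`w`; for `s = 1/2` the integral is a principal value. Here `fderiv ℝ w x y = ∇w(x)·y`. -/
def stableOp {n : ℕ} (s : ℝ) (K : EuclideanSpace ℝ (Fin n) → ℝ) (b : EuclideanSpace ℝ (Fin n))
    (w : EuclideanSpace ℝ (Fin n) → ℝ) (x : EuclideanSpace ℝ (Fin n)) : ℝ :=
  open Classical in
  if s < 1 / 2 then ∫ y, (w x - w (x + y)) * K y
  else if s = 1 / 2 then
    limUnder (𝓝[>] (0 : ℝ)) (fun ε => ∫ y in {y | ε < ‖y‖}, (w x - w (x + y)) * K y) +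
      fderiv ℝ w x b
  else ∫ y, (w x - w (x + y) + fderiv ℝ w x y) * K y

/-- The adjoint operator `L^*`: the kernel is `K^*(y) = K_e(y) - K_o(y) = K(-y)`, the drift `-b`. -/
def stableOpAdjoint {n : ℕ} (s : ℝ) (K : EuclideanSpace ℝ (Fin n) → ℝ)
    (b : EuclideanSpace ℝ (Fin n)) (w : EuclideanSpace ℝ (Fin n) → ℝ) :
    EuclideanSpace ℝ (Fin n) → ℝ :=
  stableOp s (fun y => K (-y)) (-b) w

/-- `L u = f` in the open set `Ω` in the weak sense (for `u` bounded in `ℝⁿ` and `f` bounded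
in `Ω`): `∫ u L^*η = ∫_Ω f η` for all `η ∈ C_c^∞(Ω)`. -/
def IsWeakSolution {n : ℕ} (s : ℝ) (K : EuclideanSpace ℝ (Fin n) → ℝ)
    (b : EuclideanSpace ℝ (Fin n)) (Ω : Set (EuclideanSpace ℝ (Fin n)))
    (u f : EuclideanSpace ℝ (Fin n) → ℝ) : Prop :=
  ∀ η : EuclideanSpace ℝ (Fin n) → ℝ, ContDiff ℝ ∞ η → HasCompactSupport η → tsupport η ⊆ Ω →
    ∫ x, u x * stableOpAdjoint s K b η x = ∫ x in Ω, f x * η x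

end

noncomputable section

/-! ### Polar coordinates: from conditions on the sphere to volume integrals of the kernel. -/

section Polar

open Module

variable {E : Type*} [NormedAddCommGroup E] [InnerProductSpace ℝ E] [FiniteDimensional ℝ E]
  [MeasurableSpace E] [BorelSpace E]

/-! The proof builds an exact parametrix at each frequency scale, tests the equation with it, and
converts the resulting bounds on frequency blocks into Hölder regularity.

Parametrix. Let `A` be the Fourier symbol of the operator that falls on the test functions. For a
smooth amplitude `a` supported in `1 ≤ |ξ| ≤ 4`, the function `φ = Re 𝓕(a / A)` is mapped by the
operator to `ψ = Re 𝓕 a`. What has to be shown is that `φ` decays: `∫ (1 + |z|^s) |φ| ≤ C`. Since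
`K` is only integrable on the sphere, `A` has little smoothness. Write `A = g - 𝓕 k`, with `k` the
kernel outside the unit ball. Then `g` is smooth, because the oscillation in it only involves `|y| <
1`, and `k` has a finite mass and a finite moment of order `s`. Ellipticity gives `Re g ≥ ‖k‖₁ + c`
on the annulus, so `a / A = ∑ (𝓕 k)^j a / g^(j+1)` converges geometrically. The derivatives of
`g^(-j-1)` cost a power of `j`, and multiplication by `𝓕 k` becomes a correlation with `k` after
transforming, so the weighted `L¹` norms are summable (`exists_symbol_quotient_bound`).

Blocks. The test function is `χ φ(·/r)` with a fixed cutoff `χ`. The commutator with `χ` only sees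
`|z| ≳ 1/r`, where the weight is worth a factor `r^s`, and the outcome is `|∫ U(r z) ψ(z) dz| ≤ C
r^(2s) (‖U‖ + ‖F‖)` in supremum norms (`exists_weakEq_bound`). A symmetric second difference of `U`
with step `h` is a sum of dyadic blocks, of size `r^(2s)` if `r ≤ |h|` and `r^(2s) (|h|/r)²` if `r ≥
|h|`; the sum is at most `C |h|^(2s)` (`exists_secondDiff_le`). For `s = 1/2` this is the Zygmund
estimate.

Hölder norms. Let `avg r` be the convolution with a smooth even probability density at scale `r`.
Then `(1 - avg r) U` is an average of second differences, hence `O(r^(2s))`. Conversely, if `(1 -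
avg r)^m u = O(r^β)` at small dyadic scales, telescoping the smooth approximations `1 - (1 - avg
r)^m` shows that `u` is of class `C^β` for non-integer `β` (`exists_holderNorm_le_of_approx`). This
gives (a) for `s ≠ 1/2`. A continuous representative is found by applying the estimate to averages
of the solution and passing to the limit.

Higher regularity. Averages commute with the operator, so `V = (1 - avg r)^m U` solves the equation
with right-hand side `(1 - avg r)^m F`. In (b) both are `O(r^α)`, and the basic estimate gives `(1 -
avg r)^(m+1) U = O(r^(α+2s))`. In (c) `U` is only bounded, so `V` is truncated to a ball. The tail
produces a new right-hand side in which, by symmetry of the averages, `(1 - avg r)^m` acts on the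
kernel away from the origin; Hölder continuity of `K` makes it `O(r^α)`. Each round improves the
local decay by `2s`, up to `α + 2s` (`DecayEstimate.succ`). -/

lemma lintegral_volumeIoiPow (d : ℕ) (h : ℝ → ℝ≥0∞) (hh : Measurable h) :
    ∫⁻ r, h (r : ℝ) ∂(Measure.volumeIoiPow d) = ∫⁻ r in Ioi (0 : ℝ), ENNReal.ofReal (r ^ d) * h r := by
  rw [Measure.volumeIoiPow, lintegral_withDensity_eq_lintegral_mul _ (by fun_prop) (by fun_prop),
    ← lintegral_subtype_comap measurableSet_Ioi]
  rfl

lemma lintegral_eq_lintegral_sphere_prod [Nontrivial E] (G : E → ℝ≥0∞) :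
    ∫⁻ y, G y = ∫⁻ p : Metric.sphere (0 : E) 1 × Ioi (0 : ℝ), G ((p.2 : ℝ) • (p.1 : E))
      ∂((volume : Measure E).toSphere.prod (Measure.volumeIoiPow (finrank ℝ E - 1))) := by
  have h1 := (volume : Measure E).measurePreserving_homeomorphUnitSphereProd
  have h2 := h1.lintegral_comp_emb (Homeomorph.measurableEmbedding _)
    (fun p : Metric.sphere (0 : E) 1 × Ioi (0 : ℝ) => G ((p.2 : ℝ) • (p.1 : E)))
  rw [← h2]
  have h3 : ∀ y : ({0}ᶜ : Set E), G ((((homeomorphUnitSphereProd E) y).2 : ℝ) •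
      (((homeomorphUnitSphereProd E) y).1 : E)) = G y := by
    intro y
    have hy : ‖(y : E)‖ ≠ 0 := norm_ne_zero_iff.2 y.2
    simp [smul_smul, hy]
  simp_rw [h3]
  rw [lintegral_subtype_comap (measurableSet_singleton _).compl, restrict_compl_singleton]

/-- Homogeneity of degree `-d - 2s`, where `d` is the dimension. -/
def HomogKernel (s : ℝ) (K : E → ℝ) : Prop :=
  ∀ t : ℝ, 0 < t → ∀ y, K (t • y) = t ^ (-(finrank ℝ E : ℝ) - 2 * s) * K y

/-- The sphere is a null set, so a.e. measurability does not simply restrict to it. In polar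
coordinates the homogeneity removes the radial variable: `K θ` is a.e. measurable on the product
space, and then so is almost every slice in `θ`; one slice is enough. -/
lemma aemeasurable_sphere [Nontrivial E] {s : ℝ} {K : E → ℝ} (hK : HomogKernel s K)
    (hm : AEMeasurable K volume) :
    AEMeasurable (fun θ : Metric.sphere (0 : E) 1 => K θ) (volume : Measure E).toSphere := by
  have h1 := (volume : Measure E).measurePreserving_homeomorphUnitSphereProd
  have hK1 : AEMeasurable (fun y : ({0}ᶜ : Set E) => K y) ((volume : Measure E).comap (↑)) := by
    have := hm.restrict (s := ({0}ᶜ : Set E))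
    rw [← map_comap_subtype_coe (measurableSet_singleton (0:E)).compl] at this
    exact this.comp_aemeasurable measurable_subtype_coe.aemeasurable
  have hK2 : AEMeasurable (fun p : Metric.sphere (0 : E) 1 × Ioi (0 : ℝ) =>
      K ((p.2 : ℝ) • (p.1 : E)))
      ((volume : Measure E).toSphere.prod (Measure.volumeIoiPow (finrank ℝ E - 1))) := by
    rw [← h1.aemeasurable_comp_iff (Homeomorph.measurableEmbedding _)]
    refine hK1.congr (Eventually.of_forall fun y => ?_)
    have hy : ‖(y : E)‖ ≠ 0 := norm_ne_zero_iff.2 y.2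
    simp [smul_smul, hy]
  have hK3 : AEMeasurable (fun p : Metric.sphere (0 : E) 1 × Ioi (0 : ℝ) => K (p.1 : E))
      ((volume : Measure E).toSphere.prod (Measure.volumeIoiPow (finrank ℝ E - 1))) := by
    have h4 : Measurable (fun p : Metric.sphere (0 : E) 1 × Ioi (0 : ℝ) =>
        (p.2 : ℝ) ^ (-(-(finrank ℝ E : ℝ) - 2 * s))) := by fun_prop
    refine (h4.aemeasurable.mul hK2).congr (Eventually.of_forall fun p => ?_)
    have hp : 0 < (p.2 : ℝ) := p.2.2
    simp only [Pi.mul_apply]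
    rw [hK _ hp, ← mul_assoc, ← Real.rpow_add hp, neg_add_cancel, Real.rpow_zero, one_mul]
  have hK4 := hK3.prod_swap.aestronglyMeasurable.prodMk_left
  have hne : (Measure.volumeIoiPow (finrank ℝ E - 1)) ≠ 0 := by
    intro h
    have := Measure.volumeIoiPow_apply_Iio (finrank ℝ E - 1) ⟨1, mem_Ioi.2 one_pos⟩
    rw [h] at this
    simp at this
    norm_cast at this
  have : NeZero (Measure.volumeIoiPow (finrank ℝ E - 1)) := ⟨hne⟩
  obtain ⟨r, hr⟩ := hK4.exists
  exact hr.aemeasurable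

/-- The Jacobian `r ^ (d - 1)` and the homogeneity `r ^ (-d - 2s)` combine to `r ^ (-1 - 2s)`, and
the integral splits into a radial and an angular factor. -/
lemma lintegral_polar_homog [Nontrivial E] {s : ℝ} {K : E → ℝ} (hK : HomogKernel s K)
    (hm : AEMeasurable K volume)
    (m : ℝ → ℝ≥0∞) (hmm : Measurable m) (g : E → ℝ≥0∞) (hg : Measurable g) :
    ∫⁻ y, m ‖y‖ * g (‖y‖⁻¹ • y) * ENNReal.ofReal (K y) =
      (∫⁻ r in Ioi (0 : ℝ), m r * ENNReal.ofReal (r ^ (-1 - 2 * s))) *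
        ∫⁻ θ : Metric.sphere (0 : E) 1, g θ * ENNReal.ofReal (K θ)
          ∂(volume : Measure E).toSphere := by
  rw [lintegral_eq_lintegral_sphere_prod]
  have h1 : ∀ p : Metric.sphere (0 : E) 1 × Ioi (0 : ℝ),
      m ‖(p.2 : ℝ) • (p.1 : E)‖ * g (‖(p.2 : ℝ) • (p.1 : E)‖⁻¹ • (p.2 : ℝ) • (p.1 : E)) *
        ENNReal.ofReal (K ((p.2 : ℝ) • (p.1 : E))) =
      (g p.1 * ENNReal.ofReal (K p.1)) *
       (m p.2 * ENNReal.ofReal ((p.2 : ℝ) ^ (-(finrank ℝ E : ℝ) - 2 * s))) := by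
    intro p
    have hp : 0 < (p.2 : ℝ) := p.2.2
    have hp1 : ‖(p.2 : ℝ) • (p.1 : E)‖ = p.2 := by
      rw [norm_smul, norm_eq_of_mem_sphere, mul_one, Real.norm_of_nonneg hp.le]
    rw [hp1, smul_smul, inv_mul_cancel₀ hp.ne', one_smul, hK _ hp,
      ENNReal.ofReal_mul (Real.rpow_nonneg hp.le _)]
    ring
  simp_rw [h1]
  rw [lintegral_prod_mul (f := fun θ : Metric.sphere (0 : E) 1 => g θ * ENNReal.ofReal (K θ))
    (g := fun r : Ioi (0 : ℝ) => m r * ENNReal.ofReal ((r : ℝ) ^ (-(finrank ℝ E : ℝ) - 2 * s)))]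
  · rw [mul_comm]
    congr 1
    rw [lintegral_volumeIoiPow _ (fun r : ℝ => m r * ENNReal.ofReal (r ^ (-(finrank ℝ E : ℝ) - 2 * s)))
      (by fun_prop)]
    refine setLIntegral_congr_fun measurableSet_Ioi fun r hr => ?_
    have hr0 : (0:ℝ) < r := hr
    rw [mul_left_comm, ← ENNReal.ofReal_mul (by positivity), ← Real.rpow_natCast,
      ← Real.rpow_add hr0, Nat.cast_sub (Nat.one_le_iff_ne_zero.2 finrank_pos.ne')]
    congr 3
    push_cast; ring
  · exact ((hg.comp measurable_subtype_coe).aemeasurable).mul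
      (aemeasurable_sphere hK hm).ennreal_ofReal
  · fun_prop

lemma lintegral_Ioo_rpow {q R : ℝ} (hq : -1 < q) (hR : 0 < R) :
    ∫⁻ r in Ioo 0 R, ENNReal.ofReal (r ^ q) = ENNReal.ofReal (R ^ (q + 1) / (q + 1)) := by
  have h1 := intervalIntegral.intervalIntegrable_rpow' (a := 0) (b := R) hq
  rw [Measure.restrict_congr_set Ioo_ae_eq_Ioc, ← ofReal_integral_eq_lintegral_ofReal h1.1,
    ← intervalIntegral.integral_of_le hR.le, integral_rpow (Or.inl hq),
    Real.zero_rpow (by linarith), sub_zero]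
  filter_upwards [ae_restrict_mem measurableSet_Ioc] with y hy
  exact Real.rpow_nonneg hy.1.le _

lemma lintegral_Ici_rpow {q R : ℝ} (hq : q < -1) (hR : 0 < R) :
    ∫⁻ r in Ici R, ENNReal.ofReal (r ^ q) = ENNReal.ofReal (R ^ (q + 1) / (-q - 1)) := by
  rw [Measure.restrict_congr_set Ioi_ae_eq_Ici.symm,
    ← ofReal_integral_eq_lintegral_ofReal (integrableOn_Ioi_rpow_of_lt hq hR),
    integral_Ioi_rpow_of_lt hq hR]
  · congr 1
    rw [neg_div, ← div_neg]; congr 1; ring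
  filter_upwards [ae_restrict_mem measurableSet_Ioi] with y hy
  exact Real.rpow_nonneg (hR.trans hy).le _


/-- The properties of the kernel and the drift of a stable operator that are used below, in terms
of volume integrals. They are invariant under the reflection `y ↦ -y`. -/
structure StableKer (s c Λ : ℝ) (K : E → ℝ) (b : E) : Prop where
  meas : AEMeasurable K volume
  nonneg : ∀ y, 0 ≤ K y
  homog : HomogKernel s K
  near : ∀ p R, 2 * s < p → 0 < R → ∫⁻ y in Metric.ball 0 R, ENNReal.ofReal (‖y‖ ^ p * K y) ≤
    ENNReal.ofReal (Λ * (R ^ (p - 2 * s) / (p - 2 * s)))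
  far : ∀ p R, p < 2 * s → 0 < R → ∫⁻ y in (Metric.ball 0 R)ᶜ, ENNReal.ofReal (‖y‖ ^ p * K y) ≤
    ENNReal.ofReal (Λ * (R ^ (p - 2 * s) / (2 * s - p)))
  low : ∀ ξ : E, ENNReal.ofReal (c * ‖ξ‖ ^ 2) ≤
    ∫⁻ y in Metric.ball 0 (1 / 8), ENNReal.ofReal ((inner ℝ y ξ) ^ 2 * K y)
  farpos : 0 < ∫⁻ y in (Metric.ball 0 1)ᶜ, ENNReal.ofReal (K y)
  cancel : s = 1 / 2 → ∀ ε R : ℝ, 0 < ε → ∀ v : E,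
    ∫ y in {y : E | ε ≤ ‖y‖ ∧ ‖y‖ < R}, inner ℝ v y * K y = 0
  drift : s = 1 / 2 → ‖b‖ ≤ Λ

/-- Weak solutions are tested against the adjoint, whose kernel and drift are the reflected ones; by
this lemma every estimate for such data applies to it. -/
lemma StableKer.reflect {s c Λ : ℝ} {K : E → ℝ} {b : E} (h : StableKer s c Λ K b) :
    StableKer s c Λ (fun y => K (-y)) (-b) := by
  have key : ∀ (S : Set E), (∀ y, -y ∈ S ↔ y ∈ S) → MeasurableSet S → ∀ G : E → ℝ≥0∞,
      ∫⁻ y in S, G (-y) = ∫⁻ y in S, G y := by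
    intro S hS hSm G
    rw [← lintegral_indicator hSm, ← lintegral_indicator hSm,
      ← lintegral_neg_eq_self (S.indicator G)]
    refine lintegral_congr fun y => ?_
    simp only [indicator, hS]
    by_cases hy : y ∈ S
    · rw [if_pos hy, if_pos ((hS y).2 hy)]
    · rw [if_neg hy, if_neg (fun h => hy ((hS y).1 h))]
  refine ⟨?_, fun y => h.nonneg _, fun t ht y => ?_, fun p R hp hR => ?_, fun p R hp hR => ?_,
    fun ξ => ?_, ?_, fun hs ε R hε v => ?_, fun hs => by simpa using h.drift hs⟩
  · exact h.meas.comp_quasiMeasurePreserving (Measure.measurePreserving_neg volume).quasiMeasurePreserving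
  · rw [← smul_neg]; exact h.homog t ht _
  · have := key (Metric.ball 0 R) (by simp) Metric.isOpen_ball.measurableSet
      (fun y => ENNReal.ofReal (‖y‖ ^ p * K y))
    simp only [norm_neg] at this
    rw [this]; exact h.near p R hp hR
  · have := key (Metric.ball 0 R)ᶜ (by simp) Metric.isOpen_ball.measurableSet.compl
      (fun y => ENNReal.ofReal (‖y‖ ^ p * K y))
    simp only [norm_neg] at this
    rw [this]; exact h.far p R hp hR
  · have := key (Metric.ball 0 (1 / 8)) (by simp) Metric.isOpen_ball.measurableSet
      (fun y => ENNReal.ofReal ((inner ℝ y ξ) ^ 2 * K y))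
    simp only [inner_neg_left, neg_sq] at this
    rw [this]; exact h.low ξ
  · have := key (Metric.ball 0 1)ᶜ (by simp) Metric.isOpen_ball.measurableSet.compl
      (fun y => ENNReal.ofReal (K y))
    rw [this]; exact h.farpos
  · have hSm : MeasurableSet {y : E | ε ≤ ‖y‖ ∧ ‖y‖ < R} := by measurability
    rw [← integral_indicator hSm, ← integral_neg_eq_self]
    have h2 := h.cancel hs ε R hε v
    rw [← integral_indicator hSm] at h2
    rw [← neg_eq_zero, ← integral_neg, ← h2]
    refine integral_congr_ae (Eventually.of_forall fun y => ?_)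
    simp only [indicator, mem_ofPred_eq, norm_neg, neg_neg, inner_neg_right]
    split_ifs <;> ring

/-- The moments factor in polar coordinates. The ellipticity condition involves `|ν·θ| ^ (2s)`,
while the symbol at bounded frequencies is controlled by second moments. They are compared by
`t^(2s) ≤ e₀ + e₀^(-1/s) t²` for `0 ≤ t ≤ 1`; with `e₀ = lam / (2Λ)` the first term takes away at
most half of the lower bound. -/
lemma stableKer_of_sphere [Nontrivial E] {s lam Λ : ℝ} (hs0 : 0 < s) (hs1 : s < 1) (hl : 0 < lam)
    (hlΛ : lam ≤ Λ) {K : E → ℝ} {b : E} (hm : AEMeasurable K volume)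
    (hint : IntegrableOn K {y : E | 1 ≤ ‖y‖ ∧ ‖y‖ ≤ 2}) (hnn : ∀ y, 0 ≤ K y)
    (hK : HomogKernel s K)
    (hlow : ∀ ν : E, ‖ν‖ = 1 → lam ≤ ∫ θ : Metric.sphere (0 : E) 1,
      |inner ℝ ν (θ : E)| ^ (2 * s) * K θ ∂(volume : Measure E).toSphere)
    (hup : ∫ θ : Metric.sphere (0 : E) 1, K θ ∂(volume : Measure E).toSphere ≤ Λ)
    (hcan : s = 1 / 2 → ∫ θ : Metric.sphere (0 : E) 1, K θ • (θ : E)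
      ∂(volume : Measure E).toSphere = 0)
    (hb : s = 1 / 2 → ‖b‖ ≤ Λ) :
    StableKer s (lam / 2 * (lam / (2 * Λ)) ^ (1 / s) * ((1 / 8) ^ (2 - 2 * s) / (2 - 2 * s)))
      Λ K b := by
  have hΛ : 0 < Λ := hl.trans_le hlΛ
  set σ := (volume : Measure E).toSphere with hσ
  have hmS := aemeasurable_sphere hK hm
  -- the total mass on the sphere
  set S := ∫⁻ θ : Metric.sphere (0 : E) 1, ENNReal.ofReal (K θ) ∂σ with hS
  have polar := lintegral_polar_homog hK hm
  have polar1 : ∀ m : ℝ → ℝ≥0∞, Measurable m → ∫⁻ y, m ‖y‖ * ENNReal.ofReal (K y) =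
      (∫⁻ r in Ioi (0 : ℝ), m r * ENNReal.ofReal (r ^ (-1 - 2 * s))) * S := by
    intro m hmm
    simpa using polar m hmm (fun _ => 1) measurable_const
  -- A Bochner integral is `0` by default for a function that is not integrable, so `hup` alone
  -- bounds nothing. The finite mass on the sphere comes from integrability on the annulus `1 ≤ ‖y‖
  -- ≤ 2`.
  have hSfin : S ≠ ⊤ := by
    intro hStop
    have h1 := polar1 (indicator (Icc 1 2) 1) (measurable_one.indicator measurableSet_Icc)
    rw [hStop] at h1
    have h2 : ∫⁻ y : E, (indicator (Icc 1 2) 1 : ℝ → ℝ≥0∞) ‖y‖ * ENNReal.ofReal (K y) ≠ ⊤ := by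
      have h3 := hint.lintegral_lt_top.ne
      rw [← lintegral_indicator (by measurability)] at h3
      convert h3 using 3 with y
      simp only [indicator, mem_Icc, mem_ofPred_eq]
      split_ifs <;> simp
    rw [h1] at h2
    apply h2
    refine ENNReal.mul_top ?_
    refine ((lintegral_pos_iff_support (Measurable.mul
      (measurable_one.indicator measurableSet_Icc) (by fun_prop))).2 ?_).ne'
    refine lt_of_lt_of_le ?_ (measure_mono (s := Icc (1:ℝ) 2) fun r hr => ?_)
    · rw [Measure.restrict_apply measurableSet_Icc, inter_eq_left.2
        (fun r hr => mem_Ioi.2 (one_pos.trans_le hr.1))]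
      simp
    · have hr0 : 0 < r := one_pos.trans_le hr.1
      rw [Function.mem_support, Pi.mul_apply, indicator_of_mem hr, Pi.one_apply, one_mul]
      exact (ENNReal.ofReal_pos.2 (by positivity)).ne'
  have hKint : Integrable (fun θ : Metric.sphere (0 : E) 1 => K θ) σ :=
    (lintegral_ofReal_ne_top_iff_integrable hmS.aestronglyMeasurable
      (Eventually.of_forall fun θ => hnn _)).1 hSfin
  have hSΛ : S ≤ ENNReal.ofReal Λ := by
    rw [hS, ← ofReal_integral_eq_lintegral_ofReal hKint (Eventually.of_forall fun θ => hnn _)]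
    exact ENNReal.ofReal_le_ofReal hup
  have hbd : ∀ (M : ℝ) (g : E → ℝ), Measurable g → (∀ θ, ‖θ‖ = 1 → |g θ| ≤ M) →
      Integrable (fun θ : Metric.sphere (0 : E) 1 => g θ * K θ) σ := by
    intro M g hg hg1
    refine hKint.bdd_mul (c := M) (hg.comp measurable_subtype_coe).aestronglyMeasurable
      (Eventually.of_forall fun θ => ?_)
    exact hg1 _ (norm_eq_of_mem_sphere θ)
  have habs : ∀ ν : E, ‖ν‖ = 1 → ∀ θ : E, ‖θ‖ = 1 → |inner ℝ ν θ| ≤ 1 := by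
    intro ν hν θ hθ
    simpa [hν, hθ] using abs_real_inner_le_norm ν θ
  -- lower bound for the second moments
  set e0 := lam / (2 * Λ) with he0
  have he0p : 0 < e0 := by positivity
  have hsec : ∀ ν : E, ‖ν‖ = 1 → lam / 2 * e0 ^ (1 / s) ≤
      ∫ θ : Metric.sphere (0 : E) 1, (inner ℝ ν (θ : E)) ^ 2 * K θ ∂σ := by
    intro ν hν
    have i2 := hbd 1 (fun θ => (inner ℝ ν θ) ^ 2) (by fun_prop) (fun θ hθ => by
      rw [abs_of_nonneg (sq_nonneg _), ← sq_abs]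
      exact pow_le_one₀ (abs_nonneg _) (habs ν hν θ hθ))
    have i1 := hbd 1 (fun θ => |inner ℝ ν θ| ^ (2 * s)) (by fun_prop) (fun θ hθ => by
      rw [abs_of_nonneg (by positivity)]
      exact Real.rpow_le_one (abs_nonneg _) (habs ν hν θ hθ) (by positivity))
    have h1 : ∫ θ : Metric.sphere (0 : E) 1, |inner ℝ ν (θ : E)| ^ (2 * s) * K θ ∂σ ≤
        ∫ θ : Metric.sphere (0 : E) 1, (e0 * K θ + e0 ^ (-(1 / s)) *
          ((inner ℝ ν (θ : E)) ^ 2 * K θ)) ∂σ := by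
      refine integral_mono i1 ((hKint.const_mul _).add (i2.const_mul _)) fun θ => ?_
      have ht := habs ν hν θ (norm_eq_of_mem_sphere θ)
      have hk := hnn θ
      simp only
      rw [← mul_assoc, ← add_mul]
      refine mul_le_mul_of_nonneg_right ?_ hk
      rw [← sq_abs]
      set t := |inner ℝ ν (θ : E)|
      have ht0 : 0 ≤ t := abs_nonneg _
      by_cases hte : t ^ (2 * s) ≤ e0
      · have : 0 ≤ e0 ^ (-(1 / s)) * t ^ 2 := by positivity
        linarith
      · push Not at hte
        have h3 : e0 ^ (1 / s) ≤ t ^ 2 := by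
          calc e0 ^ (1 / s) ≤ (t ^ (2 * s)) ^ (1 / s) :=
                Real.rpow_le_rpow he0p.le hte.le (by positivity)
            _ = t ^ 2 := by
                rw [← Real.rpow_mul ht0, ← Real.rpow_natCast]
                congr 1; field_simp; norm_num
        have h4 : 1 ≤ e0 ^ (-(1 / s)) * t ^ 2 := by
          calc (1:ℝ) = e0 ^ (-(1 / s)) * e0 ^ (1 / s) := by
                rw [← Real.rpow_add he0p]; simp
            _ ≤ _ := mul_le_mul_of_nonneg_left h3 (by positivity)
        have : t ^ (2 * s) ≤ 1 := Real.rpow_le_one ht0 ht (by positivity)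
        linarith
    rw [integral_add (hKint.const_mul _) (i2.const_mul _), integral_const_mul,
      integral_const_mul] at h1
    have h2 := hlow ν hν
    have h5 : e0 * ∫ θ : Metric.sphere (0 : E) 1, K θ ∂σ ≤ lam / 2 := by
      calc _ ≤ e0 * Λ := by gcongr
        _ = lam / 2 := by rw [he0]; field_simp
    set J := ∫ θ : Metric.sphere (0 : E) 1, (inner ℝ ν (θ : E)) ^ 2 * K θ ∂σ
    have h6 : lam / 2 ≤ e0 ^ (-(1 / s)) * J := by linarith
    calc lam / 2 * e0 ^ (1 / s) ≤ (e0 ^ (-(1 / s)) * J) * e0 ^ (1 / s) := by gcongr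
      _ = (e0 ^ (-(1 / s)) * e0 ^ (1 / s)) * J := by ring
      _ = J := by rw [← Real.rpow_add he0p]; simp
  refine ⟨hm, hnn, hK, fun p R hp hR => ?_, fun p R hp hR => ?_, fun ξ => ?_, ?_,
    fun hs ε R hε v => ?_, hb⟩
  · have h1 := polar1 ((Iio R).indicator fun r => ENNReal.ofReal (r ^ p))
      ((by fun_prop : Measurable fun r : ℝ => ENNReal.ofReal (r ^ p)).indicator measurableSet_Iio)
    have h2 : ∫⁻ r in Ioi (0 : ℝ), ((Iio R).indicator (fun r => ENNReal.ofReal (r ^ p)) r) *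
        ENNReal.ofReal (r ^ (-1 - 2 * s)) =
        ENNReal.ofReal (R ^ (p - 2 * s) / (p - 2 * s)) := by
      have h3 := lintegral_Ioo_rpow (q := p - 1 - 2 * s) (R := R) (by linarith) hR
      rw [show p - 1 - 2 * s + 1 = p - 2 * s by ring] at h3
      rw [← h3, ← lintegral_indicator measurableSet_Ioi, ← lintegral_indicator measurableSet_Ioo]
      refine lintegral_congr fun r => ?_
      simp only [indicator, mem_Ioi, mem_Iio, mem_Ioo]
      by_cases h0 : 0 < r <;> by_cases h1 : r < R <;> simp only [h0, h1, and_self, and_true, and_false, if_true, if_false, zero_mul]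
      rw [← ENNReal.ofReal_mul (by positivity), ← Real.rpow_add h0]; congr 2; ring
    rw [h2] at h1
    rw [mul_comm Λ, ENNReal.ofReal_mul (div_nonneg (by positivity) (by linarith))]
    refine le_trans (le_of_eq ?_) (h1.le.trans (by gcongr))
    rw [← lintegral_indicator Metric.isOpen_ball.measurableSet]
    refine lintegral_congr fun y => ?_
    simp only [indicator, mem_ball_zero_iff, mem_Iio]
    split_ifs
    · rw [ENNReal.ofReal_mul (by positivity)]
    · simp
  · have h1 := polar1 ((Ici R).indicator fun r => ENNReal.ofReal (r ^ p))
      ((by fun_prop : Measurable fun r : ℝ => ENNReal.ofReal (r ^ p)).indicator measurableSet_Ici)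
    have h2 : ∫⁻ r in Ioi (0 : ℝ), ((Ici R).indicator (fun r => ENNReal.ofReal (r ^ p)) r) *
        ENNReal.ofReal (r ^ (-1 - 2 * s)) =
        ENNReal.ofReal (R ^ (p - 2 * s) / (2 * s - p)) := by
      have h3 := lintegral_Ici_rpow (q := p - 1 - 2 * s) (R := R) (by linarith) hR
      rw [show p - 1 - 2 * s + 1 = p - 2 * s by ring,
        show -(p - 1 - 2 * s) - 1 = 2 * s - p by ring] at h3
      rw [← h3, ← lintegral_indicator measurableSet_Ioi, ← lintegral_indicator measurableSet_Ici]
      refine lintegral_congr fun r => ?_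
      simp only [indicator, mem_Ioi, mem_Ici]
      by_cases h1 : R ≤ r
      · have h0 : 0 < r := hR.trans_le h1
        simp only [h0, h1, if_true]
        rw [← ENNReal.ofReal_mul (by positivity), ← Real.rpow_add h0]; congr 2; ring
      · simp [h1]
    rw [h2] at h1
    rw [mul_comm Λ, ENNReal.ofReal_mul (div_nonneg (by positivity) (by linarith))]
    refine le_trans (le_of_eq ?_) (h1.le.trans (by gcongr))
    rw [← lintegral_indicator Metric.isOpen_ball.measurableSet.compl]
    refine lintegral_congr fun y => ?_
    simp only [indicator, mem_compl_iff, mem_ball_zero_iff, mem_Ici, not_lt]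
    split_ifs
    · rw [ENNReal.ofReal_mul (by positivity)]
    · simp
  · by_cases hξ : ξ = 0
    · simp [hξ]
    have hξn : 0 < ‖ξ‖ := norm_pos_iff.2 hξ
    have h1 := polar ((Iio (1 / 8)).indicator fun r => ENNReal.ofReal (r ^ (2:ℝ)))
      ((by fun_prop : Measurable fun r : ℝ => ENNReal.ofReal (r ^ (2:ℝ))).indicator measurableSet_Iio)
      (fun θ => ENNReal.ofReal ((inner ℝ θ ξ) ^ 2)) (by fun_prop)
    have h2 : ∫⁻ r in Ioi (0 : ℝ), ((Iio (1 / 8)).indicator (fun r => ENNReal.ofReal (r ^ (2:ℝ))) r) *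
        ENNReal.ofReal (r ^ (-1 - 2 * s)) =
        ENNReal.ofReal ((1 / 8) ^ (2 - 2 * s) / (2 - 2 * s)) := by
      have h3 := lintegral_Ioo_rpow (q := 2 - 1 - 2 * s) (R := 1 / 8) (by linarith) (by norm_num)
      rw [show 2 - 1 - 2 * s + 1 = 2 - 2 * s by ring] at h3
      rw [← h3, ← lintegral_indicator measurableSet_Ioi, ← lintegral_indicator measurableSet_Ioo]
      refine lintegral_congr fun r => ?_
      simp only [indicator, mem_Ioi, mem_Iio, mem_Ioo]
      by_cases h0 : 0 < r <;> by_cases h1 : r < 1 / 8 <;> simp only [h0, h1, and_self, and_true, and_false, if_true, if_false, zero_mul]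
      rw [← ENNReal.ofReal_mul (by positivity), ← Real.rpow_add h0]; congr 2; ring
    rw [h2] at h1
    have h4 : ∫⁻ y in Metric.ball 0 (1 / 8), ENNReal.ofReal ((inner ℝ y ξ) ^ 2 * K y) =
        ∫⁻ y : E, ((Iio (1 / 8)).indicator (fun r => ENNReal.ofReal (r ^ (2:ℝ))) ‖y‖) *
          ENNReal.ofReal ((inner ℝ (‖y‖⁻¹ • y) ξ) ^ 2) * ENNReal.ofReal (K y) := by
      rw [← lintegral_indicator Metric.isOpen_ball.measurableSet]
      refine lintegral_congr fun y => ?_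
      simp only [indicator, mem_ball_zero_iff, mem_Iio]
      split_ifs
      · rw [← ENNReal.ofReal_mul (by positivity), ← ENNReal.ofReal_mul (by positivity)]
        congr 2
        by_cases hy : y = 0
        · simp [hy]
        · have : ‖y‖ ≠ 0 := norm_ne_zero_iff.2 hy
          rw [inner_smul_left, Real.rpow_ofNat]
          simp; field_simp
      · simp
    have i2 := hbd (‖ξ‖ ^ 2) (fun θ => (inner ℝ θ ξ) ^ 2) (by fun_prop) (fun θ hθ => by
      rw [abs_of_nonneg (sq_nonneg _), ← sq_abs]
      gcongr
      simpa [hθ] using abs_real_inner_le_norm θ ξ)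
    have h5 : ∫⁻ θ : Metric.sphere (0 : E) 1, ENNReal.ofReal ((inner ℝ (θ : E) ξ) ^ 2) *
        ENNReal.ofReal (K θ) ∂σ = ENNReal.ofReal
        (∫ θ : Metric.sphere (0 : E) 1, (inner ℝ (θ : E) ξ) ^ 2 * K θ ∂σ) := by
      rw [ofReal_integral_eq_lintegral_ofReal i2
        (Eventually.of_forall fun θ => mul_nonneg (sq_nonneg _) (hnn _))]
      simp_rw [ENNReal.ofReal_mul (sq_nonneg _)]
    have h6 := hsec (‖ξ‖⁻¹ • ξ) (by rw [norm_smul, norm_inv, norm_norm]; field_simp)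
    have h7 : ∫ θ : Metric.sphere (0 : E) 1, (inner ℝ (θ : E) ξ) ^ 2 * K θ ∂σ =
        ‖ξ‖ ^ 2 * ∫ θ : Metric.sphere (0 : E) 1, (inner ℝ (‖ξ‖⁻¹ • ξ) (θ : E)) ^ 2 * K θ ∂σ := by
      rw [← integral_const_mul]
      refine integral_congr_ae (Eventually.of_forall fun θ => ?_)
      simp only
      rw [inner_smul_left, real_inner_comm ξ (θ : E)]
      simp; field_simp
    have hM0 : 0 ≤ ((1:ℝ) / 8) ^ (2 - 2 * s) / (2 - 2 * s) :=
      div_nonneg (by positivity) (by linarith)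
    rw [h4, h1, h5, h7, ← ENNReal.ofReal_mul hM0]
    refine ENNReal.ofReal_le_ofReal ?_
    calc _ = (1 / 8) ^ (2 - 2 * s) / (2 - 2 * s) * (‖ξ‖ ^ 2 * (lam / 2 * e0 ^ (1 / s))) := by ring
      _ ≤ _ := by gcongr
  · have h1 := polar1 ((Ici 1).indicator 1) (measurable_one.indicator measurableSet_Ici)
    have h2 : ∫⁻ r in Ioi (0 : ℝ), ((Ici 1).indicator 1 r : ℝ≥0∞) *
        ENNReal.ofReal (r ^ (-1 - 2 * s)) = ENNReal.ofReal (1 / (2 * s)) := by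
      have h3 := lintegral_Ici_rpow (q := - 1 - 2 * s) (R := 1) (by linarith) one_pos
      rw [show -(- 1 - 2 * s) - 1 = 2 * s by ring, Real.one_rpow] at h3
      rw [← h3, ← lintegral_indicator measurableSet_Ioi, ← lintegral_indicator measurableSet_Ici]
      refine lintegral_congr fun r => ?_
      simp only [indicator, mem_Ioi, mem_Ici]
      by_cases h1 : 1 ≤ r
      · have h0 : 0 < r := one_pos.trans_le h1
        simp [h0, h1]
      · simp [h1]
    have h3 : ∫⁻ y in (Metric.ball (0 : E) 1)ᶜ, ENNReal.ofReal (K y) =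
        ∫⁻ y : E, ((Ici (1:ℝ)).indicator 1 ‖y‖ : ℝ≥0∞) * ENNReal.ofReal (K y) := by
      rw [← lintegral_indicator Metric.isOpen_ball.measurableSet.compl]
      refine lintegral_congr fun y => ?_
      simp only [indicator, mem_compl_iff, mem_ball_zero_iff, mem_Ici, not_lt]
      split_ifs <;> simp
    rw [h3, h1, h2]
    -- The mass on the sphere is at least `lam`, since the factor `|ν·θ| ^ (2s)` in `hlow` is at
    -- most `1`.
    refine ENNReal.mul_pos (ENNReal.ofReal_pos.2 (by positivity)).ne' ?_
    rw [hS, ← ofReal_integral_eq_lintegral_ofReal hKint (Eventually.of_forall fun θ => hnn _)]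
    refine (ENNReal.ofReal_pos.2 ?_).ne'
    obtain ⟨ν, hν⟩ := exists_norm_eq E zero_le_one
    refine hl.trans_le ((hlow ν hν).trans (integral_mono_of_nonneg
      (Eventually.of_forall fun θ => mul_nonneg (by positivity) (hnn _)) hKint
      (Eventually.of_forall fun θ => ?_)))
    refine mul_le_of_le_one_left (hnn _) (Real.rpow_le_one (abs_nonneg _)
      (habs ν hν θ (norm_eq_of_mem_sphere θ)) (by positivity))
  · set T : Set E := {y : E | ε ≤ ‖y‖ ∧ ‖y‖ < R} with hT
    have hTm : MeasurableSet T := by measurability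
    have key : ∀ w : E, ∫⁻ y in T, ENNReal.ofReal (inner ℝ w y * K y) =
        (∫⁻ r in Ioi (0 : ℝ), ((Ico ε R).indicator (fun r => ENNReal.ofReal r) r) *
          ENNReal.ofReal (r ^ (-1 - 2 * s))) *
        ∫⁻ θ : Metric.sphere (0 : E) 1, ENNReal.ofReal (inner ℝ w (θ : E) * K θ) ∂σ := by
      intro w
      have h1 := polar ((Ico ε R).indicator fun r => ENNReal.ofReal r)
        (ENNReal.measurable_ofReal.indicator measurableSet_Ico)
        (fun θ => ENNReal.ofReal (inner ℝ w θ)) (by fun_prop)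
      simp_rw [← ENNReal.ofReal_mul' (hnn _)] at h1
      rw [← h1, ← lintegral_indicator hTm]
      refine lintegral_congr fun y => ?_
      simp only [indicator, hT, mem_ofPred_eq, mem_Ico]
      split_ifs with h
      · have hy : 0 < ‖y‖ := hε.trans_le h.1
        rw [mul_assoc, ← ENNReal.ofReal_mul' (hnn _), ← ENNReal.ofReal_mul hy.le, inner_smul_right]
        congr 1; field_simp
      · simp
    -- Cancellation, written as equality of the integrals of the positive and the negative part: in
    -- this form it passes through the polar formula for `[0,∞]`-valued integrals.
    have hsph : ∫⁻ θ : Metric.sphere (0 : E) 1, ENNReal.ofReal (inner ℝ v (θ : E) * K θ) ∂σ =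
        ∫⁻ θ : Metric.sphere (0 : E) 1, ENNReal.ofReal (inner ℝ (-v) (θ : E) * K θ) ∂σ := by
      have i1 := hbd ‖v‖ (fun θ => inner ℝ v θ) (by fun_prop) (fun θ hθ => by
        simpa [hθ] using abs_real_inner_le_norm v θ)
      have h0 : ∫ θ : Metric.sphere (0 : E) 1, inner ℝ v (θ : E) * K θ ∂σ = 0 := by
        have i2 : Integrable (fun θ : Metric.sphere (0 : E) 1 => K θ • (θ : E)) σ := by
          refine hKint.smul_bdd 1
            measurable_subtype_coe.aestronglyMeasurable
            (Eventually.of_forall fun θ => (norm_eq_of_mem_sphere θ).le)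
        have h3 := integral_inner (𝕜 := ℝ) i2 v
        rw [hcan hs, inner_zero_right] at h3
        rw [← h3]
        refine integral_congr_ae (Eventually.of_forall fun θ => ?_)
        simp only [inner_smul_right]; ring
      rw [integral_eq_lintegral_pos_part_sub_lintegral_neg_part i1, sub_eq_zero] at h0
      have h4 := (ENNReal.toReal_eq_toReal_iff' i1.lintegral_lt_top.ne i1.neg.lintegral_lt_top.ne).1 h0
      rw [h4]
      simp [inner_neg_left]
    by_cases hi : Integrable (fun y => inner ℝ v y * K y) (volume.restrict T)
    · rw [integral_eq_lintegral_pos_part_sub_lintegral_neg_part hi, key v, hsph, ← key (-v)]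
      simp [inner_neg_left]
    · exact integral_undef hi

/-- The ellipticity constant of the volume form of the lower bound. -/
def ellipConst (s lam Λ : ℝ) : ℝ :=
  lam / 2 * (lam / (2 * Λ)) ^ (1 / s) * ((1 / 8) ^ (2 - 2 * s) / (2 - 2 * s))

lemma ellipConst_pos {s lam Λ : ℝ} (hs1 : s < 1) (hl : 0 < lam) (hlΛ : lam ≤ Λ) :
    0 < ellipConst s lam Λ := by
  have hΛ : 0 < Λ := hl.trans_le hlΛ
  have : 0 < 2 - 2 * s := by linarith
  unfold ellipConst; positivity

end Polar

/-- The data say nothing about `K 0`. Setting this value to `0` makes homogeneity and nonnegativity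
hold everywhere and changes `K` only on a null set. -/
lemma IsStableData.stableKer {n : ℕ} (hn : 1 ≤ n) {s lam Λ : ℝ} (hs0 : 0 < s) (hs1 : s < 1)
    (hl : 0 < lam) (hlΛ : lam ≤ Λ) {K : EuclideanSpace ℝ (Fin n) → ℝ}
    {b : EuclideanSpace ℝ (Fin n)} (h : IsStableData n s lam Λ K b) :
    StableKer s (ellipConst s lam Λ) Λ (({0}ᶜ : Set (EuclideanSpace ℝ (Fin n))).indicator K) b := by
  have : Nontrivial (EuclideanSpace ℝ (Fin n)) := by
    have : Nonempty (Fin n) := ⟨⟨0, hn⟩⟩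
    infer_instance
  have hne : ∀ θ : Metric.sphere (0 : EuclideanSpace ℝ (Fin n)) 1,
      ({0}ᶜ : Set (EuclideanSpace ℝ (Fin n))).indicator K θ = K θ := fun θ =>
    indicator_of_mem (ne_zero_of_mem_unit_sphere θ) _
  refine stableKer_of_sphere hs0 hs1 hl hlΛ ?_ ?_ ?_ ?_ ?_ ?_ ?_ h.drift
  · have h1 := h.locInt.aestronglyMeasurable.aemeasurable
    exact (aemeasurable_indicator_iff (measurableSet_singleton _).compl).2 h1
  · have hc : IsCompact {y : EuclideanSpace ℝ (Fin n) | 1 ≤ ‖y‖ ∧ ‖y‖ ≤ 2} := by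
      refine (isCompact_closedBall (0 : EuclideanSpace ℝ (Fin n)) 2).of_isClosed_subset ?_ ?_
      · exact (isClosed_le continuous_const continuous_norm).inter
          (isClosed_le continuous_norm continuous_const)
      · intro y hy; simpa using hy.2
    have hsub : {y : EuclideanSpace ℝ (Fin n) | 1 ≤ ‖y‖ ∧ ‖y‖ ≤ 2} ⊆ {0}ᶜ := by
      rintro y hy rfl
      have := hy.1
      simp at this
      linarith
    refine (h.locInt.integrableOn_compact_subset hsub hc).congr_fun (fun y hy => ?_)
      hc.measurableSet
    exact (indicator_of_mem (hsub hy) _).symm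
  · exact fun y => indicator_nonneg (fun y hy => h.nonneg y hy) y
  · intro t ht y
    by_cases hy : y = 0
    · simp [hy]
    · rw [indicator_of_mem (show t • y ∈ ({0}ᶜ : Set _) from smul_ne_zero ht.ne' hy),
        indicator_of_mem (show y ∈ ({0}ᶜ : Set _) from hy), h.homog t ht y hy]
      simp
  · intro ν hν
    simpa only [hne] using h.lower ν hν
  · simpa only [hne] using h.upper
  · intro hs
    simpa only [hne] using h.cancel hs

/-! ### The operator as an absolutely convergent integral: bounds, scaling, product rule,
integrability. -/

section LevyOperator

open Module

variable {E : Type*} [NormedAddCommGroup E] [InnerProductSpace ℝ E] [FiniteDimensional ℝ E]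
  [MeasurableSpace E] [BorelSpace E]

lemma integrableOn_of_lintegral_ofReal_le {S : Set E} {f : E → ℝ} {C : ℝ}
    (hm : AEMeasurable f volume) (hf : ∀ y, 0 ≤ f y) (hC : 0 ≤ C)
    (h : ∫⁻ y in S, ENNReal.ofReal (f y) ≤ ENNReal.ofReal C) :
    IntegrableOn f S ∧ ∫ y in S, f y ≤ C := by
  have hi : IntegrableOn f S := (lintegral_ofReal_ne_top_iff_integrable
    hm.restrict.aestronglyMeasurable (Eventually.of_forall fun y => hf y)).1
    (h.trans_lt ENNReal.ofReal_lt_top).ne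
  refine ⟨hi, ?_⟩
  rw [← ofReal_integral_eq_lintegral_ofReal hi (Eventually.of_forall fun y => hf y)] at h
  exact (ENNReal.ofReal_le_ofReal_iff hC).1 h

lemma StableKer.near_integrable {s c Λ : ℝ} {K : E → ℝ} {b : E} (h : StableKer s c Λ K b)
    (hΛ : 0 ≤ Λ) {p R : ℝ} (hp : 2 * s < p) (hR : 0 < R) :
    IntegrableOn (fun y => ‖y‖ ^ p * K y) (Metric.ball 0 R) ∧
      ∫ y in Metric.ball 0 R, ‖y‖ ^ p * K y ≤ Λ * (R ^ (p - 2 * s) / (p - 2 * s)) := by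
  have h1 : 0 < p - 2 * s := by linarith
  exact integrableOn_of_lintegral_ofReal_le (h.meas.const_mul 1 |>.congr (by simp) |> fun hm =>
    ((by fun_prop : Measurable fun y : E => ‖y‖ ^ p).aemeasurable.mul hm))
    (fun y => mul_nonneg (by positivity) (h.nonneg y)) (by positivity) (h.near p R hp hR)

lemma StableKer.far_integrable {s c Λ : ℝ} {K : E → ℝ} {b : E} (h : StableKer s c Λ K b)
    (hΛ : 0 ≤ Λ) {p R : ℝ} (hp : p < 2 * s) (hR : 0 < R) :
    IntegrableOn (fun y => ‖y‖ ^ p * K y) (Metric.ball 0 R)ᶜ ∧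
      ∫ y in (Metric.ball 0 R)ᶜ, ‖y‖ ^ p * K y ≤ Λ * (R ^ (p - 2 * s) / (2 * s - p)) := by
  have h1 : 0 < 2 * s - p := by linarith
  exact integrableOn_of_lintegral_ofReal_le
    ((by fun_prop : Measurable fun y : E => ‖y‖ ^ p).aemeasurable.mul h.meas)
    (fun y => mul_nonneg (by positivity) (h.nonneg y)) (by positivity) (h.far p R hp hR)

/-- The factor multiplying the gradient in the integrand of the operator. -/
def levyComp (s : ℝ) (y : E) : ℝ :=
  open Classical in
  if s < 1 / 2 then 0 else if s = 1 / 2 then (if ‖y‖ < 1 then 1 else 0) else 1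

/-- The size of the integrand of the operator for a bounded `C²` function. -/
def levyWeight (s : ℝ) (y : E) : ℝ :=
  open Classical in
  if s < 1 / 2 then min ‖y‖ 1 else if s = 1 / 2 then min (‖y‖ ^ 2) 1 else min (‖y‖ ^ 2) ‖y‖

lemma levyComp_measurable (s : ℝ) : Measurable (levyComp s : E → ℝ) := by
  unfold levyComp
  split_ifs
  · exact measurable_const
  · exact Measurable.ite (by measurability) measurable_const measurable_const
  · exact measurable_const

lemma levyWeight_measurable (s : ℝ) : Measurable (levyWeight s : E → ℝ) := by
  unfold levyWeight
  split_ifs <;> fun_prop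

lemma levyWeight_nonneg (s : ℝ) (y : E) : 0 ≤ levyWeight s y := by
  unfold levyWeight
  split_ifs <;> positivity

lemma min_sq_le_levyWeight (s : ℝ) (y : E) : min (‖y‖ ^ 2) 1 ≤ levyWeight s y := by
  unfold levyWeight
  have := norm_nonneg y
  split_ifs
  · rcases le_total ‖y‖ 1 with h | h
    · rw [min_eq_left h]; exact (min_le_left _ _).trans (by nlinarith)
    · rw [min_eq_right h]; exact min_le_right _ _
  · exact le_rfl
  · rcases le_total ‖y‖ 1 with h | h
    · rw [min_eq_left (by nlinarith : ‖y‖ ^ 2 ≤ ‖y‖)]; exact min_le_left _ _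
    · rw [min_eq_right (by nlinarith : ‖y‖ ≤ ‖y‖ ^ 2)]; exact (min_le_right _ _).trans h

/-- Near the origin the weight is at most `‖y‖ ^ p` with `p > 2s`, and away from it at most `‖y‖ ^
q` with `q < 2s`. The constant depends on `s` and `Λ` but not on the kernel, and all later constants
inherit this uniformity. -/
lemma levyWeight_integrable {s : ℝ} (hs0 : 0 < s) (hs1 : s < 1) {Λ : ℝ} (hΛ : 0 ≤ Λ) :
    ∃ C, 0 ≤ C ∧ ∀ (c : ℝ) (K : E → ℝ) (b : E), StableKer s c Λ K b →
      Integrable (fun y => levyWeight s y * K y) ∧ ∫ y, levyWeight s y * K y ≤ C := by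
  obtain ⟨p, q, hp, hq, h1, h2⟩ : ∃ p q : ℝ, 2 * s < p ∧ q < 2 * s ∧
      (∀ y : E, levyWeight s y ≤ ‖y‖ ^ p) ∧
      (∀ y : E, 1 ≤ ‖y‖ → levyWeight s y ≤ ‖y‖ ^ q) := by
    unfold levyWeight
    split_ifs with h1 h2
    · exact ⟨1, 0, by linarith, by linarith, fun y => by simp, fun y _ => by simp⟩
    · exact ⟨2, 0, by linarith, by linarith, fun y => by simp, fun y _ => by simp⟩
    · have : 1 / 2 < s := lt_of_le_of_ne (not_lt.1 h1) (Ne.symm h2)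
      exact ⟨2, 1, by linarith, by linarith, fun y => by simp, fun y _ => by simp⟩
  refine ⟨Λ * (1 ^ (p - 2 * s) / (p - 2 * s)) + Λ * (1 ^ (q - 2 * s) / (2 * s - q)), ?_, ?_⟩
  · have : 0 < p - 2 * s := by linarith
    have : 0 < 2 * s - q := by linarith
    positivity
  intro c K b h
  have hm : AEStronglyMeasurable (fun y => levyWeight s y * K y) volume :=
    ((levyWeight_measurable s).aemeasurable.mul h.meas).aestronglyMeasurable
  obtain ⟨a1, a2⟩ := h.near_integrable hΛ hp one_pos
  obtain ⟨b1, b2⟩ := h.far_integrable hΛ hq one_pos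
  have hn : ∀ y, 0 ≤ levyWeight s y * K y := fun y => mul_nonneg (levyWeight_nonneg s y) (h.nonneg y)
  have i1 : IntegrableOn (fun y => levyWeight s y * K y) (Metric.ball 0 1) :=
    a1.mono' hm.restrict (Eventually.of_forall fun y => by
      rw [Real.norm_of_nonneg (hn y)]; exact mul_le_mul_of_nonneg_right (h1 y) (h.nonneg y))
  have e2 : ∀ᵐ y ∂(volume.restrict (Metric.ball (0:E) 1)ᶜ),
      levyWeight s y * K y ≤ ‖y‖ ^ q * K y := by
    filter_upwards [ae_restrict_mem Metric.isOpen_ball.measurableSet.compl] with y hy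
    exact mul_le_mul_of_nonneg_right (h2 y (by simpa using hy)) (h.nonneg y)
  have i2 : IntegrableOn (fun y => levyWeight s y * K y) (Metric.ball 0 1)ᶜ :=
    b1.mono' hm.restrict (by
      filter_upwards [e2] with y hy
      rwa [Real.norm_of_nonneg (hn y)])
  have i3 : Integrable (fun y => levyWeight s y * K y) := by
    rw [← integrableOn_univ, ← union_compl_self (Metric.ball (0:E) 1)]
    exact i1.union i2
  refine ⟨i3, ?_⟩
  rw [← integral_add_compl Metric.isOpen_ball.measurableSet i3]
  refine add_le_add ((integral_mono i1 a1 fun y => ?_).trans a2)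
    ((integral_mono_ae i2 b1 e2).trans b2)
  exact mul_le_mul_of_nonneg_right (h1 y) (h.nonneg y)

/-- A `C²` function which is bounded by `M` together with its derivatives up to order two. -/
structure BddC2 (M : ℝ) (w : E → ℝ) : Prop where
  contDiff : ContDiff ℝ 2 w
  bdd : ∀ x, |w x| ≤ M
  bdd1 : ∀ x, ‖fderiv ℝ w x‖ ≤ M
  bdd2 : ∀ x, ‖fderiv ℝ (fderiv ℝ w) x‖ ≤ M

lemma BddC2.nonneg {M : ℝ} {w : E → ℝ} (h : BddC2 M w) : 0 ≤ M := (abs_nonneg _).trans (h.bdd 0)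

lemma BddC2.differentiable {M : ℝ} {w : E → ℝ} (h : BddC2 M w) : Differentiable ℝ w :=
  h.contDiff.differentiable (by norm_num)

lemma BddC2.differentiable1 {M : ℝ} {w : E → ℝ} (h : BddC2 M w) : Differentiable ℝ (fderiv ℝ w) :=
  (h.contDiff.fderiv_right (m := 1) (by norm_num)).differentiable (by norm_num)

lemma BddC2.abs_sub_le {M : ℝ} {w : E → ℝ} (h : BddC2 M w) (x y : E) :
    |w x - w (x + y)| ≤ M * ‖y‖ := by
  have := Convex.norm_image_sub_le_of_norm_fderiv_le (𝕜 := ℝ) (f := w) (s := univ)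
    (fun x _ => h.differentiable x) (fun x _ => h.bdd1 x) convex_univ (mem_univ (x + y)) (mem_univ x)
  simpa using this

lemma BddC2.taylor {M : ℝ} {w : E → ℝ} (h : BddC2 M w) (x y : E) :
    |w x - w (x + y) + fderiv ℝ w x y| ≤ M * ‖y‖ ^ 2 := by
  have h1 : ∀ z, ‖fderiv ℝ w z - fderiv ℝ w x‖ ≤ M * ‖z - x‖ := fun z =>
    Convex.norm_image_sub_le_of_norm_fderiv_le (𝕜 := ℝ) (f := fderiv ℝ w) (s := univ)
      (fun x _ => h.differentiable1 x) (fun x _ => h.bdd2 x) convex_univ (mem_univ x) (mem_univ z)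
  have h2 := Convex.norm_image_sub_le_of_norm_fderiv_le' (𝕜 := ℝ) (f := w) (s := Metric.closedBall x ‖y‖)
    (φ := fderiv ℝ w x) (C := M * ‖y‖)
    (fun x _ => h.differentiable x) (fun z hz => (h1 z).trans (mul_le_mul_of_nonneg_left
      (by simpa [dist_eq_norm] using hz) h.nonneg))
    (convex_closedBall _ _) (show x ∈ _ by simp) (show x + y ∈ _ by simp)
  rw [add_sub_cancel_left, Real.norm_eq_abs] at h2
  rw [← abs_neg]
  calc _ = |w (x + y) - w x - fderiv ℝ w x y| := by congr 1; ring
    _ ≤ _ := h2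
    _ = _ := by ring

lemma BddC2.integrand_le {M : ℝ} {w : E → ℝ} (h : BddC2 M w) (s : ℝ) (x y : E) :
    |w x - w (x + y) + levyComp s y * fderiv ℝ w x y| ≤ 2 * M * levyWeight s y := by
  have h0 := h.nonneg
  have hn := norm_nonneg y
  have b0 : |w x - w (x + y)| ≤ 2 * M := by
    have := abs_sub (w x) (w (x + y)); have := h.bdd x; have := h.bdd (x + y); linarith
  have b1 := h.abs_sub_le x y
  have b2 := h.taylor x y
  have b3 : |fderiv ℝ w x y| ≤ M * ‖y‖ := (fderiv ℝ w x).le_of_opNorm_le (h.bdd1 x) y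
  unfold levyComp levyWeight
  split_ifs with h1 h2 h3
  · rw [zero_mul, add_zero]
    rcases le_total ‖y‖ 1 with h | h
    · rw [min_eq_left h]; nlinarith
    · rw [min_eq_right h]; linarith
  · rw [one_mul, min_eq_left (by nlinarith)]; nlinarith [mul_nonneg h0 (sq_nonneg ‖y‖)]
  · rw [zero_mul, add_zero, min_eq_right (by nlinarith)]; linarith
  · rw [one_mul]
    rcases le_total ‖y‖ 1 with h | h
    · rw [min_eq_left (by nlinarith)]; nlinarith [mul_nonneg h0 (sq_nonneg ‖y‖)]
    · rw [min_eq_right (by nlinarith)]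
      have := abs_add_le (w x - w (x + y)) (fderiv ℝ w x y); linarith

/-- The operator in Lévy form, with an absolutely convergent integral in all cases. -/
def levyOp (s : ℝ) (K : E → ℝ) (b : E) (w : E → ℝ) (x : E) : ℝ :=
  open Classical in
  (∫ y, (w x - w (x + y) + levyComp s y * fderiv ℝ w x y) * K y) +
    if s = 1 / 2 then fderiv ℝ w x b else 0

lemma levyOp_integrand_aestronglyMeasurable {s : ℝ} {K : E → ℝ} (hK : AEMeasurable K volume)
    {w : E → ℝ} (hw : Continuous w) (x : E) :
    AEStronglyMeasurable (fun y => (w x - w (x + y) + levyComp s y * fderiv ℝ w x y) * K y)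
      volume := by
  refine (AEMeasurable.mul ?_ hK).aestronglyMeasurable
  have := levyComp_measurable (E := E) s
  fun_prop

lemma BddC2.integrable {s : ℝ} (hs0 : 0 < s) (hs1 : s < 1) {Λ : ℝ} (hΛ : 0 ≤ Λ) {c : ℝ}
    {K : E → ℝ} {b : E} (hK : StableKer s c Λ K b) {M : ℝ} {w : E → ℝ} (h : BddC2 M w) (x : E) :
    Integrable (fun y => (w x - w (x + y) + levyComp s y * fderiv ℝ w x y) * K y) := by
  obtain ⟨C, -, hC⟩ := levyWeight_integrable (E := E) hs0 hs1 hΛ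
  refine ((hC c K b hK).1.const_mul (2 * M)).mono'
    (levyOp_integrand_aestronglyMeasurable hK.meas h.contDiff.continuous x)
    (Eventually.of_forall fun y => ?_)
  rw [norm_mul, Real.norm_of_nonneg (hK.nonneg y), ← mul_assoc]
  exact mul_le_mul_of_nonneg_right (h.integrand_le s x y) (hK.nonneg y)

lemma exists_levyOp_bound {s : ℝ} (hs0 : 0 < s) (hs1 : s < 1) {Λ : ℝ} (hΛ : 0 ≤ Λ) :
    ∃ C, 0 ≤ C ∧ ∀ (c : ℝ) (K : E → ℝ) (b : E), StableKer s c Λ K b →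
      ∀ (M : ℝ) (w : E → ℝ), BddC2 M w → ∀ x, |levyOp s K b w x| ≤ C * M := by
  obtain ⟨C, hC0, hC⟩ := levyWeight_integrable (E := E) hs0 hs1 hΛ
  refine ⟨2 * C + Λ, by positivity, fun c K b hK M w h x => ?_⟩
  have h0 := h.nonneg
  unfold levyOp
  refine (abs_add_le _ _).trans ?_
  have h1 : |∫ y, (w x - w (x + y) + levyComp s y * fderiv ℝ w x y) * K y| ≤ 2 * M * C := by
    rw [← Real.norm_eq_abs]
    refine (norm_integral_le_of_norm_le ((hC c K b hK).1.const_mul (2 * M))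
      (Eventually.of_forall fun y => ?_)).trans ?_
    · rw [norm_mul, Real.norm_of_nonneg (hK.nonneg y), ← mul_assoc]
      exact mul_le_mul_of_nonneg_right (h.integrand_le s x y) (hK.nonneg y)
    · rw [integral_const_mul]; exact mul_le_mul_of_nonneg_left (hC c K b hK).2 (by positivity)
  have h2 : |if s = 1 / 2 then fderiv ℝ w x b else 0| ≤ M * Λ := by
    split_ifs with hs
    · exact ((fderiv ℝ w x).le_of_opNorm_le (h.bdd1 x) b).trans
        (mul_le_mul_of_nonneg_left (hK.drift hs) h0)
    · simp; positivity
  nlinarith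

lemma levyOp_continuous {s : ℝ} (hs0 : 0 < s) (hs1 : s < 1) {Λ : ℝ} (hΛ : 0 ≤ Λ) {c : ℝ}
    {K : E → ℝ} {b : E} (hK : StableKer s c Λ K b) {M : ℝ} {w : E → ℝ} (h : BddC2 M w) :
    Continuous (levyOp s K b w) := by
  obtain ⟨C, -, hC⟩ := levyWeight_integrable (E := E) hs0 hs1 hΛ
  have hc1 : Continuous (fderiv ℝ w) := h.differentiable1.continuous
  have hc0 : Continuous w := h.contDiff.continuous
  unfold levyOp
  refine Continuous.add ?_ ?_
  · refine continuous_of_dominated (bound := fun y => 2 * M * (levyWeight s y * K y))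
      (fun x => levyOp_integrand_aestronglyMeasurable hK.meas hc0 x)
      (fun x => Eventually.of_forall fun y => ?_) ((hC c K b hK).1.const_mul (2 * M))
      (Eventually.of_forall fun y => ?_)
    · rw [norm_mul, Real.norm_of_nonneg (hK.nonneg y), ← mul_assoc]
      exact mul_le_mul_of_nonneg_right (h.integrand_le s x y) (hK.nonneg y)
    · fun_prop
  · split_ifs <;> fun_prop

lemma levyOp_comp_add_right (s : ℝ) (K : E → ℝ) (b : E) (w : E → ℝ) (a x : E) :
    levyOp s K b (fun z => w (z + a)) x = levyOp s K b w (x + a) := by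
  unfold levyOp
  simp only [fderiv_comp_add_right, add_right_comm]

lemma StableKer.cancel_clm {s c Λ : ℝ} {K : E → ℝ} {b : E} (h : StableKer s c Λ K b)
    (hs : s = 1 / 2) {ε R : ℝ} (hε : 0 < ε) (ℓ : E →L[ℝ] ℝ) :
    ∫ y in {y : E | ε ≤ ‖y‖ ∧ ‖y‖ < R}, ℓ y * K y = 0 := by
  have := h.cancel hs ε R hε ((InnerProductSpace.toDual ℝ E).symm ℓ)
  simpa using this

lemma StableKer.integrableOn_annulus {s c Λ : ℝ} {K : E → ℝ} {b : E} (h : StableKer s c Λ K b)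
    (hs0 : 0 < s) (hs1 : s < 1) (hΛ : 0 ≤ Λ) {ε R : ℝ} (hε : 0 < ε) (ℓ : E →L[ℝ] ℝ) :
    IntegrableOn (fun y => ℓ y * K y) {y : E | ε ≤ ‖y‖ ∧ ‖y‖ < R} := by
  have hm : MeasurableSet {y : E | ε ≤ ‖y‖ ∧ ‖y‖ < R} := by measurability
  have h1 := (h.far_integrable hΛ (p := 0) (R := ε) (by linarith) hε).1
  have hsub : {y : E | ε ≤ ‖y‖ ∧ ‖y‖ < R} ⊆ (Metric.ball 0 ε)ᶜ := fun y hy => by simpa using hy.1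
  refine ((h1.mono_set hsub).const_mul (‖ℓ‖ * R)).mono' ?_ ?_
  · exact ((by fun_prop : Measurable fun y => ℓ y).aemeasurable.mul h.meas).aestronglyMeasurable.restrict
  · filter_upwards [ae_restrict_mem hm] with y hy
    rw [Real.rpow_zero, one_mul, norm_mul, Real.norm_of_nonneg (h.nonneg y)]
    refine mul_le_mul_of_nonneg_right ((ℓ.le_opNorm y).trans ?_) (h.nonneg y)
    exact mul_le_mul_of_nonneg_left hy.2.le (norm_nonneg _)

/-- Substituting `y ↦ r y`, the Jacobian and the homogeneity leave `r ^ (-2s)`. For `s = 1/2` the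
compensator becomes the indicator of `‖y‖ < r⁻¹` instead of `‖y‖ < 1`; the discrepancy is the
integral of a linear form over an annulus, which is zero by cancellation. The drift scales like
`r⁻¹`, and `2s = 1` in that case. -/
lemma levyOp_scale {s : ℝ} (hs0 : 0 < s) (hs1 : s < 1) {Λ : ℝ} (hΛ : 0 ≤ Λ) {c : ℝ}
    {K : E → ℝ} {b : E} (hK : StableKer s c Λ K b) {M : ℝ} {w : E → ℝ} (h : BddC2 M w)
    {r : ℝ} (hr : 0 < r) (hr1 : r ≤ 1) (x : E) :
    levyOp s K b (fun z => w (r⁻¹ • z)) x = r ^ (-(2 * s)) * levyOp s K b w (r⁻¹ • x) := by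
  have hfd : ∀ y, fderiv ℝ (fun z => w (r⁻¹ • z)) x y = r⁻¹ * fderiv ℝ w (r⁻¹ • x) y := by
    intro y
    rw [fderiv_comp_smul]; simp
  unfold levyOp
  rw [mul_add]
  congr 1
  · set g : E → ℝ := fun y => (w (r⁻¹ • x) - w (r⁻¹ • (x + y)) +
      levyComp s y * fderiv ℝ (fun z => w (r⁻¹ • z)) x y) * K y with hg
    have h1 := Measure.integral_comp_smul (volume : Measure E) g r
    have h2 : ∫ y, g y = r ^ (finrank ℝ E) * ∫ y, g (r • y) := by
      rw [h1, abs_of_nonneg (by positivity), smul_eq_mul, ← mul_assoc, mul_inv_cancel₀ (by positivity),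
        one_mul]
    have h3 : ∀ y, g (r • y) = r ^ (-(finrank ℝ E : ℝ) - 2 * s) * ((w (r⁻¹ • x) - w (r⁻¹ • x + y) +
      levyComp s (r • y) * fderiv ℝ w (r⁻¹ • x) y) * K y) := by
      intro y
      simp only [hg]
      rw [hK.homog r hr, hfd, smul_add, smul_smul, inv_mul_cancel₀ hr.ne', one_smul, map_smul,
        smul_eq_mul, ← mul_assoc r⁻¹, inv_mul_cancel₀ hr.ne', one_mul]
      ring
    have h4 : ∫ y, (w (r⁻¹ • x) - w (r⁻¹ • x + y) +
        levyComp s (r • y) * fderiv ℝ w (r⁻¹ • x) y) * K y =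
        ∫ y, (w (r⁻¹ • x) - w (r⁻¹ • x + y) + levyComp s y * fderiv ℝ w (r⁻¹ • x) y) * K y := by
      by_cases hs : s = 1 / 2
      · have hm : MeasurableSet {y : E | 1 ≤ ‖y‖ ∧ ‖y‖ < r⁻¹} :=
          (measurableSet_le measurable_const measurable_norm).inter
            (measurableSet_lt measurable_norm measurable_const)
        have i1 := h.integrable hs0 hs1 hΛ hK (r⁻¹ • x)
        have i2 := hK.integrableOn_annulus hs0 hs1 hΛ (R := r⁻¹) one_pos (fderiv ℝ w (r⁻¹ • x))
        rw [← add_zero (∫ y, (w (r⁻¹ • x) - w (r⁻¹ • x + y) +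
          levyComp s y * fderiv ℝ w (r⁻¹ • x) y) * K y),
          ← hK.cancel_clm hs (R := r⁻¹) one_pos (fderiv ℝ w (r⁻¹ • x)), ← integral_indicator hm,
          ← integral_add i1 ((integrable_indicator_iff hm).2 i2)]
        refine integral_congr_ae (Eventually.of_forall fun y => ?_)
        have e1 : ‖r • y‖ < 1 ↔ ‖y‖ < r⁻¹ := by
          rw [norm_smul, Real.norm_of_nonneg hr.le, ← one_div, lt_div_iff₀ hr, mul_comm]
        have e2 : 1 ≤ r⁻¹ := (one_le_inv₀ hr).2 hr1
        have e3 : ∀ y : E, levyComp s y = if ‖y‖ < 1 then 1 else 0 := fun y => by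
          unfold levyComp; rw [if_neg (by rw [hs]; exact lt_irrefl _), if_pos hs]
        simp only [e3, e1, indicator, mem_ofPred_eq]
        by_cases ha : ‖y‖ < 1
        · have : ‖y‖ < r⁻¹ := ha.trans_le e2
          simp [ha, this, not_le.2 ha]
        · by_cases hb : ‖y‖ < r⁻¹
          · simp [ha, hb, not_lt.1 ha]; ring
          · simp [ha, hb]
      · simp only [levyComp, hs, if_false]
    rw [h2]
    simp_rw [h3]
    rw [integral_const_mul, h4, ← mul_assoc, ← Real.rpow_natCast, ← Real.rpow_add hr]
    congr 2; ring
  · split_ifs with hs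
    · rw [hfd, hs]
      norm_num [Real.rpow_neg_one]
    · simp

/-- With increments `χ x - χ (x + y)` and `φ x - φ (x + y)`, the increment of a product is given by
the Leibniz formula minus the product of the two increments; the gradient terms obey the Leibniz
rule exactly. The bilinear term is integrable against `K` because it is of size `min (‖y‖²) 1`. -/
lemma levyOp_mul {s : ℝ} (hs0 : 0 < s) (hs1 : s < 1) {Λ : ℝ} (hΛ : 0 ≤ Λ) {c : ℝ}
    {K : E → ℝ} {b : E} (hK : StableKer s c Λ K b) {M M' : ℝ} {χ φ : E → ℝ} (h : BddC2 M χ)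
    (h' : BddC2 M' φ) (x : E) :
    Integrable (fun y => (χ x - χ (x + y)) * (φ x - φ (x + y)) * K y) ∧
    levyOp s K b (fun z => χ z * φ z) x = χ x * levyOp s K b φ x + φ x * levyOp s K b χ x -
      ∫ y, (χ x - χ (x + y)) * (φ x - φ (x + y)) * K y := by
  have h0 := h.nonneg
  have h0' := h'.nonneg
  have hc : Continuous χ := h.contDiff.continuous
  have hc' : Continuous φ := h'.contDiff.continuous
  have i3 : Integrable (fun y => (χ x - χ (x + y)) * (φ x - φ (x + y)) * K y) := by
    obtain ⟨C, -, hC⟩ := levyWeight_integrable (E := E) hs0 hs1 hΛ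
    refine ((hC c K b hK).1.const_mul (4 * M * M')).mono' (AEMeasurable.aestronglyMeasurable
      (AEMeasurable.mul (by fun_prop) hK.meas)) (Eventually.of_forall fun y => ?_)
    rw [norm_mul, Real.norm_of_nonneg (hK.nonneg y), ← mul_assoc]
    refine mul_le_mul_of_nonneg_right ?_ (hK.nonneg y)
    refine le_trans ?_ (mul_le_mul_of_nonneg_left (min_sq_le_levyWeight s y) (by positivity))
    rw [norm_mul, Real.norm_eq_abs, Real.norm_eq_abs]
    have a1 : |χ x - χ (x + y)| ≤ 2 * M := by
      have := abs_sub (χ x) (χ (x + y)); have := h.bdd x; have := h.bdd (x + y); linarith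
    have a2 : |φ x - φ (x + y)| ≤ 2 * M' := by
      have := abs_sub (φ x) (φ (x + y)); have := h'.bdd x; have := h'.bdd (x + y); linarith
    have a3 := h.abs_sub_le x y
    have a4 := h'.abs_sub_le x y
    rcases le_total (‖y‖ ^ 2) 1 with hy | hy
    · rw [min_eq_left hy]
      calc _ ≤ (M * ‖y‖) * (M' * ‖y‖) := mul_le_mul a3 a4 (abs_nonneg _) (by positivity)
        _ ≤ _ := by nlinarith [mul_nonneg (mul_nonneg h0 h0') (sq_nonneg ‖y‖)]
    · rw [min_eq_right hy]
      calc _ ≤ (2 * M) * (2 * M') := mul_le_mul a1 a2 (abs_nonneg _) (by positivity)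
        _ = _ := by ring
  refine ⟨i3, ?_⟩
  have i1 := h.integrable hs0 hs1 hΛ hK x
  have i2 := h'.integrable hs0 hs1 hΛ hK x
  unfold levyOp
  rw [fderiv_fun_mul (h.differentiable x) (h'.differentiable x)]
  have e1 : ∫ y, (χ x * φ x - χ (x + y) * φ (x + y) +
      levyComp s y * (χ x • fderiv ℝ φ x + φ x • fderiv ℝ χ x) y) * K y =
      χ x * (∫ y, (φ x - φ (x + y) + levyComp s y * fderiv ℝ φ x y) * K y) +
      φ x * (∫ y, (χ x - χ (x + y) + levyComp s y * fderiv ℝ χ x y) * K y) -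
      ∫ y, (χ x - χ (x + y)) * (φ x - φ (x + y)) * K y := by
    have i4 := ((i2.const_mul (χ x)).add (i1.const_mul (φ x)))
    rw [← integral_const_mul, ← integral_const_mul, ← integral_add (i2.const_mul _) (i1.const_mul _)]
    refine Eq.trans ?_ (integral_sub i4 i3)
    refine integral_congr_ae (Eventually.of_forall fun y => ?_)
    simp only [add_apply, smul_apply, smul_eq_mul, Pi.add_apply]
    ring
  rw [e1]
  split_ifs <;> simp <;> ring

lemma lintegral_lintegral_comp_add {f g : E → ℝ≥0∞} (hf : Measurable f) (hg : AEMeasurable g volume) :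
    ∫⁻ x, ∫⁻ y, f (x + y) * g y = (∫⁻ x, f x) * ∫⁻ y, g y := by
  rw [lintegral_lintegral_swap]
  · have : ∀ y, ∫⁻ x, f (x + y) * g y = (∫⁻ x, f x) * g y := fun y => by
      rw [lintegral_mul_const _ (by fun_prop), lintegral_add_right_eq_self f y]
    simp_rw [this]
    rw [lintegral_const_mul'' _ hg]
  · exact (hf.comp (measurable_fst.add measurable_snd)).aemeasurable.mul hg.comp_snd

lemma exists_bddC2_of_hasCompactSupport {η : E → ℝ} (h : ContDiff ℝ 2 η)
    (hc : HasCompactSupport η) : ∃ M, BddC2 M η := by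
  obtain ⟨C0, h0⟩ := h.continuous.bounded_above_of_compact_support hc
  obtain ⟨C1, h1⟩ := (h.continuous_fderiv (by norm_num)).bounded_above_of_compact_support
    (hc.fderiv (𝕜 := ℝ))
  obtain ⟨C2, h2⟩ := ((h.fderiv_right (m := 1) (by norm_num)).continuous_fderiv
    (by norm_num)).bounded_above_of_compact_support ((hc.fderiv (𝕜 := ℝ)).fderiv (𝕜 := ℝ))
  refine ⟨max C0 (max C1 C2), h, fun x => (h0 x).trans (le_max_left _ _),
    fun x => (h1 x).trans ?_, fun x => (h2 x).trans ?_⟩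
  · exact (le_max_left _ _).trans (le_max_right _ _)
  · exact (le_max_right _ _).trans (le_max_right _ _)

lemma levyOp_eq_of_notMem_tsupport (s : ℝ) (K : E → ℝ) (b : E) {η : E → ℝ} {x : E}
    (hx : x ∉ tsupport η) : levyOp s K b η x = -∫ y, η (x + y) * K y := by
  have h1 : fderiv ℝ η x = 0 := fderiv_of_notMem_tsupport ℝ hx
  unfold levyOp
  rw [h1, image_eq_zero_of_notMem_tsupport hx, ← integral_neg]
  simp

/-- Needed because solutions are only bounded on the whole space. In a large ball continuity
suffices; outside of it `η` is reached only by jumps of length at least `1`, and the integral is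
controlled by `‖η‖₁` times the mass of the far kernel. -/
lemma levyOp_integrable {s : ℝ} (hs0 : 0 < s) (hs1 : s < 1) {Λ : ℝ} (hΛ : 0 ≤ Λ) {c : ℝ}
    {K : E → ℝ} {b : E} (hK : StableKer s c Λ K b) {η : E → ℝ} (h : ContDiff ℝ 2 η)
    (hc : HasCompactSupport η) : Integrable (levyOp s K b η) := by
  obtain ⟨M, hM⟩ := exists_bddC2_of_hasCompactSupport h hc
  have hcont := levyOp_continuous hs0 hs1 hΛ hK hM
  obtain ⟨R, hR⟩ := hc.isBounded.subset_closedBall (0 : E)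
  have i1 : IntegrableOn (levyOp s K b η) (Metric.closedBall 0 (R + 1)) :=
    hcont.continuousOn.integrableOn_compact (isCompact_closedBall _ _)
  set k : E → ℝ≥0∞ := (Metric.ball 0 1)ᶜ.indicator fun y => ENNReal.ofReal (K y) with hk
  have hkm : AEMeasurable k volume :=
    hK.meas.ennreal_ofReal.indicator Metric.isOpen_ball.measurableSet.compl
  have hkfin : ∫⁻ y, k y < ⊤ := by
    rw [hk, lintegral_indicator Metric.isOpen_ball.measurableSet.compl]
    have := hK.far 0 1 (by linarith) one_pos
    simp only [Real.rpow_zero, one_mul] at this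
    exact this.trans_lt ENNReal.ofReal_lt_top
  have i2 : IntegrableOn (levyOp s K b η) (Metric.closedBall 0 (R + 1))ᶜ := by
    refine ⟨hcont.aestronglyMeasurable, ?_⟩
    refine lt_of_le_of_lt (b := ∫⁻ x, ∫⁻ y, ‖η (x + y)‖ₑ * k y) ?_ ?_
    · refine (lintegral_mono_ae ?_).trans (setLIntegral_le_lintegral (Metric.closedBall (0:E) (R + 1))ᶜ _)
      filter_upwards [ae_restrict_mem Metric.isClosed_closedBall.measurableSet.compl] with x hx
      have hx' : R + 1 < ‖x‖ := by simpa using hx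
      have hxn : x ∉ tsupport η := fun hmem => by
        have : ‖x‖ ≤ R := by simpa using hR hmem
        linarith
      rw [levyOp_eq_of_notMem_tsupport s K b hxn, enorm_neg]
      refine (enorm_integral_le_lintegral_enorm _).trans (lintegral_mono fun y => ?_)
      simp only [enorm_mul]
      by_cases hy : ‖y‖ < 1
      · have : η (x + y) = 0 := image_eq_zero_of_notMem_tsupport fun hmem => by
          have h1 : ‖x + y‖ ≤ R := by simpa using hR hmem
          have h2 : ‖x‖ ≤ ‖x + y‖ + ‖y‖ := by simpa using norm_sub_le (x + y) y
          linarith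
        simp [this]
      · refine mul_le_mul_right (le_of_eq ?_) _
        rw [hk, indicator_of_mem (by simpa using hy), Real.enorm_of_nonneg (hK.nonneg y)]
    · rw [lintegral_lintegral_comp_add (f := fun x => ‖η x‖ₑ) h.continuous.measurable.enorm hkm]
      exact ENNReal.mul_lt_top (h.continuous.integrable_of_hasCompactSupport hc).2 hkfin
  rw [← integrableOn_univ, ← union_compl_self (Metric.closedBall (0:E) (R + 1))]
  exact i1.union i2

end LevyOperator

/-- Only `s = 1/2` needs an argument: over `ε < ‖y‖ < 1` the compensator integrates to zero by
cancellation, so it can be inserted for each `ε`, and then the principal value is a limit by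
dominated convergence. The kernels may differ on a null set, which takes care of the value at the
origin. -/
lemma stableOp_eq_levyOp {n : ℕ} {s : ℝ} (hs0 : 0 < s) (hs1 : s < 1) {Λ : ℝ} (hΛ : 0 ≤ Λ) {c : ℝ}
    {K K' : EuclideanSpace ℝ (Fin n) → ℝ} {b : EuclideanSpace ℝ (Fin n)}
    (hK : StableKer s c Λ K b) (hKK : K' =ᵐ[volume] K) {M : ℝ} {w : EuclideanSpace ℝ (Fin n) → ℝ}
    (h : BddC2 M w) (x : EuclideanSpace ℝ (Fin n)) : stableOp s K' b w x = levyOp s K b w x := by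
  unfold stableOp levyOp
  have hne : ∀ g : EuclideanSpace ℝ (Fin n) → ℝ, (fun y => g y * K' y) =ᵐ[volume] fun y => g y * K y := by
    intro g
    filter_upwards [hKK] with y hy
    rw [hy]
  split_ifs with h1 h2 h2
  · linarith
  · rw [integral_congr_ae (hne _), add_zero]
    simp only [levyComp, if_pos h1, zero_mul, add_zero]
  · congr 1
    refine Tendsto.limUnder_eq ?_
    have hc := h.contDiff.continuous
    have hint := h.integrable hs0 hs1 hΛ hK x
    have hcomp : ∀ y : EuclideanSpace ℝ (Fin n), levyComp s y = if ‖y‖ < 1 then 1 else 0 := fun y => by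
      unfold levyComp; rw [if_neg h1, if_pos h2]
    set G : EuclideanSpace ℝ (Fin n) → ℝ :=
      fun y => (w x - w (x + y) + levyComp s y * fderiv ℝ w x y) * K y with hG
    have hm : ∀ ε : ℝ, MeasurableSet {y : EuclideanSpace ℝ (Fin n) | ε < ‖y‖} := fun ε =>
      measurableSet_lt measurable_const measurable_norm
    have e1 : (fun ε : ℝ => ∫ y, {y : EuclideanSpace ℝ (Fin n) | ε < ‖y‖}.indicator G y) =ᶠ[𝓝[>] (0:ℝ)]
        fun ε => ∫ y in {y | ε < ‖y‖}, (w x - w (x + y)) * K' y := by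
      filter_upwards [Ioo_mem_nhdsGT (zero_lt_one (α := ℝ))] with ε hε
      rw [integral_indicator (hm ε), integral_congr_ae (ae_restrict_of_ae (hne _))]
      have hA : {y : EuclideanSpace ℝ (Fin n) | ε ≤ ‖y‖ ∧ ‖y‖ < 1} =ᵐ[volume]
          {y : EuclideanSpace ℝ (Fin n) | ε < ‖y‖ ∧ ‖y‖ < 1} := by
        have h0 : volume (Metric.sphere (0 : EuclideanSpace ℝ (Fin n)) ε) = 0 :=
          Measure.addHaar_sphere_of_ne_zero volume 0 hε.1.ne'
        refine Filter.eventuallyLE_antisymm_iff.2 ⟨?_, ?_⟩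
        · filter_upwards [measure_eq_zero_iff_ae_notMem.1 h0] with y hy hy'
          refine ⟨lt_of_le_of_ne hy'.1 fun h => hy (by simp [← h]), hy'.2⟩
        · exact Eventually.of_forall fun y hy => ⟨hy.1.le, hy.2⟩
      have hm2 : MeasurableSet {y : EuclideanSpace ℝ (Fin n) | ε < ‖y‖ ∧ ‖y‖ < 1} :=
        (hm ε).inter (measurableSet_lt measurable_norm measurable_const)
      have h3 := hK.cancel_clm h2 (R := 1) hε.1 (fderiv ℝ w x)
      have h4 := hK.integrableOn_annulus hs0 hs1 hΛ (R := 1) hε.1 (fderiv ℝ w x)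
      rw [setIntegral_congr_set hA] at h3
      rw [integrableOn_congr_set_ae hA] at h4
      rw [← integral_indicator (hm ε), ← integral_indicator (hm ε)]
      rw [← integral_indicator hm2] at h3
      rw [← integrable_indicator_iff hm2] at h4
      have h5 : ∫ y, {y : EuclideanSpace ℝ (Fin n) | ε < ‖y‖}.indicator
          (fun y => (w x - w (x + y)) * K y) y =
          ∫ y, ({y : EuclideanSpace ℝ (Fin n) | ε < ‖y‖}.indicator G y -
            {y : EuclideanSpace ℝ (Fin n) | ε < ‖y‖ ∧ ‖y‖ < 1}.indicator
              (fun y => fderiv ℝ w x y * K y) y) := by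
        refine integral_congr_ae (Eventually.of_forall fun y => ?_)
        simp only [indicator, mem_ofPred_eq, hG, hcomp]
        by_cases ha : ε < ‖y‖ <;> by_cases hb : ‖y‖ < 1 <;> simp only [ha, hb, and_self, and_true, and_false, true_and, false_and, if_true, if_false] <;> ring
      rw [h5, integral_sub (hint.indicator (hm ε)) h4, h3, sub_zero]
    refine Tendsto.congr' e1 ?_
    refine tendsto_integral_filter_of_dominated_convergence (fun y => ‖G y‖)
      (Eventually.of_forall fun ε => hint.aestronglyMeasurable.indicator (hm ε))
      (Eventually.of_forall fun ε => Eventually.of_forall fun y => norm_indicator_le_norm_self _ _)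
      hint.norm ?_
    -- The truncated integrands vanish at `y = 0` for every `ε`, so convergence at this point
    -- requires `G 0 = 0`.
    have h0 : ∀ᵐ y : EuclideanSpace ℝ (Fin n), y = 0 → G y = 0 := 
      Eventually.of_forall fun y hy => by simp [hG, hy]
    filter_upwards [h0] with y hy
    by_cases hy0 : y = 0
    · have : ∀ ε : ℝ, {y : EuclideanSpace ℝ (Fin n) | ε < ‖y‖}.indicator G y = 0 := fun ε => by
        rw [indicator_apply_eq_zero]; exact fun _ => hy hy0
      have h6 := hy hy0
      simp only [hG] at h6
      rw [h6]; simp only [this]; exact tendsto_const_nhds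
    · refine tendsto_const_nhds.congr' ?_
      filter_upwards [Ioo_mem_nhdsGT (norm_pos_iff.2 hy0)] with ε hε
      rw [indicator_of_mem (by exact hε.2)]
  · rw [integral_congr_ae (hne _), add_zero]
    simp only [levyComp, if_neg h1, if_neg h2, one_mul]

/-! ### The Fourier symbol: a smooth elliptic part minus the transform of the far kernel. -/

section Symbol

open Module FourierTransform

variable {E : Type*} [NormedAddCommGroup E] [InnerProductSpace ℝ E] [FiniteDimensional ℝ E]
  [MeasurableSpace E] [BorelSpace E]

/-- The character `ξ ↦ exp (-2 π i ⟨y, ξ⟩)`. -/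
def ech (y ξ : E) : ℂ := (Real.fourierChar (-(inner ℝ y ξ : ℝ)) : ℂ)

/-- The linear form `ξ ↦ ⟨y, ξ⟩`, with complex values. -/
def innerC : E →L[ℝ] E →L[ℝ] ℂ :=
  (ContinuousLinearMap.compL ℝ E ℝ ℂ Complex.ofRealCLM) ∘L innerSL ℝ

lemma innerC_apply (y ξ : E) : innerC y ξ = (inner ℝ y ξ : ℝ) := rfl

lemma norm_innerC_le (y : E) : ‖innerC y‖ ≤ ‖y‖ := by
  refine ContinuousLinearMap.opNorm_le_bound _ (norm_nonneg _) fun ξ => ?_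
  rw [innerC_apply, Complex.norm_real]
  exact norm_inner_le_norm y ξ

lemma norm_ech (y ξ : E) : ‖ech y ξ‖ = 1 := by
  unfold ech; exact Circle.norm_coe _

lemma ech_eq_exp (y ξ : E) : ech y ξ = Complex.exp (Complex.I * ((-(2 * Real.pi * inner ℝ y ξ) : ℝ) : ℂ)) := by
  unfold ech
  rw [Real.fourierChar_apply]
  congr 1
  push_cast; ring

lemma continuous_ech_left (ξ : E) : Continuous fun y : E => ech y ξ := by
  simp only [ech_eq_exp]
  fun_prop

lemma continuous_ech : Continuous fun p : E × E => ech p.1 p.2 := by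
  simp only [ech_eq_exp]
  fun_prop

lemma ech_comm (y ξ : E) : ech y ξ = ech ξ y := by
  unfold ech; rw [real_inner_comm]

lemma ech_add_left (x y ξ : E) : ech (x + y) ξ = ech x ξ * ech y ξ := by
  simp only [ech_eq_exp, ← Complex.exp_add, inner_add_left]
  congr 1; push_cast; ring

lemma ech_zero_right (y : E) : ech y 0 = 1 := by
  simp [ech_eq_exp]

lemma hasFDerivAt_ech (y ξ : E) :
    HasFDerivAt (ech y) ((-2 * Real.pi * Complex.I * ech y ξ) • innerC y) ξ :=
  Real.hasFDerivAt_fourierChar_neg_bilinear_right (innerSL ℝ) y ξ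

lemma norm_ech_sub_one_le (y ξ : E) : ‖ech y ξ - 1‖ ≤ 2 * Real.pi * (‖y‖ * ‖ξ‖) := by
  rw [ech_eq_exp]
  refine (Real.norm_exp_I_mul_ofReal_sub_one_le).trans ?_
  rw [norm_neg, norm_mul, Real.norm_of_nonneg (by positivity)]
  exact mul_le_mul_of_nonneg_left (norm_inner_le_norm y ξ) (by positivity)

lemma ech_re (y ξ : E) : (ech y ξ).re = Real.cos (2 * Real.pi * inner ℝ y ξ) := by
  rw [ech_eq_exp, mul_comm, Complex.exp_ofReal_mul_I_re, Real.cos_neg]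

lemma fourier_eq_integral_ech (h : E → ℂ) (z : E) : 𝓕 h z = ∫ ξ, ech ξ z * h ξ := rfl

/-- The indicator function of the unit ball. -/
def nearInd (y : E) : ℝ := (Metric.ball (0 : E) 1).indicator 1 y

lemma nearInd_measurable : Measurable (nearInd : E → ℝ) :=
  measurable_one.indicator Metric.isOpen_ball.measurableSet

lemma nearInd_eq (y : E) : nearInd y = if ‖y‖ < 1 then 1 else 0 := by
  simp [nearInd, indicator]

/-- In each regime the compensator is what makes this small. For `s < 1/2` nothing is subtracted and
`‖y‖` suffices near the origin; for `s ≥ 1/2` the subtraction of `1` gains a second factor `‖y‖`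
there, and for `s > 1/2` the constant compensator leaves `‖y‖` at infinity. -/
lemma norm_nearInd_ech_sub_comp_le (s : ℝ) (y ξ : E) :
    ‖((nearInd y : ℂ) * ech y ξ - levyComp s y)‖ * ‖y‖ ≤ (1 + 2 * Real.pi * ‖ξ‖) * levyWeight s y := by
  have hpi := Real.pi_pos
  have hn := norm_nonneg y
  have h1 := norm_ech_sub_one_le y ξ
  have h2 := norm_ech y ξ
  have h3 : 0 ≤ 2 * Real.pi * ‖ξ‖ := by positivity
  rw [nearInd_eq]
  unfold levyComp levyWeight
  split_ifs with ha hb hc hd <;> simp only [Complex.ofReal_one, Complex.ofReal_zero, one_mul, zero_mul, sub_zero, zero_sub, norm_neg, norm_one, norm_zero]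
  · rw [h2, min_eq_left ha.le]; nlinarith
  · rw [min_eq_left (by nlinarith)]
    nlinarith [mul_le_mul_of_nonneg_right h1 hn, sq_nonneg ‖y‖]
  · rw [min_eq_left (by nlinarith)]
    nlinarith [mul_le_mul_of_nonneg_right h1 hn, sq_nonneg ‖y‖]
  · positivity
  · positivity
  · rw [min_eq_right (by nlinarith)]; nlinarith

/-- The integrand of the symbol, without the oscillation outside of the unit ball. -/
def symInt (s : ℝ) (K : E → ℝ) (ξ y : E) : ℂ :=
  (1 - nearInd y * ech y ξ - 2 * Real.pi * Complex.I * levyComp s y * (inner ℝ y ξ : ℝ)) * K y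

/-- The derivative of `symInt s K · y` at `ξ`. -/
def symInt1 (s : ℝ) (K : E → ℝ) (ξ y : E) : E →L[ℝ] ℂ :=
  (2 * Real.pi * Complex.I * (nearInd y * ech y ξ - levyComp s y) * K y) • innerC y

/-- The amplitude of the oscillating part of the derivative of the symbol. -/
def symAmp (K : E → ℝ) (y : E) : E →L[ℝ] ℂ :=
  (2 * Real.pi * Complex.I * (nearInd y * K y : ℝ) : ℂ) • innerC y

/-- The regular part of the symbol. -/
def symReg (s : ℝ) (K : E → ℝ) (b : E) (ξ : E) : ℂ :=
  open Classical in
  (∫ y, symInt s K ξ y) - 2 * Real.pi * Complex.I * (if s = 1 / 2 then (inner ℝ b ξ : ℝ) else (0 : ℝ) : ℝ)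

lemma hasFDerivAt_symInt (s : ℝ) (K : E → ℝ) (ξ y : E) :
    HasFDerivAt (fun ξ => symInt s K ξ y) (symInt1 s K ξ y) ξ := by
  unfold symInt symInt1
  have h1 := hasFDerivAt_ech y ξ
  have h2 : HasFDerivAt (fun ξ => ((inner ℝ y ξ : ℝ) : ℂ)) (innerC y) ξ := (innerC y).hasFDerivAt
  have h3 := (((h1.const_mul (nearInd y : ℂ)).const_sub 1).sub
    (h2.const_mul (2 * Real.pi * Complex.I * levyComp s y : ℂ))).mul_const (K y : ℂ)
  refine h3.congr_fderiv ?_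
  ext v
  simp only [neg_apply, smul_apply, sub_apply, smul_eq_mul]
  ring

lemma norm_symInt1_le {s : ℝ} {K : E → ℝ} (hK : ∀ y, 0 ≤ K y) (ξ y : E) :
    ‖symInt1 s K ξ y‖ ≤ 2 * Real.pi * (1 + 2 * Real.pi * ‖ξ‖) * (levyWeight s y * K y) := by
  have h1 := norm_nearInd_ech_sub_comp_le s y ξ
  have h2 := norm_innerC_le y
  have hpi := Real.pi_pos
  unfold symInt1
  rw [norm_smul, norm_mul, norm_mul, Complex.norm_real, Real.norm_of_nonneg (hK y)]
  have h3 : ‖(2 * Real.pi * Complex.I : ℂ)‖ = 2 * Real.pi := by simp [abs_of_pos hpi]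
  rw [h3]
  calc _ ≤ 2 * Real.pi * ‖(nearInd y : ℂ) * ech y ξ - levyComp s y‖ * K y * ‖y‖ := by
        gcongr
        exact mul_nonneg (by positivity) (hK y)
    _ = 2 * Real.pi * (‖(nearInd y : ℂ) * ech y ξ - levyComp s y‖ * ‖y‖) * K y := by ring
    _ ≤ 2 * Real.pi * ((1 + 2 * Real.pi * ‖ξ‖) * levyWeight s y) * K y := by
        gcongr; exact hK y
    _ = _ := by ring

lemma symInt_aesm {s : ℝ} {K : E → ℝ} (hK : AEMeasurable K volume) (ξ : E) :
    AEStronglyMeasurable (symInt s K ξ) volume := by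
  have h1 := levyComp_measurable (E := E) s
  have h2 := nearInd_measurable (E := E)
  have h3 := (continuous_ech_left ξ).measurable
  refine AEMeasurable.aestronglyMeasurable ?_
  unfold symInt
  have h4 : Measurable fun y : E => ((inner ℝ y ξ : ℝ) : ℂ) := by fun_prop
  refine AEMeasurable.mul (Measurable.aemeasurable ?_) (Complex.measurable_ofReal.comp_aemeasurable hK)
  fun_prop

lemma symInt1_aesm {s : ℝ} {K : E → ℝ} (hK : AEMeasurable K volume) (ξ : E) :
    AEStronglyMeasurable (symInt1 s K ξ) volume := by
  have h1 := levyComp_measurable (E := E) s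
  have h2 := nearInd_measurable (E := E)
  have h3 := (continuous_ech_left ξ).measurable
  have h4 : AEMeasurable (fun y => (2 * Real.pi * Complex.I * (nearInd y * ech y ξ - levyComp s y) * K y : ℂ))
      volume := by
    refine AEMeasurable.mul (Measurable.aemeasurable ?_) (Complex.measurable_ofReal.comp_aemeasurable hK)
    fun_prop
  have h5 : AEStronglyMeasurable (fun y : E => innerC y) volume :=
    (innerC (E := E)).continuous.aestronglyMeasurable
  exact h4.aestronglyMeasurable.smul h5

lemma symAmp_aesm {K : E → ℝ} (hK : AEMeasurable K volume) :
    AEStronglyMeasurable (symAmp K) volume := by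
  have h2 := nearInd_measurable (E := E)
  have h4 : AEMeasurable (fun y => (2 * Real.pi * Complex.I * (nearInd y * K y : ℝ) : ℂ)) volume :=
    (Complex.measurable_ofReal.comp_aemeasurable (h2.aemeasurable.mul hK)).const_mul _
  have h5 : AEStronglyMeasurable (fun y : E => innerC y) volume :=
    (innerC (E := E)).continuous.aestronglyMeasurable
  exact h4.aestronglyMeasurable.smul h5

lemma norm_symAmp_le {K : E → ℝ} (hK : ∀ y, 0 ≤ K y) (y : E) :
    ‖symAmp K y‖ ≤ 2 * Real.pi * (nearInd y * (‖y‖ * K y)) := by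
  have h2 := norm_innerC_le y
  have hn : 0 ≤ nearInd y := indicator_nonneg (fun _ _ => zero_le_one) y
  have h3 : ‖(2 * Real.pi * Complex.I * (nearInd y * K y : ℝ) : ℂ)‖ = 2 * Real.pi * (nearInd y * K y) := by
    rw [norm_mul, Complex.norm_real, Real.norm_of_nonneg (mul_nonneg hn (hK y))]
    simp [abs_of_pos Real.pi_pos]
  unfold symAmp
  rw [norm_smul, h3]
  calc _ ≤ 2 * Real.pi * (nearInd y * K y) * ‖y‖ := by
        gcongr
        exact mul_nonneg Real.two_pi_pos.le (mul_nonneg hn (hK y))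
    _ = _ := by ring

/-- All dependence on `ξ` is collected in `ech y ξ - 1`, against an amplitude supported in the unit
ball. That amplitude has size `‖y‖ * K y`, which need not be integrable for `s ≥ 1/2`, so the `-1`
cannot be dropped. -/
lemma symInt1_eq (s : ℝ) (K : E → ℝ) (ξ y : E) :
    symInt1 s K ξ y = symInt1 s K 0 y + (ech y ξ - 1) • symAmp K y := by
  unfold symInt1 symAmp
  ext v
  simp only [ech_zero_right, add_apply, smul_apply, smul_eq_mul]
  push_cast; ring

/-! ### Oscillating integrals of amplitudes whose moments are finite from order one on. -/

section Oscillation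

variable {F : Type*} [NormedAddCommGroup F] [NormedSpace ℂ F] {f : E → F}

lemma norm_fourierSMulRight_innerSL_le (f : E → F) (y : E) :
    ‖VectorFourier.fourierSMulRight (innerSL ℝ) f y‖ ≤ 2 * Real.pi * (‖y‖ * ‖f y‖) := by
  refine (VectorFourier.norm_fourierSMulRight_le _ _ _).trans ?_
  calc 2 * Real.pi * ‖innerSL ℝ (E := E)‖ * ‖y‖ * ‖f y‖ ≤ 2 * Real.pi * 1 * ‖y‖ * ‖f y‖ := by
        gcongr; exact norm_innerSL_le ℝ
    _ = _ := by ring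

lemma integrable_pow_mul_fourierSMulRight (hf : AEStronglyMeasurable f volume)
    (hi : ∀ i, 1 ≤ i → Integrable (fun y => ‖y‖ ^ i * ‖f y‖)) (i : ℕ) :
    Integrable (fun y => ‖y‖ ^ i * ‖VectorFourier.fourierSMulRight (innerSL ℝ) f y‖) := by
  refine ((hi (i + 1) (by omega)).const_mul (2 * Real.pi)).mono' (AEStronglyMeasurable.mul
      (continuous_norm.pow i).aestronglyMeasurable
      (AEStronglyMeasurable.fourierSMulRight (L := innerSL ℝ) hf).norm) (Eventually.of_forall fun y => ?_)
  rw [Real.norm_of_nonneg (by positivity)]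
  calc _ ≤ ‖y‖ ^ i * (2 * Real.pi * (‖y‖ * ‖f y‖)) := by
        gcongr; exact norm_fourierSMulRight_innerSL_le f y
    _ = _ := by ring

/-- Subtracting `1` makes the integrand integrable with only a first moment. Differentiating once
brings down a factor `y`; the new amplitude has all moments, so from then on this is an ordinary
Fourier transform. -/
lemma hasFDerivAt_integral_ech_sub_one (hf : AEStronglyMeasurable f volume)
    (hi : ∀ i, 1 ≤ i → Integrable (fun y => ‖y‖ ^ i * ‖f y‖)) (ξ : E) :
    HasFDerivAt (fun ξ => ∫ y, (ech y ξ - 1) • f y)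
      (𝓕 (VectorFourier.fourierSMulRight (innerSL ℝ) f) ξ) ξ := by
  have hm : ∀ η : E, AEStronglyMeasurable (fun y => (ech y η - 1) • f y) volume := fun η =>
    ((continuous_ech_left η).sub continuous_const).aestronglyMeasurable.smul hf
  have h1 : Integrable (fun y => ‖y‖ * ‖f y‖) := by simpa using hi 1 le_rfl
  refine hasFDerivAt_integral_of_dominated_of_fderiv_le (s := univ)
      (F' := fun η y => (Real.fourierChar (-(inner ℝ y η : ℝ))) •
        VectorFourier.fourierSMulRight (innerSL ℝ) f y)
      (bound := fun y => ‖VectorFourier.fourierSMulRight (innerSL ℝ) f y‖)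
      Filter.univ_mem (Eventually.of_forall hm) ?_ ?_
      (Eventually.of_forall fun y η _ => by
        rw [Circle.smul_def, norm_smul, Circle.norm_coe, one_mul])
      (by simpa using integrable_pow_mul_fourierSMulRight hf hi 0)
      (Eventually.of_forall fun y η _ => ?_)
  · refine (h1.const_mul (2 * Real.pi * ‖ξ‖)).mono' (hm ξ) (Eventually.of_forall fun y => ?_)
    rw [norm_smul]
    calc _ ≤ 2 * Real.pi * (‖y‖ * ‖ξ‖) * ‖f y‖ := by
          gcongr; exact norm_ech_sub_one_le y ξ
      _ = _ := by ring
  · have := (continuous_ech_left ξ).aestronglyMeasurable.smul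
      (AEStronglyMeasurable.fourierSMulRight (L := innerSL ℝ) hf)
    exact this
  · have h := (VectorFourier.hasFDerivAt_fourierChar_smul (innerSL ℝ) f y η).sub_const (f y)
    refine h.congr_of_eventuallyEq (Eventually.of_forall fun η => ?_)
    simp only [sub_smul, one_smul]
    rfl

lemma contDiff_integral_ech_sub_one (hf : AEStronglyMeasurable f volume)
    (hi : ∀ i, 1 ≤ i → Integrable (fun y => ‖y‖ ^ i * ‖f y‖)) :
    ContDiff ℝ ∞ (fun ξ => ∫ y, (ech y ξ - 1) • f y) := by
  rw [contDiff_infty_iff_fderiv]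
  refine ⟨fun ξ => (hasFDerivAt_integral_ech_sub_one hf hi ξ).differentiableAt, ?_⟩
  rw [funext fun ξ => (hasFDerivAt_integral_ech_sub_one hf hi ξ).fderiv]
  exact Real.contDiff_fourier (N := ⊤) fun i _ => integrable_pow_mul_fourierSMulRight hf hi i

lemma norm_iteratedFDeriv_integral_ech_sub_one_le (hf : AEStronglyMeasurable f volume)
    (hi : ∀ i, 1 ≤ i → Integrable (fun y => ‖y‖ ^ i * ‖f y‖)) (i : ℕ) (ξ : E) :
    ‖iteratedFDeriv ℝ (i + 1) (fun ξ => ∫ y, (ech y ξ - 1) • f y) ξ‖ ≤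
      (2 * Real.pi) ^ (i + 1) * ∫ y, ‖y‖ ^ (i + 1) * ‖f y‖ := by
  have hI := integrable_pow_mul_fourierSMulRight hf hi
  rw [← norm_iteratedFDeriv_fderiv, funext fun ξ => (hasFDerivAt_integral_ech_sub_one hf hi ξ).fderiv,
    Real.iteratedFDeriv_fourier (N := ⊤) (fun i _ => hI i)
      (AEStronglyMeasurable.fourierSMulRight (L := innerSL ℝ) hf) le_top]
  refine (VectorFourier.norm_fourierIntegral_le_integral_norm _ _ _ _ _).trans ?_
  rw [← integral_const_mul]
  refine integral_mono_of_nonneg (Eventually.of_forall fun y => norm_nonneg _)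
      ((hi (i + 1) (by omega)).const_mul _) (Eventually.of_forall fun y => ?_)
  refine (VectorFourier.norm_fourierPowSMulRight_le _ _ _ _).trans ?_
  calc (2 * Real.pi * ‖innerSL ℝ (E := E)‖) ^ i * ‖y‖ ^ i *
        ‖VectorFourier.fourierSMulRight (innerSL ℝ) f y‖
      ≤ (2 * Real.pi * 1) ^ i * ‖y‖ ^ i * (2 * Real.pi * (‖y‖ * ‖f y‖)) := by
        gcongr
        · exact norm_innerSL_le ℝ
        · exact norm_fourierSMulRight_innerSL_le f y
    _ = _ := by ring

end Oscillation

variable {s c Λ : ℝ} {K : E → ℝ} {b : E}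

lemma StableKer.nearSq_integrable (hK : StableKer s c Λ K b) (hs1 : s < 1) (hΛ : 0 ≤ Λ) :
    Integrable (fun y => nearInd y * (‖y‖ ^ 2 * K y)) ∧
      ∫ y, nearInd y * (‖y‖ ^ 2 * K y) ≤ Λ * (1 / (2 - 2 * s)) := by
  have h := hK.near_integrable hΛ (p := 2) (R := 1) (by linarith) one_pos
  have h1 : (fun y : E => nearInd y * (‖y‖ ^ 2 * K y)) =
      (Metric.ball 0 1).indicator fun y => ‖y‖ ^ (2:ℝ) * K y := by
    ext y; simp [nearInd, indicator]
  rw [h1, integrable_indicator_iff Metric.isOpen_ball.measurableSet,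
    integral_indicator Metric.isOpen_ball.measurableSet]
  simpa using h

lemma StableKer.farInt (hK : StableKer s c Λ K b) (hs0 : 0 < s) (hΛ : 0 ≤ Λ) :
    Integrable (fun y => (1 - nearInd y) * K y) ∧
      ∫ y, (1 - nearInd y) * K y ≤ Λ * (1 / (2 * s)) ∧ 0 < ∫ y, (1 - nearInd y) * K y := by
  have h := hK.far_integrable hΛ (p := 0) (R := 1) (by linarith) one_pos
  have h1 : (fun y : E => (1 - nearInd y) * K y) =
      (Metric.ball 0 1)ᶜ.indicator fun y => ‖y‖ ^ (0:ℝ) * K y := by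
    ext y
    rw [nearInd_eq]
    by_cases hy : ‖y‖ < 1
    · simp [indicator, hy]
    · simp [indicator, hy]
  rw [h1, integrable_indicator_iff Metric.isOpen_ball.measurableSet.compl,
    integral_indicator Metric.isOpen_ball.measurableSet.compl]
  refine ⟨h.1, by simpa using h.2, ?_⟩
  have h2 := hK.farpos
  simp only [Real.rpow_zero, one_mul] at h ⊢
  rw [← ofReal_integral_eq_lintegral_ofReal h.1 (Eventually.of_forall fun y => hK.nonneg y)] at h2
  exact ENNReal.ofReal_pos.1 h2

/-- The mass of the kernel outside of the unit ball. -/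
def farMass (K : E → ℝ) : ℝ := ∫ y, (1 - nearInd y) * K y

lemma norm_symInt_sub_le {K : E → ℝ} (hK : ∀ y, 0 ≤ K y) (ξ y : E) :
    ‖symInt s K ξ y - symInt s K 0 y‖ ≤
      2 * Real.pi * (1 + 2 * Real.pi * ‖ξ‖) * (levyWeight s y * K y) * ‖ξ‖ := by
  have hb : ∀ η ∈ Metric.closedBall (0:E) ‖ξ‖, ‖symInt1 s K η y‖ ≤
      2 * Real.pi * (1 + 2 * Real.pi * ‖ξ‖) * (levyWeight s y * K y) := by
    intro η hη
    refine (norm_symInt1_le hK η y).trans ?_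
    have h2 : ‖η‖ ≤ ‖ξ‖ := mem_closedBall_zero_iff.1 hη
    have h3 := mul_nonneg (levyWeight_nonneg s y) (hK y)
    have hpi := Real.pi_pos
    gcongr
  have h := Convex.norm_image_sub_le_of_norm_hasFDerivWithin_le
    (f := fun η => symInt s K η y) (f' := fun η => symInt1 s K η y) (x := 0) (y := ξ)
    (fun η _ => (hasFDerivAt_symInt s K η y).hasFDerivWithinAt) hb
    (convex_closedBall 0 ‖ξ‖) (Metric.mem_closedBall_self (norm_nonneg ξ))
    (mem_closedBall_zero_iff.2 le_rfl)
  rwa [sub_zero] at h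

lemma symInt_integrable (hs0 : 0 < s) (hs1 : s < 1) (hΛ : 0 ≤ Λ) (hK : StableKer s c Λ K b) (ξ : E) :
    Integrable (symInt s K ξ) := by
  obtain ⟨C, -, hC⟩ := levyWeight_integrable (E := E) hs0 hs1 hΛ
  obtain ⟨i1, -⟩ := hC c K b hK
  have i2 := (hK.farInt hs0 hΛ).1
  have hpi := Real.pi_pos
  refine (i2.add (i1.const_mul (2 * Real.pi * (1 + 2 * Real.pi * ‖ξ‖) * ‖ξ‖))).mono'
    (symInt_aesm hK.meas ξ) (Eventually.of_forall fun y => ?_)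
  have h0 : symInt s K 0 y = ((1 - nearInd y) * K y : ℝ) := by
    simp [symInt, ech_zero_right]
  have hn : 0 ≤ 1 - nearInd y := by rw [nearInd_eq]; split_ifs <;> norm_num
  have h1 := norm_symInt_sub_le (s := s) hK.nonneg ξ y
  have h2 := norm_le_norm_add_norm_sub' (symInt s K ξ y) (symInt s K 0 y)
  rw [h0, Complex.norm_real, Real.norm_of_nonneg (mul_nonneg hn (hK.nonneg y)), ← h0] at h2
  have h3 : 2 * Real.pi * (1 + 2 * Real.pi * ‖ξ‖) * ‖ξ‖ * (levyWeight s y * K y) =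
    2 * Real.pi * (1 + 2 * Real.pi * ‖ξ‖) * (levyWeight s y * K y) * ‖ξ‖ := by ring
  simp only [Pi.add_apply]
  rw [h3]
  linarith

def symReg1 (s : ℝ) (K : E → ℝ) (b : E) (ξ : E) : E →L[ℝ] ℂ :=
  open Classical in
  (∫ y, symInt1 s K ξ y) - (2 * Real.pi * Complex.I) • (if s = 1 / 2 then innerC b else 0)

lemma hasFDerivAt_symReg (hs0 : 0 < s) (hs1 : s < 1) (hΛ : 0 ≤ Λ) (hK : StableKer s c Λ K b) (ξ : E) :
    HasFDerivAt (symReg s K b) (symReg1 s K b ξ) ξ := by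
  obtain ⟨C, -, hC⟩ := levyWeight_integrable (E := E) hs0 hs1 hΛ
  obtain ⟨i1, -⟩ := hC c K b hK
  have hpi := Real.pi_pos
  unfold symReg symReg1
  refine HasFDerivAt.sub ?_ ?_
  · refine hasFDerivAt_integral_of_dominated_of_fderiv_le (s := Metric.ball ξ 1)
      (bound := fun y => 2 * Real.pi * (1 + 2 * Real.pi * (‖ξ‖ + 1)) * (levyWeight s y * K y))
      (Metric.ball_mem_nhds _ one_pos) (Eventually.of_forall fun η => symInt_aesm hK.meas η)
      (symInt_integrable hs0 hs1 hΛ hK ξ) (symInt1_aesm hK.meas ξ)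
      (Eventually.of_forall fun y η hη => ?_) (i1.const_mul _)
      (Eventually.of_forall fun y η hη => hasFDerivAt_symInt s K η y)
    refine (norm_symInt1_le hK.nonneg η y).trans ?_
    have : ‖η‖ ≤ ‖ξ‖ + 1 := by
      have h1 : ‖η - ξ‖ < 1 := by simpa [dist_eq_norm] using hη
      have h2 := norm_add_le (η - ξ) ξ
      rw [sub_add_cancel] at h2
      linarith
    have := mul_nonneg (levyWeight_nonneg s y) (hK.nonneg y)
    gcongr
  · refine HasFDerivAt.const_mul ?_ _
    split_ifs
    · exact (innerC b).hasFDerivAt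
    · simpa using hasFDerivAt_const (0:ℂ) ξ

lemma symAmp_integrable_pow (hs1 : s < 1) (hΛ : 0 ≤ Λ) (hK : StableKer s c Λ K b) (i : ℕ)
    (hi : 1 ≤ i) :
    Integrable (fun y => ‖y‖ ^ i * ‖symAmp K y‖) ∧
      ∫ y, ‖y‖ ^ i * ‖symAmp K y‖ ≤ 2 * Real.pi * (Λ * (1 / (2 - 2 * s))) := by
  obtain ⟨h1, h2⟩ := hK.nearSq_integrable hs1 hΛ
  have hpi := Real.pi_pos
  have hb : ∀ y, ‖y‖ ^ i * ‖symAmp K y‖ ≤ 2 * Real.pi * (nearInd y * (‖y‖ ^ 2 * K y)) := by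
    intro y
    have h3 := norm_symAmp_le hK.nonneg y
    by_cases hy : ‖y‖ < 1
    · calc ‖y‖ ^ i * ‖symAmp K y‖ ≤ ‖y‖ ^ 1 * (2 * Real.pi * (nearInd y * (‖y‖ * K y))) := by
            gcongr ?_ * ?_
            exact pow_le_pow_of_le_one (norm_nonneg _) hy.le hi
        _ = _ := by ring
    · have h4 : nearInd y = 0 := by rw [nearInd_eq, if_neg hy]
      rw [h4] at h3 ⊢
      have : ‖symAmp K y‖ = 0 := le_antisymm (by simpa using h3) (norm_nonneg _)
      simp [this]
  have i0 : Integrable (fun y => ‖y‖ ^ i * ‖symAmp K y‖) :=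
    (h1.const_mul (2 * Real.pi)).mono' (AEStronglyMeasurable.mul
      (continuous_norm.pow i).aestronglyMeasurable (symAmp_aesm hK.meas).norm)
      (Eventually.of_forall fun y => by
        rw [Real.norm_of_nonneg (by positivity)]; exact hb y)
  refine ⟨i0, (integral_mono i0 (h1.const_mul _) hb).trans ?_⟩
  rw [integral_const_mul]
  gcongr

lemma symReg1_eq (hs0 : 0 < s) (hs1 : s < 1) (hΛ : 0 ≤ Λ) (hK : StableKer s c Λ K b) :
    symReg1 s K b = fun ξ => (∫ y, (ech y ξ - 1) • symAmp K y) + symReg1 s K b 0 := by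
  obtain ⟨C, -, hC⟩ := levyWeight_integrable (E := E) hs0 hs1 hΛ
  obtain ⟨i1, -⟩ := hC c K b hK
  have hI : ∀ ξ, Integrable (symInt1 s K ξ) := fun ξ =>
    (i1.const_mul _).mono' (symInt1_aesm hK.meas ξ)
      (Eventually.of_forall fun y => norm_symInt1_le hK.nonneg ξ y)
  funext ξ
  have h1 : ∫ y, (ech y ξ - 1) • symAmp K y = (∫ y, symInt1 s K ξ y) - ∫ y, symInt1 s K 0 y := by
    rw [← integral_sub (hI ξ) (hI 0)]
    refine integral_congr_ae (Eventually.of_forall fun y => ?_)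
    show _ = symInt1 s K ξ y - symInt1 s K 0 y
    rw [symInt1_eq s K ξ y, add_sub_cancel_left]
  rw [h1]
  unfold symReg1
  abel

lemma symReg_contDiff (hs0 : 0 < s) (hs1 : s < 1) (hΛ : 0 ≤ Λ) (hK : StableKer s c Λ K b) :
    ContDiff ℝ ∞ (symReg s K b) := by
  rw [contDiff_infty_iff_fderiv]
  refine ⟨fun ξ => (hasFDerivAt_symReg hs0 hs1 hΛ hK ξ).differentiableAt, ?_⟩
  rw [funext fun ξ => (hasFDerivAt_symReg hs0 hs1 hΛ hK ξ).fderiv]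
  change ContDiff ℝ ∞ (symReg1 s K b)
  rw [symReg1_eq hs0 hs1 hΛ hK]
  exact (contDiff_integral_ech_sub_one (symAmp_aesm hK.meas)
    fun i hi => (symAmp_integrable_pow hs1 hΛ hK i hi).1).add contDiff_const

lemma norm_symReg1_le (hs0 : 0 < s) (hs1 : s < 1) (hΛ : 0 ≤ Λ) :
    ∃ D, 0 ≤ D ∧ ∀ (c : ℝ) (K : E → ℝ) (b : E), StableKer s c Λ K b →
      ∀ ξ : E, ‖ξ‖ ≤ 4 → ‖symReg1 s K b ξ‖ ≤ D := by
  obtain ⟨C, hC0, hC⟩ := levyWeight_integrable (E := E) hs0 hs1 hΛ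
  have hpi := Real.pi_pos
  refine ⟨2 * Real.pi * (1 + 2 * Real.pi * 4) * C + 2 * Real.pi * Λ, by positivity, ?_⟩
  intro c K b hK ξ hξ
  obtain ⟨i1, i2⟩ := hC c K b hK
  unfold symReg1
  refine (norm_sub_le _ _).trans (add_le_add ?_ ?_)
  · refine (norm_integral_le_of_norm_le (i1.const_mul (2 * Real.pi * (1 + 2 * Real.pi * 4)))
        (Eventually.of_forall fun y => (norm_symInt1_le hK.nonneg ξ y).trans ?_)).trans ?_
    · have := mul_nonneg (levyWeight_nonneg s y) (hK.nonneg y)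
      gcongr
    · rw [integral_const_mul]; gcongr
  · have h3 : ‖(2 * Real.pi * Complex.I : ℂ)‖ = 2 * Real.pi := by simp [abs_of_pos Real.pi_pos]
    rw [norm_smul, h3]
    gcongr
    split_ifs with hs
    · exact (norm_innerC_le b).trans (hK.drift hs)
    · rw [norm_zero]; exact hΛ

/-- The first derivative grows with `ξ`, which is why `‖ξ‖ ≤ 4` is imposed. The higher ones are
transforms of `symAmp` times powers of `y`, bounded by the second moment of the kernel in the unit
ball. Both bounds depend on the kernel only through `s` and `Λ`. -/
lemma exists_symReg_deriv_bound (hs0 : 0 < s) (hs1 : s < 1) (hΛ : 0 ≤ Λ) (N : ℕ) :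
    ∃ D, 0 ≤ D ∧ ∀ (c : ℝ) (K : E → ℝ) (b : E), StableKer s c Λ K b →
      ∀ i ≤ N, ∀ ξ : E, ‖ξ‖ ≤ 4 → ‖iteratedFDeriv ℝ i (fderiv ℝ (symReg s K b)) ξ‖ ≤ D := by
  obtain ⟨D, hD0, hD⟩ := norm_symReg1_le (E := E) hs0 hs1 hΛ
  have hpi := Real.pi_gt_three
  have hs2 : 0 < 2 - 2 * s := by linarith
  refine ⟨max D ((2 * Real.pi) ^ N * (2 * Real.pi * (Λ * (1 / (2 - 2 * s))))), by positivity, ?_⟩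
  intro c K b hK i hi ξ hξ
  have e1 : fderiv ℝ (symReg s K b) = symReg1 s K b :=
    funext fun ξ => (hasFDerivAt_symReg hs0 hs1 hΛ hK ξ).fderiv
  have hf := symAmp_aesm hK.meas
  have hint : ∀ i, 1 ≤ i → Integrable (fun y => ‖y‖ ^ i * ‖symAmp K y‖) :=
    fun i hi => (symAmp_integrable_pow hs1 hΛ hK i hi).1
  rw [e1]
  rcases i with - | i
  · refine le_max_of_le_left ?_
    rw [norm_iteratedFDeriv_zero]
    exact hD c K b hK ξ hξ
  · refine le_max_of_le_right ?_
    rw [symReg1_eq hs0 hs1 hΛ hK, ← norm_iteratedFDeriv_fderiv]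
    have e2 : fderiv ℝ (fun ξ => (∫ y, (ech y ξ - 1) • symAmp K y) + symReg1 s K b 0) =
        fderiv ℝ (fun ξ => ∫ y, (ech y ξ - 1) • symAmp K y) :=
      funext fun ξ => fderiv_add_const _
    rw [e2, norm_iteratedFDeriv_fderiv]
    refine (norm_iteratedFDeriv_integral_ech_sub_one_le hf hint i ξ).trans ?_
    have h2 := (symAmp_integrable_pow hs1 hΛ hK (i + 1) (by omega)).2
    gcongr
    linarith

/-- The part of the kernel outside of the unit ball. -/
def farKer (K : E → ℝ) (y : E) : ℂ := ((1 - nearInd y) * K y : ℝ)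

/-- The Fourier symbol of the operator. -/
def levySymbol (s : ℝ) (K : E → ℝ) (b ξ : E) : ℂ := symReg s K b ξ - 𝓕 (farKer K) ξ

lemma farKer_integrable (hs0 : 0 < s) (hΛ : 0 ≤ Λ) (hK : StableKer s c Λ K b) :
    Integrable (farKer K) := (hK.farInt hs0 hΛ).1.ofReal

lemma nearInd_le_one (y : E) : nearInd y ≤ 1 := by rw [nearInd_eq]; split_ifs <;> norm_num

lemma norm_fourier_farKer_le (hK : StableKer s c Λ K b) (ξ : E) :
    ‖𝓕 (farKer K) ξ‖ ≤ farMass K := by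
  refine (VectorFourier.norm_fourierIntegral_le_integral_norm _ _ _ _ _).trans (le_of_eq ?_)
  refine integral_congr_ae (Eventually.of_forall fun y => ?_)
  simp only [farKer]
  rw [Complex.norm_real, Real.norm_of_nonneg]
  exact mul_nonneg (sub_nonneg.2 (nearInd_le_one y)) (hK.nonneg y)

/-- The real part is the mass of the far kernel plus the integral of `(1 - cos (2π⟨y, ξ⟩)) K y` over
the unit ball. The second term is nonnegative; on the annulus it is at least `c ‖ξ‖²` by the bound
on second moments. This excess over the far mass is what makes the Neumann series converge. -/
lemma symReg_re_ge (hs0 : 0 < s) (hs1 : s < 1) (hΛ : 0 ≤ Λ) (hK : StableKer s c Λ K b) (ξ : E) :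
    farMass K ≤ (symReg s K b ξ).re ∧
      (1 ≤ ‖ξ‖ → ‖ξ‖ ≤ 4 → 0 ≤ c → farMass K + c ≤ (symReg s K b ξ).re) := by
  have hI := symInt_integrable hs0 hs1 hΛ hK ξ
  obtain ⟨f1, -, -⟩ := hK.farInt hs0 hΛ
  have hre : (symReg s K b ξ).re = ∫ y, (symInt s K ξ y).re := by
    unfold symReg
    have h1 : (∫ y, symInt s K ξ y).re = ∫ y, (symInt s K ξ y).re := (integral_re hI).symm
    rw [Complex.sub_re, h1]
    simp
  have hre2 : ∀ y, (symInt s K ξ y).re =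
      (1 - nearInd y) * K y + nearInd y * (1 - Real.cos (2 * Real.pi * inner ℝ y ξ)) * K y := by
    intro y
    unfold symInt
    simp [ech_re]; ring
  have i2 : Integrable (fun y => nearInd y * (1 - Real.cos (2 * Real.pi * inner ℝ y ξ)) * K y) := by
    refine (hI.re.sub f1).congr (Eventually.of_forall fun y => ?_)
    have := hre2 y
    simp only [Pi.sub_apply, RCLike.re_to_complex]
    linarith
  have hn : ∀ y : E, 0 ≤ nearInd y := fun y => indicator_nonneg (fun _ _ => zero_le_one) y
  have hpos : ∀ y, 0 ≤ nearInd y * (1 - Real.cos (2 * Real.pi * inner ℝ y ξ)) * K y := fun y =>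
    mul_nonneg (mul_nonneg (hn y) (sub_nonneg.2 (Real.cos_le_one _))) (hK.nonneg y)
  rw [hre]
  simp_rw [hre2]
  rw [integral_add f1 i2]
  refine ⟨le_add_of_nonneg_right (integral_nonneg hpos), fun hξ1 hξ4 hc => ?_⟩
  refine add_le_add le_rfl ?_
  have h1 : ENNReal.ofReal c ≤
      ENNReal.ofReal (∫ y, nearInd y * (1 - Real.cos (2 * Real.pi * inner ℝ y ξ)) * K y) := by
    rw [ofReal_integral_eq_lintegral_ofReal i2 (Eventually.of_forall hpos)]
    calc ENNReal.ofReal c ≤ ENNReal.ofReal (c * ‖ξ‖ ^ 2) :=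
          ENNReal.ofReal_le_ofReal (le_mul_of_one_le_right hc (by nlinarith))
      _ ≤ _ := hK.low ξ
      _ ≤ ∫⁻ y in Metric.ball 0 (1 / 8), ENNReal.ofReal
            (nearInd y * (1 - Real.cos (2 * Real.pi * inner ℝ y ξ)) * K y) := by
          refine setLIntegral_mono_ae' Metric.isOpen_ball.measurableSet
            (Eventually.of_forall fun y hy => ENNReal.ofReal_le_ofReal ?_)
          have hy8 : ‖y‖ < 1 / 8 := by simpa using hy
          have h5 : nearInd y = 1 := by rw [nearInd_eq, if_pos (by linarith)]
          rw [h5, one_mul]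
          refine mul_le_mul_of_nonneg_right ?_ (hK.nonneg y)
          have hpi := Real.pi_pos
          have h6 : |(inner ℝ y ξ : ℝ)| ≤ 1 / 2 := by
            refine (abs_real_inner_le_norm y ξ).trans ?_
            nlinarith [norm_nonneg y]
          -- With `‖y‖ < 1/8` and `‖ξ‖ ≤ 4` the argument is at most `π` in absolute value, the range
          -- in which `1 - cos` dominates a quadratic; this explains the radius `1/8` in
          -- `StableKer.low`.
          have h7 := Real.cos_le_one_sub_mul_cos_sq (x := 2 * Real.pi * inner ℝ y ξ) (by
            rw [abs_mul, abs_of_pos (by positivity)]; nlinarith)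
          have h8 : 2 / Real.pi ^ 2 * (2 * Real.pi * inner ℝ y ξ) ^ 2 = 8 * (inner ℝ y ξ : ℝ) ^ 2 := by
            field_simp; ring
          rw [h8] at h7
          nlinarith [sq_nonneg (inner ℝ y ξ : ℝ)]
      _ ≤ _ := setLIntegral_le_lintegral _ _
  exact (ENNReal.ofReal_le_ofReal_iff (integral_nonneg hpos)).1 h1

end Symbol

/-! ### Derivatives of negative powers, with the dependence on the exponent. -/

section PowerBounds

variable {E : Type*} [NormedAddCommGroup E] [NormedSpace ℝ E]

lemma hasFDerivAt_inv_pow {g : E → ℂ} {g' : E →L[ℝ] ℂ} {ξ : E} (hg : HasFDerivAt g g' ξ)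
    (h0 : g ξ ≠ 0) (j : ℕ) :
    HasFDerivAt (fun ξ => (g ξ)⁻¹ ^ j) ((-(j : ℂ) * (g ξ)⁻¹ ^ (j + 1)) • g') ξ := by
  refine ((((hasFDerivAt_inv' (𝕜 := ℝ) h0).comp ξ hg)).pow j).congr_fderiv ?_
  ext v
  rcases j with - | j
  · simp
  · simp [pow_succ]; ring

/-- Quantitative bounds on the derivatives of the negative powers of a function whose modulus is
at least `Q` on a set. -/
lemma norm_iteratedFDeriv_inv_pow_le (c D : ℝ) (hc : 0 < c) (hD : 0 ≤ D) (N : ℕ) :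
    ∃ B : ℝ, 1 ≤ B ∧ ∀ (g : E → ℂ), ContDiff ℝ ∞ g → (∀ ξ, g ξ ≠ 0) → ∀ (S : Set E) (Q : ℝ), c ≤ Q →
      (∀ ξ ∈ S, Q ≤ ‖g ξ‖) → (∀ i ≤ N, ∀ ξ ∈ S, ‖iteratedFDeriv ℝ i (fderiv ℝ g) ξ‖ ≤ D) →
      ∀ l ≤ N, ∀ j : ℕ, ∀ ξ ∈ S,
        ‖iteratedFDeriv ℝ l (fun ξ => (g ξ)⁻¹ ^ j) ξ‖ ≤ B * (j + 1 : ℝ) ^ l * (Q ^ j)⁻¹ := by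
  -- Induction on the order of differentiation, for all exponents at once: the derivative of
  -- `g^(-j)` is `-j g^(-j-1) g'`. Each derivative thus costs a factor `j + 1` and a power of `Q⁻¹ ≤
  -- c⁻¹`, so the growth in `j` beyond `Q^(-j)` stays polynomial.
  have key : ∀ n : ℕ, n ≤ N → ∃ B : ℝ, 1 ≤ B ∧ ∀ (g : E → ℂ), ContDiff ℝ ∞ g → (∀ ξ, g ξ ≠ 0) →
      ∀ (S : Set E) (Q : ℝ), c ≤ Q →
      (∀ ξ ∈ S, Q ≤ ‖g ξ‖) → (∀ i ≤ N, ∀ ξ ∈ S, ‖iteratedFDeriv ℝ i (fderiv ℝ g) ξ‖ ≤ D) →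
      ∀ l ≤ n, ∀ j : ℕ, ∀ ξ ∈ S,
        ‖iteratedFDeriv ℝ l (fun ξ => (g ξ)⁻¹ ^ j) ξ‖ ≤ B * (j + 1 : ℝ) ^ l * (Q ^ j)⁻¹ := by
    intro n
    induction n with
    | zero =>
      intro _
      refine ⟨1, le_rfl, fun g hg hg0 S Q hQ hgQ hgD l hl j ξ hξ => ?_⟩
      obtain rfl : l = 0 := by omega
      rw [norm_iteratedFDeriv_zero, norm_pow, norm_inv, pow_zero, one_mul, one_mul, inv_pow]
      have hQ0 : 0 < Q := hc.trans_le hQ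
      have := hgQ ξ hξ
      gcongr
    | succ n ih =>
      intro hn
      obtain ⟨B, hB1, hB⟩ := ih (by omega)
      have hB0 : 0 ≤ B := zero_le_one.trans hB1
      refine ⟨B + 2 ^ n * (2 ^ n * (B * (D / c))), by
        have : 0 ≤ 2 ^ n * (2 ^ n * (B * (D / c))) := by positivity
        linarith, fun g hg hg0 S Q hQ hgQ hgD l hl j ξ hξ => ?_⟩
      have hQ0 : 0 < Q := hc.trans_le hQ
      rcases Nat.lt_or_ge l (n + 1) with h | h
      · refine (hB g hg hg0 S Q hQ hgQ hgD l (by omega) j ξ hξ).trans ?_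
        gcongr
        have : 0 ≤ 2 ^ n * (2 ^ n * (B * (D / c))) := by positivity
        linarith
      obtain rfl : l = n + 1 := by omega
      have hd : ∀ ξ, HasFDerivAt g (fderiv ℝ g ξ) ξ := fun ξ =>
        ((hg.differentiable (by simp)) ξ).hasFDerivAt
      have hf : fderiv ℝ (fun ξ => (g ξ)⁻¹ ^ j) =
          (-(j : ℂ)) • fun ξ => (g ξ)⁻¹ ^ (j + 1) • fderiv ℝ g ξ := by
        funext ξ
        rw [(hasFDerivAt_inv_pow (hd ξ) (hg0 ξ) j).fderiv, Pi.smul_apply, smul_smul]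
      have hs : ContDiff ℝ ∞ fun ξ => (g ξ)⁻¹ ^ (j + 1) := (hg.inv hg0).pow _
      have hg' : ContDiff ℝ ∞ (fderiv ℝ g) := hg.fderiv_right (by simp)
      have hle : ((n : ℕ∞ω)) ≤ (∞ : ℕ∞ω) := by exact_mod_cast le_top
      rw [← norm_iteratedFDeriv_fderiv, hf, iteratedFDeriv_const_smul_apply
        (f := fun ξ => (g ξ)⁻¹ ^ (j + 1) • fderiv ℝ g ξ) ((hs.smul hg').of_le hle).contDiffAt, norm_smul, norm_neg, Complex.norm_natCast]
      have h1 : ‖iteratedFDeriv ℝ n (fun ξ => (g ξ)⁻¹ ^ (j + 1) • fderiv ℝ g ξ) ξ‖ ≤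
          2 ^ n * (B * (j + 2 : ℝ) ^ n * (Q ^ (j + 1))⁻¹ * D) := by
        refine (norm_iteratedFDeriv_smul_le hs hg' ξ hle).trans ?_
        have h2 : ∀ i ∈ Finset.range (n + 1), (n.choose i : ℝ) *
            ‖iteratedFDeriv ℝ i (fun ξ => (g ξ)⁻¹ ^ (j + 1)) ξ‖ *
              ‖iteratedFDeriv ℝ (n - i) (fderiv ℝ g) ξ‖ ≤
            (n.choose i : ℝ) * (B * (j + 2 : ℝ) ^ n * (Q ^ (j + 1))⁻¹ * D) := by
          intro i hi
          have hi' : i ≤ n := by simpa [Nat.lt_succ_iff] using hi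
          have h3 := hB g hg hg0 S Q hQ hgQ hgD i hi' (j + 1) ξ hξ
          have h4 := hgD (n - i) (by omega) ξ hξ
          rw [mul_assoc]
          gcongr
          refine h3.trans ?_
          gcongr
          push_cast
          calc ((j:ℝ) + 1 + 1) ^ i ≤ ((j:ℝ) + 1 + 1) ^ n :=
                pow_le_pow_right₀ (by have : (0:ℝ) ≤ j := j.cast_nonneg
                                      linarith) hi'
            _ = _ := by ring
        refine (Finset.sum_le_sum h2).trans (le_of_eq ?_)
        rw [← Finset.sum_mul]
        congr 1
        exact_mod_cast Nat.sum_range_choose n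
      calc (j:ℝ) * ‖iteratedFDeriv ℝ n (fun ξ => (g ξ)⁻¹ ^ (j + 1) • fderiv ℝ g ξ) ξ‖
          ≤ (j + 1) * (2 ^ n * (B * (2 * (j + 1 : ℝ)) ^ n * (Q ^ (j + 1))⁻¹ * D)) := by
            refine mul_le_mul (by linarith) (h1.trans ?_) (norm_nonneg _) (by positivity)
            gcongr
            have : (0:ℝ) ≤ j := j.cast_nonneg
            linarith
        _ = 2 ^ n * (2 ^ n * (B * (D / Q))) * (j + 1) ^ (n + 1) * (Q ^ j)⁻¹ := by
            rw [mul_pow]; field_simp; ring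
        _ ≤ (B + 2 ^ n * (2 ^ n * (B * (D / c)))) * (j + 1) ^ (n + 1) * (Q ^ j)⁻¹ := by
            gcongr
            have : 2 ^ n * (2 ^ n * (B * (D / Q))) ≤ 2 ^ n * (2 ^ n * (B * (D / c))) := by gcongr
            linarith
  exact key N le_rfl

end PowerBounds

/-! ### Amplitudes supported in an annulus and the decay of their Fourier transforms. -/

section Annulus

variable {E : Type*} [NormedAddCommGroup E] [InnerProductSpace ℝ E]

/-- Smooth amplitudes supported in `κ ≤ ‖ξ‖ ≤ 4`, with derivatives up to the order `N` bounded
by `P`. -/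
structure AnnulusAmp (κ : ℝ) (N : ℕ) (P : ℝ) (a : E → ℂ) : Prop where
  contDiff : ContDiff ℝ ∞ a
  supp : ∀ ξ, a ξ ≠ 0 → κ ≤ ‖ξ‖ ∧ ‖ξ‖ ≤ 4
  bound : ∀ i ≤ N, ∀ ξ, ‖iteratedFDeriv ℝ i a ξ‖ ≤ P

lemma AnnulusAmp.nonneg {κ : ℝ} {N : ℕ} {P : ℝ} {a : E → ℂ} (h : AnnulusAmp κ N P a) : 0 ≤ P :=
  (norm_nonneg _).trans (h.bound 0 (Nat.zero_le _) 0)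

lemma AnnulusAmp.tsupport_subset {κ : ℝ} {N : ℕ} {P : ℝ} {a : E → ℂ} (h : AnnulusAmp κ N P a) :
    tsupport a ⊆ {ξ | κ ≤ ‖ξ‖ ∧ ‖ξ‖ ≤ 4} := by
  refine closure_minimal (fun ξ hξ => h.supp ξ hξ) ?_
  exact (isClosed_le continuous_const continuous_norm).inter
    (isClosed_le continuous_norm continuous_const)

/-- The factor `g` needs to be controlled only on the annulus, because all derivatives of `a` vanish
outside of it. -/
lemma AnnulusAmp.mul {κ : ℝ} {N : ℕ} {P R : ℝ} {a g : E → ℂ} (h : AnnulusAmp κ N P a) (hg : ContDiff ℝ ∞ g)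
    (hR : 0 ≤ R)
    (hb : ∀ i ≤ N, ∀ ξ, κ ≤ ‖ξ‖ → ‖ξ‖ ≤ 4 → ‖iteratedFDeriv ℝ i g ξ‖ ≤ R) :
    AnnulusAmp κ N (2 ^ N * (P * R)) (fun ξ => a ξ * g ξ) := by
  have hP := h.nonneg
  refine ⟨h.contDiff.mul hg, fun ξ hξ => h.supp ξ (left_ne_zero_of_mul hξ), fun n hn ξ => ?_⟩
  have hle : ((n : ℕ∞ω)) ≤ (∞ : ℕ∞ω) := by exact_mod_cast le_top
  refine (norm_iteratedFDeriv_mul_le h.contDiff hg ξ hle).trans ?_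
  have h2 : ∀ i ∈ Finset.range (n + 1), (n.choose i : ℝ) * ‖iteratedFDeriv ℝ i a ξ‖ *
      ‖iteratedFDeriv ℝ (n - i) g ξ‖ ≤ (n.choose i : ℝ) * (P * R) := by
    intro i hi
    have hi' : i ≤ n := by simpa [Nat.lt_succ_iff] using hi
    rw [mul_assoc]
    refine mul_le_mul_of_nonneg_left ?_ (Nat.cast_nonneg _)
    by_cases hξ : iteratedFDeriv ℝ i a ξ = 0
    · rw [hξ, norm_zero, zero_mul]; positivity
    · have h3 := h.tsupport_subset (support_iteratedFDeriv_subset (𝕜 := ℝ) i hξ)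
      exact mul_le_mul (h.bound i (by omega) ξ) (hb _ (by omega) ξ h3.1 h3.2) (norm_nonneg _) hP
  refine (Finset.sum_le_sum h2).trans ?_
  rw [← Finset.sum_mul]
  gcongr
  calc (∑ i ∈ Finset.range (n + 1), (n.choose i : ℝ)) = 2 ^ n := by
        exact_mod_cast Nat.sum_range_choose n
    _ ≤ 2 ^ N := pow_le_pow_right₀ one_le_two hn

variable [FiniteDimensional ℝ E]

lemma AnnulusAmp.hasCompactSupport {κ : ℝ} {N : ℕ} {P : ℝ} {a : E → ℂ} (h : AnnulusAmp κ N P a) :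
    HasCompactSupport a :=
  HasCompactSupport.of_support_subset_isCompact (isCompact_closedBall 0 4)
    fun ξ hξ => by simpa using (h.supp ξ hξ).2

variable [MeasurableSpace E] [BorelSpace E]

lemma AnnulusAmp.integrable {κ : ℝ} {N : ℕ} {P : ℝ} {a : E → ℂ} (h : AnnulusAmp κ N P a) : Integrable a :=
  h.contDiff.continuous.integrable_of_hasCompactSupport h.hasCompactSupport

open FourierTransform in
/-- Decay of the Fourier transform of an amplitude. -/
lemma exists_fourier_decay (N : ℕ) : ∃ C : ℝ, 0 ≤ C ∧ ∀ (κ P : ℝ) (a : E → ℂ), AnnulusAmp κ N P a →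
    ∀ z, (1 + ‖z‖) ^ N * ‖𝓕 a z‖ ≤ C * P := by
  set V : ℝ := volume.real (Metric.closedBall (0:E) 4)
  refine ⟨2 ^ N * (V + 2 ^ N * ((N + 1) * V)), by positivity, fun κ P a h z => ?_⟩
  have hc := h.hasCompactSupport
  have hi : ∀ n : ℕ, Integrable (iteratedFDeriv ℝ n a) := fun n =>
    (h.contDiff.continuous_iteratedFDeriv (by exact_mod_cast le_top)).integrable_of_hasCompactSupport
      (hc.iteratedFDeriv n)
  have hint : ∀ n ≤ N, ∫ v, ‖iteratedFDeriv ℝ n a v‖ ≤ P * V := by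
    intro n hn
    have hb : ∀ v, ‖iteratedFDeriv ℝ n a v‖ ≤ (Metric.closedBall (0:E) 4).indicator (fun _ => P) v := by
      intro v
      by_cases hv : v ∈ Metric.closedBall (0:E) 4
      · rw [indicator_of_mem hv]; exact h.bound n hn v
      · rw [indicator_of_notMem hv]
        have : iteratedFDeriv ℝ n a v = 0 := by
          by_contra h0
          exact hv (by simpa using (h.tsupport_subset (support_iteratedFDeriv_subset (𝕜 := ℝ) n h0)).2)
        rw [this, norm_zero]
    have hm : MeasurableSet (Metric.closedBall (0:E) 4) := Metric.isClosed_closedBall.measurableSet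
    refine (integral_mono (hi n).norm ((integrable_indicator_iff hm).2
      (integrableOn_const measure_closedBall_lt_top.ne)) hb).trans (le_of_eq ?_)
    rw [integral_indicator hm, setIntegral_const, smul_eq_mul, mul_comm]
  have h0 : ‖𝓕 a z‖ ≤ P * V := by
    refine (VectorFourier.norm_fourierIntegral_le_integral_norm _ _ _ _ _).trans ?_
    have := hint 0 (Nat.zero_le _)
    simpa only [norm_iteratedFDeriv_zero] using this
  have h1 : ‖z‖ ^ N * ‖𝓕 a z‖ ≤ 2 ^ N * ((N + 1) * (P * V)) := by
    have h2 := Real.pow_mul_norm_iteratedFDeriv_fourier_le (K := 0) (N := ⊤) (f := a)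
      (h.contDiff.of_le (by simp)) (fun k n hk _ => by
        have hk' : k = 0 := by exact_mod_cast le_antisymm hk bot_le
        subst hk'
        simpa using (hi n).norm) (k := 0) (n := N) le_rfl le_top z
    simp only [norm_iteratedFDeriv_zero, pow_zero, Nat.cast_zero, mul_zero, zero_add, one_mul] at h2
    refine h2.trans ?_
    gcongr
    rw [Finset.sum_product]
    simp only [Finset.range_one, Finset.sum_singleton, pow_zero, one_mul]
    refine (Finset.sum_le_card_nsmul _ _ (P * V) fun i hi => hint i ?_).trans (le_of_eq ?_)
    · simpa [Nat.lt_succ_iff] using hi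
    · simp
  have h3 : (1 + ‖z‖) ^ N ≤ 2 ^ N * (1 + ‖z‖ ^ N) := by
    have h4 : 1 + ‖z‖ ≤ 2 * max 1 ‖z‖ := by
      have := le_max_left 1 ‖z‖; have := le_max_right 1 ‖z‖; linarith
    calc (1 + ‖z‖) ^ N ≤ (2 * max 1 ‖z‖) ^ N := by gcongr
      _ = 2 ^ N * (max 1 ‖z‖) ^ N := mul_pow _ _ _
      _ ≤ _ := by
        gcongr
        rcases max_cases 1 ‖z‖ with h | h <;> rw [h.1]
        · rw [one_pow]; have : 0 ≤ ‖z‖ ^ N := by positivity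
          linarith
        · linarith
  calc (1 + ‖z‖) ^ N * ‖𝓕 a z‖ ≤ 2 ^ N * (1 + ‖z‖ ^ N) * ‖𝓕 a z‖ := by gcongr
    _ = 2 ^ N * (‖𝓕 a z‖ + ‖z‖ ^ N * ‖𝓕 a z‖) := by ring
    _ ≤ 2 ^ N * (P * V + 2 ^ N * ((N + 1) * (P * V))) := by gcongr
    _ = _ := by ring

open FourierTransform Module in
/-- Weighted `L¹` bound for the Fourier transform of an amplitude. -/
lemma exists_fourier_weight_bound (N : ℕ) : ∃ C : ℝ, 0 ≤ C ∧ ∀ (κ P : ℝ) (a : E → ℂ),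
    AnnulusAmp κ (N + finrank ℝ E + 1) P a →
    ∫⁻ z, ENNReal.ofReal ((1 + ‖z‖) ^ N * ‖𝓕 a z‖) ≤ ENNReal.ofReal (C * P) := by
  obtain ⟨C, hC, h⟩ := exists_fourier_decay (E := E) (N + finrank ℝ E + 1)
  have hr : (finrank ℝ E : ℝ) < (finrank ℝ E + 1 : ℕ) := by push_cast; linarith
  have hf := finite_integral_one_add_norm (E := E) (μ := volume) hr
  set I := ∫⁻ (x : E), ENNReal.ofReal ((1 + ‖x‖) ^ (-((finrank ℝ E + 1 : ℕ) : ℝ)))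
  refine ⟨C * I.toReal, by positivity, fun κ P a ha => ?_⟩
  have hP := ha.nonneg
  calc ∫⁻ z, ENNReal.ofReal ((1 + ‖z‖) ^ N * ‖𝓕 a z‖)
      ≤ ∫⁻ z, ENNReal.ofReal (C * P) * ENNReal.ofReal ((1 + ‖z‖) ^ (-((finrank ℝ E + 1 : ℕ) : ℝ))) := by
        refine lintegral_mono fun z => ?_
        rw [← ENNReal.ofReal_mul (by positivity)]
        refine ENNReal.ofReal_le_ofReal ?_
        have h1 := h κ P a ha z
        have h2 : 0 < 1 + ‖z‖ := by positivity
        rw [Real.rpow_neg h2.le, Real.rpow_natCast, ← div_eq_mul_inv, le_div_iff₀ (by positivity)]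
        calc _ = (1 + ‖z‖) ^ (N + finrank ℝ E + 1) * ‖𝓕 a z‖ := by ring
          _ ≤ _ := h1
    _ = ENNReal.ofReal (C * P) * I := lintegral_const_mul' _ _ ENNReal.ofReal_ne_top
    _ = ENNReal.ofReal (C * I.toReal * P) := by
        rw [mul_right_comm, ENNReal.ofReal_mul (p := C * P) (by positivity), ENNReal.ofReal_toReal hf.ne]

end Annulus

/-! ### The Neumann series for the quotient of an amplitude by the symbol. -/

section Neumann

open Module FourierTransform

variable {E : Type*} [NormedAddCommGroup E] [InnerProductSpace ℝ E] [FiniteDimensional ℝ E]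
  [MeasurableSpace E] [BorelSpace E]

lemma continuous_fourier {k : E → ℂ} (hk : Integrable k) : Continuous (𝓕 k) :=
  VectorFourier.fourierIntegral_continuous Real.continuous_fourierChar
    (continuous_inner : Continuous fun p : E × E => inner ℝ p.1 p.2) hk

lemma norm_fourier_le (k : E → ℂ) (ξ : E) : ‖𝓕 k ξ‖ ≤ ∫ y, ‖k y‖ :=
  VectorFourier.norm_fourierIntegral_le_integral_norm _ _ _ _ _

lemma integrable_fourier_mul {k h : E → ℂ} (hk : Integrable k) (hh : Integrable h) :
    Integrable fun ξ => 𝓕 k ξ * h ξ :=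
  Integrable.bdd_mul (c := ∫ y, ‖k y‖) hh (continuous_fourier hk).aestronglyMeasurable
    (Eventually.of_forall fun ξ => norm_fourier_le k ξ)

/-- Fubini: multiplying by `𝓕 k` before the transform amounts to correlating with `k` after it. No
regularity of `𝓕 k` is used. -/
lemma fourier_fourier_mul {k h : E → ℂ} (hk : Integrable k) (hh : Integrable h) (z : E) :
    𝓕 (fun ξ => 𝓕 k ξ * h ξ) z = ∫ y, k y * 𝓕 h (z + y) := by
  have hint : Integrable (fun p : E × E => ech p.1 z * (ech p.1 p.2 * (h p.1 * k p.2)))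
      (volume.prod volume) := by
    have h1 : Integrable (fun p : E × E => h p.1 * k p.2) (volume.prod volume) := hh.mul_prod hk
    have h2 : Continuous fun p : E × E => ech p.1 z * ech p.1 p.2 :=
      ((continuous_ech_left z).comp continuous_fst).mul continuous_ech
    refine (Integrable.bdd_mul (c := 1) h1 h2.aestronglyMeasurable
      (Eventually.of_forall fun p => ?_)).congr (Eventually.of_forall fun p => ?_)
    · rw [norm_mul, norm_ech, norm_ech, one_mul]
    · simp only; ring
  have e1 : ∀ ξ, ech ξ z * (𝓕 k ξ * h ξ) = ∫ y, ech ξ z * (ech ξ y * (h ξ * k y)) := by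
    intro ξ
    rw [integral_const_mul, fourier_eq_integral_ech, ← integral_mul_const]
    congr 1
    refine integral_congr_ae (Eventually.of_forall fun y => ?_)
    simp only [ech_comm y ξ]; ring
  rw [fourier_eq_integral_ech]
  simp_rw [e1]
  rw [integral_integral_swap hint]
  refine integral_congr_ae (Eventually.of_forall fun y => ?_)
  simp only [fourier_eq_integral_ech]
  rw [← integral_const_mul]
  refine integral_congr_ae (Eventually.of_forall fun ξ => ?_)
  simp only [ech_comm ξ (z + y), ech_add_left, ech_comm ξ z, ech_comm ξ y]
  ring

/-- Young's inequality with a weight: the subadditivity `w z ≤ w (z + y) + τ y` lets the weight fall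
either on the transform of `h` or on `k`. -/
lemma lintegral_weight_fourier_mul_le {k h : E → ℂ} (hk : Integrable k) (hh : Integrable h)
    {w τ : E → ℝ≥0∞} (hw : Measurable w) (hτ : Measurable τ) (hwτ : ∀ z y, w z ≤ w (z + y) + τ y) :
    ∫⁻ z, w z * ‖𝓕 (fun ξ => 𝓕 k ξ * h ξ) z‖ₑ ≤
      (∫⁻ z, w z * ‖𝓕 h z‖ₑ) * (∫⁻ y, ‖k y‖ₑ) + (∫⁻ z, ‖𝓕 h z‖ₑ) * ∫⁻ y, τ y * ‖k y‖ₑ := by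
  have hm : Measurable fun z => ‖𝓕 h z‖ₑ := (continuous_fourier hh).measurable.enorm
  have hkm : AEMeasurable (fun y => ‖k y‖ₑ) volume := hk.1.enorm
  calc ∫⁻ z, w z * ‖𝓕 (fun ξ => 𝓕 k ξ * h ξ) z‖ₑ
      ≤ ∫⁻ z, ∫⁻ y, ((w (z + y) * ‖𝓕 h (z + y)‖ₑ) * ‖k y‖ₑ + ‖𝓕 h (z + y)‖ₑ * (τ y * ‖k y‖ₑ)) := by
        refine lintegral_mono fun z => ?_
        rw [fourier_fourier_mul hk hh]
        calc w z * ‖∫ y, k y * 𝓕 h (z + y)‖ₑ ≤ w z * ∫⁻ y, ‖k y * 𝓕 h (z + y)‖ₑ := by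
              gcongr; exact enorm_integral_le_lintegral_enorm _
          _ ≤ ∫⁻ y, w z * ‖k y * 𝓕 h (z + y)‖ₑ := lintegral_const_mul_le _ _
          _ ≤ _ := by
            refine lintegral_mono fun y => ?_
            rw [enorm_mul]
            calc w z * (‖k y‖ₑ * ‖𝓕 h (z + y)‖ₑ) ≤ (w (z + y) + τ y) * (‖k y‖ₑ * ‖𝓕 h (z + y)‖ₑ) := by
                  gcongr; exact hwτ z y
              _ = _ := by ring
    _ = ∫⁻ z, ((∫⁻ y, (w (z + y) * ‖𝓕 h (z + y)‖ₑ) * ‖k y‖ₑ) + ∫⁻ y, ‖𝓕 h (z + y)‖ₑ * (τ y * ‖k y‖ₑ)) := by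
        refine lintegral_congr fun z => lintegral_add_left' ?_ _
        exact ((hw.mul hm).comp (measurable_const_add z)).aemeasurable.mul hkm
    _ = _ := by
        have e1 := lintegral_lintegral_comp_add (hw.mul hm) hkm
        have e2 := lintegral_lintegral_comp_add hm (hτ.aemeasurable.mul hkm)
        simp only [Pi.mul_apply] at e1 e2
        rw [lintegral_add_left', e1, e2]
        refine AEMeasurable.lintegral_prod_right' (f := fun p : E × E => (w (p.1 + p.2) *
          ‖𝓕 h (p.1 + p.2)‖ₑ) * ‖k p.2‖ₑ) ?_
        exact ((hw.mul hm).comp (measurable_fst.add measurable_snd)).aemeasurable.mul hkm.comp_snd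

lemma integrable_fourier_pow_mul {k h : E → ℂ} (hk : Integrable k) (hh : Integrable h) (j : ℕ) :
    Integrable fun ξ => 𝓕 k ξ ^ j * h ξ := by
  induction j with
  | zero => simpa using hh
  | succ j ih =>
    refine (integrable_fourier_mul hk ih).congr (Eventually.of_forall fun ξ => ?_)
    simp only; ring

/-- In a `j`-fold correlation the weight falls on `h` or on one of the `j` copies of `k`. Hence the
cost is `m ^ j` with a factor that is only linear in `j`. -/
lemma lintegral_weight_fourier_pow_mul_le {k h : E → ℂ} (hk : Integrable k) (hh : Integrable h)
    {w τ : E → ℝ≥0∞} (hw : Measurable w) (hτ : Measurable τ) (hwτ : ∀ z y, w z ≤ w (z + y) + τ y)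
    (hw1 : ∀ z, 1 ≤ w z) {m T : ℝ} (hm : 0 < m) (hT : 0 ≤ T) (hkm : ∫⁻ y, ‖k y‖ₑ ≤ ENNReal.ofReal m)
    (hkT : ∫⁻ y, τ y * ‖k y‖ₑ ≤ ENNReal.ofReal T) (j : ℕ) :
    ∫⁻ z, w z * ‖𝓕 (fun ξ => 𝓕 k ξ ^ j * h ξ) z‖ₑ ≤
      ENNReal.ofReal (m ^ j * (1 + j * (T / m))) * ∫⁻ z, w z * ‖𝓕 h z‖ₑ := by
  have e : ∀ j, (fun ξ => 𝓕 k ξ ^ (j + 1) * h ξ) = fun ξ => 𝓕 k ξ * (𝓕 k ξ ^ j * h ξ) := by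
    intro j; funext ξ; ring
  -- The unweighted bound, used for the remaining factors when the weight falls on the newest copy
  -- of `k`.
  have h0 : ∀ j : ℕ, ∫⁻ z, ‖𝓕 (fun ξ => 𝓕 k ξ ^ j * h ξ) z‖ₑ ≤
      ENNReal.ofReal (m ^ j) * ∫⁻ z, w z * ‖𝓕 h z‖ₑ := by
    intro j
    induction j with
    | zero =>
      simp only [pow_zero, one_mul, ENNReal.ofReal_one]
      exact lintegral_mono fun z => le_mul_of_one_le_left' (hw1 z)
    | succ j ih =>
      rw [e j]
      have := lintegral_weight_fourier_mul_le hk (integrable_fourier_pow_mul hk hh j)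
        (w := 1) (τ := 0) measurable_one measurable_zero (by simp)
      simp only [Pi.one_apply, one_mul, Pi.zero_apply, zero_mul, lintegral_zero, mul_zero,
        add_zero] at this
      refine this.trans ((mul_le_mul' ih hkm).trans (le_of_eq ?_))
      rw [pow_succ, ENNReal.ofReal_mul (by positivity)]; ring
  induction j with
  | zero => simp
  | succ j ih =>
    rw [e j]
    refine (lintegral_weight_fourier_mul_le hk (integrable_fourier_pow_mul hk hh j) hw hτ hwτ).trans ?_
    refine (add_le_add (mul_le_mul' ih hkm) (mul_le_mul' (h0 j) hkT)).trans (le_of_eq ?_)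
    have e2 : m ^ (j + 1) * (1 + ((j + 1 : ℕ) : ℝ) * (T / m)) =
        m ^ j * (1 + j * (T / m)) * m + m ^ j * T := by
      push_cast; field_simp; ring
    rw [e2, ENNReal.ofReal_add (by positivity) (by positivity), ENNReal.ofReal_mul (q := m) (by positivity),
      ENNReal.ofReal_mul (q := T) (by positivity)]
    ring

/-- Termwise Fourier transform of a Neumann series. -/
lemma lintegral_weight_fourier_tsum_le {F : ℕ → E → ℂ} {q : E → ℂ} {w : E → ℝ≥0∞} (hw : Measurable w)
    (hF : ∀ j, Integrable (F j)) (hs : Summable fun j => ∫ ξ, ‖F j ξ‖)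
    (hq : ∀ ξ, HasSum (fun j => F j ξ) (q ξ)) :
    ∫⁻ z, w z * ‖𝓕 q z‖ₑ ≤ ∑' j, ∫⁻ z, w z * ‖𝓕 (F j) z‖ₑ := by
  rw [← lintegral_tsum (f := fun j z => w z * ‖𝓕 (F j) z‖ₑ)
    fun j => (hw.mul (continuous_fourier (hF j)).measurable.enorm).aemeasurable]
  refine lintegral_mono fun z => ?_
  have h1 : HasSum (fun j => 𝓕 (F j) z) (𝓕 q z) := by
    have h2 := hasSum_integral_of_summable_integral_norm (μ := volume)
      (F := fun j ξ => ech ξ z * F j ξ) (fun j => Integrable.bdd_mul (c := 1) (hF j)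
        (continuous_ech_left z).aestronglyMeasurable
        (Eventually.of_forall fun ξ => (norm_ech ξ z).le))
      (by simpa only [norm_mul, norm_ech, one_mul] using hs)
    have h3 : (∫ ξ, ∑' j, ech ξ z * F j ξ) = 𝓕 q z := by
      rw [fourier_eq_integral_ech]
      refine integral_congr_ae (Eventually.of_forall fun ξ => ?_)
      exact ((hq ξ).mul_left _).tsum_eq
    rw [h3] at h2
    exact h2
  rw [← h1.tsum_eq, ENNReal.tsum_mul_left]
  gcongr
  exact enorm_tsum_le_tsum_enorm

lemma one_add_rpow_le_mul_sq {s : ℝ} (hs0 : 0 < s) (hs1 : s < 1) {t : ℝ} (ht : 0 ≤ t) :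
    1 + t ^ s ≤ 2 * (1 + t) ^ 2 := by
  have h1 : t ^ s ≤ (1 + t) ^ s := Real.rpow_le_rpow ht (by linarith) hs0.le
  have h2 : (1 + t) ^ s ≤ (1 + t) ^ (1:ℝ) := Real.rpow_le_rpow_of_exponent_le (by linarith) hs1.le
  rw [Real.rpow_one] at h2
  nlinarith

variable {s c Λ : ℝ} {K : E → ℝ} {b : E}

lemma StableKer.lintegral_farKer (hK : StableKer s c Λ K b) (hs0 : 0 < s) (hΛ : 0 ≤ Λ) :
    ∫⁻ y, ‖farKer K y‖ₑ = ENNReal.ofReal (farMass K) := by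
  rw [farMass, ofReal_integral_eq_lintegral_ofReal (hK.farInt hs0 hΛ).1
    (Eventually.of_forall fun y => mul_nonneg (sub_nonneg.2 (nearInd_le_one y)) (hK.nonneg y))]
  refine lintegral_congr fun y => ?_
  rw [farKer, ← ofReal_norm, Complex.norm_real, Real.norm_of_nonneg
    (mul_nonneg (sub_nonneg.2 (nearInd_le_one y)) (hK.nonneg y))]

lemma StableKer.lintegral_rpow_farKer_le (hK : StableKer s c Λ K b) (hs0 : 0 < s) (hΛ : 0 ≤ Λ) :
    ∫⁻ y, ENNReal.ofReal (‖y‖ ^ s) * ‖farKer K y‖ₑ ≤ ENNReal.ofReal (Λ / s) := by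
  have h := hK.far s 1 (by linarith) one_pos
  have e : Λ * (1 ^ (s - 2 * s) / (2 * s - s)) = Λ / s := by
    rw [Real.one_rpow, show 2 * s - s = s by ring]; ring
  rw [e] at h
  refine le_trans (le_of_eq ?_) h
  rw [← lintegral_indicator Metric.isOpen_ball.measurableSet.compl]
  refine lintegral_congr fun y => ?_
  rw [farKer, ← ofReal_norm, Complex.norm_real, nearInd_eq, ← ENNReal.ofReal_mul (by positivity)]
  by_cases hy : ‖y‖ < 1
  · simp [indicator, hy]
  · simp [indicator, hy, abs_of_nonneg (hK.nonneg y)]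

lemma levySymbol_re_pos (hs0 : 0 < s) (hs1 : s < 1) (hΛ : 0 ≤ Λ) (hc : 0 < c)
    (hK : StableKer s c Λ K b) {ξ : E} (h1 : 1 ≤ ‖ξ‖) (h4 : ‖ξ‖ ≤ 4) :
    c ≤ (levySymbol s K b ξ).re := by
  have h2 := (symReg_re_ge hs0 hs1 hΛ hK ξ).2 h1 h4 hc.le
  have h3 := (Complex.abs_re_le_norm (𝓕 (farKer K) ξ)).trans (norm_fourier_farKer_le hK ξ)
  have h4 := (abs_le.1 h3).2
  rw [levySymbol, Complex.sub_re]
  linarith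

lemma levySymbol_continuous (hs0 : 0 < s) (hs1 : s < 1) (hΛ : 0 ≤ Λ) (hK : StableKer s c Λ K b) :
    Continuous (levySymbol s K b) :=
  (symReg_contDiff hs0 hs1 hΛ hK).continuous.sub (continuous_fourier (farKer_integrable hs0 hΛ hK))

lemma AnnulusAmp.continuous_div {N : ℕ} {P : ℝ} {a g : E → ℂ} (h : AnnulusAmp 1 N P a)
    (hg : Continuous g) (hg0 : ∀ ξ, 1 ≤ ‖ξ‖ → ‖ξ‖ ≤ 4 → g ξ ≠ 0) :
    Continuous fun ξ => a ξ / g ξ := by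
  rw [continuous_iff_continuousAt]
  intro ξ
  by_cases h0 : g ξ = 0
  · have h1 : ξ ∉ tsupport a := fun hξ => hg0 ξ (h.tsupport_subset hξ).1 (h.tsupport_subset hξ).2 h0
    refine ContinuousAt.congr (f := fun _ => (0:ℂ)) continuousAt_const ?_
    filter_upwards [(isClosed_tsupport a).isOpen_compl.mem_nhds h1] with η hη
    rw [image_eq_zero_of_notMem_tsupport hη, zero_div]
  · exact h.contDiff.continuous.continuousAt.div hg.continuousAt h0

/-- The weighted `L¹` bound for the multipliers `a / A`, with `A` the symbol of the operator. -/
lemma exists_symbol_quotient_bound (hs0 : 0 < s) (hs1 : s < 1) (hc : 0 < c) (hΛ : 0 < Λ) :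
    ∃ C : ℝ, 0 ≤ C ∧ ∀ (K : E → ℝ) (b : E), StableKer s c Λ K b → ∀ (P : ℝ) (a : E → ℂ),
      AnnulusAmp 1 (2 + finrank ℝ E + 1) P a →
      ∫⁻ z, ENNReal.ofReal (1 + ‖z‖ ^ s) * ‖𝓕 (fun ξ => a ξ / levySymbol s K b ξ) z‖ₑ ≤
        ENNReal.ofReal (C * P) := by
  -- Two derivatives for the weight `(1 + ‖z‖)²` and `finrank + 1` for integrability.
  set N := 2 + finrank ℝ E + 1 with hN
  obtain ⟨D, hD0, hD⟩ := exists_symReg_deriv_bound (E := E) hs0 hs1 hΛ.le N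
  obtain ⟨B, hB1, hB⟩ := norm_iteratedFDeriv_inv_pow_le (E := E) c D hc hD0 N
  obtain ⟨W, hW0, hW⟩ := exists_fourier_weight_bound (E := E) 2
  set M := Λ * (1 / (2 * s)) with hM
  have hM0 : 0 < M := by positivity
  -- The ratio of the series is at most `farMass / (farMass + c)`, which increases with the far
  -- mass; `M` bounds the latter for all admissible kernels, so `θ < 1` is uniform.
  set θ := M / (M + c) with hθ
  have hθ0 : 0 < θ := by positivity
  have hθ1 : θ < 1 := by rw [hθ, div_lt_one (by positivity)]; linarith
  set T := Λ / s with hT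
  have hT0 : 0 < T := by positivity
  have hB0 : 0 < B := by linarith
  -- the general term of the bound
  set β : ℕ → ℝ := fun j => θ ^ j * (1 + j * (T / (θ * c))) * (j + 2 : ℝ) ^ N with hβ
  have hβ0 : ∀ j, 0 ≤ β j := fun j => by positivity
  have hβs : Summable β := by
    have h1 := (summable_nat_add_iff 2).2 (summable_pow_mul_geometric_of_norm_lt_one (R := ℝ) (N + 1)
      (r := θ) (by rwa [Real.norm_of_nonneg hθ0.le]))
    refine Summable.of_nonneg_of_le hβ0 (fun j => ?_) (h1.mul_left ((1 + T / (θ * c)) / θ ^ 2))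
    have h2 : 1 + j * (T / (θ * c)) ≤ (1 + T / (θ * c)) * (j + 2 : ℝ) := by
      have : 0 ≤ T / (θ * c) := by positivity
      have hj : (0:ℝ) ≤ j := j.cast_nonneg
      nlinarith
    calc β j ≤ θ ^ j * ((1 + T / (θ * c)) * (j + 2 : ℝ)) * (j + 2 : ℝ) ^ N := by
          simp only [hβ]; gcongr
      _ = _ := by push_cast; field_simp; ring
  refine ⟨2 * W * (2 ^ N * (B * c⁻¹)) * ∑' j, β j, by
    have : 0 ≤ ∑' j, β j := tsum_nonneg hβ0
    positivity, fun K b hK P a ha => ?_⟩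
  have hP := ha.nonneg
  obtain ⟨-, f2, f3⟩ := hK.farInt hs0 hΛ.le
  change farMass K ≤ M at f2
  change 0 < farMass K at f3
  set g := symReg s K b with hg
  set k := farKer K with hk
  have hki : Integrable k := farKer_integrable hs0 hΛ.le hK
  have hgs : ContDiff ℝ ∞ g := symReg_contDiff hs0 hs1 hΛ.le hK
  have hg0 : ∀ ξ, g ξ ≠ 0 := fun ξ h0 => by
    have := (symReg_re_ge hs0 hs1 hΛ.le hK ξ).1
    rw [← hg, h0, Complex.zero_re] at this
    linarith
  set Q := farMass K + c with hQ
  have hQc : c ≤ Q := by linarith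
  have hQ0 : 0 < Q := by linarith
  have hmQ : farMass K ≤ θ * Q := by
    rw [hθ, hQ, div_mul_eq_mul_div, le_div_iff₀ (by positivity)]
    nlinarith
  have hgQ : ∀ ξ ∈ {ξ : E | 1 ≤ ‖ξ‖ ∧ ‖ξ‖ ≤ 4}, Q ≤ ‖g ξ‖ := fun ξ hξ =>
    ((symReg_re_ge hs0 hs1 hΛ.le hK ξ).2 hξ.1 hξ.2 hc.le).trans
      ((le_abs_self _).trans (Complex.abs_re_le_norm _))
  have hgB := hB g hgs hg0 _ Q hQc hgQ (fun i hi ξ hξ => hD c K b hK i hi ξ hξ.2)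
  set h : ℕ → E → ℂ := fun j ξ => a ξ * (g ξ)⁻¹ ^ (j + 1) with hh
  have hamp : ∀ j : ℕ, AnnulusAmp 1 N (2 ^ N * (P * (B * (j + 2 : ℝ) ^ N * (Q ^ (j + 1))⁻¹))) (h j) := by
    intro j
    refine ha.mul ((hgs.inv hg0).pow _) (by positivity) fun i hi ξ h1 h4 => ?_
    refine (hgB i hi (j + 1) ξ ⟨h1, h4⟩).trans ?_
    push_cast
    have hj : (0:ℝ) ≤ j := j.cast_nonneg
    have e : (j : ℝ) + 1 + 1 = j + 2 := by ring
    rw [e]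
    gcongr
    linarith
  -- The terms of `a / (g - 𝓕 k) = ∑ (𝓕 k)^j a / g^(j+1)`, with the smooth factors collected in `h
  -- j`.
  set F : ℕ → E → ℂ := fun j ξ => 𝓕 k ξ ^ j * h j ξ with hF
  have hFi : ∀ j, Integrable (F j) := fun j => integrable_fourier_pow_mul hki (hamp j).integrable j
  have hkn : ∀ ξ, ‖𝓕 k ξ‖ ≤ θ * Q := fun ξ => (norm_fourier_farKer_le hK ξ).trans hmQ
  have hFn : ∀ j ξ, ‖F j ξ‖ ≤ θ ^ j * (c⁻¹ * ‖a ξ‖) := by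
    intro j ξ
    by_cases hξ : a ξ = 0
    · simp [hF, hh, hξ]
    · have h1 := hgQ ξ (ha.supp ξ hξ)
      have h2 := hkn ξ
      simp only [hF, hh, norm_mul, norm_pow, norm_inv]
      calc ‖𝓕 k ξ‖ ^ j * (‖a ξ‖ * ‖g ξ‖⁻¹ ^ (j + 1)) ≤ (θ * Q) ^ j * (‖a ξ‖ * Q⁻¹ ^ (j + 1)) := by
            gcongr
        _ = θ ^ j * (Q⁻¹ * ‖a ξ‖) := by rw [mul_pow, inv_pow, pow_succ]; field_simp
        _ ≤ _ := by gcongr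
  have hFs : Summable fun j => ∫ ξ, ‖F j ξ‖ := by
    refine Summable.of_nonneg_of_le (fun j => integral_nonneg fun ξ => norm_nonneg _)
      (f := fun j => θ ^ j * (c⁻¹ * ∫ ξ, ‖a ξ‖)) (fun j => ?_)
      ((summable_geometric_of_lt_one hθ0.le hθ1).mul_right _)
    rw [← integral_const_mul, ← integral_const_mul]
    exact integral_mono (hFi j).norm ((ha.integrable.norm.const_mul _).const_mul _) (hFn j)
  have hFq : ∀ ξ, HasSum (fun j => F j ξ) (a ξ / levySymbol s K b ξ) := by
    intro ξ
    by_cases hξ : a ξ = 0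
    · simp only [hF, hh, hξ, zero_mul, mul_zero, zero_div]; exact hasSum_zero
    · have h1 := hgQ ξ (ha.supp ξ hξ)
      have h2 := hkn ξ
      have h3 : ‖𝓕 k ξ / g ξ‖ < 1 := by
        rw [norm_div, div_lt_one (by linarith)]
        nlinarith
      have h4 := (hasSum_geometric_of_norm_lt_one h3).mul_left (a ξ / g ξ)
      have h5 : levySymbol s K b ξ ≠ 0 := by
        intro h0
        have := levySymbol_re_pos hs0 hs1 hΛ.le hc hK (ha.supp ξ hξ).1 (ha.supp ξ hξ).2
        rw [h0, Complex.zero_re] at this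
        linarith
      have h6 : levySymbol s K b ξ = g ξ - 𝓕 k ξ := rfl
      have h7 := hg0 ξ
      have e1 : (fun j => F j ξ) = fun j => a ξ / g ξ * (𝓕 k ξ / g ξ) ^ j := by
        funext j
        simp only [hF, hh]
        rw [div_pow, inv_pow, pow_succ]
        field_simp
      have e2 : a ξ / levySymbol s K b ξ = a ξ / g ξ * (1 - 𝓕 k ξ / g ξ)⁻¹ := by
        rw [h6] at h5 ⊢
        have h8 : 1 - 𝓕 k ξ / g ξ = (g ξ - 𝓕 k ξ) / g ξ := by field_simp
        rw [h8]
        field_simp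
      rw [e1, e2]
      exact h4
  have hw : Measurable fun z : E => ENNReal.ofReal (1 + ‖z‖ ^ s) := by fun_prop
  have hτ : Measurable fun z : E => ENNReal.ofReal (‖z‖ ^ s) := by fun_prop
  have hwτ : ∀ z y : E, ENNReal.ofReal (1 + ‖z‖ ^ s) ≤
      ENNReal.ofReal (1 + ‖z + y‖ ^ s) + ENNReal.ofReal (‖y‖ ^ s) := by
    intro z y
    rw [← ENNReal.ofReal_add (by positivity) (by positivity)]
    refine ENNReal.ofReal_le_ofReal ?_
    have h1 : ‖z‖ ≤ ‖z + y‖ + ‖y‖ := by simpa using norm_sub_le (z + y) y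
    have h2 := (Real.rpow_le_rpow (norm_nonneg _) h1 hs0.le).trans
      (Real.rpow_add_le_add_rpow (norm_nonneg _) (norm_nonneg _) hs0.le hs1.le)
    linarith
  refine (lintegral_weight_fourier_tsum_le hw hFi hFs hFq).trans ?_
  have hterm : ∀ j, ∫⁻ z, ENNReal.ofReal (1 + ‖z‖ ^ s) * ‖𝓕 (F j) z‖ₑ ≤
      ENNReal.ofReal (2 * W * (2 ^ N * (B * c⁻¹)) * P * β j) := by
    intro j
    have hkm : ∫⁻ y, ‖k y‖ₑ ≤ ENNReal.ofReal (θ * Q) := by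
      rw [hk, hK.lintegral_farKer hs0 hΛ.le]; exact ENNReal.ofReal_le_ofReal hmQ
    refine (lintegral_weight_fourier_pow_mul_le hki (hamp j).integrable hw hτ hwτ
      (fun z => by rw [← ENNReal.ofReal_one]; exact ENNReal.ofReal_le_ofReal (by
        have : 0 ≤ ‖z‖ ^ s := by positivity
        linarith)) (by positivity) hT0.le hkm (hK.lintegral_rpow_farKer_le hs0 hΛ.le) j).trans ?_
    have h1 : ∫⁻ z, ENNReal.ofReal (1 + ‖z‖ ^ s) * ‖𝓕 (h j) z‖ₑ ≤
        ENNReal.ofReal (2 * (W * (2 ^ N * (P * (B * (j + 2 : ℝ) ^ N * (Q ^ (j + 1))⁻¹))))) := by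
      rw [ENNReal.ofReal_mul zero_le_two]
      refine le_trans ?_ (mul_le_mul_right (hW _ _ _ (hamp j)) _)
      rw [← lintegral_const_mul' _ _ ENNReal.ofReal_ne_top]
      refine lintegral_mono fun z => ?_
      rw [← ofReal_norm, ← ENNReal.ofReal_mul (by positivity), ← ENNReal.ofReal_mul zero_le_two]
      refine ENNReal.ofReal_le_ofReal ?_
      rw [← mul_assoc]
      gcongr
      exact one_add_rpow_le_mul_sq hs0 hs1 (norm_nonneg z)
    refine (mul_le_mul_right h1 _).trans ?_
    rw [← ENNReal.ofReal_mul (by positivity)]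
    refine ENNReal.ofReal_le_ofReal ?_
    simp only [hβ]
    calc (θ * Q) ^ j * (1 + j * (T / (θ * Q))) *
          (2 * (W * (2 ^ N * (P * (B * (j + 2 : ℝ) ^ N * (Q ^ (j + 1))⁻¹)))))
        = (θ ^ j * (1 + j * (T / (θ * Q))) * (j + 2 : ℝ) ^ N) * (2 * W * (2 ^ N * (B * Q⁻¹)) * P) := by
          rw [mul_pow, pow_succ]; field_simp; ring
      _ ≤ (θ ^ j * (1 + j * (T / (θ * c))) * (j + 2 : ℝ) ^ N) * (2 * W * (2 ^ N * (B * c⁻¹)) * P) := by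
          gcongr
      _ = _ := by ring
  refine (ENNReal.tsum_le_tsum hterm).trans (le_of_eq ?_)
  rw [← ENNReal.ofReal_tsum_of_nonneg (fun j => by have := hβ0 j; positivity) (hβs.mul_left _), tsum_mul_left]
  congr 1
  ring

end Neumann

/-! ### Exact solutions of the operator equation with frequency-localised right-hand side. -/

section Parametrix

open Module FourierTransform

variable {E : Type*} [NormedAddCommGroup E] [InnerProductSpace ℝ E] [FiniteDimensional ℝ E]
  [MeasurableSpace E] [BorelSpace E]

lemma norm_iteratedFDeriv_ech_le (y : E) (i : ℕ) (ξ : E) :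
    ‖iteratedFDeriv ℝ i (ech y) ξ‖ ≤ (2 * Real.pi * ‖y‖) ^ i := by
  set c : ℂ := -2 * Real.pi * Complex.I with hc
  have hcn : ‖c‖ = 2 * Real.pi := by simp [hc, abs_of_pos Real.pi_pos]
  have h1 : ∀ (i : ℕ) (t : ℝ), iteratedDeriv i (fun t : ℝ => Complex.exp (c * t)) t =
      c ^ i * Complex.exp (c * t) := by
    intro i
    induction i with
    | zero => simp
    | succ i ih =>
      intro t
      rw [iteratedDeriv_succ, funext ih]
      have h2 : HasDerivAt (fun t : ℝ => c ^ i * Complex.exp (c * t)) (c ^ i * (Complex.exp (c * t) * c)) t := by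
        have h3 : HasDerivAt (fun t : ℝ => c * (t : ℂ)) c t := by
          simpa using (Complex.ofRealCLM.hasDerivAt (x := t)).const_mul c
        exact h3.cexp.const_mul _
      rw [h2.deriv]; ring
  have h2 : ech y = (fun t : ℝ => Complex.exp (c * t)) ∘ (innerSL ℝ y : E →L[ℝ] ℝ) := by
    funext η
    have e : Complex.I * ((-(2 * Real.pi * inner ℝ y η) : ℝ) : ℂ) = c * (innerSL ℝ y η : ℝ) := by
      rw [hc, innerSL_apply_apply]; push_cast; ring
    rw [ech_eq_exp, e, Function.comp_apply]
  have h3 : ContDiff ℝ i (fun t : ℝ => Complex.exp (c * t)) :=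
    (contDiff_const.mul Complex.ofRealCLM.contDiff).cexp
  rw [h2]
  have h4 := ContinuousLinearMap.iteratedFDeriv_comp_right (innerSL ℝ y : E →L[ℝ] ℝ) h3 ξ le_rfl
  rw [h4]
  refine (ContinuousMultilinearMap.norm_compContinuousLinearMap_le _ _).trans ?_
  rw [norm_iteratedFDeriv_eq_norm_iteratedDeriv, h1, Finset.prod_const, Finset.card_univ,
    Fintype.card_fin, norm_mul, norm_pow, hcn, innerSL_apply_norm, mul_pow]
  have h5 : ‖Complex.exp (c * (innerSL ℝ y ξ : ℝ))‖ = 1 := by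
    rw [Complex.norm_exp]; simp [hc]
  rw [h5]
  exact le_of_eq (by ring)

lemma ech_contDiff (y : E) : ContDiff ℝ ∞ (ech y) := by
  have h : ContDiff ℝ ∞ fun ξ : E => (((-(2 * Real.pi * inner ℝ y ξ) : ℝ) : ℂ)) :=
    Complex.ofRealCLM.contDiff.comp (contDiff_const.mul (innerSL ℝ y).contDiff).neg
  simp only [funext (ech_eq_exp y)]
  exact (contDiff_const.mul h).cexp

/-- On the transformed side this multiplication is a difference with step `y`. It keeps the support
and gains a factor `‖y‖`, so differences are handled by applying bounds for amplitudes once more. -/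
lemma AnnulusAmp.mul_ech_sub_one (N : ℕ) : ∃ C : ℝ, 0 ≤ C ∧ ∀ (κ P : ℝ) (a : E → ℂ), AnnulusAmp κ N P a →
    ∀ y : E, ‖y‖ ≤ 1 → AnnulusAmp κ N (C * P * ‖y‖) fun ξ => a ξ * (ech y ξ - 1) := by
  have hpi := Real.pi_gt_three
  refine ⟨2 ^ N * (4 * (2 * Real.pi) ^ (N + 1)), by positivity, fun κ P a h y hy => ?_⟩
  have key := h.mul (g := fun ξ => ech y ξ - 1) ((ech_contDiff y).sub contDiff_const)
    (R := 4 * (2 * Real.pi) ^ (N + 1) * ‖y‖) (by positivity) ?_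
  · convert key using 1; ring
  intro i hi ξ _ h4
  have hn := norm_nonneg y
  rcases i with - | i
  · rw [norm_iteratedFDeriv_zero]
    calc _ ≤ 2 * Real.pi * (‖y‖ * ‖ξ‖) := norm_ech_sub_one_le y ξ
      _ ≤ 2 * Real.pi * (‖y‖ * 4) := by gcongr
      _ = 4 * (2 * Real.pi) ^ 1 * ‖y‖ := by ring
      _ ≤ _ := by
        gcongr
        · linarith
        · omega
  · have e : fderiv ℝ (fun ξ => ech y ξ - 1) = fderiv ℝ (ech y) := funext fun ξ => fderiv_sub_const _
    rw [← norm_iteratedFDeriv_fderiv, e, norm_iteratedFDeriv_fderiv]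
    refine (norm_iteratedFDeriv_ech_le y (i + 1) ξ).trans ?_
    calc (2 * Real.pi * ‖y‖) ^ (i + 1) = 1 * (2 * Real.pi) ^ (i + 1) * ‖y‖ ^ (i + 1) := by
          rw [mul_pow]; ring
      _ ≤ 4 * (2 * Real.pi) ^ (N + 1) * ‖y‖ ^ 1 := by
        gcongr ?_ * ?_ * ?_
        · norm_num
        · exact pow_le_pow_right₀ (by linarith) (by omega)
        · exact pow_le_pow_of_le_one hn hy (by omega)
      _ = _ := by rw [pow_one]

/-- The multiplier of the integrand of the operator. -/
def levyMult (s : ℝ) (y ξ : E) : ℂ :=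
  1 - ech y ξ - 2 * Real.pi * Complex.I * levyComp s y * (inner ℝ y ξ : ℝ)

/-- With `R = 2π‖ξ‖`, the uncompensated multiplier is bounded by `2` and by `R‖y‖`, the compensated
one by `2R‖y‖` and by `2(R‖y‖)²`; the weight picks the right one in each regime. -/
lemma norm_levyMult_le (s : ℝ) (y ξ : E) :
    ‖levyMult s y ξ‖ ≤ 4 * (1 + 2 * Real.pi * ‖ξ‖) ^ 2 * levyWeight s y := by
  have hn := norm_nonneg y
  have hpi := Real.pi_pos
  set R := 2 * Real.pi * ‖ξ‖ with hR
  have hR0 : 0 ≤ R := by positivity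
  have b0 : ‖1 - ech y ξ‖ ≤ 2 := by
    refine (norm_sub_le _ _).trans ?_
    rw [norm_one, norm_ech]; norm_num
  have b1 : ‖1 - ech y ξ‖ ≤ R * ‖y‖ := by
    rw [norm_sub_rev]
    refine (norm_ech_sub_one_le y ξ).trans (le_of_eq ?_)
    rw [hR]; ring
  set u : ℂ := 2 * Real.pi * Complex.I * (inner ℝ y ξ : ℝ) with hu
  have hun : ‖u‖ ≤ R * ‖y‖ := by
    have : ‖u‖ = 2 * Real.pi * |inner ℝ y ξ| := by simp [hu, abs_of_pos hpi]
    rw [this, hR]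
    have := abs_real_inner_le_norm y ξ
    calc _ ≤ 2 * Real.pi * (‖y‖ * ‖ξ‖) := by gcongr
      _ = _ := by ring
  have b2 : ‖1 - ech y ξ - u‖ ≤ 2 * (R * ‖y‖) ^ 2 := by
    have e : ‖1 - ech y ξ - u‖ = ‖Complex.exp (-u) - 1 - (-u)‖ := by
      rw [← norm_neg, ech_eq_exp]
      congr 1
      have : Complex.I * ((-(2 * Real.pi * inner ℝ y ξ) : ℝ) : ℂ) = -u := by rw [hu]; push_cast; ring
      rw [this]; ring
    have h0 : ‖u‖ ^ 2 ≤ (R * ‖y‖) ^ 2 := by gcongr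
    rcases le_total ‖u‖ 1 with h | h
    · rw [e]
      have := Complex.norm_exp_sub_one_sub_id_le (x := -u) (by rwa [norm_neg])
      rw [norm_neg] at this
      nlinarith [sq_nonneg (R * ‖y‖)]
    · have h3 := norm_sub_le (1 - ech y ξ) u
      have h4 : ‖1 - ech y ξ‖ ≤ ‖u‖ := by
        have h5 : ‖ech y ξ - 1‖ ≤ ‖(2 * Real.pi * inner ℝ y ξ : ℝ)‖ := by
          rw [ech_eq_exp]
          refine (Real.norm_exp_I_mul_ofReal_sub_one_le).trans ?_
          rw [norm_neg]
        rw [norm_sub_rev]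
        refine h5.trans (le_of_eq ?_)
        simp [hu, abs_of_pos hpi]
      nlinarith
  have b3 : ‖1 - ech y ξ - u‖ ≤ 2 * (R * ‖y‖) := (norm_sub_le _ _).trans (by linarith)
  have e1 : (2 * Real.pi * Complex.I * (1:ℝ) * (inner ℝ y ξ : ℝ) : ℂ) = u := by rw [hu]; push_cast; ring
  have e0 : (2 * Real.pi * Complex.I * (0:ℝ) * (inner ℝ y ξ : ℝ) : ℂ) = 0 := by push_cast; ring
  unfold levyMult levyComp levyWeight
  have hA : 1 ≤ (1 + R) ^ 2 := by nlinarith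
  have hB : R ≤ (1 + R) ^ 2 := by nlinarith
  have hC : R ^ 2 ≤ (1 + R) ^ 2 := by nlinarith
  split_ifs with h1 h2 h3
  · rw [e0, sub_zero]
    rcases le_total ‖y‖ 1 with h | h
    · rw [min_eq_left h]; nlinarith
    · rw [min_eq_right h]; nlinarith
  · rw [e1, min_eq_left (by nlinarith)]; nlinarith [mul_le_mul_of_nonneg_right hC (sq_nonneg ‖y‖), sq_nonneg ‖y‖]
  · rw [e0, sub_zero, min_eq_right (by nlinarith)]; nlinarith
  · rw [e1]
    rcases le_total ‖y‖ 1 with h | h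
    · rw [min_eq_left (by nlinarith)]; nlinarith [mul_le_mul_of_nonneg_right hC (sq_nonneg ‖y‖), sq_nonneg ‖y‖]
    · rw [min_eq_right (by nlinarith)]; nlinarith [mul_le_mul_of_nonneg_right hB hn]

lemma levyMult_measurable (s : ℝ) : Measurable fun p : E × E => levyMult s p.1 p.2 := by
  unfold levyMult
  have h1 := levyComp_measurable (E := E) s
  have h2 : Measurable fun p : E × E => ech p.1 p.2 := continuous_ech.measurable
  have h3 : Measurable fun p : E × E => ((inner ℝ p.1 p.2 : ℝ) : ℂ) := by fun_prop
  fun_prop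

variable {s c Λ : ℝ} {K : E → ℝ} {b : E}

lemma integral_levyMult (hs0 : 0 < s) (hs1 : s < 1) (hΛ : 0 ≤ Λ) (hK : StableKer s c Λ K b) (ξ : E) :
    ∫ y, levyMult s y ξ * K y = (∫ y, symInt s K ξ y) - 𝓕 (farKer K) ξ := by
  rw [fourier_eq_integral_ech, ← integral_sub (symInt_integrable hs0 hs1 hΛ hK ξ)
    (Integrable.bdd_mul (c := 1) (farKer_integrable hs0 hΛ hK) (continuous_ech_left ξ).aestronglyMeasurable
        (Eventually.of_forall fun y => (norm_ech y ξ).le))]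
  refine integral_congr_ae (Eventually.of_forall fun y => ?_)
  simp only [levyMult, symInt, farKer]
  push_cast
  ring

lemma hasFDerivAt_re_fourier {q : E → ℂ} (hq : Continuous q) (hqc : HasCompactSupport q) (x v : E) :
    fderiv ℝ (fun z => (𝓕 q z).re) x v =
      (∫ ξ, ech ξ x * (q ξ * (-(2 * Real.pi * Complex.I * (inner ℝ v ξ : ℝ))))).re := by
  have hi : Integrable q := hq.integrable_of_hasCompactSupport hqc
  have hi1 : Integrable fun ξ => ‖ξ‖ * ‖q ξ‖ :=
    (continuous_norm.mul hq.norm).integrable_of_hasCompactSupport (hqc.norm.mul_left)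
  have h1 := Real.hasFDerivAt_fourier hi hi1 x
  have h2 : HasFDerivAt (fun z => (𝓕 q z).re)
      (Complex.reCLM ∘L (𝓕 (VectorFourier.fourierSMulRight (innerSL ℝ) q) x)) x :=
    Complex.reCLM.hasFDerivAt.comp x h1
  have hi2 : Integrable (VectorFourier.fourierSMulRight (innerSL ℝ) q) := by
    refine (hi1.const_mul (2 * Real.pi)).mono'
      (AEStronglyMeasurable.fourierSMulRight (L := innerSL ℝ) hi.1) (Eventually.of_forall fun y => ?_)
    exact norm_fourierSMulRight_innerSL_le q y
  rw [h2.fderiv, ContinuousLinearMap.comp_apply, Complex.reCLM_apply,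
    Real.fourier_continuousLinearMap_apply hi2, fourier_eq_integral_ech]
  congr 1
  refine integral_congr_ae (Eventually.of_forall fun ξ => ?_)
  have e : (innerSL ℝ ξ v : ℝ) = inner ℝ v ξ := by rw [innerSL_apply_apply, real_inner_comm]
  simp only [VectorFourier.fourierSMulRight_apply, e, smul_eq_mul, Complex.real_smul]
  ring

/-- The integrand of the operator acts on each character as multiplication by `levyMult`, and Fubini
allows integrating in `y` first. Compact support of `q` makes the growth of `levyMult` in `ξ`
harmless, and no smoothness of `q` is required; this matters since `q` will be a quotient by the
symbol. -/
lemma levyOp_re_fourier (hs0 : 0 < s) (hs1 : s < 1) (hΛ : 0 ≤ Λ) (hK : StableKer s c Λ K b)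
    {q : E → ℂ} (hq : Continuous q) (hqc : HasCompactSupport q) (x : E) :
    levyOp s K b (fun z => (𝓕 q z).re) x = (𝓕 (fun ξ => q ξ * levySymbol s K b ξ) x).re := by
  classical
  obtain ⟨C, -, hC⟩ := levyWeight_integrable (E := E) hs0 hs1 hΛ
  have hi : Integrable q := hq.integrable_of_hasCompactSupport hqc
  have hie : ∀ x, Integrable fun ξ => ech ξ x * q ξ := fun x =>
    Integrable.bdd_mul (c := 1) hi (continuous_ech_left x).aestronglyMeasurable
        (Eventually.of_forall fun y => (norm_ech y x).le)
  have hid : ∀ x v : E, Integrable fun ξ => ech ξ x * (q ξ * (-(2 * Real.pi * Complex.I * (inner ℝ v ξ : ℝ)))) := by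
    intro x v
    have hc2 : Continuous fun ξ : E => (-(2 * Real.pi * Complex.I * ((inner ℝ v ξ : ℝ) : ℂ))) := by fun_prop
    exact ((continuous_ech_left x).mul (hq.mul hc2)).integrable_of_hasCompactSupport
      ((hqc.mul_right).mul_left)
  have e1 : ∀ y, ((𝓕 q x).re - (𝓕 q (x + y)).re + levyComp s y * fderiv ℝ (fun z => (𝓕 q z).re) x y) * K y =
      (∫ ξ, (ech ξ x * q ξ) * (levyMult s y ξ * K y)).re := by
    intro y
    rw [hasFDerivAt_re_fourier hq hqc]
    have h1 : (∫ ξ, (ech ξ x * q ξ) * (levyMult s y ξ * K y)) =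
        (𝓕 q x - 𝓕 q (x + y) + levyComp s y *
          ∫ ξ, ech ξ x * (q ξ * (-(2 * Real.pi * Complex.I * (inner ℝ y ξ : ℝ))))) * K y := by
      rw [fourier_eq_integral_ech, fourier_eq_integral_ech, ← integral_sub (hie x) (hie (x + y)),
        ← integral_const_mul, ← integral_add (f := fun ξ => ech ξ x * q ξ - ech ξ (x + y) * q ξ) ((hie x).sub (hie _)) ((hid x y).const_mul _), ← integral_mul_const]
      refine integral_congr_ae (Eventually.of_forall fun ξ => ?_)
      simp only [levyMult, Pi.sub_apply, ech_comm ξ (x + y), ech_add_left, ech_comm x ξ]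
      ring
    rw [h1, Complex.re_mul_ofReal, Complex.add_re, Complex.sub_re, Complex.re_ofReal_mul]
  have hprod : Integrable (fun p : E × E => (ech p.2 x * q p.2) * (levyMult s p.1 p.2 * K p.1))
      (volume.prod volume) := by
    have hb : Integrable (fun ξ => 4 * (1 + 2 * Real.pi * ‖ξ‖) ^ 2 * ‖q ξ‖) := by
      have hcont : Continuous fun ξ : E => 4 * (1 + 2 * Real.pi * ‖ξ‖) ^ 2 * ‖q ξ‖ := by fun_prop
      exact hcont.integrable_of_hasCompactSupport (hqc.norm.mul_left)
    refine ((hC c K b hK).1.mul_prod hb).mono' ?_ (Eventually.of_forall fun p => ?_)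
    · have h1 : AEMeasurable (fun p : E × E => (K p.1 : ℂ)) (volume.prod volume) :=
        (Complex.measurable_ofReal.comp_aemeasurable hK.meas).comp_fst
      have h2 : Measurable fun p : E × E => ech p.2 x * q p.2 :=
        (((continuous_ech_left x).mul hq).comp continuous_snd).measurable
      exact (h2.aemeasurable.mul ((levyMult_measurable s).aemeasurable.mul h1)).aestronglyMeasurable
    · rw [norm_mul, norm_mul, norm_ech, one_mul, norm_mul, Complex.norm_real,
        Real.norm_of_nonneg (hK.nonneg _)]
      have := norm_levyMult_le s p.1 p.2
      have h0 := hK.nonneg p.1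
      calc ‖q p.2‖ * (‖levyMult s p.1 p.2‖ * K p.1) ≤
          ‖q p.2‖ * ((4 * (1 + 2 * Real.pi * ‖p.2‖) ^ 2 * levyWeight s p.1) * K p.1) := by gcongr
        _ = _ := by ring
  have e2 : ∫ y, ((𝓕 q x).re - (𝓕 q (x + y)).re + levyComp s y * fderiv ℝ (fun z => (𝓕 q z).re) x y) * K y =
      (∫ ξ, (ech ξ x * q ξ) * ((∫ y, symInt s K ξ y) - 𝓕 (farKer K) ξ)).re := by
    simp_rw [e1]
    have h1 : ∫ y, (∫ ξ, (ech ξ x * q ξ) * (levyMult s y ξ * K y)).re =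
        (∫ y, ∫ ξ, (ech ξ x * q ξ) * (levyMult s y ξ * K y)).re := integral_re hprod.integral_prod_left
    rw [h1, integral_integral_swap hprod]
    congr 1
    refine integral_congr_ae (Eventually.of_forall fun ξ => ?_)
    simp only
    rw [integral_const_mul, integral_levyMult hs0 hs1 hΛ hK]
  have hI3 : Integrable fun ξ => (ech ξ x * q ξ) * ((∫ y, symInt s K ξ y) - 𝓕 (farKer K) ξ) := by
    refine hprod.integral_prod_right.congr (Eventually.of_forall fun ξ => ?_)
    simp only
    rw [integral_const_mul, integral_levyMult hs0 hs1 hΛ hK]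
  unfold levyOp
  rw [e2, fourier_eq_integral_ech]
  have e3 : (if s = 1 / 2 then fderiv ℝ (fun z => (𝓕 q z).re) x b else 0) =
      (∫ ξ, ech ξ x * (q ξ * (-(2 * Real.pi * Complex.I * (if s = 1 / 2 then (inner ℝ b ξ : ℝ) else (0 : ℝ) : ℝ))))).re := by
    split_ifs
    · exact hasFDerivAt_re_fourier hq hqc x b
    · simp
  have hI4 : Integrable fun ξ => ech ξ x * (q ξ * (-(2 * Real.pi * Complex.I * (if s = 1 / 2 then (inner ℝ b ξ : ℝ) else (0 : ℝ) : ℝ)))) := by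
    split_ifs
    · exact hid x b
    · simp
  rw [e3, ← Complex.add_re, ← integral_add hI3 hI4]
  congr 1
  refine integral_congr_ae (Eventually.of_forall fun ξ => ?_)
  simp only [levySymbol, symReg]
  ring

lemma exists_bddC2_re_fourier {q : E → ℂ} (hq : Continuous q) (hqc : HasCompactSupport q) :
    ContDiff ℝ ∞ (fun z => (𝓕 q z).re) ∧ ∃ M, BddC2 M (fun z => (𝓕 q z).re) := by
  have hi : ∀ i : ℕ, Integrable fun ξ => ‖ξ‖ ^ i * ‖q ξ‖ := fun i =>
    ((continuous_norm.pow i).mul hq.norm).integrable_of_hasCompactSupport (hqc.norm.mul_left)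
  have h1 : ContDiff ℝ ∞ (𝓕 q) := Real.contDiff_fourier (N := ⊤) fun i _ => hi i
  have h2 : ContDiff ℝ ∞ (fun z => (𝓕 q z).re) := Complex.reCLM.contDiff.comp h1
  have h3 : ∀ i : ℕ, ∃ M, ∀ z, ‖iteratedFDeriv ℝ i (fun z => (𝓕 q z).re) z‖ ≤ M := by
    intro i
    refine ⟨‖Complex.reCLM‖ * ∫ ξ, ‖VectorFourier.fourierPowSMulRight (innerSL ℝ) q ξ i‖, fun z => ?_⟩
    have e : (fun z => (𝓕 q z).re) = Complex.reCLM ∘ 𝓕 q := rfl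
    rw [e, ContinuousLinearMap.iteratedFDeriv_comp_left _ h1.contDiffAt (by exact_mod_cast le_top)]
    refine (ContinuousLinearMap.norm_compContinuousMultilinearMap_le _ _).trans ?_
    gcongr
    rw [Real.iteratedFDeriv_fourier (N := ⊤) (fun i _ => hi i) hq.aestronglyMeasurable le_top]
    exact VectorFourier.norm_fourierIntegral_le_integral_norm _ _ _ _ _
  refine ⟨h2, ?_⟩
  obtain ⟨M0, h0⟩ := h3 0
  obtain ⟨M1, hM1⟩ := h3 1
  obtain ⟨M2, hM2⟩ := h3 2
  refine ⟨max M0 (max M1 M2), h2.of_le (by exact WithTop.coe_le_coe.2 le_top), fun x => ?_, fun x => ?_, fun x => ?_⟩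
  · have := h0 x
    rw [norm_iteratedFDeriv_zero] at this
    exact this.trans (le_max_left _ _)
  · have := hM1 x
    rw [norm_iteratedFDeriv_one] at this
    exact this.trans ((le_max_left _ _).trans (le_max_right _ _))
  · have := hM2 x
    rw [← norm_iteratedFDeriv_fderiv, norm_iteratedFDeriv_one] at this
    exact this.trans ((le_max_right _ _).trans (le_max_right _ _))

/-- A smooth function `φ`, its image `ψ` under the operator, and the bounds needed to use a
truncation of a rescaling of `φ` as a test function. -/
structure LevyPair (s : ℝ) (K : E → ℝ) (b : E) (φ ψ : E → ℝ) (B : ℝ) : Prop where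
  smooth : ContDiff ℝ ∞ φ
  bdd : ∃ M, BddC2 M φ
  eq : ∀ x, levyOp s K b φ x = ψ x
  int : ∫⁻ z, ENNReal.ofReal ((1 + ‖z‖ ^ s) * |φ z|) ≤ ENNReal.ofReal B
  diff : ∀ y, ‖y‖ ≤ 1 →
    ∫⁻ z, ENNReal.ofReal ((1 + ‖z‖ ^ s) * |φ (z + y) - φ z|) ≤ ENNReal.ofReal (B * ‖y‖)
  cont : Continuous ψ
  rhs : ∫⁻ z, ENNReal.ofReal ((1 + ‖z‖) ^ 2 * |ψ z|) ≤ ENNReal.ofReal B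

/-- Dividing by the symbol inverts the operator on the annulus, where the symbol has real part at
least `c`. The weight on `φ` is only `‖z‖ ^ s`, limited by the moments of the far kernel; `ψ` is the
transform of a smooth function and carries a quadratic weight. -/
lemma exists_levyPair (hs0 : 0 < s) (hs1 : s < 1) (hc : 0 < c) (hΛ : 0 < Λ) :
    ∃ C : ℝ, 0 ≤ C ∧ ∀ (K : E → ℝ) (b : E), StableKer s c Λ K b → ∀ (P : ℝ) (a : E → ℂ),
      AnnulusAmp 1 (2 + finrank ℝ E + 1) P a →
      LevyPair s K b (fun z => (𝓕 (fun ξ => a ξ / levySymbol s K b ξ) z).re)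
        (fun z => (𝓕 a z).re) (C * P) := by
  obtain ⟨C, hC, h1⟩ := exists_symbol_quotient_bound (E := E) hs0 hs1 hc hΛ
  obtain ⟨D, hD, h2⟩ := AnnulusAmp.mul_ech_sub_one (E := E) (2 + finrank ℝ E + 1)
  obtain ⟨W, hW, h3⟩ := exists_fourier_weight_bound (E := E) 2
  refine ⟨max (max C (C * D)) W, by positivity, fun K b hK P a ha => ?_⟩
  have hP := ha.nonneg
  have hA := levySymbol_continuous hs0 hs1 hΛ.le hK
  have hA0 : ∀ ξ : E, 1 ≤ ‖ξ‖ → ‖ξ‖ ≤ 4 → levySymbol s K b ξ ≠ 0 := fun ξ hξ hξ4 h0 => by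
    have := levySymbol_re_pos hs0 hs1 hΛ.le hc hK hξ hξ4
    rw [h0, Complex.zero_re] at this
    linarith
  set q : E → ℂ := fun ξ => a ξ / levySymbol s K b ξ with hq
  have hqcont : Continuous q := ha.continuous_div hA hA0
  have hqc : HasCompactSupport q := HasCompactSupport.of_support_subset_isCompact
    (isCompact_closedBall 0 4) fun ξ hξ => by
      simpa using (ha.supp ξ (left_ne_zero_of_mul (by simpa [hq, div_eq_mul_inv] using hξ))).2
  have hi : Integrable q := hqcont.integrable_of_hasCompactSupport hqc
  have hie : ∀ x, Integrable fun ξ => ech ξ x * q ξ := fun x =>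
    Integrable.bdd_mul (c := 1) hi (continuous_ech_left x).aestronglyMeasurable
        (Eventually.of_forall fun y => (norm_ech y x).le)
  obtain ⟨g1, g2⟩ := exists_bddC2_re_fourier hqcont hqc
  have hle : ∀ (x z : E) (g : ℂ), ENNReal.ofReal ((1 + ‖z‖ ^ s) * |g.re|) ≤
      ENNReal.ofReal (1 + ‖z‖ ^ s) * ‖g‖ₑ := fun x z g => by
    rw [← ofReal_norm, ← ENNReal.ofReal_mul (by positivity)]
    refine ENNReal.ofReal_le_ofReal ?_
    gcongr
    exact Complex.abs_re_le_norm g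
  refine ⟨g1, g2, fun x => ?_, ?_, fun y hy => ?_, ?_, ?_⟩
  · rw [levyOp_re_fourier hs0 hs1 hΛ.le hK hqcont hqc]
    have e : (fun ξ => q ξ * levySymbol s K b ξ) = a := by
      funext ξ
      by_cases hξ : a ξ = 0
      · simp [hq, hξ]
      · exact div_mul_cancel₀ _ (hA0 ξ (ha.supp ξ hξ).1 (ha.supp ξ hξ).2)
    rw [e]
  · refine (lintegral_mono fun z => hle 0 z _).trans ((h1 K b hK P a ha).trans ?_)
    refine ENNReal.ofReal_le_ofReal (mul_le_mul_of_nonneg_right ?_ hP)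
    exact (le_max_left _ _).trans (le_max_left _ _)
  -- A difference of `φ` with step `y` is the same construction with the amplitude `a * (ech y -
  -- 1)`, whose bounds carry the factor `‖y‖`.
  · have h4 := h1 K b hK _ _ (h2 1 P a ha y hy)
    have e : ∀ z, (𝓕 q (z + y)).re - (𝓕 q z).re =
        (𝓕 (fun ξ => a ξ * (ech y ξ - 1) / levySymbol s K b ξ) z).re := by
      intro z
      rw [← Complex.sub_re, fourier_eq_integral_ech, fourier_eq_integral_ech, fourier_eq_integral_ech,
        ← integral_sub (hie _) (hie _)]
      congr 2
      funext ξ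
      rw [ech_comm ξ (z + y), ech_add_left, ech_comm ξ z]
      simp only [hq]
      ring
    simp only [e]
    refine (lintegral_mono fun z => hle 0 z _).trans (h4.trans ?_)
    refine ENNReal.ofReal_le_ofReal ?_
    calc C * (D * P * ‖y‖) = C * D * P * ‖y‖ := by ring
      _ ≤ _ := by
        gcongr
        exact (le_max_right _ _).trans (le_max_left _ _)
  · exact Complex.continuous_re.comp (continuous_fourier ha.integrable)
  · refine (lintegral_mono fun z => ENNReal.ofReal_le_ofReal ?_).trans ((h3 1 P a ha).trans ?_)
    · gcongr
      exact Complex.abs_re_le_norm _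
    · exact ENNReal.ofReal_le_ofReal (mul_le_mul_of_nonneg_right (le_max_right _ _) hP)

end Parametrix

/-! ### Testing the equation with a truncated rescaled parametrix. -/

section Core

open Module

variable {E : Type*} [NormedAddCommGroup E] [InnerProductSpace ℝ E] [FiniteDimensional ℝ E]
  [MeasurableSpace E] [BorelSpace E]

variable {s c Λ : ℝ} {K : E → ℝ} {b : E}

lemma rpow_mul_le_rpow_one_add {s r t : ℝ} (hs1 : s < 1) (hr : 0 < r) (ht : 0 ≤ t) (htr : t ≤ r) :
    r ^ s * (t * (t / r)) ≤ t ^ (1 + s) := by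
  rcases ht.eq_or_lt with rfl | ht
  · rw [zero_mul, mul_zero]; positivity
  have h1 : t * (t / r) * r ^ s = t ^ (1 + s) * (t / r) ^ (1 - s) := by
    rw [Real.div_rpow ht.le hr.le, Real.rpow_sub ht, Real.rpow_sub hr, Real.rpow_add ht, Real.rpow_one, Real.rpow_one]
    have := Real.rpow_pos_of_pos ht s
    have := Real.rpow_pos_of_pos hr s
    field_simp
  rw [mul_comm, h1]
  refine mul_le_of_le_one_right (by positivity) (Real.rpow_le_one (by positivity) ?_ (by linarith))
  rwa [div_le_one hr]

/-- The bound for the inner integral of the commutator between a cutoff and a rescaled function. -/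
lemma lintegral_cutoff_diff_le {χ φ : E → ℝ} {δ A B r : ℝ} (hs0 : 0 < s) (hs1 : s < 1) (hδ : 0 < δ)
    (hδ1 : δ ≤ 1) (hA : 0 ≤ A) (hχ0 : ∀ z, 0 ≤ χ z) (hχ1 : ∀ z, χ z ≤ 1)
    (hχ : ∀ z, ‖z‖ < δ / 2 → χ z = 1) (hχA : ∀ x y, |χ x - χ (x + y)| ≤ A * ‖y‖)
    (hφ : Continuous φ) (hB : 0 ≤ B)
    (h1 : ∫⁻ z, ENNReal.ofReal ((1 + ‖z‖ ^ s) * |φ z|) ≤ ENNReal.ofReal B)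
    (h2 : ∀ y, ‖y‖ ≤ 1 →
      ∫⁻ z, ENNReal.ofReal ((1 + ‖z‖ ^ s) * |φ (z + y) - φ z|) ≤ ENNReal.ofReal (B * ‖y‖))
    (hr : 0 < r) (hr1 : r ≤ 1) (y : E) :
    ∫⁻ z, ENNReal.ofReal (|χ (r • z) - χ (r • z + y)| * |φ z - φ (z + r⁻¹ • y)|) ≤
      ENNReal.ofReal (2 * B) ∧
    (‖y‖ < δ / 8 → ∫⁻ z, ENNReal.ofReal (|χ (r • z) - χ (r • z + y)| * |φ z - φ (z + r⁻¹ • y)|) ≤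
      ENNReal.ofReal (2 * A * (8 / δ) ^ s * B * ‖y‖ ^ (1 + s))) := by
  have hm : Measurable fun z => ENNReal.ofReal ((1 + ‖z‖ ^ s) * |φ z|) := by fun_prop
  have h1' : ∫⁻ z, ENNReal.ofReal ((1 + ‖z + r⁻¹ • y‖ ^ s) * |φ (z + r⁻¹ • y)|) ≤ ENNReal.ofReal B := by
    rw [lintegral_add_right_eq_self (fun z => ENNReal.ofReal ((1 + ‖z‖ ^ s) * |φ z|)) (r⁻¹ • y)]
    exact h1
  have hsum : ∀ G : ℝ, 0 ≤ G → ∫⁻ z, ENNReal.ofReal (G * ((1 + ‖z‖ ^ s) * |φ z| +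
      (1 + ‖z + r⁻¹ • y‖ ^ s) * |φ (z + r⁻¹ • y)|)) ≤ ENNReal.ofReal (G * (2 * B)) := by
    intro G hG
    have e : ∀ z, ENNReal.ofReal (G * ((1 + ‖z‖ ^ s) * |φ z| +
      (1 + ‖z + r⁻¹ • y‖ ^ s) * |φ (z + r⁻¹ • y)|)) = ENNReal.ofReal G *
        (ENNReal.ofReal ((1 + ‖z‖ ^ s) * |φ z|) +
          ENNReal.ofReal ((1 + ‖z + r⁻¹ • y‖ ^ s) * |φ (z + r⁻¹ • y)|)) := fun z => by
      rw [ENNReal.ofReal_mul hG, ENNReal.ofReal_add (by positivity) (by positivity)]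
    simp_rw [e]
    rw [lintegral_const_mul' _ _ ENNReal.ofReal_ne_top, lintegral_add_left hm, ENNReal.ofReal_mul hG, two_mul,
      ENNReal.ofReal_add hB hB]
    gcongr
  have hw : ∀ z : E, 1 ≤ 1 + ‖z‖ ^ s := fun z => by
    have : 0 ≤ ‖z‖ ^ s := by positivity
    linarith
  have htri : ∀ z, |φ z - φ (z + r⁻¹ • y)| ≤ |φ z| + |φ (z + r⁻¹ • y)| := fun z => abs_sub _ _
  refine ⟨?_, fun hy => ?_⟩
  · have h3 := hsum 1 zero_le_one
    rw [one_mul] at h3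
    refine (lintegral_mono fun z => ENNReal.ofReal_le_ofReal ?_).trans h3
    have h4 : |χ (r • z) - χ (r • z + y)| ≤ 1 := by
      rw [abs_le]; constructor <;> linarith [hχ0 (r • z), hχ1 (r • z), hχ0 (r • z + y), hχ1 (r • z + y)]
    calc _ ≤ 1 * (|φ z| + |φ (z + r⁻¹ • y)|) := by
          gcongr; exact htri z
      _ ≤ _ := by
          rw [one_mul, one_mul]
          gcongr
          · exact le_mul_of_one_le_left (abs_nonneg _) (hw _)
          · exact le_mul_of_one_le_left (abs_nonneg _) (hw _)
  -- away from the region where the cutoff is constant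
  have hz : ∀ z, |χ (r • z) - χ (r • z + y)| ≠ 0 → δ / (4 * r) ≤ ‖z‖ := by
    intro z h0
    by_contra hlt
    push Not at hlt
    rw [lt_div_iff₀ (by positivity)] at hlt
    have h3 : ‖r • z‖ < δ / 4 := by
      rw [norm_smul, Real.norm_of_nonneg hr.le]; linarith
    have h4 : ‖r • z + y‖ < δ / 2 := (norm_add_le _ _).trans_lt (by linarith)
    exact h0 (by rw [hχ _ h4, hχ _ (by linarith), sub_self, abs_zero])
  -- The differences of the cutoff vanish unless `‖z‖` is at least of order `δ / r`, and there the
  -- weight `1 + ‖z‖ ^ s` is at least of order `r ^ (-s)`. Inserting it gains the factor `r ^ s`.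
  have hwt : ∀ z : E, δ / (8 * r) ≤ ‖z‖ → 1 ≤ (8 / δ) ^ s * r ^ s * (1 + ‖z‖ ^ s) := by
    intro z h3
    have h4 : 1 ≤ (8 / δ * r) * ‖z‖ := by
      rw [div_le_iff₀ (by positivity)] at h3
      rw [div_mul_eq_mul_div, div_mul_eq_mul_div, le_div_iff₀ hδ]; linarith
    have h5 : 1 ≤ ((8 / δ * r) * ‖z‖) ^ s := Real.one_le_rpow h4 hs0.le
    rw [Real.mul_rpow (by positivity) (norm_nonneg _), Real.mul_rpow (by positivity) hr.le] at h5
    have : 0 ≤ (8 / δ) ^ s * r ^ s := by positivity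
    nlinarith
  have hz8 : ∀ z : E, δ / (4 * r) ≤ ‖z‖ → δ / (8 * r) ≤ ‖z‖ := fun z h => by
    refine le_trans ?_ h
    gcongr
    norm_num
  have hyn : ‖r⁻¹ • y‖ = ‖y‖ / r := by
    rw [norm_smul, norm_inv, Real.norm_of_nonneg hr.le]; field_simp
  -- If `‖y‖ ≤ r`, the step `r⁻¹ y` is at most `1` and the difference bound of `φ` gives `‖y‖ r^s
  -- ‖y‖/r ≤ ‖y‖^(1+s)`. If `‖y‖ ≥ r`, the two values of `φ` are estimated separately, and `‖y‖ r^s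
  -- ≤ ‖y‖^(1+s)`.
  rcases le_total ‖y‖ r with hyr | hyr
  · have h3 := h2 (r⁻¹ • y) (by rw [hyn, div_le_one hr]; exact hyr)
    calc _ ≤ ∫⁻ z, ENNReal.ofReal (A * ‖y‖ * ((8 / δ) ^ s * r ^ s)) *
          ENNReal.ofReal ((1 + ‖z‖ ^ s) * |φ (z + r⁻¹ • y) - φ z|) := by
          refine lintegral_mono fun z => ?_
          rw [← ENNReal.ofReal_mul (by positivity)]
          refine ENNReal.ofReal_le_ofReal ?_
          by_cases h0 : |χ (r • z) - χ (r • z + y)| = 0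
          · rw [h0, zero_mul]; positivity
          · have h4 := hwt z (hz8 z (hz z h0))
            rw [abs_sub_comm (φ z)]
            calc _ ≤ A * ‖y‖ * |φ (z + r⁻¹ • y) - φ z| := by gcongr; exact hχA _ _
              _ ≤ A * ‖y‖ * (((8 / δ) ^ s * r ^ s * (1 + ‖z‖ ^ s)) * |φ (z + r⁻¹ • y) - φ z|) := by
                gcongr; exact le_mul_of_one_le_left (abs_nonneg _) h4
              _ = _ := by ring
      _ = ENNReal.ofReal (A * ‖y‖ * ((8 / δ) ^ s * r ^ s)) *
          ∫⁻ z, ENNReal.ofReal ((1 + ‖z‖ ^ s) * |φ (z + r⁻¹ • y) - φ z|) :=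
          lintegral_const_mul' _ _ ENNReal.ofReal_ne_top
      _ ≤ ENNReal.ofReal (A * ‖y‖ * ((8 / δ) ^ s * r ^ s)) * ENNReal.ofReal (B * ‖r⁻¹ • y‖) := by gcongr
      _ ≤ _ := by
          rw [← ENNReal.ofReal_mul (by positivity), hyn]
          refine ENNReal.ofReal_le_ofReal ?_
          have h5 := rpow_mul_le_rpow_one_add hs1 hr (norm_nonneg y) hyr
          calc A * ‖y‖ * ((8 / δ) ^ s * r ^ s) * (B * (‖y‖ / r)) =
              1 * A * (8 / δ) ^ s * B * (r ^ s * (‖y‖ * (‖y‖ / r))) := by ring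
            _ ≤ 2 * A * (8 / δ) ^ s * B * ‖y‖ ^ (1 + s) := by
              gcongr
              norm_num
  · have hy0 : 0 < ‖y‖ := hr.trans_le hyr
    refine le_trans ?_ ((hsum (A * ‖y‖ * ((8 / δ) ^ s * r ^ s)) (by positivity)).trans
      (ENNReal.ofReal_le_ofReal ?_))
    · refine lintegral_mono fun z => ENNReal.ofReal_le_ofReal ?_
      by_cases h0 : |χ (r • z) - χ (r • z + y)| = 0
      · rw [h0, zero_mul]; positivity
      · have h4 := hwt z (hz8 z (hz z h0))
        have h5 : 1 ≤ (8 / δ) ^ s * r ^ s * (1 + ‖z + r⁻¹ • y‖ ^ s) := by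
          refine hwt _ ?_
          have h6 := hz z h0
          have h7 : ‖z‖ ≤ ‖z + r⁻¹ • y‖ + ‖y‖ / r := by
            rw [← hyn]; simpa using norm_sub_le (z + r⁻¹ • y) (r⁻¹ • y)
          have h8 : ‖y‖ / r ≤ δ / (8 * r) := by
            rw [← div_div]; gcongr
          have h9 : δ / (4 * r) = δ / (8 * r) + δ / (8 * r) := by field_simp; norm_num
          linarith
        calc _ ≤ A * ‖y‖ * (|φ z| + |φ (z + r⁻¹ • y)|) := by
              gcongr
              · exact hχA _ _
              · exact htri z
          _ ≤ A * ‖y‖ * (((8 / δ) ^ s * r ^ s * (1 + ‖z‖ ^ s)) * |φ z| +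
              ((8 / δ) ^ s * r ^ s * (1 + ‖z + r⁻¹ • y‖ ^ s)) * |φ (z + r⁻¹ • y)|) := by
              gcongr
              · exact le_mul_of_one_le_left (abs_nonneg _) h4
              · exact le_mul_of_one_le_left (abs_nonneg _) h5
          _ = _ := by ring
    · rw [Real.rpow_add hy0, Real.rpow_one]
      calc A * ‖y‖ * ((8 / δ) ^ s * r ^ s) * (2 * B) = 2 * A * (8 / δ) ^ s * B * (‖y‖ * r ^ s) := by ring
        _ ≤ _ := by gcongr

/-- The commutator between a cutoff and a rescaled function. -/
lemma lintegral_commutator_le {χ φ : E → ℝ} {δ A B r : ℝ} (hs0 : 0 < s) (hs1 : s < 1) (hΛ : 0 ≤ Λ)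
    (hK : StableKer s c Λ K b) (hδ : 0 < δ)
    (hδ1 : δ ≤ 1) (hA : 0 ≤ A) (hχ0 : ∀ z, 0 ≤ χ z) (hχ1 : ∀ z, χ z ≤ 1) (hχc : Continuous χ)
    (hχ : ∀ z, ‖z‖ < δ / 2 → χ z = 1) (hχA : ∀ x y, |χ x - χ (x + y)| ≤ A * ‖y‖)
    (hφ : Continuous φ) (hB : 0 ≤ B)
    (h1 : ∫⁻ z, ENNReal.ofReal ((1 + ‖z‖ ^ s) * |φ z|) ≤ ENNReal.ofReal B)
    (h2 : ∀ y, ‖y‖ ≤ 1 →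
      ∫⁻ z, ENNReal.ofReal ((1 + ‖z‖ ^ s) * |φ (z + y) - φ z|) ≤ ENNReal.ofReal (B * ‖y‖))
    (hr : 0 < r) (hr1 : r ≤ 1) :
    ∫⁻ z, ENNReal.ofReal |∫ y, (χ (r • z) - χ (r • z + y)) * (φ z - φ (z + r⁻¹ • y)) * K y| ≤
      ENNReal.ofReal ((2 * A * (8 / δ) ^ s * (Λ * ((δ / 8) ^ (1 + s - 2 * s) / (1 + s - 2 * s))) +
        2 * (Λ * ((δ / 8) ^ (0 - 2 * s) / (2 * s - 0)))) * B) := by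
  set f : E → E → ℝ := fun z y => |χ (r • z) - χ (r • z + y)| * |φ z - φ (z + r⁻¹ • y)| with hf
  have hf0 : ∀ z y, 0 ≤ f z y := fun z y => by positivity
  have hfm : Measurable fun p : E × E => ENNReal.ofReal (f p.1 p.2) := by
    refine Measurable.ennreal_ofReal (Continuous.measurable ?_)
    simp only [hf]
    fun_prop
  have key := lintegral_cutoff_diff_le hs0 hs1 hδ hδ1 hA hχ0 hχ1 hχ hχA hφ hB h1 h2 hr hr1
  have hKm : AEMeasurable (fun y => ENNReal.ofReal (K y)) volume := hK.meas.ennreal_ofReal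
  have hδ8 : 0 < δ / 8 := by positivity
  have hs2 : 0 < 1 + s - 2 * s := by linarith
  have hs3 : 0 < 2 * s - 0 := by linarith
  calc ∫⁻ z, ENNReal.ofReal |∫ y, (χ (r • z) - χ (r • z + y)) * (φ z - φ (z + r⁻¹ • y)) * K y|
      ≤ ∫⁻ z, ∫⁻ y, ENNReal.ofReal (f z y) * ENNReal.ofReal (K y) := by
        refine lintegral_mono fun z => ?_
        rw [← Real.norm_eq_abs, ofReal_norm]
        refine (enorm_integral_le_lintegral_enorm _).trans (lintegral_mono fun y => ?_)
        rw [← ofReal_norm, ← ENNReal.ofReal_mul (hf0 z y), norm_mul, norm_mul,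
          Real.norm_of_nonneg (hK.nonneg y)]
        exact le_rfl
    _ = ∫⁻ y, (∫⁻ z, ENNReal.ofReal (f z y)) * ENNReal.ofReal (K y) := by
        rw [lintegral_lintegral_swap (hfm.aemeasurable.mul hKm.comp_snd)]
        refine lintegral_congr fun y => ?_
        have hfy : Measurable fun z => ENNReal.ofReal (f z y) := by
          refine Measurable.ennreal_ofReal (Continuous.measurable ?_)
          simp only [hf]
          fun_prop
        exact lintegral_mul_const _ hfy
    -- In the ball the bound `‖y‖^(1+s)` is integrable against `K` because `1 + s > 2s`; outside,
    -- the uniform bound meets the finite mass of the kernel.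
    _ = (∫⁻ y in Metric.ball 0 (δ / 8), (∫⁻ z, ENNReal.ofReal (f z y)) * ENNReal.ofReal (K y)) +
        ∫⁻ y in (Metric.ball 0 (δ / 8))ᶜ, (∫⁻ z, ENNReal.ofReal (f z y)) * ENNReal.ofReal (K y) :=
        (lintegral_add_compl _ Metric.isOpen_ball.measurableSet).symm
    _ ≤ ENNReal.ofReal (2 * A * (8 / δ) ^ s * B) *
          ENNReal.ofReal (Λ * ((δ / 8) ^ (1 + s - 2 * s) / (1 + s - 2 * s))) +
        ENNReal.ofReal (2 * B) * ENNReal.ofReal (Λ * ((δ / 8) ^ (0 - 2 * s) / (2 * s - 0))) := by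
        gcongr
        · refine le_trans ?_ (mul_le_mul_right (hK.near (1 + s) (δ / 8) (by linarith) hδ8) _)
          rw [← lintegral_const_mul' _ _ ENNReal.ofReal_ne_top]
          refine setLIntegral_mono_ae' Metric.isOpen_ball.measurableSet
            (Eventually.of_forall fun y hy => ?_)
          have hG : 0 ≤ 2 * A * (8 / δ) ^ s * B := by positivity
          have hy' : 0 ≤ ‖y‖ ^ (1 + s) := by positivity
          have e : ENNReal.ofReal (2 * A * (8 / δ) ^ s * B) * ENNReal.ofReal (‖y‖ ^ (1 + s) * K y) =
              ENNReal.ofReal (2 * A * (8 / δ) ^ s * B * ‖y‖ ^ (1 + s)) * ENNReal.ofReal (K y) := by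
            rw [ENNReal.ofReal_mul hy', ENNReal.ofReal_mul hG]; ring
          rw [e]
          exact mul_le_mul_left ((key y).2 (mem_ball_zero_iff.1 hy)) _
        · refine le_trans ?_ (mul_le_mul_right (hK.far 0 (δ / 8) (by linarith) hδ8) _)
          rw [← lintegral_const_mul' _ _ ENNReal.ofReal_ne_top]
          refine lintegral_mono fun y => ?_
          rw [Real.rpow_zero, one_mul]
          exact mul_le_mul_left (key y).1 _
    _ = _ := by
        rw [← ENNReal.ofReal_mul (by positivity), ← ENNReal.ofReal_mul (by positivity),
          ← ENNReal.ofReal_add (by positivity) (by positivity)]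
        congr 1
        ring

/-- The weak form of an equation, tested against the operator with kernel `K` and drift `b`. -/
def WeakEq (s : ℝ) (K : E → ℝ) (b : E) (Ω : Set E) (U F : E → ℝ) : Prop :=
  ∀ η : E → ℝ, ContDiff ℝ ∞ η → HasCompactSupport η → tsupport η ⊆ Ω →
    ∫ x, U x * levyOp s K b η x = ∫ x, F x * η x

lemma WeakEq.translate {Ω Ω' : Set E} {U F : E → ℝ} (h : WeakEq s K b Ω U F) (a : E)
    (hΩ : ∀ x ∈ Ω', a + x ∈ Ω) : WeakEq s K b Ω' (fun x => U (a + x)) (fun x => F (a + x)) := by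
  intro η hη hc hs
  have h1 := h (fun z => η (z + -a)) (hη.comp (contDiff_id.add contDiff_const))
    (hc.comp_homeomorph (Homeomorph.addRight (-a))) (by
      intro x hx
      have h2 : x + -a ∈ tsupport η := by
        have h3 := tsupport_comp_subset_preimage η (Homeomorph.addRight (-a)).continuous hx
        exact h3
      have := hΩ _ (hs h2)
      simpa using this)
  rw [← integral_add_left_eq_self _ a, ← integral_add_left_eq_self (fun x => F x * _) a] at h1
  simpa [levyOp_comp_add_right] using h1

lemma ofReal_abs_integral_le {f : E → ℝ} : ENNReal.ofReal |∫ x, f x| ≤ ∫⁻ x, ENNReal.ofReal |f x| := by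
  rw [← Real.norm_eq_abs, ofReal_norm]
  refine (enorm_integral_le_lintegral_enorm _).trans (le_of_eq ?_)
  simp only [← ofReal_norm, Real.norm_eq_abs]

lemma LevyPair.lintegral_abs_le {φ ψ : E → ℝ} {B : ℝ} (h : LevyPair s K b φ ψ B) :
    ∫⁻ z, ENNReal.ofReal |φ z| ≤ ENNReal.ofReal B := by
  refine (lintegral_mono fun z => ENNReal.ofReal_le_ofReal ?_).trans h.int
  have : 0 ≤ ‖z‖ ^ s := by positivity
  exact le_mul_of_one_le_left (abs_nonneg _) (by linarith)

lemma LevyPair.integrable_rhs {φ ψ : E → ℝ} {B : ℝ} (h : LevyPair s K b φ ψ B) : Integrable ψ := by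
  refine ⟨h.cont.aestronglyMeasurable, lt_of_le_of_lt ?_ (h.rhs.trans_lt ENNReal.ofReal_lt_top)⟩
  refine lintegral_mono fun z => ?_
  rw [← ofReal_norm, Real.norm_eq_abs]
  refine ENNReal.ofReal_le_ofReal (le_mul_of_one_le_left (abs_nonneg _) ?_)
  have := norm_nonneg z
  nlinarith

lemma BddC2.exists_comp_smul {M : ℝ} {w : E → ℝ} (h : BddC2 M w) {t : ℝ} (ht : 0 ≤ t) :
    ∃ M', BddC2 M' fun z => w (t • z) := by
  have hM := h.nonneg
  have e1 : ∀ x, fderiv ℝ (fun z => w (t • z)) x = t • fderiv ℝ w (t • x) := fun x => by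
    rw [fderiv_comp_smul]
  have h1 : ∀ z x, ‖fderiv ℝ w z - fderiv ℝ w x‖ ≤ M * ‖z - x‖ := fun z x =>
    Convex.norm_image_sub_le_of_norm_fderiv_le (𝕜 := ℝ) (f := fderiv ℝ w) (s := univ)
      (fun x _ => h.differentiable1 x) (fun x _ => h.bdd2 x) convex_univ (mem_univ x) (mem_univ z)
  have h2 : LipschitzWith (M * t ^ 2).toNNReal (fderiv ℝ fun z => w (t • z)) := by
    refine LipschitzWith.of_dist_le_mul fun x y => ?_
    rw [Real.coe_toNNReal _ (by positivity), dist_eq_norm, dist_eq_norm, e1, e1, ← smul_sub, norm_smul,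
      Real.norm_of_nonneg ht]
    have h3 := h1 (t • x) (t • y)
    rw [← smul_sub, norm_smul, Real.norm_of_nonneg ht] at h3
    calc _ ≤ t * (M * (t * ‖x - y‖)) := by gcongr
      _ = _ := by ring
  refine ⟨max M (max (M * t) (M * t ^ 2)), h.contDiff.comp (contDiff_const_smul _), fun x => ?_,
    fun x => ?_, fun x => ?_⟩
  · exact (h.bdd _).trans (le_max_left _ _)
  · rw [e1, norm_smul, Real.norm_of_nonneg ht, mul_comm]
    exact (mul_le_mul_of_nonneg_right (h.bdd1 _) ht).trans ((le_max_left _ _).trans (le_max_right _ _))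
  · have h3 := norm_fderiv_le_of_lipschitz (x₀ := x) ℝ h2
    rw [Real.coe_toNNReal _ (by positivity)] at h3
    exact h3.trans ((le_max_right _ _).trans (le_max_right _ _))

/-- The basic estimate for weak solutions at the scale `r`. -/
lemma exists_weakEq_bound (hs0 : 0 < s) (hs1 : s < 1) (hΛ : 0 ≤ Λ) {δ : ℝ} (hδ : 0 < δ) (hδ1 : δ ≤ 1) :
    ∃ C : ℝ, 0 ≤ C ∧ ∀ (c : ℝ) (K : E → ℝ) (b : E), StableKer s c Λ K b →
      ∀ (φ ψ : E → ℝ) (B : ℝ), 0 ≤ B → LevyPair s K b φ ψ B →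
      ∀ (U F : E → ℝ) (MU MF : ℝ), Measurable U → Measurable F → (∀ x, |U x| ≤ MU) → (∀ x, |F x| ≤ MF) →
      WeakEq s K b (Metric.ball 0 δ) U F → ∀ r : ℝ, 0 < r → r ≤ 1 →
      |∫ z, U (r • z) * ψ z| ≤ C * r ^ (2 * s) * B * (MU + MF) := by
  obtain ⟨CL, hCL, hL⟩ := exists_levyOp_bound (E := E) hs0 hs1 hΛ
  let χ : ContDiffBump (0 : E) := ⟨δ / 2, 3 * δ / 4, by positivity, by linarith⟩
  obtain ⟨A, hχB⟩ := exists_bddC2_of_hasCompactSupport (η := χ) (χ.contDiff (n := 2)) χ.hasCompactSupport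
  have hA : 0 ≤ A := hχB.nonneg
  have hχc : Continuous χ := χ.continuous
  have hχin : ∀ z, ‖z‖ < δ / 2 → χ z = 1 := fun z hz =>
    χ.one_of_mem_closedBall (by simpa using hz.le)
  have hχts : tsupport χ ⊆ Metric.ball 0 δ := by
    rw [χ.tsupport_eq]
    exact Metric.closedBall_subset_ball (by show 3 * δ / 4 < δ; linarith)
  set CM := (2 * A * (8 / δ) ^ s * (Λ * ((δ / 8) ^ (1 + s - 2 * s) / (1 + s - 2 * s))) +
        2 * (Λ * ((δ / 8) ^ (0 - 2 * s) / (2 * s - 0)))) with hCM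
  have hCM0 : 0 ≤ CM := by
    have : 0 < 1 + s - 2 * s := by linarith
    have : 0 < 2 * s - 0 := by linarith
    positivity
  refine ⟨1 + CL * A + CM + (2 / δ) ^ 2, by positivity, ?_⟩
  intro c K b hK φ ψ B hB hφ U F MU MF hU hF hUM hFM hw r hr hr1
  have hMU : 0 ≤ MU := (abs_nonneg _).trans (hUM 0)
  have hMF : 0 ≤ MF := (abs_nonneg _).trans (hFM 0)
  obtain ⟨Mφ, hφB⟩ := hφ.bdd
  have hφc : Continuous φ := hφ.smooth.continuous
  set w : E → ℝ := fun z => φ (r⁻¹ • z) with hwdef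
  have hwB : ∃ M, BddC2 M w := hφB.exists_comp_smul (by positivity)
  obtain ⟨Mw, hwB⟩ := hwB
  -- The rescaled parametrix is not compactly supported, so it is cut off at the fixed scale `δ`,
  -- not at scale `r`.
  set η : E → ℝ := fun z => χ z * w z with hη
  have hηs : ContDiff ℝ ∞ η := χ.contDiff.mul (hφ.smooth.comp (contDiff_const_smul _))
  have hηc : HasCompactSupport η := χ.hasCompactSupport.mul_right
  have hηt : tsupport η ⊆ Metric.ball 0 δ := (tsupport_mul_subset_left).trans hχts
  have hweak := hw η hηs hηc hηt
  -- rescale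
  have hweak' : ∫ z, U (r • z) * levyOp s K b η (r • z) = ∫ z, F (r • z) * η (r • z) := by
    have h1 := Measure.integral_comp_smul volume (fun z => U z * levyOp s K b η z) r
    have h2 := Measure.integral_comp_smul volume (fun z => F z * η z) r
    rw [h1, h2, hweak]
  set Bt : E → ℝ := fun z => ∫ y, (χ (r • z) - χ (r • z + y)) * (φ z - φ (z + r⁻¹ • y)) * K y with hBt
  have hrr : ∀ z : E, r⁻¹ • r • z = z := fun z => inv_smul_smul₀ hr.ne' z
  have hηr : ∀ z, η (r • z) = χ (r • z) * φ z := fun z => by simp only [hη, hwdef, hrr]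
  have hLη : ∀ z, levyOp s K b η (r • z) = χ (r • z) * (r ^ (-(2 * s)) * ψ z) +
      φ z * levyOp s K b χ (r • z) - Bt z := by
    intro z
    rw [hη, (levyOp_mul hs0 hs1 hΛ hK hχB hwB (r • z)).2, levyOp_scale hs0 hs1 hΛ hK hφB hr hr1,
      hrr, hφ.eq]
    simp only [hwdef, hrr, hBt, smul_add]
  have hρ : 0 < r ^ (2 * s) := Real.rpow_pos_of_pos hr _
  have hρn : r ^ (2 * s) * r ^ (-(2 * s)) = 1 := by
    rw [← Real.rpow_add hr]; simp
  have hUr : Measurable fun z : E => U (r • z) := hU.comp (measurable_const_smul r)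
  have i1 : Integrable fun z => U (r • z) * ψ z :=
    Integrable.bdd_mul (c := MU) hφ.integrable_rhs hUr.aestronglyMeasurable
      (Eventually.of_forall fun z => hUM _)
  have i2 : Integrable fun z => U (r • z) * levyOp s K b η (r • z) :=
    Integrable.bdd_mul (c := MU)
      ((levyOp_integrable hs0 hs1 hΛ hK (hηs.of_le (WithTop.coe_le_coe.2 le_top)) hηc).comp_smul hr.ne')
      hUr.aestronglyMeasurable (Eventually.of_forall fun z => hUM _)
  have e1 : ∫ z, U (r • z) * ψ z = r ^ (2 * s) * (∫ z, F (r • z) * η (r • z)) +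
      ∫ z, (U (r • z) * ψ z - r ^ (2 * s) * (U (r • z) * levyOp s K b η (r • z))) := by
    rw [integral_sub i1 (i2.const_mul _), integral_const_mul, hweak']; ring
  have hφ1 := hφ.lintegral_abs_le
  have b1 : |∫ z, F (r • z) * η (r • z)| ≤ MF * B := by
    refine (ENNReal.ofReal_le_ofReal_iff (by positivity)).1 (ofReal_abs_integral_le.trans ?_)
    calc _ ≤ ∫⁻ z, ENNReal.ofReal MF * ENNReal.ofReal |φ z| := by
          refine lintegral_mono fun z => ?_
          rw [← ENNReal.ofReal_mul hMF]
          refine ENNReal.ofReal_le_ofReal ?_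
          rw [hηr, abs_mul, abs_mul, abs_of_nonneg χ.nonneg]
          have := hFM (r • z)
          exact mul_le_mul this (mul_le_of_le_one_left (abs_nonneg _) χ.le_one) (by have := χ.nonneg (x := r • z); positivity) hMF
      _ = ENNReal.ofReal MF * ∫⁻ z, ENNReal.ofReal |φ z| := lintegral_const_mul' _ _ ENNReal.ofReal_ne_top
      _ ≤ ENNReal.ofReal MF * ENNReal.ofReal B := by gcongr
      _ = _ := (ENNReal.ofReal_mul hMF).symm
  have hcomm := lintegral_commutator_le (χ := χ) hs0 hs1 hΛ hK hδ hδ1 hA (fun z => χ.nonneg) (fun z => χ.le_one)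
    hχc hχin hχB.abs_sub_le hφc hB hφ.int hφ.diff hr hr1
  rw [← hCM] at hcomm
  have hψw := hφ.rhs
  have hpt : ∀ z, |U (r • z) * ψ z - r ^ (2 * s) * (U (r • z) * levyOp s K b η (r • z))| ≤
      r ^ (2 * s) * MU * (CL * A) * |φ z| + (r ^ (2 * s) * MU * |Bt z| +
        r ^ (2 * s) * MU * (2 / δ) ^ 2 * ((1 + ‖z‖) ^ 2 * |ψ z|)) := by
    intro z
    -- By the product rule the error consists of three terms: `ψ` where `χ ≠ 1`, `φ` times the
    -- operator applied to the cutoff, and the commutator. The factor `r^(2s)` is already visible in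
    -- the last two.
    have e2 : U (r • z) * ψ z - r ^ (2 * s) * (U (r • z) * levyOp s K b η (r • z)) =
        (1 - χ (r • z)) * U (r • z) * ψ z + (-(r ^ (2 * s) * U (r • z) * φ z * levyOp s K b χ (r • z)) +
          r ^ (2 * s) * U (r • z) * Bt z) := by
      rw [hLη]
      linear_combination (-(U (r • z) * χ (r • z) * ψ z)) * hρn
    have hu := hUM (r • z)
    have h3 : |(1 - χ (r • z)) * U (r • z) * ψ z| ≤
        r ^ (2 * s) * MU * (2 / δ) ^ 2 * ((1 + ‖z‖) ^ 2 * |ψ z|) := by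
      by_cases hz : ‖r • z‖ < δ / 2
      · rw [hχin _ hz, sub_self, zero_mul, zero_mul, abs_zero]; positivity
      · rw [norm_smul, Real.norm_of_nonneg hr.le] at hz
        push Not at hz
        have h4 : |1 - χ (r • z)| ≤ 1 := by
          rw [abs_le]; constructor <;> linarith [χ.nonneg (x := r • z), χ.le_one (x := r • z)]
        -- Where `χ ≠ 1` one has `‖z‖ ≥ δ / (2r)`, so the quadratic weight on `ψ` gains `r²`, and
        -- `r² ≤ r^(2s)`.
        have h5 : 1 ≤ r ^ (2 * s) * ((2 / δ) ^ 2 * (1 + ‖z‖) ^ 2) := by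
          have h6 : 1 ≤ 2 / δ * (r * ‖z‖) := by
            rw [div_mul_eq_mul_div, le_div_iff₀ hδ]; linarith
          have h7 : r ^ 2 ≤ r ^ (2 * s) := by
            rw [← Real.rpow_natCast]
            exact Real.rpow_le_rpow_of_exponent_ge hr hr1 (by push_cast; linarith)
          have hn := norm_nonneg z
          calc 1 ≤ (2 / δ * (r * ‖z‖)) ^ 2 := one_le_pow₀ h6
            _ = r ^ 2 * ((2 / δ) ^ 2 * ‖z‖ ^ 2) := by ring
            _ ≤ _ := by gcongr; linarith
        rw [abs_mul, abs_mul]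
        calc _ ≤ 1 * MU * |ψ z| := by gcongr
          _ ≤ (r ^ (2 * s) * ((2 / δ) ^ 2 * (1 + ‖z‖) ^ 2)) * MU * |ψ z| := by gcongr
          _ = _ := by ring
    have h8 : |-(r ^ (2 * s) * U (r • z) * φ z * levyOp s K b χ (r • z))| ≤
        r ^ (2 * s) * MU * (CL * A) * |φ z| := by
      rw [abs_neg, abs_mul, abs_mul, abs_mul, abs_of_pos hρ]
      have := hL c K b hK A χ hχB (r • z)
      calc _ ≤ r ^ (2 * s) * MU * |φ z| * (CL * A) := by gcongr
        _ = _ := by ring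
    have h9 : |r ^ (2 * s) * U (r • z) * Bt z| ≤ r ^ (2 * s) * MU * |Bt z| := by
      rw [abs_mul, abs_mul, abs_of_pos hρ]; gcongr
    rw [e2]
    refine (abs_add_le _ _).trans ?_
    have := abs_add_le (-(r ^ (2 * s) * U (r • z) * φ z * levyOp s K b χ (r • z))) (r ^ (2 * s) * U (r • z) * Bt z)
    linarith
  have b2 : |∫ z, (U (r • z) * ψ z - r ^ (2 * s) * (U (r • z) * levyOp s K b η (r • z)))| ≤
      r ^ (2 * s) * MU * (CL * A) * B + (r ^ (2 * s) * MU * (CM * B) +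
        r ^ (2 * s) * MU * (2 / δ) ^ 2 * B) := by
    refine (ENNReal.ofReal_le_ofReal_iff (by positivity)).1 (ofReal_abs_integral_le.trans ?_)
    have m1 : Measurable fun z => ENNReal.ofReal (r ^ (2 * s) * MU * (CL * A)) * ENNReal.ofReal |φ z| := by
      fun_prop
    have m3 : Measurable fun z : E => ENNReal.ofReal (r ^ (2 * s) * MU * (2 / δ) ^ 2) *
        ENNReal.ofReal ((1 + ‖z‖) ^ 2 * |ψ z|) := by
      have := hφ.cont
      fun_prop
    calc _ ≤ ∫⁻ z, (ENNReal.ofReal (r ^ (2 * s) * MU * (CL * A)) * ENNReal.ofReal |φ z| +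
          (ENNReal.ofReal (r ^ (2 * s) * MU) * ENNReal.ofReal |Bt z| +
            ENNReal.ofReal (r ^ (2 * s) * MU * (2 / δ) ^ 2) * ENNReal.ofReal ((1 + ‖z‖) ^ 2 * |ψ z|))) := by
          refine lintegral_mono fun z => ?_
          rw [← ENNReal.ofReal_mul (by positivity), ← ENNReal.ofReal_mul (by positivity),
            ← ENNReal.ofReal_mul (by positivity), ← ENNReal.ofReal_add (by positivity) (by positivity),
            ← ENNReal.ofReal_add (by positivity) (by positivity)]
          exact ENNReal.ofReal_le_ofReal (hpt z)
      _ = ENNReal.ofReal (r ^ (2 * s) * MU * (CL * A)) * (∫⁻ z, ENNReal.ofReal |φ z|) +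
          (ENNReal.ofReal (r ^ (2 * s) * MU) * (∫⁻ z, ENNReal.ofReal |Bt z|) +
            ENNReal.ofReal (r ^ (2 * s) * MU * (2 / δ) ^ 2) * ∫⁻ z, ENNReal.ofReal ((1 + ‖z‖) ^ 2 * |ψ z|)) := by
          rw [lintegral_add_left m1, lintegral_add_right _ m3, lintegral_const_mul' _ _ ENNReal.ofReal_ne_top,
            lintegral_const_mul' _ _ ENNReal.ofReal_ne_top, lintegral_const_mul' _ _ ENNReal.ofReal_ne_top]
      _ ≤ ENNReal.ofReal (r ^ (2 * s) * MU * (CL * A)) * ENNReal.ofReal B +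
          (ENNReal.ofReal (r ^ (2 * s) * MU) * ENNReal.ofReal (CM * B) +
            ENNReal.ofReal (r ^ (2 * s) * MU * (2 / δ) ^ 2) * ENNReal.ofReal B) := by
          gcongr
      _ = _ := by
          rw [← ENNReal.ofReal_mul (by positivity), ← ENNReal.ofReal_mul (by positivity),
            ← ENNReal.ofReal_mul (by positivity), ← ENNReal.ofReal_add (by positivity) (by positivity),
            ← ENNReal.ofReal_add (by positivity) (by positivity)]
  rw [e1]
  refine (abs_add_le _ _).trans ?_
  rw [abs_mul, abs_of_pos hρ]
  have h10 : 0 ≤ CL * A + CM + (2 / δ) ^ 2 := by positivity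
  have h11 : 0 ≤ r ^ (2 * s) * B := by positivity
  calc _ ≤ r ^ (2 * s) * (MF * B) + (r ^ (2 * s) * MU * (CL * A) * B + (r ^ (2 * s) * MU * (CM * B) +
        r ^ (2 * s) * MU * (2 / δ) ^ 2 * B)) := by gcongr
    _ = (r ^ (2 * s) * B) * (MF + (CL * A + CM + (2 / δ) ^ 2) * MU) := by ring
    _ ≤ (r ^ (2 * s) * B) * ((1 + CL * A + CM + (2 / δ) ^ 2) * (MU + MF)) := by
        gcongr
        nlinarith [mul_nonneg h10 hMF]
    _ = _ := by ring

end Core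

/-! ### Summation over dyadic scales. -/

section Dyadic

/-- A sum over dyadic scales, of terms controlled by the smaller of two geometric sequences. -/
lemma exists_sum_min_rpow_le {p q : ℝ} (hp : 0 < p) (hq : 0 < q) : ∃ C : ℝ, 0 ≤ C ∧ ∀ t : ℝ, 0 < t → ∀ N : ℕ,
    ∑ l ∈ Finset.range N, min (((1 / 2 : ℝ) ^ l) ^ p) (((1 / 2 : ℝ) ^ l) ^ (-q) * t ^ (p + q)) ≤
      C * t ^ p := by
  have h2p : (1:ℝ) < 2 ^ p := Real.one_lt_rpow one_lt_two hp
  have h2q : (1:ℝ) < 2 ^ q := Real.one_lt_rpow one_lt_two hq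
  set a : ℝ := 1 / (2 ^ q - 1) with ha
  set d : ℝ := 1 / (1 - 2 ^ (-p)) with hd
  have h2p' : (2:ℝ) ^ (-p) < 1 := Real.rpow_lt_one_of_one_lt_of_neg one_lt_two (by linarith)
  have ha0 : 0 < a := one_div_pos.2 (by linarith)
  have hd0 : 0 < d := one_div_pos.2 (by linarith)
  have haq : a * 2 ^ q = a + 1 := by
    rw [ha]; field_simp [(by linarith : (2:ℝ) ^ q - 1 ≠ 0)]; ring
  have hdp : d * 2 ^ (-p) = d - 1 := by
    rw [hd]; field_simp [(by linarith : 1 - (2:ℝ) ^ (-p) ≠ 0)]; ring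
  refine ⟨a + 1 + d, by positivity, fun t ht N => ?_⟩
  -- A potential for telescoping: `Φ (2x) - Φ x ≥ min (x^(-p)) (x^q)`. The constants `a` and `d` are
  -- chosen so that `a 2^q = a + 1` and `d 2^(-p) = d - 1`; since `Φ` is bounded, the sum over `x =
  -- 2^l t` is bounded independently of `t` and `N`.
  set Φ : ℝ → ℝ := fun x => if x ≤ 1 then a * x ^ q else a + 1 + d - d * x ^ (-p) with hΦ
  have hstep : ∀ x : ℝ, 0 < x → Φ x + min (x ^ (-p)) (x ^ q) ≤ Φ (2 * x) := by
    intro x hx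
    have e1 : (2 * x) ^ q = 2 ^ q * x ^ q := Real.mul_rpow (by norm_num) hx.le
    have e2 : (2 * x) ^ (-p) = 2 ^ (-p) * x ^ (-p) := Real.mul_rpow (by norm_num) hx.le
    have hxp : 0 < x ^ (-p) := by positivity
    have hxq : 0 < x ^ q := by positivity
    by_cases h1 : x ≤ 1
    · by_cases h2 : 2 * x ≤ 1
      · simp only [hΦ, if_pos h1, if_pos h2, e1]
        have := min_le_right (x ^ (-p)) (x ^ q)
        nlinarith
      · simp only [hΦ, if_pos h1, if_neg h2]
        have h3 : (2 * x) ^ (-p) ≤ 1 := Real.rpow_le_one_of_one_le_of_nonpos (by linarith) (by linarith)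
        have h4 : x ^ q ≤ 1 := Real.rpow_le_one hx.le h1 hq.le
        have := min_le_right (x ^ (-p)) (x ^ q)
        nlinarith
    · simp only [hΦ, if_neg h1, if_neg (by linarith : ¬ 2 * x ≤ 1), e2]
      have := min_le_left (x ^ (-p)) (x ^ q)
      nlinarith
  have hmain : ∑ l ∈ Finset.range N, min ((2 ^ l * t) ^ (-p)) ((2 ^ l * t) ^ q) ≤ Φ (2 ^ N * t) := by
    induction N with
    | zero =>
      simp only [Finset.range_zero, Finset.sum_empty, pow_zero, one_mul, hΦ]
      split_ifs with h
      · positivity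
      · have : t ^ (-p) ≤ 1 := Real.rpow_le_one_of_one_le_of_nonpos (by linarith) (by linarith)
        nlinarith
    | succ N ih =>
      rw [Finset.sum_range_succ, pow_succ', mul_assoc]
      exact (add_le_add_left ih _).trans (hstep _ (by positivity))
  have hΦb : ∀ x : ℝ, 0 < x → Φ x ≤ a + 1 + d := fun x hx => by
    simp only [hΦ]
    split_ifs with h
    · have : x ^ q ≤ 1 := Real.rpow_le_one hx.le h hq.le
      nlinarith
    · have : 0 < x ^ (-p) := by positivity
      nlinarith
  calc _ = ∑ l ∈ Finset.range N, t ^ p * min ((2 ^ l * t) ^ (-p)) ((2 ^ l * t) ^ q) := by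
        refine Finset.sum_congr rfl fun l _ => ?_
        have h2 : (0:ℝ) < 2 ^ l := by positivity
        rw [mul_min_of_nonneg _ _ (by positivity)]
        congr 1
        · rw [one_div, inv_pow, Real.inv_rpow h2.le, Real.mul_rpow h2.le ht.le, Real.rpow_neg h2.le, Real.rpow_neg ht.le]
          have := Real.rpow_pos_of_pos ht p
          field_simp
        · rw [one_div, inv_pow, Real.inv_rpow h2.le, Real.rpow_neg h2.le, inv_inv, Real.mul_rpow h2.le ht.le,
            Real.rpow_add ht]
          ring
    _ ≤ t ^ p * (a + 1 + d) := by
        rw [← Finset.mul_sum]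
        have := hmain.trans (hΦb _ (by positivity))
        gcongr
    _ = _ := mul_comm _ _

end Dyadic

/-! ### Second differences of solutions, by a Littlewood–Paley decomposition. -/

section SecondDiff

open Module FourierTransform

variable {E : Type*} [NormedAddCommGroup E] [InnerProductSpace ℝ E] [FiniteDimensional ℝ E]
  [MeasurableSpace E] [BorelSpace E]

variable {s c Λ : ℝ} {K : E → ℝ} {b : E}

/-- The symmetric second difference of a function. -/
def secondDiff (U : E → ℝ) (h x : E) : ℝ := U (x + h) + U (x - h) - 2 * U x

lemma integrable_comp_smul_mul {U ψ : E → ℝ} {M : ℝ} (hU : Measurable U) (hM : ∀ x, |U x| ≤ M)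
    (hψ : Integrable ψ) (r : ℝ) (a : E) : Integrable fun z => U (r • z + a) * ψ z :=
  hψ.bdd_mul (c := M) (hU.comp (by fun_prop : Measurable fun z : E => r • z + a)).aestronglyMeasurable
    (Eventually.of_forall fun z => hM _)

lemma integral_comp_smul_add {U ψ : E → ℝ} {r : ℝ} (hr : r ≠ 0) (h : E) :
    ∫ z, U (r • z + h) * ψ z = ∫ z, U (r • z) * ψ (z - r⁻¹ • h) := by
  rw [← integral_add_right_eq_self (fun z => U (r • z) * ψ (z - r⁻¹ • h)) (r⁻¹ • h)]
  refine integral_congr_ae (Eventually.of_forall fun z => ?_)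
  simp only [smul_add, smul_inv_smul₀ hr, add_sub_cancel_right]

lemma integral_secondDiff_comp_smul {U ψ : E → ℝ} {M : ℝ} (hU : Measurable U) (hM : ∀ x, |U x| ≤ M)
    (hψ : Integrable ψ) (r : ℝ) (h : E) :
    ∫ z, secondDiff U h (r • z) * ψ z = (∫ z, U (r • z + h) * ψ z) + (∫ z, U (r • z + -h) * ψ z) -
      2 * ∫ z, U (r • z + 0) * ψ z := by
  have i := fun a => integrable_comp_smul_mul hU hM hψ r a
  rw [← integral_const_mul, ← integral_add (i h) (i (-h)), ← integral_sub (by exact (i h).add (i (-h))) ((i 0).const_mul 2)]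
  refine integral_congr_ae (Eventually.of_forall fun z => ?_)
  simp only [secondDiff, Pi.add_apply, add_zero, sub_eq_add_neg]
  ring

/-- The difference is moved from `U` onto the smooth function, where the step becomes `r⁻¹ h`: it is
small exactly at scales larger than `‖h‖`. -/
lemma integral_secondDiff_eq {U ψ : E → ℝ} {M : ℝ} (hU : Measurable U) (hM : ∀ x, |U x| ≤ M)
    (hψ : Integrable ψ) {r : ℝ} (hr : r ≠ 0) (h : E) :
    ∫ z, secondDiff U h (r • z) * ψ z =
      ∫ z, U (r • z) * secondDiff ψ (r⁻¹ • h) z := by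
  have i := fun a : E => integrable_comp_smul_mul hU hM (hψ.comp_sub_right a) r 0
  rw [integral_secondDiff_comp_smul hU hM hψ, integral_comp_smul_add hr, integral_comp_smul_add hr,
    integral_comp_smul_add hr, ← integral_const_mul, ← integral_add, ← integral_sub]
  · refine integral_congr_ae (Eventually.of_forall fun z => ?_)
    simp only [secondDiff, smul_neg, sub_neg_eq_add, smul_zero, sub_zero]
    ring
  · have := (i (r⁻¹ • h)).add (i (r⁻¹ • (-h)))
    simp only [add_zero] at this
    exact this
  · simpa using (i 0).const_mul 2
  · simpa using i (r⁻¹ • h)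
  · simpa using i (r⁻¹ • (-h))

/-- The second difference of a Fourier transform, as the transform of a modified amplitude. -/
lemma secondDiff_re_fourier {a : E → ℂ} (ha : Integrable a) (k z : E) :
    secondDiff (fun z => (𝓕 a z).re) k z =
      -(𝓕 (fun ξ => a ξ * (ech k ξ - 1) * (ech (-k) ξ - 1)) z).re := by
  have hi : ∀ x, Integrable fun ξ => ech ξ x * a ξ := fun x =>
    Integrable.bdd_mul (c := 1) ha (continuous_ech_left x).aestronglyMeasurable
        (Eventually.of_forall fun y => (norm_ech y x).le)
  simp only [secondDiff, fourier_eq_integral_ech]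
  have e : ∀ ξ, ech ξ z * (a ξ * (ech k ξ - 1) * (ech (-k) ξ - 1)) =
      2 * (ech ξ z * a ξ) - ech ξ (z + k) * a ξ - ech ξ (z - k) * a ξ := fun ξ => by
    have e1 : ech k ξ * ech (-k) ξ = 1 := by rw [← ech_add_left, add_neg_cancel, ech_comm, ech_zero_right]
    rw [ech_comm ξ (z + k), ech_comm ξ (z - k), sub_eq_add_neg z k, ech_add_left, ech_add_left, ech_comm ξ z]
    linear_combination (ech z ξ * a ξ) * e1
  simp only [e]
  rw [integral_sub (by exact ((hi z).const_mul 2).sub (hi _)) (hi _), integral_sub ((hi z).const_mul 2) (hi _),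
    integral_const_mul]
  simp only [Complex.sub_re, Complex.mul_re, Complex.re_ofNat, Complex.im_ofNat, zero_mul, sub_zero]
  ring

/-- A smooth cutoff on the Fourier side. -/
def lowAmp : E → ℂ := fun ξ => (((⟨1, 2, one_pos, one_lt_two⟩ : ContDiffBump (0 : E)) ξ : ℝ) : ℂ)

/-- A smooth function on the Fourier side, supported in a dyadic annulus. -/
def annAmp : E → ℂ := fun ξ => lowAmp ((1 / 2 : ℝ) • ξ) - lowAmp ξ

lemma lowAmp_contDiff : ContDiff ℝ ∞ (lowAmp : E → ℂ) :=
  Complex.ofRealCLM.contDiff.comp (ContDiffBump.contDiff _)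

lemma lowAmp_eq_one {ξ : E} (h : ‖ξ‖ ≤ 1) : lowAmp ξ = 1 := by
  rw [lowAmp, ContDiffBump.one_of_mem_closedBall _ (by simpa using h), Complex.ofReal_one]

lemma lowAmp_eq_zero {ξ : E} (h : 2 ≤ ‖ξ‖) : lowAmp ξ = 0 := by
  rw [lowAmp, ContDiffBump.zero_of_le_dist _ (by simpa using h), Complex.ofReal_zero]

lemma annAmp_contDiff : ContDiff ℝ ∞ (annAmp : E → ℂ) :=
  (lowAmp_contDiff.comp (contDiff_const.smul contDiff_id)).sub lowAmp_contDiff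

lemma exists_iteratedFDeriv_bound_of_hasCompactSupport {F : Type*} [NormedAddCommGroup F] [NormedSpace ℝ F]
    {a : E → F} (h : ContDiff ℝ ∞ a) (hc : HasCompactSupport a) (N : ℕ) :
    ∃ P : ℝ, 0 ≤ P ∧ ∀ i ≤ N, ∀ ξ, ‖iteratedFDeriv ℝ i a ξ‖ ≤ P := by
  have h1 : ∀ i : ℕ, ∃ C, ∀ ξ, ‖iteratedFDeriv ℝ i a ξ‖ ≤ C := fun i =>
    (hc.iteratedFDeriv i).exists_bound_of_continuous (h.continuous_iteratedFDeriv (by exact_mod_cast le_top))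
  choose C hC using h1
  have hC0 : ∀ i, 0 ≤ C i := fun i => (norm_nonneg _).trans (hC i 0)
  exact ⟨∑ i ∈ Finset.range (N + 1), C i, Finset.sum_nonneg fun i _ => hC0 i, fun i hi ξ => (hC i ξ).trans
    (Finset.single_le_sum (f := C) (fun i _ => hC0 i) (Finset.mem_range.2 (by omega)))⟩

lemma exists_annulusAmp_annAmp (N : ℕ) : ∃ P : ℝ, AnnulusAmp 1 N P (annAmp : E → ℂ) := by
  have hs : ∀ ξ : E, annAmp ξ ≠ 0 → 1 ≤ ‖ξ‖ ∧ ‖ξ‖ ≤ 4 := by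
    intro ξ hξ
    have hn : ‖(1 / 2 : ℝ) • ξ‖ = ‖ξ‖ / 2 := by rw [norm_smul]; norm_num; ring
    constructor
    · by_contra h
      push Not at h
      exact hξ (by rw [annAmp, lowAmp_eq_one h.le, lowAmp_eq_one (by rw [hn]; linarith), sub_self])
    · by_contra h
      push Not at h
      exact hξ (by rw [annAmp, lowAmp_eq_zero (ξ := ξ) (by linarith), lowAmp_eq_zero (by rw [hn]; linarith), sub_self])
  have hc : HasCompactSupport (annAmp : E → ℂ) :=
    HasCompactSupport.of_support_subset_isCompact (isCompact_closedBall 0 4) fun ξ hξ => by simpa using (hs ξ hξ).2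
  obtain ⟨P, -, hP⟩ := exists_iteratedFDeriv_bound_of_hasCompactSupport annAmp_contDiff hc N
  exact ⟨P, annAmp_contDiff, hs, hP⟩

lemma exists_annulusAmp_lowAmp (N : ℕ) : ∃ P : ℝ, AnnulusAmp 0 N P (lowAmp : E → ℂ) := by
  have hs : ∀ ξ : E, lowAmp ξ ≠ 0 → 0 ≤ ‖ξ‖ ∧ ‖ξ‖ ≤ 4 := fun ξ hξ => by
    refine ⟨norm_nonneg _, ?_⟩
    by_contra h
    push Not at h
    exact hξ (lowAmp_eq_zero (by linarith))
  have hc : HasCompactSupport (lowAmp : E → ℂ) :=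
    HasCompactSupport.of_support_subset_isCompact (isCompact_closedBall 0 4) fun ξ hξ => by simpa using (hs ξ hξ).2
  obtain ⟨P, -, hP⟩ := exists_iteratedFDeriv_bound_of_hasCompactSupport lowAmp_contDiff hc N
  exact ⟨P, lowAmp_contDiff, hs, hP⟩

lemma integrable_fourier_of_annulusAmp {κ P : ℝ} {a : E → ℂ} (h : AnnulusAmp κ (0 + finrank ℝ E + 1) P a) :
    Integrable (𝓕 a) := by
  obtain ⟨C, -, hC⟩ := exists_fourier_weight_bound (E := E) 0
  refine ⟨(continuous_fourier h.integrable).aestronglyMeasurable,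
    lt_of_le_of_lt ?_ ((hC κ P a h).trans_lt ENNReal.ofReal_lt_top)⟩
  refine lintegral_mono fun z => ?_
  rw [pow_zero, one_mul, ofReal_norm]

lemma lintegral_abs_re_fourier_le {κ P C : ℝ} {a : E → ℂ}
    (h : ∫⁻ z, ENNReal.ofReal ((1 + ‖z‖) ^ 0 * ‖𝓕 a z‖) ≤ ENNReal.ofReal (C * P)) :
    ∫⁻ z, ENNReal.ofReal |(𝓕 a z).re| ≤ ENNReal.ofReal (C * P) := by
  refine (lintegral_mono fun z => ENNReal.ofReal_le_ofReal ?_).trans h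
  rw [pow_zero, one_mul]
  exact Complex.abs_re_le_norm _

/-- Fourier inversion at the origin, where the amplitude equals `1`. Averages against this function
at scales tending to `0` therefore converge to the value at the point. -/
lemma integral_re_fourier_lowAmp : ∫ z : E, (𝓕 (lowAmp : E → ℂ) z).re = 1 := by
  obtain ⟨P, hP⟩ := exists_annulusAmp_lowAmp (E := E) (0 + finrank ℝ E + 1)
  have hi := integrable_fourier_of_annulusAmp hP
  have h := Continuous.fourierInv_fourier_eq (lowAmp_contDiff (E := E)).continuous hP.integrable hi
  have h0 := congrFun h 0
  rw [Real.fourierInv_eq', lowAmp_eq_one (by simp)] at h0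
  simp only [inner_zero_right, mul_zero, Complex.ofReal_zero, zero_mul, Complex.exp_zero, one_smul] at h0
  have := integral_re (𝕜 := ℂ) hi
  simp only [RCLike.re_eq_complex_re] at this
  rw [this, h0, Complex.one_re]

/-- Dilating the amplitude by `2` contracts its transform with the Jacobian `2 ^ d`, so the annular
block is the difference of the averages at two consecutive scales. -/
lemma re_fourier_annAmp (z : E) :
    (𝓕 (annAmp : E → ℂ) z).re = 2 ^ finrank ℝ E * (𝓕 (lowAmp : E → ℂ) ((2 : ℝ) • z)).re - (𝓕 (lowAmp : E → ℂ) z).re := by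
  obtain ⟨P, hP⟩ := exists_annulusAmp_lowAmp (E := E) 0
  have hi1 : Integrable fun ξ : E => lowAmp ((1 / 2 : ℝ) • ξ) :=
    hP.integrable.comp_smul (by norm_num)
  have hi : ∀ (x : E) (a : E → ℂ), Integrable a → Integrable fun ξ => ech ξ x * a ξ := fun x a ha =>
    Integrable.bdd_mul (c := 1) ha (continuous_ech_left x).aestronglyMeasurable
        (Eventually.of_forall fun y => (norm_ech y x).le)
  rw [fourier_eq_integral_ech, fourier_eq_integral_ech, fourier_eq_integral_ech]
  have e : ∀ ξ : E, ech ξ z * annAmp ξ = ech ξ z * lowAmp ((1 / 2 : ℝ) • ξ) - ech ξ z * lowAmp ξ := fun ξ => by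
    rw [annAmp, mul_sub]
  simp only [e]
  rw [integral_sub (hi z _ hi1) (hi z _ hP.integrable), Complex.sub_re]
  congr 1
  have h1 := Measure.integral_comp_smul (volume : Measure E) (fun ξ : E => ech ξ ((2:ℝ) • z) * lowAmp ξ) (1 / 2)
  have e2 : ∀ ξ : E, ech ((1 / 2 : ℝ) • ξ) ((2:ℝ) • z) = ech ξ z := fun ξ => by
    simp only [ech, inner_smul_left, inner_smul_right]
    congr 2
    simp
  simp only [e2] at h1
  rw [h1, Complex.smul_re, smul_eq_mul]
  congr 1
  rw [abs_of_pos (by positivity)]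
  simp

/-- Passing from a scale to the next one in an average. -/
lemma integral_comp_half_smul {W : E → ℝ} {M : ℝ} (hW : Measurable W) (hM : ∀ x, |W x| ≤ M) (r : ℝ) :
    (∫ z, W ((r / 2) • z) * (𝓕 (lowAmp : E → ℂ) z).re) = (∫ z, W (r • z) * (𝓕 (lowAmp : E → ℂ) z).re) +
      ∫ z, W (r • z) * (𝓕 (annAmp : E → ℂ) z).re := by
  obtain ⟨P, hP⟩ := exists_annulusAmp_lowAmp (E := E) (0 + finrank ℝ E + 1)
  have hi : Integrable fun z : E => (𝓕 (lowAmp : E → ℂ) z).re := (integrable_fourier_of_annulusAmp hP).re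
  have hi2 : Integrable fun z : E => (𝓕 (lowAmp : E → ℂ) ((2:ℝ) • z)).re := hi.comp_smul (R := (2:ℝ)) (by norm_num)
  have j1 := integrable_comp_smul_mul hW hM hi r 0
  have j2 := integrable_comp_smul_mul hW hM hi2 r 0
  simp only [add_zero] at j1 j2
  have e : ∀ z, W (r • z) * (𝓕 (annAmp : E → ℂ) z).re =
    2 ^ finrank ℝ E * (W (r • z) * (𝓕 (lowAmp : E → ℂ) ((2 : ℝ) • z)).re) - W (r • z) * (𝓕 (lowAmp : E → ℂ) z).re := fun z => by
      rw [re_fourier_annAmp]; ring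
  simp only [e]
  rw [integral_sub (j2.const_mul _) j1, integral_const_mul]
  have h1 := Measure.integral_comp_smul (volume : Measure E) (fun z : E => W ((r/2) • z) * (𝓕 (lowAmp : E → ℂ) z).re) 2
  have e2 : ∀ z : E, (r / 2) • (2:ℝ) • z = r • z := fun z => by rw [smul_smul]; congr 1; ring
  simp only [e2] at h1
  rw [h1, smul_eq_mul, abs_of_pos (by positivity)]
  have : (2:ℝ) ^ finrank ℝ E ≠ 0 := by positivity
  field_simp
  ring

lemma secondDiff_measurable {U : E → ℝ} (hU : Measurable U) (h : E) : Measurable (secondDiff U h) := by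
  unfold secondDiff
  have h1 : Measurable fun x => U (x + h) := hU.comp (measurable_id.add_const h)
  have h2 : Measurable fun x => U (x - h) := hU.comp (measurable_id.sub_const h)
  exact (h1.add h2).sub (hU.const_mul 2)

lemma abs_secondDiff_le {U : E → ℝ} {M : ℝ} (hM : ∀ x, |U x| ≤ M) (h x : E) : |secondDiff U h x| ≤ 4 * M := by
  unfold secondDiff
  have h1 := abs_le.1 (hM (x + h))
  have h2 := abs_le.1 (hM (x - h))
  have h3 := abs_le.1 (hM x)
  rw [abs_le]
  constructor <;> linarith

/-- The value at `0` of `V = secondDiff U h` is its average at scale `1` plus the blocks at the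
scales `r = 2^(-l)`. The basic estimate at the points `0, ±h` bounds a block by `r^(2s)`; when `‖h‖
≤ r`, putting the difference on the block function adds the factor `(‖h‖/r)²`. Since `0 < 2s < 2`,
the sum of the minima is of order `‖h‖^(2s)`. -/
lemma exists_secondDiff_le_aux (hs0 : 0 < s) (hs1 : s < 1) (hc : 0 < c) (hΛ : 0 < Λ) {δ : ℝ} (hδ : 0 < δ)
    (hδ1 : δ ≤ 1) :
    ∃ C : ℝ, 0 ≤ C ∧ ∀ (K : E → ℝ) (b : E), StableKer s c Λ K b →
      ∀ (U F : E → ℝ) (MU MF : ℝ), Measurable U → Measurable F → (∀ x, |U x| ≤ MU) → (∀ x, |F x| ≤ MF) →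
      WeakEq s K b (Metric.ball 0 δ) U F → ∀ h : E, h ≠ 0 → ‖h‖ ≤ δ / 2 →
      ContinuousAt U 0 → ContinuousAt U h → ContinuousAt U (-h) →
      |secondDiff U h 0| ≤ C * ‖h‖ ^ (2 * s) * (MU + MF) := by
  obtain ⟨C1, hC1, h1⟩ := exists_levyPair (E := E) hs0 hs1 hc hΛ
  obtain ⟨C2, hC2, h2⟩ := exists_weakEq_bound (E := E) hs0 hs1 hΛ.le (half_pos hδ) (by linarith : δ / 2 ≤ 1)
  obtain ⟨D, hD, hech⟩ := AnnulusAmp.mul_ech_sub_one (E := E) (2 + finrank ℝ E + 1)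
  obtain ⟨D', hD', hech'⟩ := AnnulusAmp.mul_ech_sub_one (E := E) (0 + finrank ℝ E + 1)
  obtain ⟨W, hW, hwt⟩ := exists_fourier_weight_bound (E := E) 0
  obtain ⟨P, hP⟩ := exists_annulusAmp_annAmp (E := E) (2 + finrank ℝ E + 1)
  obtain ⟨P', hP'⟩ := exists_annulusAmp_lowAmp (E := E) (0 + finrank ℝ E + 1)
  obtain ⟨C3, hC3, hsum⟩ := exists_sum_min_rpow_le (p := 2 * s) (q := 2 - 2 * s) (by linarith) (by linarith)
  have hP0 := hP.nonneg
  have hP0' := hP'.nonneg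
  set G : ℝ := C2 * (C1 * P) * (4 + D * D) with hG
  have hG0 : 0 ≤ G := by positivity
  refine ⟨W * (D' * (D' * P')) + G * C3, by positivity, fun K b hK U F MU MF hU hF hMU hMF hw h hh0 hh hc0 hch hch' => ?_⟩
  have hMU0 : 0 ≤ MU := (abs_nonneg _).trans (hMU 0)
  have hMF0 : 0 ≤ MF := (abs_nonneg _).trans (hMF 0)
  have hhp : 0 < ‖h‖ := norm_pos_iff.2 hh0
  have hh1 : ‖h‖ ≤ 1 := by linarith
  set V := secondDiff U h with hV
  have hVm : Measurable V := secondDiff_measurable hU h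
  have hVb : ∀ x, |V x| ≤ 4 * MU := abs_secondDiff_le hMU h
  set ψ : E → ℝ := fun z => (𝓕 (annAmp : E → ℂ) z).re with hψ
  set ρ : E → ℝ := fun z => (𝓕 (lowAmp : E → ℂ) z).re with hρ
  have hρi : Integrable ρ := (integrable_fourier_of_annulusAmp hP').re
  have hL := h1 K b hK P annAmp hP
  have hψi : Integrable ψ := hL.integrable_rhs
  have hweak : ∀ a : E, ‖a‖ ≤ δ / 2 → ∀ r : ℝ, 0 < r → r ≤ 1 → ∀ (P : ℝ) (g : E → ℂ), AnnulusAmp 1 (2 + finrank ℝ E + 1) P g →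
      |∫ z, U (r • z + a) * (𝓕 g z).re| ≤ C2 * r ^ (2 * s) * (C1 * P) * (MU + MF) := by
    intro a ha r hr hr1 P g hg
    have hwt := hw.translate (Ω' := Metric.ball 0 (δ / 2)) a fun x hx => by
      rw [mem_ball_zero_iff] at hx ⊢
      exact (norm_add_le _ _).trans_lt (by linarith)
    have := h2 c K b hK _ _ (C1 * P) (mul_nonneg hC1 hg.nonneg) (h1 K b hK P g hg) _ _ MU MF
      (hU.comp (measurable_const_add a)) (hF.comp (measurable_const_add a)) (fun x => hMU _) (fun x => hMF _) hwt r hr hr1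
    simpa only [Function.comp_def, add_comm a] using this
  -- the pieces of the telescoping sum
  have hpiece : ∀ l : ℕ, |∫ z, V (((1 / 2 : ℝ) ^ l) • z) * ψ z| ≤
      G * (MU + MF) * min (((1 / 2 : ℝ) ^ l) ^ (2 * s)) (((1 / 2 : ℝ) ^ l) ^ (-(2 - 2 * s)) * ‖h‖ ^ (2 * s + (2 - 2 * s))) := by
    intro l
    set r : ℝ := (1 / 2 : ℝ) ^ l with hr
    have hr0 : 0 < r := by positivity
    have hr1 : r ≤ 1 := pow_le_one₀ (by norm_num) (by norm_num)
    have hcase1 : |∫ z, V (r • z) * ψ z| ≤ 4 * (C2 * r ^ (2 * s) * (C1 * P) * (MU + MF)) := by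
      rw [hV, integral_secondDiff_comp_smul hU hMU hψi]
      have a1 := abs_le.1 (hweak h hh r hr0 hr1 P annAmp hP)
      have a2 := abs_le.1 (hweak (-h) (by rwa [norm_neg]) r hr0 hr1 P annAmp hP)
      have a3 := abs_le.1 (hweak 0 (by rw [norm_zero]; positivity) r hr0 hr1 P annAmp hP)
      rw [abs_le]
      constructor <;> linarith [a1.1, a1.2]
    have hX : 0 ≤ C2 * (C1 * P) * (MU + MF) := by positivity
    rw [mul_min_of_nonneg _ _ (by positivity)]
    refine le_min (hcase1.trans ?_) ?_
    · calc _ = C2 * (C1 * P) * (MU + MF) * r ^ (2 * s) * 4 := by ring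
        _ ≤ C2 * (C1 * P) * (MU + MF) * r ^ (2 * s) * (4 + D * D) := by
          gcongr
          nlinarith
        _ = _ := by rw [hG]; ring
    · have e1 : r ^ (-(2 - 2 * s)) * ‖h‖ ^ (2 * s + (2 - 2 * s)) = r ^ (2 * s) * (‖h‖ / r) ^ 2 := by
        rw [show 2 * s + (2 - 2 * s) = ((2:ℕ):ℝ) by push_cast; ring, Real.rpow_natCast,
          show -(2 - 2 * s) = 2 * s - ((2:ℕ):ℝ) by push_cast; ring, Real.rpow_sub hr0, Real.rpow_natCast]
        field_simp
      rw [e1]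
      -- For `‖h‖ ≤ r` the differenced amplitude is again an annular amplitude, with the bound
      -- multiplied by a constant times `(‖h‖/r)²`. Otherwise `(‖h‖/r)² ≥ 1` and the first bound is
      -- the stronger one.
      by_cases hk : ‖h‖ ≤ r
      · have hkn : ‖r⁻¹ • h‖ = ‖h‖ / r := by
          rw [norm_smul, norm_inv, Real.norm_of_nonneg hr0.le]; field_simp
        have hk1 : ‖r⁻¹ • h‖ ≤ 1 := by rw [hkn, div_le_one hr0]; exact hk
        rw [hV, integral_secondDiff_eq hU hMU hψi hr0.ne']
        simp only [hψ, secondDiff_re_fourier hP.integrable, mul_neg, integral_neg, abs_neg]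
        have := hweak 0 (by rw [norm_zero]; positivity) r hr0 hr1 _ _
          (hech 1 _ _ (hech 1 P annAmp hP (r⁻¹ • h) hk1) (-(r⁻¹ • h)) (by rwa [norm_neg]))
        simp only [add_zero, norm_neg, hkn] at this
        refine this.trans ?_
        calc _ = C2 * (C1 * P) * (MU + MF) * (r ^ (2 * s) * (‖h‖ / r) ^ 2) * (D * D) := by ring
          _ ≤ C2 * (C1 * P) * (MU + MF) * (r ^ (2 * s) * (‖h‖ / r) ^ 2) * (4 + D * D) := by
            gcongr
            linarith
          _ = _ := by rw [hG]; ring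
      · push Not at hk
        have : 1 ≤ (‖h‖ / r) ^ 2 := one_le_pow₀ (by rw [one_le_div hr0]; exact hk.le)
        calc _ ≤ _ := hcase1
          _ = C2 * (C1 * P) * (MU + MF) * (r ^ (2 * s) * 1) * 4 := by ring
          _ ≤ C2 * (C1 * P) * (MU + MF) * (r ^ (2 * s) * (‖h‖ / r) ^ 2) * (4 + D * D) := by
            gcongr
            nlinarith
          _ = _ := by rw [hG]; ring
  -- The low frequency part does not use the equation: its amplitude meets the origin, but two
  -- differences of a smooth rapidly decaying function give `‖h‖²`, which is at most `‖h‖^(2s)`.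
  have hlow : |∫ z, V ((1:ℝ) • z) * ρ z| ≤ W * (D' * (D' * P')) * ‖h‖ ^ (2 * s) * (MU + MF) := by
    rw [hV, integral_secondDiff_eq hU hMU hρi one_ne_zero]
    simp only [hρ, secondDiff_re_fourier hP'.integrable, mul_neg, integral_neg, abs_neg, inv_one, one_smul]
    have hA := hech' 0 _ _ (hech' 0 P' lowAmp hP' h hh1) (-h) (by rwa [norm_neg])
    have hB := lintegral_abs_re_fourier_le (κ := 0) (hwt 0 _ _ hA)
    set g : E → ℂ := fun ξ => lowAmp ξ * (ech h ξ - 1) * (ech (-h) ξ - 1)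
    have h4 : ENNReal.ofReal |∫ z, U z * (𝓕 g z).re| ≤ ENNReal.ofReal (MU * (W * (D' * (D' * P' * ‖h‖) * ‖-h‖))) := by
      refine ofReal_abs_integral_le.trans ?_
      rw [ENNReal.ofReal_mul hMU0]
      refine le_trans ?_ (mul_le_mul_right hB _)
      rw [← lintegral_const_mul' _ _ ENNReal.ofReal_ne_top]
      refine lintegral_mono fun z => ?_
      rw [← ENNReal.ofReal_mul hMU0, abs_mul]
      exact ENNReal.ofReal_le_ofReal (mul_le_mul_of_nonneg_right (hMU z) (abs_nonneg _))
    have h5 := (ENNReal.ofReal_le_ofReal_iff (by positivity)).1 h4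
    refine h5.trans ?_
    have h6 : ‖h‖ * ‖h‖ ≤ ‖h‖ ^ (2 * s) := by
      rw [← sq, ← Real.rpow_natCast]
      exact Real.rpow_le_rpow_of_exponent_ge hhp hh1 (by push_cast; linarith)
    rw [norm_neg]
    calc _ = W * (D' * (D' * P')) * (‖h‖ * ‖h‖) * MU := by ring
      _ ≤ W * (D' * (D' * P')) * ‖h‖ ^ (2 * s) * (MU + MF) := by
        gcongr
        linarith
  have htel : ∀ N : ℕ, (∫ z, V (((1 / 2 : ℝ) ^ N) • z) * ρ z) =
      (∫ z, V ((1:ℝ) • z) * ρ z) + ∑ l ∈ Finset.range N, ∫ z, V (((1 / 2 : ℝ) ^ l) • z) * ψ z := by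
    intro N
    induction N with
    | zero => simp
    | succ N ih =>
      rw [Finset.sum_range_succ, ← add_assoc, ← ih, ← integral_comp_half_smul hVm hVb]
      congr! 5
      ring
  have hbd : ∀ N : ℕ, |∫ z, V (((1 / 2 : ℝ) ^ N) • z) * ρ z| ≤ (W * (D' * (D' * P')) + G * C3) * ‖h‖ ^ (2 * s) * (MU + MF) := by
    intro N
    rw [htel]
    refine (abs_add_le _ _).trans ?_
    have h3 : |∑ l ∈ Finset.range N, ∫ z, V (((1 / 2 : ℝ) ^ l) • z) * ψ z| ≤ G * (MU + MF) * (C3 * ‖h‖ ^ (2 * s)) := by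
      refine (Finset.abs_sum_le_sum_abs _ _).trans ((Finset.sum_le_sum fun l _ => hpiece l).trans ?_)
      rw [← Finset.mul_sum]
      exact mul_le_mul_of_nonneg_left (hsum _ hhp N) (by positivity)
    calc _ ≤ _ := add_le_add hlow h3
      _ = _ := by ring
  -- The only place where continuity of `U` at `0` and `±h` enters.
  have hlim : Tendsto (fun N : ℕ => ∫ z, V (((1 / 2 : ℝ) ^ N) • z) * ρ z) atTop (𝓝 (∫ z, V 0 * ρ z)) := by
    refine tendsto_integral_of_dominated_convergence (fun z => 4 * MU * |ρ z|) (fun N => ?_) (hρi.abs.const_mul _)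
      (fun N => Eventually.of_forall fun z => ?_) (Eventually.of_forall fun z => ?_)
    · have := (integrable_comp_smul_mul hVm hVb hρi ((1 / 2 : ℝ) ^ N) 0).1
      simpa using this
    · rw [norm_mul]
      exact mul_le_mul_of_nonneg_right (hVb _) (norm_nonneg _)
    · refine Tendsto.mul_const _ ?_
      have hVc : ContinuousAt V 0 := by
        have a1 : ContinuousAt (fun x => U (x + h)) 0 :=
          ContinuousAt.comp (g := U) (by simpa using hch) (continuousAt_id.add continuousAt_const)
        have a2 : ContinuousAt (fun x => U (x - h)) 0 :=
          ContinuousAt.comp (g := U) (by simpa using hch') (continuousAt_id.sub continuousAt_const)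
        exact (a1.add a2).sub (continuousAt_const.mul hc0)
      refine hVc.tendsto.comp ?_
      have := (tendsto_pow_atTop_nhds_zero_of_lt_one (r := (1 / 2 : ℝ)) (by norm_num) (by norm_num)).smul_const z
      simpa using this
  have hfin := le_of_tendsto hlim.abs (Eventually.of_forall hbd)
  rwa [integral_const_mul, hρ, integral_re_fourier_lowAmp, mul_one] at hfin

/-- The estimate of second differences of solutions. -/
lemma exists_secondDiff_le (hs0 : 0 < s) (hs1 : s < 1) (hc : 0 < c) (hΛ : 0 < Λ) {δ : ℝ} (hδ : 0 < δ)
    (hδ1 : δ ≤ 1) :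
    ∃ C : ℝ, 0 ≤ C ∧ ∀ (K : E → ℝ) (b : E), StableKer s c Λ K b →
      ∀ (U F : E → ℝ) (MU MF : ℝ), Measurable U → Measurable F → (∀ x, |U x| ≤ MU) → (∀ x, |F x| ≤ MF) →
      ∀ x : E, WeakEq s K b (Metric.ball x δ) U F → ContinuousOn U (Metric.ball x δ) →
      ∀ h : E, ‖h‖ ≤ δ / 2 → |secondDiff U h x| ≤ C * ‖h‖ ^ (2 * s) * (MU + MF) := by
  obtain ⟨C, hC, H⟩ := exists_secondDiff_le_aux (E := E) hs0 hs1 hc hΛ hδ hδ1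
  refine ⟨C, hC, fun K b hK U F MU MF hU hF hMU hMF x hw hcont h hh => ?_⟩
  by_cases hh0 : h = 0
  · have hMU0 : 0 ≤ MU := (abs_nonneg _).trans (hMU 0)
    have hMF0 : 0 ≤ MF := (abs_nonneg _).trans (hMF 0)
    have : secondDiff U h x = 0 := by rw [secondDiff, hh0]; simp only [add_zero, sub_zero]; ring
    rw [this, abs_zero]
    positivity
  have hca : ∀ y : E, ‖y‖ ≤ δ / 2 → ContinuousAt (fun z => U (x + z)) y := fun y hy => by
    refine ContinuousAt.comp (g := U) ?_ (continuousAt_const.add continuousAt_id)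
    exact hcont.continuousAt (Metric.isOpen_ball.mem_nhds (by
      rw [mem_ball_iff_norm]; simp only [id, add_sub_cancel_left]; linarith))
  have := H K b hK _ _ MU MF (hU.comp (measurable_const_add x)) (hF.comp (measurable_const_add x))
    (fun z => hMU _) (fun z => hMF _) (hw.translate (Ω' := Metric.ball 0 δ) x fun z hz => by
      rw [mem_ball_zero_iff] at hz
      rw [mem_ball_iff_norm, add_sub_cancel_left]; exact hz) h hh0 hh
    (hca 0 (by rw [norm_zero]; positivity)) (hca h hh) (hca (-h) (by rwa [norm_neg]))
  simpa [secondDiff, sub_eq_add_neg] using this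

end SecondDiff

/-! ### Averaging operators on bounded measurable functions. -/

section Averaging

open Module

variable {E : Type*} [NormedAddCommGroup E] [InnerProductSpace ℝ E] [FiniteDimensional ℝ E]
  [MeasurableSpace E] [BorelSpace E]

/-- The bump function underlying the averaging kernel. -/
def avgBump : ContDiffBump (0 : E) := ⟨1 / 2, 1, by norm_num, by norm_num⟩

/-- A smooth even probability density supported in the unit ball. -/
def avgKer : E → ℝ := (avgBump : ContDiffBump (0 : E)).normed volume

lemma avgKer_nonneg (y : E) : 0 ≤ avgKer y := ContDiffBump.nonneg_normed _ y

lemma avgKer_contDiff : ContDiff ℝ ∞ (avgKer : E → ℝ) := ContDiffBump.contDiff_normed _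

lemma avgKer_continuous : Continuous (avgKer : E → ℝ) := avgKer_contDiff.continuous

lemma avgKer_neg (y : E) : avgKer (-y) = avgKer y := ContDiffBump.normed_neg _ y

lemma integral_avgKer : ∫ y : E, avgKer y = 1 := ContDiffBump.integral_normed _

lemma avgKer_integrable : Integrable (avgKer : E → ℝ) := ContDiffBump.integrable_normed _

lemma avgKer_hasCompactSupport : HasCompactSupport (avgKer : E → ℝ) := ContDiffBump.hasCompactSupport_normed _

lemma avgKer_tsupport : tsupport (avgKer : E → ℝ) = Metric.closedBall 0 1 := ContDiffBump.tsupport_normed_eq _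

lemma avgKer_eq_zero {y : E} (h : 1 < ‖y‖) : avgKer y = 0 := by
  refine image_eq_zero_of_notMem_tsupport (f := (avgKer : E → ℝ)) ?_
  rw [avgKer_tsupport, mem_closedBall_zero_iff]
  exact not_le.2 h

/-- The space of bounded measurable functions. -/
def bddMeas (E : Type*) [MeasurableSpace E] : Submodule ℝ (E → ℝ) where
  carrier := {f | Measurable f ∧ ∃ M, ∀ x, |f x| ≤ M}
  add_mem' := by
    rintro f g ⟨hf, M, hM⟩ ⟨hg, N, hN⟩
    exact ⟨hf.add hg, M + N, fun x => (abs_add_le _ _).trans (add_le_add (hM x) (hN x))⟩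
  zero_mem' := ⟨measurable_const, 0, fun x => by simp⟩
  smul_mem' := by
    rintro c f ⟨hf, M, hM⟩
    refine ⟨hf.const_smul c, |c| * M, fun x => ?_⟩
    rw [Pi.smul_apply, smul_eq_mul, abs_mul]
    exact mul_le_mul_of_nonneg_left (hM x) (abs_nonneg c)

lemma bddMeas.measurable (u : bddMeas E) : Measurable u.1 := u.2.1

lemma integrable_comp_mul_avgKer (u : bddMeas E) {g : E → E} (hg : Measurable g) :
    Integrable fun y => u.1 (g y) * avgKer y := by
  obtain ⟨hu, M, hM⟩ := u.2
  exact avgKer_integrable.bdd_mul (c := M) (hu.comp hg).aestronglyMeasurable (Eventually.of_forall fun y => hM _)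

lemma integrable_comp_add_smul_mul_avgKer (u : bddMeas E) (x : E) (r : ℝ) :
    Integrable fun y => u.1 (x + r • y) * avgKer y :=
  integrable_comp_mul_avgKer u (by fun_prop)

lemma abs_integral_mul_avgKer_le {f : E → ℝ} {B : ℝ} (h : ∀ y, ‖y‖ ≤ 1 → |f y| ≤ B) :
    |∫ y, f y * avgKer y| ≤ B := by
  have h1 := norm_integral_le_of_norm_le (f := fun y => f y * avgKer y)
    (g := fun y => B * avgKer y) (avgKer_integrable.const_mul B) (Eventually.of_forall fun y => ?_)
  · rwa [integral_const_mul, integral_avgKer, mul_one, Real.norm_eq_abs] at h1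
  · by_cases hy : ‖y‖ ≤ 1
    · rw [norm_mul, Real.norm_of_nonneg (avgKer_nonneg y)]
      exact mul_le_mul_of_nonneg_right (h y hy) (avgKer_nonneg y)
    · rw [avgKer_eq_zero (not_le.1 hy), mul_zero, mul_zero, norm_zero]

/-- The averaging operator at the scale `r`. -/
def avg (r : ℝ) : End ℝ (bddMeas E) where
  toFun u := ⟨fun x => ∫ y, u.1 (x + r • y) * avgKer y, by
    obtain ⟨hu, M, hM⟩ := u.2
    refine ⟨?_, M, fun x => abs_integral_mul_avgKer_le fun y _ => hM _⟩
    have h : Measurable fun p : E × E => u.1 (p.1 + r • p.2) * avgKer p.2 :=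
      (hu.comp (by fun_prop)).mul (avgKer_continuous.measurable.comp measurable_snd)
    exact h.stronglyMeasurable.integral_prod_right.measurable⟩
  map_add' u v := by
    ext x
    simp only [Submodule.coe_add, Pi.add_apply, add_mul]
    exact integral_add (integrable_comp_add_smul_mul_avgKer u x r) (integrable_comp_add_smul_mul_avgKer v x r)
  map_smul' c u := by
    ext x
    simp only [Submodule.coe_smul, Pi.smul_apply, smul_eq_mul, mul_assoc, RingHom.id_apply]
    exact integral_const_mul _ _

lemma avg_apply (r : ℝ) (u : bddMeas E) (x : E) : (avg r u).1 x = ∫ y, u.1 (x + r • y) * avgKer y := rfl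

lemma avg_commute (r t : ℝ) : Commute (avg r : End ℝ (bddMeas E)) (avg t) := by
  refine LinearMap.ext fun u => Subtype.ext (funext fun x => ?_)
  change (avg r (avg t u)).1 x = (avg t (avg r u)).1 x
  simp only [avg_apply, ← integral_mul_const]
  obtain ⟨hu, M, hM⟩ := u.2
  rw [integral_integral_swap]
  · refine integral_congr_ae (Eventually.of_forall fun z => integral_congr_ae (Eventually.of_forall fun y => ?_))
    have e : x + r • y + t • z = x + t • z + r • y := by abel
    simp only [e]; ring
  · have h1 : Integrable fun p : E × E => avgKer p.2 * avgKer p.1 :=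
      ((avgKer_integrable (E := E)).mul_prod (avgKer_integrable (E := E))).swap
    have h2 := h1.bdd_mul (c := M) (f := fun p : E × E => u.1 (x + r • p.1 + t • p.2))
      (hu.comp (by fun_prop)).aestronglyMeasurable (Eventually.of_forall fun y => hM _)
    refine h2.congr (Eventually.of_forall fun p => ?_)
    simp only [Function.uncurry]; ring

/-- The translation of functions. -/
def shift (h : E) : End ℝ (bddMeas E) where
  toFun u := ⟨fun x => u.1 (x + h), u.2.1.comp (measurable_id.add_const h), u.2.2.imp fun M hM x => hM _⟩
  map_add' u v := rfl
  map_smul' c u := rfl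

lemma shift_apply (h : E) (u : bddMeas E) (x : E) : (shift h u).1 x = u.1 (x + h) := rfl

lemma shift_commute_avg (h : E) (r : ℝ) : Commute (shift h : End ℝ (bddMeas E)) (avg r) := by
  refine LinearMap.ext fun u => Subtype.ext (funext fun x => ?_)
  change (shift h (avg r u)).1 x = (avg r (shift h u)).1 x
  simp only [avg_apply, shift_apply]
  refine integral_congr_ae (Eventually.of_forall fun y => ?_)
  have e : x + h + r • y = x + r • y + h := by abel
  simp only [e]

lemma abs_avg_le {u : bddMeas E} {x : E} {r B : ℝ} (hr : 0 ≤ r)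
    (h : ∀ z ∈ Metric.closedBall x r, |u.1 z| ≤ B) : |(avg r u).1 x| ≤ B := by
  rw [avg_apply]
  refine abs_integral_mul_avgKer_le fun y hy => h _ ?_
  rw [mem_closedBall_iff_norm, add_sub_cancel_left, norm_smul, Real.norm_of_nonneg hr]
  exact mul_le_of_le_one_right hr hy

lemma coe_one_sub_avg (r : ℝ) (u : bddMeas E) (x : E) :
    ((1 - avg r) u : bddMeas E).1 x = u.1 x - (avg r u).1 x := rfl

/-- Powers of `1 - avg r` are bounded, and local. -/
lemma abs_one_sub_avg_pow_le {r : ℝ} (hr : 0 ≤ r) (m : ℕ) : ∀ {u : bddMeas E} {x : E} {B : ℝ},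
    (∀ z ∈ Metric.closedBall x (m * r), |u.1 z| ≤ B) → |(((1 - avg r) ^ m) u : bddMeas E).1 x| ≤ 2 ^ m * B := by
  induction m with
  | zero =>
    intro u x B h
    simpa using h x (by simp)
  | succ m ih =>
    intro u x B h
    rw [pow_succ', Module.End.mul_apply, coe_one_sub_avg]
    have h1 : ∀ z ∈ Metric.closedBall x r, |(((1 - avg r) ^ m) u : bddMeas E).1 z| ≤ 2 ^ m * B := by
      intro z hz
      refine ih fun w hw => h w ?_
      rw [mem_closedBall_iff_norm] at *
      have := norm_sub_le_norm_sub_add_norm_sub w z x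
      push_cast
      linarith
    have h2 := h1 x (Metric.mem_closedBall_self hr)
    have h3 := abs_avg_le hr h1
    rw [pow_succ]
    refine (abs_sub _ _).trans ?_
    linarith

lemma one_sub_avg_pow_congr {r : ℝ} (hr : 0 ≤ r) (m : ℕ) {u v : bddMeas E} {x : E}
    (h : ∀ z ∈ Metric.closedBall x (m * r), u.1 z = v.1 z) :
    (((1 - avg r) ^ m) u : bddMeas E).1 x = (((1 - avg r) ^ m) v : bddMeas E).1 x := by
  have h1 := abs_one_sub_avg_pow_le hr m (u := u - v) (x := x) (B := 0) fun z hz => by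
    have : (u - v).1 z = u.1 z - v.1 z := rfl
    rw [this, h z hz, sub_self, abs_zero]
  rw [mul_zero, map_sub] at h1
  exact sub_eq_zero.1 (abs_nonpos_iff.1 h1)

/-- The approximation of a function at the scale `r`, to the order `m`. -/
def approx (m : ℕ) (r : ℝ) : End ℝ (bddMeas E) := 1 - (1 - avg r) ^ m

/-- Geometric sum. A factor `avg r` comes out on the left, so the approximation is smooth although
it contains the identity formally. -/
lemma approx_eq (m : ℕ) (r : ℝ) : (approx m r : End ℝ (bddMeas E)) = avg r * ∑ j ∈ Finset.range m, (1 - avg r) ^ j := by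
  have key : ∀ {R : Type _} [Ring R] (a : R), 1 - (1 - a) ^ m = a * ∑ j ∈ Finset.range m, (1 - a) ^ j := fun a => by
    rw [← mul_neg_geom_sum (1 - a) m, sub_sub_cancel]
  exact key (avg r : End ℝ (bddMeas E))

lemma approx_commute (m : ℕ) (r t : ℝ) : Commute (approx m r : End ℝ (bddMeas E)) (approx m t) := by
  have key : ∀ {R : Type _} [Ring R] (a b : R), Commute a b → Commute (1 - (1 - a) ^ m) (1 - (1 - b) ^ m) := by
    intro R _ a b hab
    have h : Commute (1 - a) (1 - b) :=
      (Commute.one_left _).sub_left ((Commute.one_right _).sub_right hab)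
    exact (Commute.one_left _).sub_left ((Commute.one_right _).sub_right (h.pow_pow m m))
  exact key (avg r : End ℝ (bddMeas E)) (avg t) (avg_commute r t)

/-- For commuting `S` and `T`, `T - S = T (1 - S) - S (1 - T)`. The increment between two scales is
thus a smoothing operator applied to approximation errors; this is what makes its derivatives small.
-/
lemma approx_sub_approx (m : ℕ) (r t : ℝ) (u : bddMeas E) :
    approx m t u - approx m r u = approx m t (((1 - avg r) ^ m) u) - approx m r (((1 - avg t) ^ m) u) := by
  have h := LinearMap.congr_fun (approx_commute (E := E) m r t) u
  have e : ∀ r : ℝ, ((1 - avg r) ^ m) u = u - approx m r u := fun r => by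
    simp [approx]
  rw [Module.End.mul_apply, Module.End.mul_apply] at h
  rw [e r, e t, map_sub, map_sub, h]
  abel

end Averaging

/-! ### Derivatives and a.e. convergence of averages. -/

section Smoothing

open Module

variable {E : Type} [NormedAddCommGroup E] [InnerProductSpace ℝ E] [FiniteDimensional ℝ E]
  [MeasurableSpace E] [BorelSpace E]

/-- All derivatives fall on the smooth factor. The target space varies in the induction, because
`fderiv ℝ g` takes values in `E →L[ℝ] F`; keeping it quantified inside the statement is what fixes
the universe of `E`. -/
lemma norm_iteratedFDeriv_convolution_le {u : E → ℝ} (hu : LocallyIntegrable u volume) (l : ℕ) :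
    ∀ {F : Type} [NormedAddCommGroup F] [NormedSpace ℝ F] [CompleteSpace F] {g : E → F}, ContDiff ℝ ∞ g →
      HasCompactSupport g → ∀ x, ‖iteratedFDeriv ℝ l (fun x => ∫ t, u t • g (x - t)) x‖ ≤
        ∫ t, |u t| * ‖iteratedFDeriv ℝ l g (x - t)‖ := by
  induction l with
  | zero =>
    intro F _ _ _ g hg hc x
    rw [norm_iteratedFDeriv_zero]
    refine (norm_integral_le_integral_norm _).trans (le_of_eq ?_)
    simp only [norm_smul, norm_iteratedFDeriv_zero, Real.norm_eq_abs]
  | succ l ih =>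
    intro F _ _ _ g hg hc x
    have h1 : fderiv ℝ (fun x => ∫ t, u t • g (x - t)) = fun x => ∫ t, u t • fderiv ℝ g (x - t) := by
      funext x
      exact (hc.hasFDerivAt_convolution_right (ContinuousLinearMap.lsmul ℝ ℝ) hu (hg.of_le (by norm_num)) x).fderiv
    rw [← norm_iteratedFDeriv_fderiv, h1]
    refine (ih (hg.fderiv_right (by norm_num)) (hc.fderiv ℝ) x).trans (le_of_eq ?_)
    simp only [norm_iteratedFDeriv_fderiv]

lemma integral_eq_pow_mul_integral_comp_add_smul (f : E → ℝ) (x : E) {r : ℝ} (hr : 0 < r) :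
    ∫ t, f t = r ^ finrank ℝ E * ∫ y, f (x + r • y) := by
  have h := Measure.integral_comp_smul (volume : Measure E) (fun y => f (x + y)) r
  rw [h, integral_add_left_eq_self f x, abs_of_pos (by positivity), smul_eq_mul]
  field_simp

lemma bddMeas.locallyIntegrable (u : bddMeas E) : LocallyIntegrable u.1 volume := by
  obtain ⟨hu, M, hM⟩ := u.2
  exact (locallyIntegrable_const M).mono hu.aestronglyMeasurable (Eventually.of_forall fun x => by
    rw [Real.norm_eq_abs]; exact (hM x).trans (le_abs_self M))

lemma avg_eq_integral (u : bddMeas E) {r : ℝ} (hr : 0 < r) (x : E) :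
    (avg r u).1 x = ∫ t, u.1 t • ((r ^ finrank ℝ E)⁻¹ * avgKer (r⁻¹ • (x - t))) := by
  rw [integral_eq_pow_mul_integral_comp_add_smul _ x hr, ← integral_const_mul, avg_apply]
  refine integral_congr_ae (Eventually.of_forall fun y => ?_)
  have e : r⁻¹ • (x - (x + r • y)) = -y := by
    rw [sub_add_cancel_left, smul_neg, inv_smul_smul₀ hr.ne']
  simp only [e, avgKer_neg, smul_eq_mul]
  have : r ^ finrank ℝ E ≠ 0 := by positivity
  field_simp

/-- The rescaled averaging kernel. -/
def avgKerScaled (r : ℝ) (y : E) : ℝ := (r ^ finrank ℝ E)⁻¹ * avgKer (r⁻¹ • y)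

lemma avgKerScaled_contDiff (r : ℝ) : ContDiff ℝ ∞ (avgKerScaled r : E → ℝ) :=
  contDiff_const.mul (avgKer_contDiff.comp (contDiff_const.smul contDiff_id))

lemma avgKerScaled_hasCompactSupport {r : ℝ} (hr : 0 < r) : HasCompactSupport (avgKerScaled r : E → ℝ) :=
  (avgKer_hasCompactSupport.comp_smul (inv_ne_zero hr.ne')).mul_left

lemma norm_iteratedFDeriv_avgKerScaled {r : ℝ} (hr : 0 < r) (l : ℕ) (y : E) :
    ‖iteratedFDeriv ℝ l (avgKerScaled r) y‖ =
      (r ^ finrank ℝ E)⁻¹ * ((r ^ l)⁻¹ * ‖iteratedFDeriv ℝ l avgKer (r⁻¹ • y)‖) := by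
  have h1 : ContDiff ℝ l (avgKer : E → ℝ) := avgKer_contDiff.of_le (by exact_mod_cast le_top)
  have h2 : ContDiff ℝ l fun y : E => avgKer (r⁻¹ • y) := h1.comp (contDiff_const.smul contDiff_id)
  have e : (avgKerScaled r : E → ℝ) = (r ^ finrank ℝ E)⁻¹ • fun y : E => avgKer (r⁻¹ • y) := rfl
  rw [e, iteratedFDeriv_const_smul_apply h2.contDiffAt, norm_smul, iteratedFDeriv_comp_const_smul _ h1, norm_smul,
    Real.norm_of_nonneg (by positivity), Real.norm_of_nonneg (by positivity), inv_pow]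

lemma avg_contDiff (u : bddMeas E) {r : ℝ} (hr : 0 < r) : ContDiff ℝ ∞ (avg r u).1 := by
  have h := (avgKerScaled_hasCompactSupport (E := E) hr).contDiff_convolution_right
    (n := ⊤) (ContinuousLinearMap.lsmul ℝ ℝ) (bddMeas.locallyIntegrable u) (avgKerScaled_contDiff r)
  rw [show (avg r u).1 = _ from funext fun x => avg_eq_integral u hr x]
  exact h

/-- The derivatives of averages. -/
lemma exists_norm_iteratedFDeriv_avg_le (l : ℕ) : ∃ C : ℝ, 0 ≤ C ∧ ∀ (u : bddMeas E) (r B : ℝ) (x : E), 0 < r →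
    (∀ z ∈ Metric.closedBall x r, |u.1 z| ≤ B) → ‖iteratedFDeriv ℝ l (avg r u).1 x‖ ≤ C * (r ^ l)⁻¹ * B := by
  refine ⟨∫ y : E, ‖iteratedFDeriv ℝ l avgKer (-y)‖, integral_nonneg fun y => norm_nonneg _, fun u r B x hr h => ?_⟩
  have h0 : (avg r u).1 = fun x => ∫ t, u.1 t • avgKerScaled r (x - t) := funext fun x => avg_eq_integral u hr x
  rw [h0]
  refine (norm_iteratedFDeriv_convolution_le (bddMeas.locallyIntegrable u) l (avgKerScaled_contDiff r)
    (avgKerScaled_hasCompactSupport hr) x).trans ?_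
  rw [integral_eq_pow_mul_integral_comp_add_smul _ x hr]
  have hi : Integrable fun y : E => ‖iteratedFDeriv ℝ l avgKer (-y)‖ := by
    have h1 : Integrable fun y : E => iteratedFDeriv ℝ l (avgKer : E → ℝ) y :=
      (avgKer_contDiff.continuous_iteratedFDeriv (by exact_mod_cast le_top)).integrable_of_hasCompactSupport
        (avgKer_hasCompactSupport.iteratedFDeriv l)
    exact h1.comp_neg.norm
  have hpow : 0 < r ^ finrank ℝ E := by positivity
  have key : ∀ y : E, |u.1 (x + r • y)| * ‖iteratedFDeriv ℝ l (avgKerScaled r) (x - (x + r • y))‖ ≤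
      (r ^ finrank ℝ E)⁻¹ * (r ^ l)⁻¹ * B * ‖iteratedFDeriv ℝ l avgKer (-y)‖ := by
    intro y
    have e : r⁻¹ • (x - (x + r • y)) = -y := by
      rw [sub_add_cancel_left, smul_neg, inv_smul_smul₀ hr.ne']
    rw [norm_iteratedFDeriv_avgKerScaled hr, e]
    by_cases hy : ‖y‖ ≤ 1
    · have := h (x + r • y) (by
        rw [mem_closedBall_iff_norm, add_sub_cancel_left, norm_smul, Real.norm_of_nonneg hr.le]
        exact mul_le_of_le_one_right hr.le hy)
      calc _ ≤ B * ((r ^ finrank ℝ E)⁻¹ * ((r ^ l)⁻¹ * ‖iteratedFDeriv ℝ l avgKer (-y)‖)) := by gcongr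
        _ = _ := by ring
    · have : iteratedFDeriv ℝ l (avgKer : E → ℝ) (-y) = 0 := by
        refine image_eq_zero_of_notMem_tsupport fun hm => hy ?_
        have := tsupport_iteratedFDeriv_subset (𝕜 := ℝ) (f := (avgKer : E → ℝ)) l hm
        rwa [avgKer_tsupport, mem_closedBall_zero_iff, norm_neg] at this
      rw [this, norm_zero]
      simp
  calc _ ≤ r ^ finrank ℝ E * ∫ y : E, (r ^ finrank ℝ E)⁻¹ * (r ^ l)⁻¹ * B * ‖iteratedFDeriv ℝ l avgKer (-y)‖ := by
        refine mul_le_mul_of_nonneg_left ?_ hpow.le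
        exact integral_mono_of_nonneg (Eventually.of_forall fun y => by positivity) (hi.const_mul _)
          (Eventually.of_forall key)
    _ = _ := by
        rw [integral_const_mul]
        field_simp

/-- Averages converge almost everywhere. -/
lemma ae_tendsto_avg (u : bddMeas E) :
    ∀ᵐ x, Tendsto (fun j : ℕ => (avg ((1 / 2 : ℝ) ^ j) u).1 x) atTop (𝓝 (u.1 x)) := by
  let φ : ℕ → ContDiffBump (0 : E) := fun j =>
    ⟨(1 / 2 : ℝ) ^ j / 2, (1 / 2 : ℝ) ^ j, by positivity, half_lt_self (by positivity)⟩
  have h := ContDiffBump.ae_convolution_tendsto_right_of_locallyIntegrable (φ := φ) (l := atTop) (K := 2)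
    (tendsto_pow_atTop_nhds_zero_of_lt_one (by norm_num) (by norm_num))
    (Eventually.of_forall fun j => by simp only [φ]; linarith) (bddMeas.locallyIntegrable u)
  filter_upwards [h] with x hx
  refine hx.congr fun j => ?_
  set r : ℝ := (1 / 2 : ℝ) ^ j with hr
  have hr0 : 0 < r := by positivity
  -- The two radii of `φ j` have the same ratio as those of `avgBump`, so `φ j` is an exact dilation
  -- of it and its normalisation is the averaging kernel at scale `r`.
  have e1 : ∀ y : E, φ j (r • y) = (avgBump : ContDiffBump (0 : E)) y := fun y => by
    rw [ContDiffBump.apply, ContDiffBump.apply]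
    have h1 : r / (r / 2) = 1 / (1 / 2) := by field_simp
    have h2 : (r / 2)⁻¹ * r = (1 / 2)⁻¹ := by field_simp
    simp only [φ, avgBump, ← hr, sub_zero, smul_smul, h1, h2]
  have e2 : ∫ y, φ j y = r ^ finrank ℝ E * ∫ y : E, (avgBump : ContDiffBump (0 : E)) y := by
    rw [integral_eq_pow_mul_integral_comp_add_smul _ 0 hr0]
    simp only [zero_add, e1]
  rw [convolution, avg_apply, integral_eq_pow_mul_integral_comp_add_smul _ 0 hr0, ← integral_const_mul]
  rw [← integral_neg_eq_self (fun y => u.1 (x + r • y) * avgKer y)]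
  refine integral_congr_ae (Eventually.of_forall fun y => ?_)
  simp only [zero_add, ContinuousLinearMap.lsmul_apply, smul_eq_mul, avgKer, ContDiffBump.normed_def, e1, e2,
    ContDiffBump.neg, smul_neg, sub_eq_add_neg]
  have h3 : r ^ finrank ℝ E ≠ 0 := by positivity
  field_simp

end Smoothing

/-! ### Hölder norms in real terms, and series with geometrically controlled derivatives. -/

section HolderNorm

variable {E : Type*} [NormedAddCommGroup E] [NormedSpace ℝ E]

lemma holderNorm_le_ofReal {β B : ℝ} {U : Set E} {w : E → ℝ} (hB : 0 ≤ B)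
    (h1 : ContDiffOn ℝ (⌊β⌋₊ : ℕ) w U)
    (h2 : ∀ j ≤ ⌊β⌋₊, ∀ x ∈ U, ‖iteratedFDeriv ℝ j w x‖ ≤ B)
    (h3 : ∀ x ∈ U, ∀ y ∈ U, ‖iteratedFDeriv ℝ ⌊β⌋₊ w x - iteratedFDeriv ℝ ⌊β⌋₊ w y‖ ≤
      B * ‖x - y‖ ^ (β - (⌊β⌋₊ : ℝ))) :
    holderNorm β U w ≤ ENNReal.ofReal ((⌊β⌋₊ + 2 : ℕ) * B) := by
  rw [holderNorm, if_pos h1, ENNReal.ofReal_mul (by positivity), ENNReal.ofReal_natCast]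
  have e : ((⌊β⌋₊ + 2 : ℕ) : ℝ≥0∞) * ENNReal.ofReal B = ((⌊β⌋₊ + 1 : ℕ) : ℝ≥0∞) * ENNReal.ofReal B + ENNReal.ofReal B := by
    push_cast; ring
  rw [e]
  refine add_le_add ?_ ?_
  · calc _ ≤ ∑ j ∈ Finset.range (⌊β⌋₊ + 1), ENNReal.ofReal B := by
          refine Finset.sum_le_sum fun j hj => iSup₂_le fun x hx => ?_
          rw [← ofReal_norm]
          exact ENNReal.ofReal_le_ofReal (h2 j (by simpa [Nat.lt_succ_iff] using hj) x hx)
      _ = _ := by simp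
  · refine iSup₂_le fun x hx => iSup₂_le fun y hy => ?_
    by_cases hxy : x = y
    · rw [hxy, sub_self, ← ofReal_norm, norm_zero, ENNReal.ofReal_zero, ENNReal.zero_div]
      exact zero_le
    · have hn : 0 < ‖x - y‖ := norm_pos_iff.2 (sub_ne_zero.2 hxy)
      rw [← ofReal_norm, ← ofReal_norm, ENNReal.ofReal_rpow_of_pos hn]
      refine ENNReal.div_le_of_le_mul ?_
      rw [← ENNReal.ofReal_mul hB]
      exact ENNReal.ofReal_le_ofReal (h3 x hx y hy)

lemma contDiffOn_of_holderNorm_lt_top {β : ℝ} {U : Set E} {w : E → ℝ} (h : holderNorm β U w < ⊤) :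
    ContDiffOn ℝ (⌊β⌋₊ : ℕ) w U := by
  by_contra hc
  rw [holderNorm, if_neg hc] at h
  exact lt_irrefl _ h

lemma norm_iteratedFDeriv_le_holderNorm {β : ℝ} {U : Set E} {w : E → ℝ} (h : holderNorm β U w < ⊤)
    {j : ℕ} (hj : j ≤ ⌊β⌋₊) {x : E} (hx : x ∈ U) : ‖iteratedFDeriv ℝ j w x‖ ≤ (holderNorm β U w).toReal := by
  have h1 : ‖iteratedFDeriv ℝ j w x‖ₑ ≤ holderNorm β U w := by
    rw [holderNorm, if_pos (contDiffOn_of_holderNorm_lt_top h)]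
    refine le_add_right (le_trans ?_ (Finset.single_le_sum (f := fun j => ⨆ x ∈ U, ‖iteratedFDeriv ℝ j w x‖ₑ)
      (fun _ _ => zero_le) (Finset.mem_range.2 (Nat.lt_succ_of_le hj))))
    exact le_iSup₂_of_le x hx le_rfl
  rw [← ofReal_norm] at h1
  exact (ENNReal.ofReal_le_iff_le_toReal h.ne).1 h1

lemma norm_iteratedFDeriv_sub_le_holderNorm {β : ℝ} {U : Set E} {w : E → ℝ} (h : holderNorm β U w < ⊤)
    {x y : E} (hx : x ∈ U) (hy : y ∈ U) :
    ‖iteratedFDeriv ℝ ⌊β⌋₊ w x - iteratedFDeriv ℝ ⌊β⌋₊ w y‖ ≤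
      (holderNorm β U w).toReal * ‖x - y‖ ^ (β - (⌊β⌋₊ : ℝ)) := by
  by_cases hxy : x = y
  · rw [hxy, sub_self, norm_zero]; positivity
  have hn : 0 < ‖x - y‖ := norm_pos_iff.2 (sub_ne_zero.2 hxy)
  have h1 : ‖iteratedFDeriv ℝ ⌊β⌋₊ w x - iteratedFDeriv ℝ ⌊β⌋₊ w y‖ₑ /
          ‖x - y‖ₑ ^ (β - (⌊β⌋₊ : ℝ)) ≤ holderNorm β U w := by
    conv_rhs => rw [holderNorm, if_pos (contDiffOn_of_holderNorm_lt_top h)]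
    refine le_add_left (le_iSup₂_of_le x hx (le_iSup₂_of_le y hy le_rfl))
  rw [← ofReal_norm, ← ofReal_norm, ENNReal.ofReal_rpow_of_pos hn,
    ← ENNReal.ofReal_div_of_pos (by positivity)] at h1
  have h2 := (ENNReal.ofReal_le_iff_le_toReal h.ne).1 h1
  rwa [div_le_iff₀ (by positivity)] at h2

lemma abs_le_holderNorm {β : ℝ} {U : Set E} {w : E → ℝ} (h : holderNorm β U w < ⊤) {x : E} (hx : x ∈ U) :
    |w x| ≤ (holderNorm β U w).toReal := by
  have := norm_iteratedFDeriv_le_holderNorm h (Nat.zero_le _) hx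
  rwa [norm_iteratedFDeriv_zero] at this

lemma holderNorm_congr {β : ℝ} {U : Set E} (hU : IsOpen U) {v w : E → ℝ} (h : EqOn v w U) :
    holderNorm β U v = holderNorm β U w := by
  have h1 : ∀ j : ℕ, ∀ x ∈ U, iteratedFDeriv ℝ j v x = iteratedFDeriv ℝ j w x := fun j x hx =>
    (Filter.EventuallyEq.iteratedFDeriv ℝ (h.eventuallyEq_of_mem (hU.mem_nhds hx)) j).eq_of_nhds
  have h2 : ContDiffOn ℝ (⌊β⌋₊ : ℕ) v U ↔ ContDiffOn ℝ (⌊β⌋₊ : ℕ) w U := contDiffOn_congr h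
  have e1 : ∀ j : ℕ, (⨆ x ∈ U, ‖iteratedFDeriv ℝ j v x‖ₑ) = ⨆ x ∈ U, ‖iteratedFDeriv ℝ j w x‖ₑ := fun j =>
    iSup_congr fun x => iSup_congr fun hx => by rw [h1 j x hx]
  have e2 : (⨆ x ∈ U, ⨆ y ∈ U, ‖iteratedFDeriv ℝ ⌊β⌋₊ v x - iteratedFDeriv ℝ ⌊β⌋₊ v y‖ₑ /
          ‖x - y‖ₑ ^ (β - (⌊β⌋₊ : ℝ))) = ⨆ x ∈ U, ⨆ y ∈ U,
          ‖iteratedFDeriv ℝ ⌊β⌋₊ w x - iteratedFDeriv ℝ ⌊β⌋₊ w y‖ₑ / ‖x - y‖ₑ ^ (β - (⌊β⌋₊ : ℝ)) :=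
    iSup_congr fun x => iSup_congr fun hx => iSup_congr fun y => iSup_congr fun hy => by rw [h1 _ x hx, h1 _ y hy]
  by_cases hc : ContDiffOn ℝ (⌊β⌋₊ : ℕ) w U
  · rw [holderNorm, if_pos (h2.2 hc), holderNorm, if_pos hc, e2]
    simp only [e1]
  · rw [holderNorm, if_neg (mt h2.1 hc), holderNorm, if_neg hc]

/-- The series of functions with geometrically controlled derivatives. -/
lemma exists_holderNorm_add_tsum_le {β β' : ℝ} (hβ' : 0 < β') (hβ : β' ≤ β) (hk : (⌊β'⌋₊ : ℝ) < β) :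
    ∃ C : ℝ, 0 ≤ C ∧ ∀ (S : E → ℝ) (W : ℕ → E → ℝ) (B : ℝ), 0 ≤ B → ContDiff ℝ ∞ S → (∀ j, ContDiff ℝ ∞ (W j)) →
      (∀ l ≤ ⌊β'⌋₊ + 1, ∀ x, ‖iteratedFDeriv ℝ l S x‖ ≤ B) →
      (∀ l ≤ ⌊β'⌋₊ + 1, ∀ j x, ‖iteratedFDeriv ℝ l (W j) x‖ ≤ B * ((1 / 2 : ℝ) ^ j) ^ (β - l)) →
      ∀ U : Set E, holderNorm β' U (fun x => S x + ∑' j, W j x) ≤ ENNReal.ofReal (C * B) := by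
  set k := ⌊β'⌋₊ with hkdef
  set γ : ℝ := β' - k with hγ
  have hγ0 : 0 ≤ γ := sub_nonneg.2 (Nat.floor_le hβ'.le)
  have hγ1 : γ < 1 := by have := Nat.lt_floor_add_one β'; rw [hγ]; linarith
  have hgeo : ∀ e : ℝ, 0 < e → Summable fun j : ℕ => ((1 / 2 : ℝ) ^ j) ^ e := fun e he => by
    have : ∀ j : ℕ, ((1 / 2 : ℝ) ^ j) ^ e = ((1 / 2 : ℝ) ^ e) ^ j := fun j => by
      rw [← Real.rpow_natCast, ← Real.rpow_mul (by norm_num), mul_comm, Real.rpow_mul (by norm_num), Real.rpow_natCast]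
    simp only [this]
    exact summable_geometric_of_lt_one (by positivity) (Real.rpow_lt_one (by norm_num) (by norm_num) he)
  set G : ℝ := ∑' j : ℕ, ((1 / 2 : ℝ) ^ j) ^ (β - k) with hG
  have hG0 : 0 ≤ G := tsum_nonneg (g := fun j : ℕ => ((1 / 2 : ℝ) ^ j) ^ (β - k)) fun j => by positivity
  -- For integer `β'` one has `γ = 0`, the last seminorm is an oscillation bounded by suprema, and
  -- no dyadic summation is needed.
  obtain ⟨D, hD, hsum⟩ : ∃ D : ℝ, 0 ≤ D ∧ (0 < γ → ∀ t : ℝ, 0 < t → ∀ N : ℕ,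
      ∑ l ∈ Finset.range N, min (((1 / 2 : ℝ) ^ l) ^ γ) (((1 / 2 : ℝ) ^ l) ^ (-(1 - γ)) * t ^ (γ + (1 - γ))) ≤ D * t ^ γ) := by
    by_cases h : 0 < γ
    · obtain ⟨D, hD, h2⟩ := exists_sum_min_rpow_le h (by linarith : 0 < 1 - γ)
      exact ⟨D, hD, fun _ => h2⟩
    · exact ⟨0, le_rfl, fun h' => absurd h' h⟩
  refine ⟨(k + 2 : ℕ) * (2 * (1 + G) + 2 + 2 * D), by positivity, fun S W B hB hS hW hSb hWb U => ?_⟩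
  have hr : ∀ j : ℕ, (0:ℝ) < (1 / 2 : ℝ) ^ j := fun j => by positivity
  have hr1 : ∀ j : ℕ, (1 / 2 : ℝ) ^ j ≤ 1 := fun j => pow_le_one₀ (by norm_num) (by norm_num)
  have hWk : ∀ l ≤ k, ∀ j x, ‖iteratedFDeriv ℝ l (W j) x‖ ≤ B * ((1 / 2 : ℝ) ^ j) ^ (β - k) := fun l hl j x => by
    refine (hWb l (by omega) j x).trans (mul_le_mul_of_nonneg_left ?_ hB)
    refine Real.rpow_le_rpow_of_exponent_ge (hr j) (hr1 j) ?_
    have : (l : ℝ) ≤ k := by exact_mod_cast hl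
    linarith
  have hWc : ∀ j, ContDiff ℝ k (W j) := fun j => (hW j).of_le (by exact_mod_cast le_top)
  have hSc : ContDiff ℝ k S := hS.of_le (by exact_mod_cast le_top)
  have hsumk := (hgeo (β - k) (by linarith)).mul_left B
  have hv : ∀ l : ℕ, (l : ℕ∞) ≤ k → Summable fun j : ℕ => B * ((1 / 2 : ℝ) ^ j) ^ (β - k) := fun l _ => hsumk
  have hb : ∀ (l : ℕ) (j : ℕ) (x : E), (l : ℕ∞) ≤ k → ‖iteratedFDeriv ℝ l (W j) x‖ ≤ B * ((1 / 2 : ℝ) ^ j) ^ (β - k) :=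
    fun l j x hl => hWk l (by exact_mod_cast hl) j x
  have hT : ContDiff ℝ k fun x => ∑' j, W j x := contDiff_tsum (N := (k : ℕ∞)) hWc hv hb
  have hder : ∀ l ≤ k, ∀ x, iteratedFDeriv ℝ l (fun x => S x + ∑' j, W j x) x =
      iteratedFDeriv ℝ l S x + ∑' j, iteratedFDeriv ℝ l (W j) x := fun l hl x => by
    have hlk : ((l : ℕ) : ℕ∞ω) ≤ (k : ℕ) := by exact_mod_cast hl
    have h1 := iteratedFDeriv_add_apply (x := x) (hSc.of_le hlk).contDiffAt (hT.of_le hlk).contDiffAt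
    have h2 := iteratedFDeriv_tsum_apply (N := (k : ℕ∞)) hWc hv hb (k := l) (by exact_mod_cast hl) x
    rw [← h2]
    exact h1
  have hs : ∀ l ≤ k, ∀ x, Summable fun j => iteratedFDeriv ℝ l (W j) x := fun l hl x =>
    Summable.of_norm_bounded hsumk fun j => hWk l hl j x
  have hbd : ∀ l ≤ k, ∀ x, ‖iteratedFDeriv ℝ l (fun x => S x + ∑' j, W j x) x‖ ≤ (1 + G) * B := fun l hl x => by
    rw [hder l hl]
    refine (norm_add_le _ _).trans ?_
    have h1 := tsum_of_norm_bounded hsumk.hasSum fun j => hWk l hl j x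
    rw [tsum_mul_left] at h1
    have := hSb l (by omega) x
    rw [← hG] at h1
    linarith
  set C : ℝ := 2 * (1 + G) + 2 + 2 * D with hC
  have hCB : (1 + G) * B ≤ C * B := by gcongr; rw [hC]; linarith
  have hmain : ∀ x ∈ U, ∀ y ∈ U, ‖iteratedFDeriv ℝ k (fun x => S x + ∑' j, W j x) x -
      iteratedFDeriv ℝ k (fun x => S x + ∑' j, W j x) y‖ ≤ C * B * ‖x - y‖ ^ γ := by
    intro x _ y _
    rcases hγ0.eq_or_lt with h0 | hpos
    · rw [← h0, Real.rpow_zero, mul_one]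
      refine (norm_sub_le _ _).trans ((add_le_add (hbd k le_rfl x) (hbd k le_rfl y)).trans ?_)
      rw [hC]
      nlinarith
    · by_cases hxy : x = y
      · rw [hxy, sub_self, norm_zero]; positivity
      set t : ℝ := ‖x - y‖ with ht
      have ht0 : 0 < t := norm_pos_iff.2 (sub_ne_zero.2 hxy)
      have hmv : ∀ (f : E → ℝ), ContDiff ℝ ∞ f → ∀ c : ℝ, (∀ x, ‖iteratedFDeriv ℝ (k + 1) f x‖ ≤ c) →
          ‖iteratedFDeriv ℝ k f x - iteratedFDeriv ℝ k f y‖ ≤ c * t := fun f hf c hc =>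
        Convex.norm_image_sub_le_of_norm_fderiv_le (𝕜 := ℝ) (f := iteratedFDeriv ℝ k f) (s := univ)
          (fun x _ => (hf.differentiable_iteratedFDeriv (m := k) (by exact_mod_cast ENat.coe_lt_top k)) x)
          (fun x _ => by rw [norm_fderiv_iteratedFDeriv]; exact hc x) convex_univ (mem_univ y) (mem_univ x)
      have hS1 : ‖iteratedFDeriv ℝ k S x - iteratedFDeriv ℝ k S y‖ ≤ 2 * B * t ^ γ := by
        rcases le_total t 1 with h1 | h1
        · refine (hmv S hS B (hSb (k + 1) le_rfl)).trans ?_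
          have : t ≤ t ^ γ := by
            conv_lhs => rw [← Real.rpow_one t]
            exact Real.rpow_le_rpow_of_exponent_ge ht0 h1 hγ1.le
          nlinarith
        · have : 1 ≤ t ^ γ := Real.one_le_rpow h1 hγ0
          refine (norm_sub_le _ _).trans ((add_le_add (hSb k (by omega) x) (hSb k (by omega) y)).trans ?_)
          nlinarith
      -- Two bounds for one term: the `k`-th derivative itself, or the mean value theorem with the
      -- derivative of order `k + 1`. The minimum is summed by `exists_sum_min_rpow_le` with `p = γ`
      -- and `q = 1 - γ`.
      have hW1 : ∀ j, ‖iteratedFDeriv ℝ k (W j) x - iteratedFDeriv ℝ k (W j) y‖ ≤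
          2 * B * min (((1 / 2 : ℝ) ^ j) ^ γ) (((1 / 2 : ℝ) ^ j) ^ (-(1 - γ)) * t ^ (γ + (1 - γ))) := by
        intro j
        have e1 : ((1 / 2 : ℝ) ^ j) ^ (β - k) ≤ ((1 / 2 : ℝ) ^ j) ^ γ :=
          Real.rpow_le_rpow_of_exponent_ge (hr j) (hr1 j) (by rw [hγ]; linarith)
        have e2 : ((1 / 2 : ℝ) ^ j) ^ (β - (k + 1 : ℕ)) ≤ ((1 / 2 : ℝ) ^ j) ^ (-(1 - γ)) :=
          Real.rpow_le_rpow_of_exponent_ge (hr j) (hr1 j) (by rw [hγ]; push_cast; linarith)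
        rw [mul_min_of_nonneg _ _ (by positivity)]
        refine le_min ?_ ?_
        · refine (norm_sub_le _ _).trans ((add_le_add (hWk k le_rfl j x) (hWk k le_rfl j y)).trans ?_)
          nlinarith
        · refine (hmv (W j) (hW j) _ (hWb (k + 1) le_rfl j)).trans ?_
          rw [add_sub_cancel, Real.rpow_one]
          have : 0 < ((1 / 2 : ℝ) ^ j) ^ (-(1 - γ)) := by positivity
          calc _ ≤ B * ((1 / 2 : ℝ) ^ j) ^ (-(1 - γ)) * t := by gcongr
            _ ≤ 2 * (B * ((1 / 2 : ℝ) ^ j) ^ (-(1 - γ)) * t) := by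
              have : 0 ≤ B * ((1 / 2 : ℝ) ^ j) ^ (-(1 - γ)) * t := by positivity
              linarith
            _ = _ := by ring
      have hT1 : ‖(∑' j, iteratedFDeriv ℝ k (W j) x) - ∑' j, iteratedFDeriv ℝ k (W j) y‖ ≤ 2 * D * B * t ^ γ := by
        have h2 := ((hs k le_rfl x).hasSum.sub (hs k le_rfl y).hasSum).tendsto_sum_nat
        refine le_of_tendsto h2.norm (Eventually.of_forall fun N => ?_)
        refine (norm_sum_le _ _).trans ((Finset.sum_le_sum fun j _ => hW1 j).trans ?_)
        rw [← Finset.mul_sum]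
        have := hsum hpos t ht0 N
        calc _ ≤ 2 * B * (D * t ^ γ) := by gcongr
          _ = _ := by ring
      rw [hder k le_rfl, hder k le_rfl, add_sub_add_comm]
      refine (norm_add_le _ _).trans ((add_le_add hS1 hT1).trans ?_)
      have h5 : 0 ≤ t ^ γ := by positivity
      have h6 : 0 ≤ B * t ^ γ := by positivity
      have h7 : 0 ≤ 2 * (1 + G) * (B * t ^ γ) := by positivity
      rw [hC]
      linarith
  have := holderNorm_le_ofReal (β := β') (B := C * B) (U := U) (by positivity) (hSc.add hT).contDiffOn
    (fun j hj x _ => (hbd j hj x).trans hCB) hmain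
  rw [mul_assoc]
  exact this

end HolderNorm

/-! ### From the rate of approximation by averages to Hölder regularity. -/

section Inverse

open Module

variable {E : Type} [NormedAddCommGroup E] [InnerProductSpace ℝ E] [FiniteDimensional ℝ E]
  [MeasurableSpace E] [BorelSpace E]

lemma coe_sum_apply {ι : Type*} (S : Finset ι) (f : ι → bddMeas E) (x : E) :
    (∑ i ∈ S, f i).1 x = ∑ i ∈ S, (f i).1 x := by
  rw [Submodule.coe_sum, Finset.sum_apply]

lemma approx_contDiff (m : ℕ) (u : bddMeas E) {r : ℝ} (hr : 0 < r) : ContDiff ℝ ∞ (approx m r u).1 := by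
  rw [approx_eq, Module.End.mul_apply]
  exact avg_contDiff _ hr

lemma exists_norm_iteratedFDeriv_approx_le (m l : ℕ) : ∃ C : ℝ, 0 ≤ C ∧ ∀ (u : bddMeas E) (r B : ℝ) (x : E), 0 < r →
    (∀ z ∈ Metric.closedBall x ((m + 1) * r), |u.1 z| ≤ B) →
    ‖iteratedFDeriv ℝ l (approx m r u).1 x‖ ≤ C * (r ^ l)⁻¹ * B := by
  obtain ⟨C, hC, h⟩ := exists_norm_iteratedFDeriv_avg_le (E := E) l
  refine ⟨C * (m * 2 ^ m), by positivity, fun u r B x hr hu => ?_⟩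
  have hB : 0 ≤ B := (abs_nonneg _).trans (hu x (Metric.mem_closedBall_self (by positivity)))
  rw [approx_eq, Module.End.mul_apply]
  refine (h _ r (m * 2 ^ m * B) x hr fun z hz => ?_).trans (le_of_eq (by ring))
  rw [LinearMap.sum_apply, coe_sum_apply]
  refine (Finset.abs_sum_le_sum_abs _ _).trans ?_
  calc _ ≤ ∑ j ∈ Finset.range m, 2 ^ m * B := by
        refine Finset.sum_le_sum fun j hj => ?_
        have hjm : j ≤ m := (Finset.mem_range.1 hj).le
        refine (abs_one_sub_avg_pow_le hr.le j (B := B) fun w hw => hu w ?_).trans ?_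
        · rw [mem_closedBall_iff_norm] at *
          have h1 := norm_sub_le_norm_sub_add_norm_sub w z x
          have h2 : (j : ℝ) * r ≤ m * r := by gcongr
          linarith
        · gcongr
          norm_num
    _ = _ := by simp; ring

lemma norm_iteratedFDeriv_mul_le_of_le {χ w : E → ℝ} (hχ : ContDiff ℝ ∞ χ) (hw : ContDiff ℝ ∞ w) {N : ℕ} {P B : ℝ}
    {x : E} (hP : ∀ i ≤ N, ‖iteratedFDeriv ℝ i χ x‖ ≤ P) (hB : ∀ i ≤ N, ‖iteratedFDeriv ℝ i w x‖ ≤ B) :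
    ‖iteratedFDeriv ℝ N (fun x => χ x * w x) x‖ ≤ 2 ^ N * P * B := by
  have hle : ((N : ℕ∞ω)) ≤ (∞ : ℕ∞ω) := by exact_mod_cast le_top
  have hP0 : 0 ≤ P := (norm_nonneg _).trans (hP 0 (Nat.zero_le _))
  refine (norm_iteratedFDeriv_mul_le hχ hw x hle).trans ?_
  calc _ ≤ ∑ i ∈ Finset.range (N + 1), (N.choose i : ℝ) * (P * B) := by
        refine Finset.sum_le_sum fun i hi => ?_
        rw [mul_assoc]
        gcongr
        · exact hP i (Nat.lt_succ_iff.1 (Finset.mem_range.1 hi))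
        · exact hB _ (by omega)
    _ = _ := by
        rw [← Finset.sum_mul, mul_assoc]
        congr 1
        exact_mod_cast Nat.sum_range_choose N

/-- The inverse theorem of approximation: a function which is approximated by its averages to the
order `β` is Hölder continuous with exponent `β`. -/
lemma exists_holderNorm_le_of_approx {β β' : ℝ} (hβ' : 0 < β') (hβ : β' ≤ β) (hk : (⌊β'⌋₊ : ℝ) < β)
    (m i₀ : ℕ) {R R' : ℝ} (hR' : 0 < R') (hR : R' < R) : ∃ C : ℝ, 0 ≤ C ∧ ∀ (u : bddMeas E) (A : ℝ), (∀ x, |u.1 x| ≤ A) →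
      (∀ i ≥ i₀, ∀ x ∈ Metric.ball (0:E) R, |(((1 - avg ((1 / 2 : ℝ) ^ i)) ^ m) u : bddMeas E).1 x| ≤ A * ((1 / 2 : ℝ) ^ i) ^ β) →
      holderNorm β' (Metric.ball 0 R') u.1 ≤ ENNReal.ofReal (C * A) := by
  have hβ0 : 0 < β := hβ'.trans_le hβ
  set k := ⌊β'⌋₊ with hkdef
  obtain ⟨D, hD, hser⟩ := exists_holderNorm_add_tsum_le (E := E) hβ' hβ hk
  choose Cap hCap0 hCap using fun l => exists_norm_iteratedFDeriv_approx_le (E := E) m l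
  set R₂ : ℝ := (R + R') / 2 with hR₂
  -- The starting scale is so small that the averages at points of the ball of radius `R₂` only see
  -- the ball of radius `R`, where the hypothesis holds.
  obtain ⟨i₁, hi₁, hi₁R⟩ : ∃ i₁ ≥ i₀, (m + 1) * (1 / 2 : ℝ) ^ i₁ ≤ R - R₂ := by
    have h1 : Tendsto (fun i : ℕ => ((m:ℝ) + 1) * (1 / 2 : ℝ) ^ i) atTop (𝓝 0) := by
      simpa using (tendsto_pow_atTop_nhds_zero_of_lt_one (r := (1 / 2 : ℝ)) (by norm_num) (by norm_num)).const_mul ((m:ℝ) + 1)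
    have h2 : 0 < R - R₂ := by rw [hR₂]; linarith
    obtain ⟨i, hi⟩ := ((h1.eventually (gt_mem_nhds h2)).and (eventually_ge_atTop i₀)).exists
    exact ⟨i, hi.2, hi.1.le⟩
  -- The bounds on the increments are local; `χ`, equal to `1` where the conclusion is wanted, turns
  -- them into global ones for the series lemma.
  let χ : ContDiffBump (0 : E) := ⟨R', (R' + R₂) / 2, hR', by rw [hR₂]; linarith⟩
  obtain ⟨P, hP0, hP⟩ := exists_iteratedFDeriv_bound_of_hasCompactSupport (χ.contDiff (n := ⊤)) χ.hasCompactSupport (k + 1)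
  set ρ : ℝ := (1 / 2 : ℝ) ^ i₁ with hρ
  have hρ0 : 0 < ρ := by positivity
  have hρ1 : ρ ≤ 1 := pow_le_one₀ (by norm_num) (by norm_num)
  -- a uniform constant for all orders up to `k + 1`
  set Q : ℝ := ∑ l ∈ Finset.range (k + 2), Cap l with hQ
  have hCapQ : ∀ l ≤ k + 1, Cap l ≤ Q := fun l hl =>
    Finset.single_le_sum (f := Cap) (fun i _ => hCap0 i) (Finset.mem_range.2 (by omega))
  have hQ0 : 0 ≤ Q := (hCap0 0).trans (hCapQ 0 (by omega))
  set B₁ : ℝ := Q * (ρ ^ (k + 1))⁻¹ with hB₁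
  set B₂ : ℝ := 2 ^ (k + 1) * P * (2 * 2 ^ (k + 1) * Q * (ρ ^ (k + 1))⁻¹) with hB₂
  refine ⟨D * (B₁ + B₂), by positivity, fun u A huA happ => ?_⟩
  have hA : 0 ≤ A := (abs_nonneg _).trans (huA 0)
  set r : ℕ → ℝ := fun i => (1 / 2 : ℝ) ^ i with hr
  have hr0 : ∀ i, 0 < r i := fun i => by positivity
  set g : ℕ → bddMeas E := fun i => ((1 - avg (r i)) ^ m) u with hg
  set w : ℕ → bddMeas E := fun j => approx m (r (i₁ + j + 1)) u - approx m (r (i₁ + j)) u with hw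
  have hrs : ∀ i, r (i + 1) = r i / 2 := fun i => by simp only [hr]; ring
  have hri : ∀ j, r (i₁ + j) = ρ * r j := fun j => by simp only [hr, hρ]; ring
  have hwsm : ∀ j, ContDiff ℝ ∞ (w j).1 := fun j =>
    (approx_contDiff m u (hr0 _)).sub (approx_contDiff m u (hr0 _))
  have hwb : ∀ l ≤ k + 1, ∀ j, ∀ x ∈ Metric.ball (0:E) R₂, ‖iteratedFDeriv ℝ l (w j).1 x‖ ≤
      2 * 2 ^ (k + 1) * Q * (ρ ^ (k + 1))⁻¹ * A * r j ^ (β - l) := by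
    intro l hl j x hx
    -- Errors of size `A a^β` are smoothed at a scale comparable to `a`, so `l` derivatives cost
    -- `a^(-l)` and the increment is of size `A a^(β-l)`.
    have e : w j = approx m (r (i₁ + j + 1)) (g (i₁ + j)) - approx m (r (i₁ + j)) (g (i₁ + j + 1)) :=
      approx_sub_approx m _ _ u
    set a := r (i₁ + j) with ha
    have ha0 : 0 < a := hr0 _
    have hrle : a ≤ ρ := by
      rw [ha, hri]; exact mul_le_of_le_one_right hρ0.le (pow_le_one₀ (by norm_num) (by norm_num))
    have hsub : ∀ z ∈ Metric.closedBall x ((m + 1) * a), z ∈ Metric.ball (0:E) R := by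
      intro z hz
      rw [mem_closedBall_iff_norm] at hz
      rw [mem_ball_zero_iff] at hx ⊢
      have h1 : ‖z‖ ≤ ‖z - x‖ + ‖x‖ := by simpa using norm_add_le (z - x) x
      have h2 : ((m:ℝ) + 1) * a ≤ (m + 1) * ρ := by gcongr
      linarith
    have hg1 : ∀ z ∈ Metric.closedBall x ((m + 1) * a), |(g (i₁ + j)).1 z| ≤ A * a ^ β := fun z hz =>
      happ (i₁ + j) (by omega) z (hsub z hz)
    have hg2 : ∀ z ∈ Metric.closedBall x ((m + 1) * a), |(g (i₁ + j + 1)).1 z| ≤ A * a ^ β := fun z hz => by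
      refine (happ (i₁ + j + 1) (by omega) z (hsub z hz)).trans ?_
      refine mul_le_mul_of_nonneg_left (Real.rpow_le_rpow (by positivity) ?_ hβ0.le) hA
      have := hrs (i₁ + j)
      simp only [hr] at this ha ⊢
      rw [this, ← ha]; linarith
    have hrs' : r (i₁ + j + 1) = a / 2 := hrs _
    have b1 := hCap l (g (i₁ + j)) (r (i₁ + j + 1)) (A * a ^ β) x (hr0 _) fun z hz =>
      hg1 z (Metric.closedBall_subset_closedBall (by rw [hrs']; gcongr; linarith) hz)
    have b2 := hCap l (g (i₁ + j + 1)) a (A * a ^ β) x ha0 hg2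
    have s1 : ContDiff ℝ l (approx m (r (i₁ + j + 1)) (g (i₁ + j))).1 := (approx_contDiff m _ (hr0 _)).of_le (by exact_mod_cast le_top)
    have s2 : ContDiff ℝ l (approx m a (g (i₁ + j + 1))).1 := (approx_contDiff m _ ha0).of_le (by exact_mod_cast le_top)
    have e2 : iteratedFDeriv ℝ l (w j).1 x = iteratedFDeriv ℝ l (approx m (r (i₁ + j + 1)) (g (i₁ + j))).1 x -
        iteratedFDeriv ℝ l (approx m a (g (i₁ + j + 1))).1 x := by
      rw [e]
      exact iteratedFDeriv_sub_apply s1.contDiffAt s2.contDiffAt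
    rw [e2]
    refine (norm_sub_le _ _).trans ((add_le_add b1 b2).trans ?_)
    rw [hrs', div_pow, inv_div]
    have e3 : a ^ β * (a ^ l)⁻¹ = ρ ^ β * (ρ ^ l)⁻¹ * r j ^ (β - l) := by
      rw [ha, hri, Real.mul_rpow hρ0.le (hr0 j).le, mul_pow, Real.rpow_sub (hr0 j), Real.rpow_natCast]
      have := pow_pos (hr0 j) l
      field_simp
    have e4 : ρ ^ β * (ρ ^ l)⁻¹ ≤ (ρ ^ (k + 1))⁻¹ := by
      have h1 : ρ ^ β ≤ 1 := Real.rpow_le_one hρ0.le hρ1 hβ0.le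
      have h2 : (ρ ^ l)⁻¹ ≤ (ρ ^ (k + 1))⁻¹ := by
        gcongr ?_⁻¹
        exact pow_le_pow_of_le_one hρ0.le hρ1 hl
      calc _ ≤ 1 * (ρ ^ (k + 1))⁻¹ := by gcongr
        _ = _ := one_mul _
    have e5 : (2:ℝ) ^ l + 1 ≤ 2 * 2 ^ (k + 1) := by
      have h1 : (2:ℝ) ^ l ≤ 2 ^ (k + 1) := pow_le_pow_right₀ (by norm_num) hl
      have h2 : (1:ℝ) ≤ 2 ^ (k + 1) := one_le_pow₀ (by norm_num)
      linarith
    have hrj : 0 ≤ r j ^ (β - l) := Real.rpow_nonneg (hr0 j).le _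
    calc _ = Cap l * (2 ^ l + 1) * A * (a ^ β * (a ^ l)⁻¹) := by field_simp
      _ = Cap l * (2 ^ l + 1) * A * (ρ ^ β * (ρ ^ l)⁻¹ * r j ^ (β - l)) := by rw [e3]
      _ ≤ Q * (2 * 2 ^ (k + 1)) * A * ((ρ ^ (k + 1))⁻¹ * r j ^ (β - l)) := by
        gcongr
        exact hCapQ l hl
      _ = _ := by ring
  have hχ0 : ∀ l, ∀ j, ∀ x, x ∉ Metric.ball (0:E) R₂ → iteratedFDeriv ℝ l (fun x => χ x * (w j).1 x) x = 0 := by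
    intro l j x hx
    refine image_eq_zero_of_notMem_tsupport fun hm => hx ?_
    have h1 := tsupport_iteratedFDeriv_subset (𝕜 := ℝ) l hm
    have h2 := tsupport_mul_subset_left h1
    rw [χ.tsupport_eq, mem_closedBall_zero_iff] at h2
    rw [mem_ball_zero_iff]
    refine h2.trans_lt ?_
    change (R' + R₂) / 2 < R₂
    rw [hR₂]; linarith
  have hWb : ∀ l ≤ k + 1, ∀ j x, ‖iteratedFDeriv ℝ l (fun x => χ x * (w j).1 x) x‖ ≤
      (B₁ + B₂) * A * ((1 / 2 : ℝ) ^ j) ^ (β - l) := by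
    intro l hl j x
    have hrj : 0 ≤ r j ^ (β - l) := Real.rpow_nonneg (hr0 j).le _
    have hB1 : 0 ≤ B₁ := by positivity
    by_cases hx : x ∈ Metric.ball (0:E) R₂
    · have h1 := norm_iteratedFDeriv_mul_le_of_le (N := l) (χ.contDiff (n := ⊤)) (hwsm j) (x := x)
        (P := P) (B := 2 * 2 ^ (k + 1) * Q * (ρ ^ (k + 1))⁻¹ * A * r j ^ (β - l)) (fun i hi => hP i (by omega) x) fun i hi => by
          refine (hwb i (by omega) j x hx).trans ?_
          refine mul_le_mul_of_nonneg_left ?_ (by positivity)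
          refine Real.rpow_le_rpow_of_exponent_ge (hr0 j) (pow_le_one₀ (by norm_num) (by norm_num)) ?_
          have : (i:ℝ) ≤ l := by exact_mod_cast hi
          linarith
      refine h1.trans ?_
      calc _ ≤ 2 ^ (k + 1) * P * (2 * 2 ^ (k + 1) * Q * (ρ ^ (k + 1))⁻¹ * A * r j ^ (β - l)) := by
            gcongr
            norm_num
        _ = B₂ * A * r j ^ (β - l) := by rw [hB₂]; ring
        _ ≤ _ := by
          refine mul_le_mul_of_nonneg_right (mul_le_mul_of_nonneg_right ?_ hA) hrj
          linarith
    · rw [hχ0 l j x hx, norm_zero]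
      positivity
  have hSb : ∀ l ≤ k + 1, ∀ x, ‖iteratedFDeriv ℝ l (approx m ρ u).1 x‖ ≤ (B₁ + B₂) * A := by
    intro l hl x
    refine (hCap l u ρ A x hρ0 fun z _ => huA z).trans ?_
    have h2 : (ρ ^ l)⁻¹ ≤ (ρ ^ (k + 1))⁻¹ := by
      gcongr ?_⁻¹
      exact pow_le_pow_of_le_one hρ0.le hρ1 hl
    have hB2 : 0 ≤ B₂ := by positivity
    calc _ ≤ Q * (ρ ^ (k + 1))⁻¹ * A := by
          gcongr
          exact hCapQ l hl
      _ ≤ _ := by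
        refine mul_le_mul_of_nonneg_right ?_ hA
        linarith
  have hmain := hser (approx m ρ u).1 (fun j x => χ x * (w j).1 x) ((B₁ + B₂) * A) (by positivity)
    (approx_contDiff m u hρ0) (fun j => (χ.contDiff (n := ⊤)).mul (hwsm j)) hSb hWb (Metric.ball 0 R')
  rw [← mul_assoc] at hmain
  rw [holderNorm_congr Metric.isOpen_ball (v := u.1) fun x hx => ?_]
  · exact hmain
  have hχ1 : χ x = 1 := χ.one_of_mem_closedBall (Metric.ball_subset_closedBall hx)
  simp only [hχ1, one_mul]
  have hxR : x ∈ Metric.ball (0:E) R := Metric.ball_subset_ball hR.le hx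
  have hgeo : Summable fun j : ℕ => (B₁ + B₂) * A * ((1 / 2 : ℝ) ^ j) ^ (β - (0:ℕ)) := by
    have : ∀ j : ℕ, ((1 / 2 : ℝ) ^ j) ^ (β - (0:ℕ)) = ((1 / 2 : ℝ) ^ (β - (0:ℕ))) ^ j := fun j => by
      rw [← Real.rpow_natCast, ← Real.rpow_mul (by norm_num), mul_comm, Real.rpow_mul (by norm_num), Real.rpow_natCast]
    simp only [this]
    exact (summable_geometric_of_lt_one (by positivity) (Real.rpow_lt_one (by norm_num) (by norm_num)
      (by simpa using hβ0))).mul_left _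
  have hsum : Summable fun j => (w j).1 x := Summable.of_norm_bounded hgeo fun j => by
    have := hWb 0 (by omega) j x
    rw [norm_iteratedFDeriv_zero, hχ1, one_mul] at this
    exact this
  have htel : ∀ N, ∑ j ∈ Finset.range N, (w j).1 x = (approx m (r (i₁ + N)) u).1 x - (approx m ρ u).1 x := by
    intro N
    have h1 : ∀ j, (w j).1 x = (approx m (r (i₁ + (j + 1))) u).1 x - (approx m (r (i₁ + j)) u).1 x := fun j => rfl
    simp only [h1]
    exact Finset.sum_range_sub (fun j => (approx m (r (i₁ + j)) u).1 x) N
  -- The errors tend to zero at every point of the ball, so the telescoping series recovers `u`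
  -- pointwise, not just almost everywhere.
  have hlim : Tendsto (fun N => (approx m (r (i₁ + N)) u).1 x) atTop (𝓝 (u.1 x)) := by
    have h1 : ∀ N, (approx m (r (i₁ + N)) u).1 x = u.1 x - (g (i₁ + N)).1 x := fun N => rfl
    simp only [h1]
    have h2 : Tendsto (fun N => (g (i₁ + N)).1 x) atTop (𝓝 0) := by
      refine squeeze_zero_norm (a := fun N : ℕ => A * r (i₁ + N) ^ β) (fun N => happ (i₁ + N) (by omega) x hxR) ?_
      have h3 : Tendsto (fun N => r (i₁ + N)) atTop (𝓝 0) := by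
        have := tendsto_pow_atTop_nhds_zero_of_lt_one (r := (1 / 2 : ℝ)) (by norm_num) (by norm_num)
        exact (tendsto_add_atTop_iff_nat (f := r) i₁).2 this |>.congr fun N => by rw [add_comm]
      have h4 := (h3.rpow_const (Or.inr hβ0.le) (p := β)).const_mul A
      rwa [Real.zero_rpow hβ0.ne', mul_zero] at h4
    simpa using h2.const_sub (u.1 x)
  have h5 := hsum.hasSum.tendsto_sum_nat
  simp only [htel] at h5
  have h6 := tendsto_nhds_unique h5 (hlim.sub_const _)
  rw [h6]; ring

end Inverse

/-! ### Iterated finite differences of Hölder functions and of products. -/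

section Differences

variable {E : Type} [NormedAddCommGroup E] [NormedSpace ℝ E]

section Algebra

variable {F : Type} [NormedAddCommGroup F]

/-- The finite difference with the step `h`. -/
def fdiff (h : E) (f : E → F) (x : E) : F := f (x + h) - f x

/-- Iterated finite differences. -/
def fdiffs (L : List E) (f : E → F) : E → F := L.foldr fdiff f

lemma fdiffs_nil (f : E → F) : fdiffs [] f = f := rfl

lemma fdiffs_cons (h : E) (L : List E) (f : E → F) (x : E) :
    fdiffs (h :: L) f x = fdiffs L f (x + h) - fdiffs L f x := rfl

lemma fdiffs_append (L L' : List E) (f : E → F) : fdiffs (L ++ L') f = fdiffs L (fdiffs L' f) := by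
  simp [fdiffs]

lemma fdiffs_concat (L : List E) (h : E) (f : E → F) : fdiffs (L ++ [h]) f = fdiffs L (fdiff h f) := by
  rw [fdiffs_append]; rfl

lemma fdiffs_add (L : List E) (f g : E → F) (x : E) :
    fdiffs L (fun y => f y + g y) x = fdiffs L f x + fdiffs L g x := by
  induction L generalizing x with
  | nil => rfl
  | cons h L ih => rw [fdiffs_cons, fdiffs_cons, fdiffs_cons, ih, ih]; abel

lemma fdiffs_comp_add (L : List E) (a : E) (f : E → F) (x : E) :
    fdiffs L (fun y => f (y + a)) x = fdiffs L f (x + a) := by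
  induction L generalizing x with
  | nil => rfl
  | cons h L ih => rw [fdiffs_cons, fdiffs_cons, ih, ih, add_right_comm]

lemma fdiffs_const_mul (L : List E) (c : ℝ) (f : E → ℝ) (x : E) :
    fdiffs L (fun y => c * f y) x = c * fdiffs L f x := by
  induction L generalizing x with
  | nil => rfl
  | cons h L ih => rw [fdiffs_cons, fdiffs_cons, ih, ih]; ring

lemma fdiffs_comp_smul (L : List E) (t : ℝ) (f : E → F) (x : E) :
    fdiffs L (fun y => f (t • y)) x = fdiffs (L.map (t • ·)) f (t • x) := by
  induction L generalizing x with
  | nil => rfl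
  | cons h L ih => rw [List.map_cons, fdiffs_cons, fdiffs_cons, ih, ih, smul_add]

lemma mem_closedBall_add {x h : E} {r a : ℝ} (hh : ‖h‖ ≤ r) {z : E} (hz : z ∈ Metric.closedBall x a) :
    z + h ∈ Metric.closedBall x (a + r) := by
  rw [mem_closedBall_iff_norm] at *
  have : z + h - x = (z - x) + h := by abel
  rw [this]
  exact (norm_add_le _ _).trans (add_le_add hz hh)

/-- Iterated differences only depend on the values in a ball. -/
lemma fdiffs_congr {r : ℝ} (hr : 0 ≤ r) {f g : E → F} (L : List E) (hL : ∀ h ∈ L, ‖h‖ ≤ r) : ∀ {x : E},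
    (∀ z ∈ Metric.closedBall x (L.length * r), f z = g z) → fdiffs L f x = fdiffs L g x := by
  induction L with
  | nil => intro x h; exact h x (by simp)
  | cons a L ih =>
    intro x h
    have ha := hL a (List.mem_cons_self)
    have hL' : ∀ h ∈ L, ‖h‖ ≤ r := fun b hb => hL b (List.mem_cons_of_mem _ hb)
    rw [fdiffs_cons, fdiffs_cons]
    have hlen : (((a :: L).length : ℕ) : ℝ) * r = L.length * r + r := by rw [List.length_cons]; push_cast; ring
    rw [hlen] at h
    rw [ih hL' (fun z hz => h z ?_), ih hL' (fun z hz => h z ?_)]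
    · exact Metric.closedBall_subset_closedBall (by linarith) hz
    · rw [mem_closedBall_iff_norm] at hz ⊢
      have e : z - x = z - (x + a) + a := by abel
      rw [e]
      exact (norm_add_le _ _).trans (add_le_add hz ha)

lemma norm_fdiffs_le_sup {r B : ℝ} (hr : 0 ≤ r) {f : E → F} (L : List E) (hL : ∀ h ∈ L, ‖h‖ ≤ r) : ∀ {x : E},
    (∀ z ∈ Metric.closedBall x (L.length * r), ‖f z‖ ≤ B) → ‖fdiffs L f x‖ ≤ 2 ^ L.length * B := by
  induction L with
  | nil => intro x h; simpa [fdiffs_nil] using h x (by simp)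
  | cons a L ih =>
    intro x h
    have ha := hL a (List.mem_cons_self)
    have hL' : ∀ h ∈ L, ‖h‖ ≤ r := fun b hb => hL b (List.mem_cons_of_mem _ hb)
    rw [fdiffs_cons]
    have hlen : (((a :: L).length : ℕ) : ℝ) * r = L.length * r + r := by rw [List.length_cons]; push_cast; ring
    rw [hlen] at h
    have h1 := ih hL' (x := x + a) (fun z hz => h z (by
      rw [mem_closedBall_iff_norm] at hz ⊢
      have e : z - x = z - (x + a) + a := by abel
      rw [e]
      exact (norm_add_le _ _).trans (add_le_add hz ha)))
    have h2 := ih hL' (x := x) (fun z hz => h z (Metric.closedBall_subset_closedBall (by linarith) hz))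
    rw [List.length_cons, pow_succ]
    refine (norm_sub_le _ _).trans ?_
    linarith

end Algebra

/-- Iterated differences are controlled by derivatives. -/
lemma norm_fdiffs_le {r A : ℝ} (hr : 0 ≤ r) {Ω : Set E} (hΩ : IsOpen Ω) (L : List E) (hL : ∀ h ∈ L, ‖h‖ ≤ r) :
    ∀ {F : Type} [NormedAddCommGroup F] [NormedSpace ℝ F] {f : E → F} {x : E},
      ContDiffOn ℝ L.length f Ω → Metric.closedBall x (L.length * r) ⊆ Ω →
      (∀ z ∈ Metric.closedBall x (L.length * r), ‖iteratedFDeriv ℝ L.length f z‖ ≤ A) →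
      ‖fdiffs L f x‖ ≤ A * r ^ L.length := by
  induction L with
  | nil =>
    intro F _ _ f x _ _ h
    simpa [fdiffs_nil] using h x (by simp)
  | cons a L ih =>
    intro F _ _ f x hf hx h
    have ha := hL a (List.mem_cons_self)
    have hL' : ∀ h ∈ L, ‖h‖ ≤ r := fun b hb => hL b (List.mem_cons_of_mem _ hb)
    have hlen : (((a :: L).length : ℕ) : ℝ) * r = L.length * r + r := by rw [List.length_cons]; push_cast; ring
    rw [hlen] at h hx
    have hf1 : ContDiffOn ℝ L.length (fderiv ℝ f) Ω := by
      refine hf.fderiv_of_isOpen hΩ ?_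
      rw [List.length_cons]; push_cast; exact le_rfl
    have hfd : ∀ z ∈ Ω, HasFDerivAt f (fderiv ℝ f z) z := fun z hz =>
      ((hf.contDiffAt (hΩ.mem_nhds hz)).differentiableAt (by rw [List.length_cons]; simp)).hasFDerivAt
    have hsub : ∀ z ∈ Metric.closedBall x r, Metric.closedBall z (L.length * r) ⊆ Metric.closedBall x (L.length * r + r) := by
      intro z hz w hw
      rw [mem_closedBall_iff_norm] at *
      have := norm_sub_le_norm_sub_add_norm_sub w z x
      linarith
    -- the derivative of an iterated difference
    have hder : ∀ (M : List E), (∀ h ∈ M, ‖h‖ ≤ r) → ∀ z, Metric.closedBall z (M.length * r) ⊆ Ω →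
        HasFDerivAt (fdiffs M f) (fdiffs M (fderiv ℝ f) z) z := by
      intro M
      induction M with
      | nil => intro _ z hz; exact hfd z (hz (by simp))
      | cons b M ihM =>
        intro hM z hz
        have hb := hM b (List.mem_cons_self)
        have hM' : ∀ h ∈ M, ‖h‖ ≤ r := fun c hc => hM c (List.mem_cons_of_mem _ hc)
        have hlen' : (((b :: M).length : ℕ) : ℝ) * r = M.length * r + r := by rw [List.length_cons]; push_cast; ring
        rw [hlen'] at hz
        have h1 := ihM hM' (z + b) fun w hw => hz (by
          rw [mem_closedBall_iff_norm] at hw ⊢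
          have e : w - z = w - (z + b) + b := by abel
          rw [e]
          exact (norm_add_le _ _).trans (add_le_add hw hb))
        have h2 := ihM hM' z fun w hw => hz (Metric.closedBall_subset_closedBall (by linarith) hw)
        have h3 : HasFDerivAt (fun y => fdiffs M f (y + b)) (fdiffs M (fderiv ℝ f) (z + b)) z :=
          (hasFDerivAt_comp_add_right b).2 h1
        exact h3.sub h2
    have hmv := Convex.norm_image_sub_le_of_norm_hasFDerivWithin_le (f := fdiffs L f)
      (f' := fun z => fdiffs L (fderiv ℝ f) z) (C := A * r ^ L.length) (s := Metric.closedBall x r) (x := x) (y := x + a)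
      (fun z hz => (hder L hL' z ((hsub z hz).trans hx)).hasFDerivWithinAt)
      (fun z hz => ih hL' hf1 ((hsub z hz).trans hx) fun w hw => by
        rw [norm_iteratedFDeriv_fderiv]
        exact h w (hsub z hz hw)) (convex_closedBall x r) (Metric.mem_closedBall_self hr) (by
        rw [mem_closedBall_iff_norm, add_sub_cancel_left]; exact ha)
    rw [fdiffs_cons, List.length_cons, pow_succ, ← mul_assoc]
    refine hmv.trans ?_
    rw [add_sub_cancel_left]
    refine mul_le_mul_of_nonneg_left ha ?_
    have := (norm_nonneg _).trans (h x (Metric.mem_closedBall_self (by positivity)))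
    positivity

/-- Iterated differences of Hölder functions. -/
lemma abs_fdiffs_le_holderNorm {α r : ℝ} (hα : 0 < α) (hr : 0 < r) (hr1 : r ≤ 1) {U : Set E} (hU : IsOpen U)
    {f : E → ℝ} (hf : holderNorm α U f < ⊤) (L : List E) (hL : ∀ h ∈ L, ‖h‖ ≤ r) {x : E}
    (hx : Metric.closedBall x (L.length * r) ⊆ U) :
    |fdiffs L f x| ≤ 2 ^ L.length * (holderNorm α U f).toReal * r ^ min (L.length : ℝ) α := by
  set k := ⌊α⌋₊ with hk
  set N := (holderNorm α U f).toReal with hN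
  have hN0 : 0 ≤ N := ENNReal.toReal_nonneg
  have hc := contDiffOn_of_holderNorm_lt_top hf
  have hkα : (k:ℝ) ≤ α := Nat.floor_le hα.le
  by_cases hlk : L.length ≤ k
  · have h1 := norm_fdiffs_le hr.le hU L hL (f := f) (x := x) (A := N) (hc.of_le (by exact_mod_cast hlk)) hx
      fun z hz => norm_iteratedFDeriv_le_holderNorm hf hlk (hx hz)
    have h2 : min (L.length : ℝ) α = L.length := min_eq_left (le_trans (by exact_mod_cast hlk) hkα)
    rw [h2, Real.rpow_natCast]
    refine h1.trans ?_
    have : (1:ℝ) ≤ 2 ^ L.length := one_le_pow₀ (by norm_num)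
    have h3 : 0 ≤ N * r ^ L.length := by positivity
    nlinarith
  · push Not at hlk
    -- the last `k + 1` steps
    obtain ⟨L₁, M, a, rfl, hM⟩ : ∃ (L₁ M : List E) (a : E), L = L₁ ++ (M ++ [a]) ∧ M.length = k := by
      obtain ⟨L', a, rfl⟩ := (List.eq_nil_or_concat' L).resolve_left (by rintro rfl; simp at hlk)
      refine ⟨L'.take (L'.length - k), L'.drop (L'.length - k), a, ?_, ?_⟩
      · rw [← List.append_assoc, List.take_append_drop]
      · rw [List.length_append, List.length_singleton] at hlk
        rw [List.length_drop]; omega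
    have ha : ‖a‖ ≤ r := hL a (by simp)
    have hL₁ : ∀ h ∈ L₁, ‖h‖ ≤ r := fun h hh => hL h (by simp [hh])
    have hM' : ∀ h ∈ M, ‖h‖ ≤ r := fun h hh => hL h (by simp [hh])
    have hlen : (((L₁ ++ (M ++ [a])).length : ℕ) : ℝ) = L₁.length + (k + 1) := by simp [hM]
    rw [hlen] at hx ⊢
    have hmin : min ((L₁.length : ℝ) + (k + 1)) α = α := by
      refine min_eq_right ?_
      have := Nat.lt_floor_add_one α
      rw [← hk] at this
      have : (0:ℝ) ≤ L₁.length := Nat.cast_nonneg _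
      linarith
    rw [hmin, fdiffs_append, fdiffs_concat]
    have key : ∀ z ∈ Metric.closedBall x (L₁.length * r), ‖fdiffs M (fdiff a f) z‖ ≤ N * r ^ α := by
      intro z hz
      have hsub : ∀ w ∈ Metric.closedBall z (k * r), w ∈ U ∧ w + a ∈ U := by
        intro w hw
        have h1 : w ∈ Metric.closedBall x ((L₁.length + k) * r) := by
          rw [mem_closedBall_iff_norm] at *
          have := norm_sub_le_norm_sub_add_norm_sub w z x
          linarith
        refine ⟨hx (Metric.closedBall_subset_closedBall ?_ h1), hx ?_⟩
        · gcongr; linarith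
        · have := mem_closedBall_add ha h1
          convert this using 2; ring
      have hball : IsOpen ({w | w ∈ U ∧ w + a ∈ U} : Set E) :=
        hU.inter (hU.preimage (continuous_id.add continuous_const))
      have hcd : ContDiffOn ℝ k (fun y => f (y + a)) {w | w ∈ U ∧ w + a ∈ U} :=
        hc.comp (contDiff_id.add contDiff_const).contDiffOn fun w hw => hw.2
      have hcd2 : ContDiffOn ℝ k f {w | w ∈ U ∧ w + a ∈ U} := hc.mono fun w hw => hw.1
      -- Applied to `f (· + a) - f`, whose `k`-th derivative is at most `N r^(α-k)` by the Hölder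
      -- seminorm; the `k` further differences contribute `r^k`.
      have h2 := norm_fdiffs_le hr.le hball M hM' (f := fdiff a f) (x := z) (A := N * r ^ (α - k))
        (by rw [hM]; exact hcd.sub hcd2) (fun w hw => hsub w (by rwa [hM] at hw)) fun w hw => by
          rw [hM] at hw ⊢
          have hw2 := hsub w hw
          have e : iteratedFDeriv ℝ k (fdiff a f) w = iteratedFDeriv ℝ k f (w + a) - iteratedFDeriv ℝ k f w := by
            rw [← iteratedFDeriv_comp_add_right k a w]
            exact iteratedFDeriv_sub_apply (hcd.contDiffAt (hball.mem_nhds hw2)) (hcd2.contDiffAt (hball.mem_nhds hw2))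
          rw [e]
          refine (norm_iteratedFDeriv_sub_le_holderNorm hf hw2.2 hw2.1).trans ?_
          rw [add_sub_cancel_left]
          gcongr
      refine h2.trans (le_of_eq ?_)
      rw [hM, mul_assoc, ← Real.rpow_natCast, ← Real.rpow_add hr, sub_add_cancel]
    have h3 := norm_fdiffs_le_sup hr.le L₁ hL₁ key
    refine h3.trans ?_
    rw [← mul_assoc]
    have h4 : (2:ℝ) ^ L₁.length ≤ 2 ^ (L₁ ++ (M ++ [a])).length := pow_le_pow_right₀ (by norm_num) (by simp)
    gcongr

/-- Iterated differences of a product. -/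
lemma abs_fdiffs_mul_le {α r : ℝ} (hα : 0 ≤ α) (hr : 0 < r) (hr1 : r ≤ 1) (n : ℕ) : ∀ {p q A B : ℝ} {f g : E → ℝ} {x : E},
    0 ≤ p → 0 ≤ q → 0 ≤ A → 0 ≤ B →
    (∀ L : List E, L.length ≤ n → (∀ h ∈ L, ‖h‖ ≤ r) → ∀ z ∈ Metric.closedBall x ((n - L.length) * r),
      |fdiffs L f z| ≤ A * r ^ min (L.length + p) α) →
    (∀ L : List E, L.length ≤ n → (∀ h ∈ L, ‖h‖ ≤ r) → ∀ z ∈ Metric.closedBall x ((n - L.length) * r),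
      |fdiffs L g z| ≤ B * r ^ min (L.length + q) α) →
    ∀ L : List E, L.length = n → (∀ h ∈ L, ‖h‖ ≤ r) →
      |fdiffs L (fun y => f y * g y) x| ≤ 2 ^ n * (A * B) * r ^ min (n + p + q) α := by
  induction n with
  | zero =>
    intro p q A B f g x hp hq hA hB hf hg L hL _
    obtain rfl := List.length_eq_zero_iff.1 hL
    have h1 := hf [] (by simp) (by simp) x (by simp)
    have h2 := hg [] (by simp) (by simp) x (by simp)
    simp only [fdiffs_nil, List.length_nil, Nat.cast_zero, zero_add] at h1 h2 ⊢
    rw [abs_mul, pow_zero, one_mul]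
    calc _ ≤ (A * r ^ min p α) * (B * r ^ min q α) := by gcongr
      _ = A * B * r ^ (min p α + min q α) := by rw [Real.rpow_add hr]; ring
      _ ≤ _ := by
        -- Here `min p α + min q α ≥ min (p + q) α`, and `r ≤ 1` reverses the order of powers. The
        -- offsets `p` and `q` record how many differences have already fallen on each factor.
        refine mul_le_mul_of_nonneg_left (Real.rpow_le_rpow_of_exponent_ge hr hr1 ?_) (by positivity)
        rcases le_total p α with h | h
        · rw [min_eq_left h]
          rcases le_total q α with h' | h'
          · rw [min_eq_left h']; exact min_le_left _ _
          · rw [min_eq_right h']; exact (min_le_right _ _).trans (by linarith)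
        · rw [min_eq_right h]
          exact (min_le_right _ _).trans (by have := le_min hq hα; linarith)
  | succ n ih =>
    intro p q A B f g x hp hq hA hB hf hg L hL hLr
    obtain ⟨M, a, rfl⟩ := (List.eq_nil_or_concat' L).resolve_left (by rintro rfl; simp at hL)
    have hM : M.length = n := by simpa using hL
    have ha : ‖a‖ ≤ r := hLr a (by simp)
    have hMr : ∀ h ∈ M, ‖h‖ ≤ r := fun h hh => hLr h (by simp [hh])
    -- Discrete Leibniz rule for the innermost difference; it raises one of the offsets by one,
    -- while the translate of `g` keeps its bounds on a ball smaller by `r`.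
    have e : fdiff a (fun y => f y * g y) = fun y => fdiff a f y * g (y + a) + f y * fdiff a g y := by
      funext y; simp only [fdiff]; ring
    have hdiff : ∀ {φ : E → ℝ} {c D : ℝ}, (∀ L : List E, L.length ≤ n + 1 → (∀ h ∈ L, ‖h‖ ≤ r) →
        ∀ z ∈ Metric.closedBall x (((n + 1 : ℕ) - L.length) * r), |fdiffs L φ z| ≤ D * r ^ min (L.length + c) α) →
        ∀ L : List E, L.length ≤ n → (∀ h ∈ L, ‖h‖ ≤ r) → ∀ z ∈ Metric.closedBall x ((n - L.length) * r),
          |fdiffs L (fdiff a φ) z| ≤ D * r ^ min (L.length + (c + 1)) α := by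
      intro φ c D h L hl hLr z hz
      have := h (L ++ [a]) (by simpa using hl) (by
        intro b hb
        rcases List.mem_append.1 hb with hb | hb
        · exact hLr b hb
        · rw [List.mem_singleton.1 hb]; exact ha) z (by
          have e : (((n + 1 : ℕ) : ℝ) - (L ++ [a]).length) * r = (n - L.length) * r := by simp
          rw [e]; exact hz)
      rw [fdiffs_concat] at this
      refine this.trans (le_of_eq ?_)
      rw [List.length_append, List.length_singleton]; push_cast
      ring_nf
    have hsame : ∀ {φ : E → ℝ} {c D : ℝ}, (∀ L : List E, L.length ≤ n + 1 → (∀ h ∈ L, ‖h‖ ≤ r) →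
        ∀ z ∈ Metric.closedBall x (((n + 1 : ℕ) - L.length) * r), |fdiffs L φ z| ≤ D * r ^ min (L.length + c) α) →
        ∀ b : E, ‖b‖ ≤ r → ∀ L : List E, L.length ≤ n → (∀ h ∈ L, ‖h‖ ≤ r) → ∀ z ∈ Metric.closedBall x ((n - L.length) * r),
          |fdiffs L (fun y => φ (y + b)) z| ≤ D * r ^ min (L.length + c) α := by
      intro φ c D h b hb L hl hLr z hz
      rw [fdiffs_comp_add]
      refine h L (by omega) hLr _ ?_
      have := mem_closedBall_add hb hz
      convert this using 2; push_cast; ring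
    have h1 := ih (by linarith : 0 ≤ p + 1) hq hA hB (hdiff hf) (hsame hg a ha) M hM hMr
    have hf' := hsame hf 0 (by rw [norm_zero]; exact hr.le)
    simp only [add_zero] at hf'
    have h2 := ih hp (by linarith : 0 ≤ q + 1) hA hB hf' (hdiff hg) M hM hMr
    rw [fdiffs_concat, e, fdiffs_add]
    have e1 : min ((n:ℝ) + (p + 1) + q) α = min (((n + 1 : ℕ) : ℝ) + p + q) α := by push_cast; ring_nf
    have e2 : min ((n:ℝ) + p + (q + 1)) α = min (((n + 1 : ℕ) : ℝ) + p + q) α := by push_cast; ring_nf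
    rw [e1] at h1
    rw [e2] at h2
    refine (abs_add_le _ _).trans ((add_le_add h1 h2).trans (le_of_eq ?_))
    rw [pow_succ]; ring

end Differences

/-! ### From Hölder regularity to the rate of approximation by averages. -/

section Direct

variable {E : Type} [NormedAddCommGroup E] [InnerProductSpace ℝ E] [FiniteDimensional ℝ E]
  [MeasurableSpace E] [BorelSpace E]

/-- Iterated differences as operators. -/
def diffOp (L : List E) : Module.End ℝ (bddMeas E) := L.foldr (fun h T => (shift h - 1) * T) 1

lemma diffOp_apply (L : List E) (u : bddMeas E) : (diffOp L u).1 = fdiffs L u.1 := by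
  induction L with
  | nil => rfl
  | cons h L ih =>
    funext x
    have : (diffOp (h :: L) u).1 x = (diffOp L u).1 (x + h) - (diffOp L u).1 x := rfl
    rw [this, ih, fdiffs_cons]

lemma diffOp_avg (L : List E) (r : ℝ) (u : bddMeas E) : diffOp L (avg r u) = avg r (diffOp L u) := by
  induction L with
  | nil => rfl
  | cons h L ih =>
    have e : ∀ v : bddMeas E, diffOp (h :: L) v = shift h (diffOp L v) - diffOp L v := fun v => rfl
    rw [e, e, ih, map_sub]
    congr 1
    exact LinearMap.congr_fun (shift_commute_avg h r) (diffOp L u)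

lemma avg_sub_eq_integral (r : ℝ) (G : bddMeas E) (x : E) :
    (avg r G).1 x - G.1 x = ∫ y, (G.1 (x + r • y) - G.1 x) * avgKer y := by
  have h := integral_sub (integrable_comp_add_smul_mul_avgKer G x r) (avgKer_integrable.const_mul (G.1 x))
  rw [integral_const_mul, integral_avgKer, mul_one] at h
  rw [avg_apply, ← h]
  simp only [sub_mul]

/-- Powers of `1 - avg r` are averages of iterated differences. -/
lemma abs_one_sub_avg_pow_le_of_fdiffs {r : ℝ} (hr : 0 ≤ r) (m : ℕ) : ∀ {u : bddMeas E} {x : E} {B : ℝ},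
    (∀ L : List E, L.length = m → (∀ h ∈ L, ‖h‖ ≤ r) → |fdiffs L u.1 x| ≤ B) →
    |(((1 - avg r) ^ m) u : bddMeas E).1 x| ≤ B := by
  induction m with
  | zero => intro u x B h; exact h [] rfl (by simp)
  | succ m ih =>
    intro u x B h
    rw [pow_succ, Module.End.mul_apply]
    refine ih fun L hL hLr => ?_
    -- Differences commute with averages, so those of `(1 - avg r) u` are averages, over one more
    -- step `r • y`, of differences of `u` of order one higher.
    rw [← diffOp_apply, LinearMap.sub_apply, map_sub, diffOp_avg]
    have e : ((diffOp L ((1 : Module.End ℝ (bddMeas E)) u) - avg r (diffOp L u) : bddMeas E)).1 x =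
        -((avg r (diffOp L u)).1 x - (diffOp L u).1 x) := by
      rw [neg_sub]; rfl
    rw [e, abs_neg, avg_sub_eq_integral]
    refine abs_integral_mul_avgKer_le fun y hy => ?_
    have hn : ‖r • y‖ ≤ r := by
      rw [norm_smul, Real.norm_of_nonneg hr]; exact mul_le_of_le_one_right hr hy
    have := h ((r • y) :: L) (by simp [hL]) (by
      intro b hb
      rcases List.mem_cons.1 hb with rfl | hb
      · exact hn
      · exact hLr b hb)
    rwa [fdiffs_cons, ← diffOp_apply] at this

/-- The direct theorem of approximation by averages. -/
lemma abs_one_sub_avg_pow_le_holderNorm {α r : ℝ} (hα : 0 < α) (hr : 0 < r) (hr1 : r ≤ 1) {U : Set E} (hU : IsOpen U)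
    {u : bddMeas E} (hu : holderNorm α U u.1 < ⊤) {m : ℕ} (hm : ⌊α⌋₊ < m) {x : E}
    (hx : Metric.closedBall x (m * r) ⊆ U) :
    |(((1 - avg r) ^ m) u : bddMeas E).1 x| ≤ 2 ^ m * (holderNorm α U u.1).toReal * r ^ α := by
  refine abs_one_sub_avg_pow_le_of_fdiffs hr.le m fun L hL hLr => ?_
  have h := abs_fdiffs_le_holderNorm hα hr hr1 hU hu L hLr (x := x) (by rwa [hL])
  rw [hL] at h
  have h2 : min (m : ℝ) α = α := by
    refine min_eq_right ?_
    have := Nat.lt_floor_add_one α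
    have : ((⌊α⌋₊ + 1 : ℕ) : ℝ) ≤ m := by exact_mod_cast hm
    push_cast at this
    linarith
  rwa [h2] at h

end Direct

/-! ### Averages of weak solutions, and the continuous representative. -/

section WeakAveraging

variable {E : Type} [NormedAddCommGroup E] [InnerProductSpace ℝ E] [FiniteDimensional ℝ E]
  [MeasurableSpace E] [BorelSpace E]

variable {s c Λ : ℝ} {K : E → ℝ} {b : E}

lemma bddMeas.integrable_mul (u : bddMeas E) {g : E → ℝ} (hg : Integrable g) : Integrable fun x => u.1 x * g x := by
  obtain ⟨hu, M, hM⟩ := u.2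
  exact hg.bdd_mul (c := M) hu.aestronglyMeasurable (Eventually.of_forall fun y => hM _)

lemma integral_avg_mul (u : bddMeas E) (r : ℝ) {g : E → ℝ} (hg : Integrable g) :
    ∫ x, (avg r u).1 x * g x = ∫ y, (∫ x, u.1 (r • y + x) * g x) * avgKer y := by
  obtain ⟨hu, M, hM⟩ := u.2
  simp only [avg_apply, ← integral_mul_const]
  rw [integral_integral_swap]
  · refine integral_congr_ae (Eventually.of_forall fun y => integral_congr_ae (Eventually.of_forall fun x => ?_))
    simp only [add_comm x]; ring
  · have h1 : Integrable fun p : E × E => g p.1 * avgKer p.2 := hg.mul_prod avgKer_integrable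
    have h2 := h1.bdd_mul (c := M) (f := fun p : E × E => u.1 (p.1 + r • p.2))
      (hu.comp (by fun_prop)).aestronglyMeasurable (Eventually.of_forall fun y => hM _)
    refine h2.congr (Eventually.of_forall fun p => ?_)
    simp only [Function.uncurry]; ring

/-- The averaging operators are symmetric. -/
lemma integral_avg_mul_comm (u g : bddMeas E) (r : ℝ) (hg : Integrable g.1) :
    ∫ x, (avg r u).1 x * g.1 x = ∫ x, u.1 x * (avg r g).1 x := by
  rw [integral_avg_mul u r hg]
  simp only [avg_apply]
  have e : ∀ y : E, ∫ x, u.1 (r • y + x) * g.1 x = ∫ x, u.1 x * g.1 (x - r • y) := fun y => by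
    rw [← integral_add_left_eq_self (fun x => u.1 x * g.1 (x - r • y)) (r • y)]
    simp only [add_sub_cancel_left]
  simp only [e, ← integral_mul_const, ← integral_const_mul]
  rw [integral_integral_swap]
  · refine integral_congr_ae (Eventually.of_forall fun x => ?_)
    simp only
    rw [← integral_neg_eq_self]
    refine integral_congr_ae (Eventually.of_forall fun y => ?_)
    simp only [avgKer_neg, smul_neg, sub_neg_eq_add]; ring
  · obtain ⟨hu, M, hM⟩ := u.2
    have h1 : Integrable fun p : E × E => g.1 p.1 * avgKer p.2 := hg.mul_prod avgKer_integrable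
    have h2 : Integrable (fun p : E × E => g.1 (p.1 - r • p.2) * avgKer p.2) := by
      refine (integrable_prod_iff' ?_).2 ⟨Eventually.of_forall fun y => ?_, ?_⟩
      · exact ((bddMeas.measurable g).comp (by fun_prop)).aestronglyMeasurable.mul
          (avgKer_continuous.comp continuous_snd).aestronglyMeasurable
      · exact (hg.comp_sub_right (r • y)).mul_const (avgKer y)
      · simp only [norm_mul, integral_mul_const]
        have e2 : ∀ y : E, ∫ x, ‖g.1 (x - r • y)‖ = ∫ x, ‖g.1 x‖ := fun y =>
          integral_sub_right_eq_self (fun x => ‖g.1 x‖) (r • y)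
        simp only [e2]
        exact avgKer_integrable.norm.const_mul _
    have h3 := h2.bdd_mul (c := M) (f := fun p : E × E => u.1 p.1)
      (hu.comp measurable_fst).aestronglyMeasurable (Eventually.of_forall fun y => hM _)
    refine h3.swap.congr (Eventually.of_forall fun p => ?_)
    simp only [Function.uncurry, Function.comp, Prod.fst_swap, Prod.snd_swap]; ring

lemma WeakEq.mono {Ω Ω' : Set E} {U F : E → ℝ} (h : WeakEq s K b Ω U F) (hΩ : Ω' ⊆ Ω) : WeakEq s K b Ω' U F :=
  fun η h1 h2 h3 => h η h1 h2 (h3.trans hΩ)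

lemma WeakEq.congr_ae {Ω : Set E} {U V F : E → ℝ} (h : WeakEq s K b Ω U F) (hUV : U =ᵐ[volume] V) :
    WeakEq s K b Ω V F := fun η h1 h2 h3 => by
  rw [← h η h1 h2 h3]
  exact integral_congr_ae (hUV.mono fun x hx => by simp only [hx])

lemma integrable_levyOp_of_hasCompactSupport (hs0 : 0 < s) (hs1 : s < 1) (hΛ : 0 ≤ Λ) (hK : StableKer s c Λ K b)
    {η : E → ℝ} (hη : ContDiff ℝ ∞ η) (hc : HasCompactSupport η) : Integrable (levyOp s K b η) :=
  levyOp_integrable hs0 hs1 hΛ hK (hη.of_le (WithTop.coe_le_coe.2 le_top)) hc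

/-- An average is a superposition of translates, and the equation is translation invariant. The
domain shrinks by the radius of the averaging kernel. -/
lemma WeakEq.avg (hs0 : 0 < s) (hs1 : s < 1) (hΛ : 0 ≤ Λ) (hK : StableKer s c Λ K b) {Ω Ω' : Set E} {U F : bddMeas E}
    (h : WeakEq s K b Ω U.1 F.1) {r : ℝ} (hΩ : ∀ x ∈ Ω', ∀ y : E, ‖y‖ ≤ 1 → r • y + x ∈ Ω) :
    WeakEq s K b Ω' (avg r U).1 (avg r F).1 := by
  intro η hη hc hs
  rw [integral_avg_mul U r (integrable_levyOp_of_hasCompactSupport hs0 hs1 hΛ hK hη hc),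
    integral_avg_mul F r (hη.continuous.integrable_of_hasCompactSupport hc)]
  refine integral_congr_ae (Eventually.of_forall fun y => ?_)
  simp only
  by_cases hy : ‖y‖ ≤ 1
  · rw [(h.translate (r • y) fun x hx => hΩ x hx y hy) η hη hc hs]
  · rw [avgKer_eq_zero (not_le.1 hy), mul_zero, mul_zero]

lemma WeakEq.sub (hs0 : 0 < s) (hs1 : s < 1) (hΛ : 0 ≤ Λ) (hK : StableKer s c Λ K b) {Ω : Set E} {U F V G : bddMeas E}
    (h : WeakEq s K b Ω U.1 F.1) (h' : WeakEq s K b Ω V.1 G.1) : WeakEq s K b Ω (U - V).1 (F - G).1 := by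
  intro η hη hc hs
  have e : ∀ (u v : bddMeas E) (g : E → ℝ), Integrable g → ∫ x, (u - v).1 x * g x = (∫ x, u.1 x * g x) - ∫ x, v.1 x * g x := by
    intro u v g hg
    rw [← integral_sub (bddMeas.integrable_mul u hg) (bddMeas.integrable_mul v hg)]
    refine integral_congr_ae (Eventually.of_forall fun x => ?_)
    have : (u - v).1 x = u.1 x - v.1 x := rfl
    simp only [this, sub_mul]
  rw [e _ _ _ (integrable_levyOp_of_hasCompactSupport hs0 hs1 hΛ hK hη hc),
    e _ _ _ (hη.continuous.integrable_of_hasCompactSupport hc), h η hη hc hs, h' η hη hc hs]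

lemma WeakEq.one_sub_avg_pow (hs0 : 0 < s) (hs1 : s < 1) (hΛ : 0 ≤ Λ) (hK : StableKer s c Λ K b) {R r : ℝ} (hr : 0 ≤ r)
    {U F : bddMeas E} (h : WeakEq s K b (Metric.ball 0 R) U.1 F.1) (m : ℕ) :
    WeakEq s K b (Metric.ball 0 (R - m * r)) (((1 - _root_.avg r) ^ m) U).1 (((1 - _root_.avg r) ^ m) F).1 := by
  induction m with
  | zero => simpa using h
  | succ m ih =>
    have h1 := WeakEq.avg hs0 hs1 hΛ hK ih (r := r) (Ω' := Metric.ball 0 (R - (m + 1 : ℕ) * r)) fun x hx y hy => by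
      rw [mem_ball_zero_iff] at hx ⊢
      refine (norm_add_le _ _).trans_lt ?_
      rw [norm_smul, Real.norm_of_nonneg hr]
      have : r * ‖y‖ ≤ r := mul_le_of_le_one_right hr hy
      push_cast at hx
      linarith
    have h2 := ih.mono (Ω' := Metric.ball 0 (R - (m + 1 : ℕ) * r))
      (Metric.ball_subset_ball (by push_cast; linarith))
    have h3 := WeakEq.sub hs0 hs1 hΛ hK h2 h1
    rw [pow_succ', Module.End.mul_apply, Module.End.mul_apply]
    exact h3

/-- The averaging kernel is even, so first differences may be symmetrised. This connects the
estimate of second differences, where the order `2s` may exceed one, with approximation by averages.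
-/
lemma avg_sub_eq_secondDiff (r : ℝ) (G : bddMeas E) (x : E) :
    (avg r G).1 x - G.1 x = ∫ y, (1 / 2 * secondDiff G.1 (r • y) x) * avgKer y := by
  rw [avg_sub_eq_integral]
  have h1 : ∀ a : ℝ, Integrable fun y => (G.1 (x + a • y) - G.1 x) * avgKer y := fun a => by
    have := (integrable_comp_add_smul_mul_avgKer G x a).sub ((avgKer_integrable (E := E)).const_mul (G.1 x))
    refine this.congr (Eventually.of_forall fun y => ?_)
    simp only [Pi.sub_apply, sub_mul]
  have h2 : ∫ y, (G.1 (x + r • y) - G.1 x) * avgKer y = ∫ y, (G.1 (x + (-r) • y) - G.1 x) * avgKer y := by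
    rw [← integral_neg_eq_self]
    simp only [avgKer_neg, smul_neg, neg_smul]
  have h3 : ∫ y, (1 / 2 * secondDiff G.1 (r • y) x) * avgKer y =
      1 / 2 * ((∫ y, (G.1 (x + r • y) - G.1 x) * avgKer y) + ∫ y, (G.1 (x + (-r) • y) - G.1 x) * avgKer y) := by
    rw [← integral_add (h1 r) (h1 (-r)), ← integral_const_mul]
    refine integral_congr_ae (Eventually.of_forall fun y => ?_)
    simp only [secondDiff, neg_smul, ← sub_eq_add_neg]; ring
  rw [h3, ← h2]; ring

/-- The approximation of solutions by averages. -/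
lemma exists_sub_avg_le (hs0 : 0 < s) (hs1 : s < 1) (hc : 0 < c) (hΛ : 0 < Λ) {δ : ℝ} (hδ : 0 < δ)
    (hδ1 : δ ≤ 1) :
    ∃ C : ℝ, 0 ≤ C ∧ ∀ (K : E → ℝ) (b : E), StableKer s c Λ K b →
      ∀ (U F : bddMeas E) (MU MF : ℝ), (∀ x, |U.1 x| ≤ MU) → (∀ x, |F.1 x| ≤ MF) →
      ∀ x : E, WeakEq s K b (Metric.ball x δ) U.1 F.1 → ContinuousOn U.1 (Metric.ball x δ) →
      ∀ r : ℝ, 0 < r → r ≤ δ / 2 → |((1 - avg r) U : bddMeas E).1 x| ≤ C * r ^ (2 * s) * (MU + MF) := by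
  obtain ⟨C, hC, h⟩ := exists_secondDiff_le (E := E) hs0 hs1 hc hΛ hδ hδ1
  refine ⟨C, hC, fun K b hK U F MU MF hMU hMF x hw hcont r hr hrδ => ?_⟩
  have hMU0 : 0 ≤ MU := (abs_nonneg _).trans (hMU 0)
  have hMF0 : 0 ≤ MF := (abs_nonneg _).trans (hMF 0)
  rw [coe_one_sub_avg, abs_sub_comm, avg_sub_eq_secondDiff]
  refine abs_integral_mul_avgKer_le fun y hy => ?_
  have hn : ‖r • y‖ ≤ r := by
    rw [norm_smul, Real.norm_of_nonneg hr.le]; exact mul_le_of_le_one_right hr.le hy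
  have h1 := h K b hK U.1 F.1 MU MF (bddMeas.measurable U) (bddMeas.measurable F) hMU hMF x hw hcont (r • y) (hn.trans hrδ)
  have h2 : C * ‖r • y‖ ^ (2 * s) * (MU + MF) ≤ C * r ^ (2 * s) * (MU + MF) := by gcongr
  rw [abs_mul, abs_of_pos (by norm_num : (0:ℝ) < 1 / 2)]
  have := abs_nonneg (secondDiff U.1 (r • y) x)
  linarith

lemma ball_subset_ball_zero {x : E} {R δ R' : ℝ} (hx : x ∈ Metric.ball (0:E) R) (h : R + δ ≤ R') :
    Metric.ball x δ ⊆ Metric.ball 0 R' := by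
  intro z hz
  rw [mem_ball_iff_norm] at hz
  rw [mem_ball_zero_iff] at hx ⊢
  have : ‖z‖ ≤ ‖z - x‖ + ‖x‖ := by simpa using norm_add_le (z - x) x
  linarith

lemma half_pow_le {i j : ℕ} (h : i ≤ j) : (1 / 2 : ℝ) ^ j ≤ (1 / 2 : ℝ) ^ i :=
  pow_le_pow_of_le_one (by norm_num) (by norm_num) h

/-- A bounded weak solution has a continuous representative. -/
lemma exists_continuous_representative (hs0 : 0 < s) (hs1 : s < 1) (hc : 0 < c) (hΛ : 0 < Λ) (hK : StableKer s c Λ K b)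
    {U F : bddMeas E} {M : ℝ} (hU : ∀ x, |U.1 x| ≤ M)
    (hw : WeakEq s K b (Metric.ball 0 1) U.1 F.1) :
    ∃ V : bddMeas E, V.1 =ᵐ[volume] U.1 ∧ (∀ x, |V.1 x| ≤ M) ∧ ContinuousOn V.1 (Metric.ball 0 (9 / 10)) := by
  have hM0 : 0 ≤ M := (abs_nonneg _).trans (hU 0)
  obtain ⟨-, MF, hF⟩ := F.2
  have hMF0 : 0 ≤ MF := (abs_nonneg _).trans (hF 0)
  obtain ⟨C, hC, h1⟩ := exists_sub_avg_le (E := E) hs0 hs1 hc hΛ (δ := 1 / 64) (by norm_num) (by norm_num)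
  have hfl : ⌊s⌋₊ = 0 := Nat.floor_eq_zero.2 hs1
  obtain ⟨D, hD, h2⟩ := exists_holderNorm_le_of_approx (E := E) (β := 2 * s) (β' := s) hs0 (by linarith)
    (by rw [hfl]; push_cast; linarith) 1 7 (R := 19 / 20) (R' := 9 / 10) (by norm_num) (by norm_num)
  set u : ℕ → bddMeas E := fun j => avg ((1 / 2 : ℝ) ^ (j + 6)) U with hu
  set A : ℝ := M + C * (M + MF) with hA
  have hA0 : 0 ≤ A := by positivity
  have hub : ∀ j x, |(u j).1 x| ≤ M := fun j x => abs_avg_le (by positivity) fun z _ => hU z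
  -- Averages of the solution are smooth and solve averaged equations, so the estimate for
  -- continuous solutions applies to them with bounds independent of `j`. The exponent `s` is chosen
  -- for convenience: it lies in `(0, 1)` and below `2s`.
  have hreg : ∀ j, holderNorm s (Metric.ball 0 (9 / 10)) (u j).1 ≤ ENNReal.ofReal (D * A) := by
    intro j
    have hj : (1 / 2 : ℝ) ^ (j + 6) ≤ 1 / 64 := (half_pow_le (by omega : 6 ≤ j + 6)).trans (by norm_num)
    have hwj : WeakEq s K b (Metric.ball 0 (63 / 64)) (u j).1 (avg ((1 / 2 : ℝ) ^ (j + 6)) F).1 :=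
      WeakEq.avg hs0 hs1 hΛ.le hK hw fun x hx y hy => by
        rw [mem_ball_zero_iff] at hx ⊢
        refine (norm_add_le _ _).trans_lt ?_
        rw [norm_smul, Real.norm_of_nonneg (by positivity)]
        have : (1 / 2 : ℝ) ^ (j + 6) * ‖y‖ ≤ (1 / 2 : ℝ) ^ (j + 6) := mul_le_of_le_one_right (by positivity) hy
        linarith
    refine h2 (u j) A (fun x => (hub j x).trans (by rw [hA]; linarith [mul_nonneg hC (add_nonneg hM0 hMF0)])) fun i hi x hx => ?_
    rw [pow_one]
    have h3 := h1 K b hK (u j) (avg ((1 / 2 : ℝ) ^ (j + 6)) F) M MF (hub j) (fun x => abs_avg_le (by positivity) fun z _ => hF z)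
      x (hwj.mono (ball_subset_ball_zero hx (by norm_num))) (avg_contDiff U (by positivity)).continuous.continuousOn
      ((1 / 2 : ℝ) ^ i) (by positivity) ((half_pow_le hi).trans (by norm_num))
    refine h3.trans ?_
    have h4 : 0 ≤ ((1 / 2 : ℝ) ^ i) ^ (2 * s) := by positivity
    rw [mul_right_comm]
    refine mul_le_mul_of_nonneg_right ?_ h4
    rw [hA]; linarith
  have hhol : ∀ j, ∀ x ∈ Metric.ball (0:E) (9 / 10), ∀ y ∈ Metric.ball (0:E) (9 / 10),
      |(u j).1 x - (u j).1 y| ≤ D * A * ‖x - y‖ ^ s := by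
    intro j x hx y hy
    have hlt := (hreg j).trans_lt ENNReal.ofReal_lt_top
    have h3 := norm_iteratedFDeriv_sub_le_holderNorm hlt hx hy
    rw [hfl, Nat.cast_zero, sub_zero] at h3
    have h4 : ‖iteratedFDeriv ℝ 0 (u j).1 x - iteratedFDeriv ℝ 0 (u j).1 y‖ = |(u j).1 x - (u j).1 y| := by
      rw [iteratedFDeriv_zero_eq_comp, Function.comp_apply, Function.comp_apply, ← map_sub, LinearIsometryEquiv.norm_map,
        Real.norm_eq_abs]
    rw [h4] at h3
    refine h3.trans ?_
    gcongr
    exact ENNReal.toReal_le_of_le_ofReal (by positivity) (hreg j)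
  have hae : ∀ᵐ x, Tendsto (fun j => (u j).1 x) atTop (𝓝 (U.1 x)) :=
    (ae_tendsto_avg U).mono fun x hx => (tendsto_add_atTop_iff_nat 6).2 hx
  have hdense := Measure.dense_of_ae hae
  have hlim : ∀ x ∈ Metric.ball (0:E) (9 / 10), ∃ l, Tendsto (fun j => (u j).1 x) atTop (𝓝 l) := by
    intro x hx
    refine cauchySeq_tendsto_of_complete (Metric.cauchySeq_iff'.2 fun ε hε => ?_)
    have hcont : Tendsto (fun z : E => D * A * ‖x - z‖ ^ s) (𝓝 x) (𝓝 0) := by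
      have h3 : Continuous fun z : E => D * A * ‖x - z‖ ^ s :=
        continuous_const.mul ((continuous_const.sub continuous_id).norm.rpow_const fun _ => Or.inr hs0.le)
      have := h3.tendsto x
      rwa [sub_self, norm_zero, Real.zero_rpow hs0.ne', mul_zero] at this
    -- Equicontinuity and convergence on a dense set: compare with a nearby point `z` at which the
    -- averages converge.
    have hev : ∀ᶠ z in 𝓝 x, D * A * ‖x - z‖ ^ s < ε / 3 ∧ z ∈ Metric.ball (0:E) (9 / 10) :=
      (hcont.eventually (gt_mem_nhds (by positivity))).and (Metric.isOpen_ball.mem_nhds hx)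
    obtain ⟨z, hz3, hz1, hz2⟩ := hdense.inter_nhds_nonempty hev
    obtain ⟨N, hN⟩ := Metric.cauchySeq_iff'.1 (Tendsto.cauchySeq hz3) (ε / 3) (by positivity)
    refine ⟨N, fun n hn => ?_⟩
    have a1 := abs_le.1 (hhol n x hx z hz2)
    have a2 := abs_le.1 (hhol N x hx z hz2)
    have a3 := abs_lt.1 (by simpa [Real.dist_eq] using hN n hn)
    rw [Real.dist_eq, abs_lt]
    constructor <;> linarith [a1.1, a1.2, a2.1, a2.2, a3.1, a3.2]
  classical
  choose! l hl using hlim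
  set v : E → ℝ := fun x => if x ∈ Metric.ball (0:E) (9 / 10) then l x else U.1 x with hv
  have hvlim : ∀ x, Tendsto (fun j => if x ∈ Metric.ball (0:E) (9 / 10) then (u j).1 x else U.1 x) atTop (𝓝 (v x)) := by
    intro x
    by_cases hx : x ∈ Metric.ball (0:E) (9 / 10)
    · simpa only [hv, if_pos hx] using hl x hx
    · simpa only [hv, if_neg hx] using tendsto_const_nhds
  have hvm : Measurable v := by
    refine measurable_of_tendsto_metrizable (fun j => ?_) (tendsto_pi_nhds.2 hvlim)
    exact Measurable.ite Metric.isOpen_ball.measurableSet (bddMeas.measurable (u j)) (bddMeas.measurable U)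
  have hvM : ∀ x, |v x| ≤ M := fun x => le_of_tendsto (hvlim x).abs (Eventually.of_forall fun j => by
    split_ifs
    · exact hub j x
    · exact hU x)
  refine ⟨⟨v, hvm, M, hvM⟩, ?_, hvM, ?_⟩
  · filter_upwards [hae] with x hx
    by_cases hxb : x ∈ Metric.ball (0:E) (9 / 10)
    · simp only [hv, if_pos hxb]
      exact tendsto_nhds_unique (hl x hxb) hx
    · simp only [hv, if_neg hxb]
  · have hvh : ∀ x ∈ Metric.ball (0:E) (9 / 10), ∀ y ∈ Metric.ball (0:E) (9 / 10), |v x - v y| ≤ D * A * ‖x - y‖ ^ s := by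
      intro x hx y hy
      simp only [hv, if_pos hx, if_pos hy]
      exact le_of_tendsto ((hl x hx).sub (hl y hy)).abs (Eventually.of_forall fun j => hhol j x hx y hy)
    intro x hx
    rw [ContinuousWithinAt, tendsto_iff_norm_sub_tendsto_zero]
    have h3 : Continuous fun z : E => D * A * ‖z - x‖ ^ s :=
        continuous_const.mul ((continuous_id.sub continuous_const).norm.rpow_const fun _ => Or.inr hs0.le)
    have h4 := (h3.tendsto x).mono_left (nhdsWithin_le_nhds (s := Metric.ball (0:E) (9 / 10)))
    rw [sub_self, norm_zero, Real.zero_rpow hs0.ne', mul_zero] at h4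
    refine squeeze_zero' (Eventually.of_forall fun z => norm_nonneg _) ?_ h4
    filter_upwards [self_mem_nhdsWithin] with z hz using hvh z hz x hx

end WeakAveraging

/-! ### Interior estimates for continuous solutions. -/

section Estimates

variable {E : Type} [NormedAddCommGroup E] [InnerProductSpace ℝ E] [FiniteDimensional ℝ E]
  [MeasurableSpace E] [BorelSpace E]

variable {s c Λ : ℝ} {K : E → ℝ} {b : E}

lemma WeakEq.congr_right {Ω : Set E} {U F G : E → ℝ} (h : WeakEq s K b Ω U F) (hFG : ∀ x ∈ Ω, F x = G x) :
    WeakEq s K b Ω U G := fun η h1 h2 h3 => by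
  rw [h η h1 h2 h3]
  refine integral_congr_ae (Eventually.of_forall fun x => ?_)
  simp only
  by_cases hx : x ∈ tsupport η
  · rw [hFG x (h3 hx)]
  · rw [image_eq_zero_of_notMem_tsupport hx, mul_zero, mul_zero]

/-- The restriction of a bounded measurable function to a set. -/
def restr {S : Set E} (hS : MeasurableSet S) (u : bddMeas E) : bddMeas E :=
  ⟨S.indicator u.1, u.2.1.indicator hS, u.2.2.imp fun M hM x => by
    by_cases hx : x ∈ S
    · rw [indicator_of_mem hx]; exact hM x
    · rw [indicator_of_notMem hx, abs_zero]; exact (abs_nonneg _).trans (hM x)⟩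

lemma restr_of_mem {S : Set E} (hS : MeasurableSet S) (u : bddMeas E) {x : E} (hx : x ∈ S) :
    (restr hS u).1 x = u.1 x := indicator_of_mem hx _

lemma restr_of_notMem {S : Set E} (hS : MeasurableSet S) (u : bddMeas E) {x : E} (hx : x ∉ S) :
    (restr hS u).1 x = 0 := indicator_of_notMem hx _

lemma abs_restr_le {S : Set E} (hS : MeasurableSet S) (u : bddMeas E) {B : ℝ} (hB : 0 ≤ B) (h : ∀ x ∈ S, |u.1 x| ≤ B) (x : E) :
    |(restr hS u).1 x| ≤ B := by
  by_cases hx : x ∈ S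
  · rw [restr_of_mem hS u hx]; exact h x hx
  · rw [restr_of_notMem hS u hx, abs_zero]; exact hB

lemma continuousOn_one_sub_avg_pow {S : Set E} {r : ℝ} (hr : 0 < r) {u : bddMeas E} (hu : ContinuousOn u.1 S) (m : ℕ) :
    ContinuousOn (((1 - avg r) ^ m) u : bddMeas E).1 S := by
  induction m with
  | zero => simpa using hu
  | succ m ih =>
    rw [pow_succ', Module.End.mul_apply]
    exact ih.sub (avg_contDiff _ hr).continuous.continuousOn

/-- The approximation of solutions in a ball by averages. -/
lemma exists_sub_avg_le_ball (hs0 : 0 < s) (hs1 : s < 1) (hc : 0 < c) (hΛ : 0 < Λ) {R R' : ℝ} (hR : R' < R) :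
    ∃ C r₀ : ℝ, 0 ≤ C ∧ 0 < r₀ ∧ ∀ (K : E → ℝ) (b : E), StableKer s c Λ K b →
      ∀ (U F : bddMeas E) (MU MF : ℝ), (∀ x, |U.1 x| ≤ MU) → 0 ≤ MF → (∀ x ∈ Metric.ball (0:E) R, |F.1 x| ≤ MF) →
      WeakEq s K b (Metric.ball 0 R) U.1 F.1 → ContinuousOn U.1 (Metric.ball 0 R) →
      ∀ x ∈ Metric.ball (0:E) R', ∀ r : ℝ, 0 < r → r ≤ r₀ →
        |((1 - avg r) U : bddMeas E).1 x| ≤ C * r ^ (2 * s) * (MU + MF) := by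
  have hδ : 0 < min (R - R') 1 := lt_min (by linarith) one_pos
  obtain ⟨C, hC, h⟩ := exists_sub_avg_le (E := E) hs0 hs1 hc hΛ hδ (min_le_right _ _)
  refine ⟨C, min (R - R') 1 / 2, hC, by positivity, fun K b hK U F MU MF hU hMF hF hw hcont x hx r hr hr0 => ?_⟩
  have hsub : Metric.ball x (min (R - R') 1) ⊆ Metric.ball 0 R := ball_subset_ball_zero hx (by
    have := min_le_left (R - R') 1; linarith)
  have hw' := hw.congr_right fun x hx => (restr_of_mem (Metric.isOpen_ball (x := (0:E)) (ε := R)).measurableSet F hx).symm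
  exact h K b hK U _ MU MF hU (abs_restr_le _ F hMF hF) x (hw'.mono hsub) (hcont.mono hsub) r hr hr0

lemma exists_half_pow_le {r₀ : ℝ} (h : 0 < r₀) : ∃ i₀ : ℕ, ∀ i ≥ i₀, (1 / 2 : ℝ) ^ i ≤ r₀ := by
  obtain ⟨i, hi⟩ := exists_pow_lt_of_lt_one h (by norm_num : (1 / 2 : ℝ) < 1)
  exact ⟨i, fun j hj => (half_pow_le hj).trans hi.le⟩

/-- Interior regularity for bounded right-hand sides. -/
lemma exists_holderNorm_le_of_bounded (hs0 : 0 < s) (hs1 : s < 1) (hc : 0 < c) (hΛ : 0 < Λ) {β' : ℝ} (hβ' : 0 < β')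
    (hβ : β' ≤ 2 * s) (hk : (⌊β'⌋₊ : ℝ) < 2 * s) :
    ∃ C : ℝ, 0 ≤ C ∧ ∀ (K : E → ℝ) (b : E), StableKer s c Λ K b →
      ∀ (U F : bddMeas E) (MU MF : ℝ), (∀ x, |U.1 x| ≤ MU) → (∀ x, |F.1 x| ≤ MF) →
      WeakEq s K b (Metric.ball 0 (9 / 10)) U.1 F.1 → ContinuousOn U.1 (Metric.ball 0 (9 / 10)) →
      holderNorm β' (Metric.ball 0 (1 / 2)) U.1 ≤ ENNReal.ofReal (C * (MU + MF)) := by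
  obtain ⟨C, r₀, hC, hr₀, h⟩ := exists_sub_avg_le_ball (E := E) hs0 hs1 hc hΛ (R := 9 / 10) (R' := 3 / 4) (by norm_num)
  obtain ⟨i₀, hi₀⟩ := exists_half_pow_le hr₀
  obtain ⟨D, hD, h2⟩ := exists_holderNorm_le_of_approx (E := E) hβ' hβ hk 1 i₀ (R := 3 / 4) (R' := 1 / 2)
    (by norm_num) (by norm_num)
  refine ⟨D * (1 + C), by positivity, fun K b hK U F MU MF hU hF hw hcont => ?_⟩
  have hMU0 : 0 ≤ MU := (abs_nonneg _).trans (hU 0)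
  have hMF0 : 0 ≤ MF := (abs_nonneg _).trans (hF 0)
  rw [mul_assoc]
  refine h2 U ((1 + C) * (MU + MF)) (fun x => (hU x).trans ?_) fun i hi x hx => ?_
  · have : 0 ≤ C * (MU + MF) := by positivity
    linarith
  · rw [pow_one]
    refine (h K b hK U F MU MF hU hMF0 (fun x _ => hF x) hw hcont x hx _ (by positivity) (hi₀ i hi)).trans ?_
    rw [mul_right_comm]
    gcongr
    linarith

/-- The Zygmund estimate for the order one. -/
lemma exists_zygmundNorm_le_of_bounded (hs : s = 1 / 2) (hc : 0 < c) (hΛ : 0 < Λ) :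
    ∃ C : ℝ, 0 ≤ C ∧ ∀ (K : E → ℝ) (b : E), StableKer s c Λ K b →
      ∀ (U F : bddMeas E) (MU MF : ℝ), (∀ x, |U.1 x| ≤ MU) → (∀ x, |F.1 x| ≤ MF) →
      WeakEq s K b (Metric.ball 0 (9 / 10)) U.1 F.1 → ContinuousOn U.1 (Metric.ball 0 (9 / 10)) →
      zygmundNorm (Metric.ball 0 (1 / 2)) U.1 ≤ ENNReal.ofReal (C * (MU + MF)) := by
  obtain ⟨C, hC, h⟩ := exists_secondDiff_le (E := E) (s := s) (c := c) (by linarith) (by linarith) hc hΛ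
    (δ := 2 / 5) (by norm_num) (by norm_num)
  -- The radius `2/5 = 9/10 - 1/2` keeps the balls in the domain. For steps longer than `1/5` the
  -- trivial bound `4 MU ≤ 20 MU ‖a‖` is used, and the last unit pays for the supremum.
  refine ⟨C + 21, by positivity, fun K b hK U F MU MF hU hF hw hcont => ?_⟩
  have hMU0 : 0 ≤ MU := (abs_nonneg _).trans (hU 0)
  have hMF0 : 0 ≤ MF := (abs_nonneg _).trans (hF 0)
  have e : (C + 21) * (MU + MF) = (C + 20) * (MU + MF) + (MU + MF) := by ring
  rw [zygmundNorm, e, ENNReal.ofReal_add (by positivity) (by positivity)]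
  refine add_le_add ?_ ?_
  · refine iSup_le fun x => iSup_le fun a => iSup_le fun hx => iSup_le fun _ => iSup_le fun _ => ?_
    by_cases ha : a = 0
    · have : U.1 (x + a) + U.1 (x - a) - 2 * U.1 x = 0 := by rw [ha, add_zero, sub_zero]; ring
      rw [this, enorm_zero, ENNReal.zero_div]
      exact zero_le
    have hn : 0 < ‖a‖ := norm_pos_iff.2 ha
    refine ENNReal.div_le_of_le_mul ?_
    rw [← ofReal_norm, ← ofReal_norm, ← ENNReal.ofReal_mul (by positivity), Real.norm_eq_abs]
    refine ENNReal.ofReal_le_ofReal ?_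
    by_cases hs5 : ‖a‖ ≤ 2 / 5 / 2
    · have hsub : Metric.ball x (2 / 5) ⊆ Metric.ball 0 (9 / 10) := ball_subset_ball_zero hx (by norm_num)
      have h1 := h K b hK U.1 F.1 MU MF (bddMeas.measurable U) (bddMeas.measurable F) hU hF x (hw.mono hsub) (hcont.mono hsub) a hs5
      rw [hs, show 2 * (1 / 2 : ℝ) = 1 by norm_num, Real.rpow_one] at h1
      refine h1.trans ?_
      rw [mul_right_comm]
      gcongr
      linarith
    · push Not at hs5
      refine (abs_secondDiff_le hU a x).trans ?_
      have : 0 ≤ C * (MU + MF) * ‖a‖ := by positivity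
      nlinarith
  · refine iSup₂_le fun x _ => ?_
    rw [← ofReal_norm]
    exact ENNReal.ofReal_le_ofReal ((hU x).trans (by linarith))

lemma floor_lt_of_forall_ne_int {β : ℝ} (hβ : 0 < β) (h : ∀ m : ℤ, β ≠ m) : (⌊β⌋₊ : ℝ) < β :=
  lt_of_le_of_ne (Nat.floor_le hβ.le) fun he => h ⌊β⌋₊ (by rw [Int.cast_natCast, he])

/-- Interior regularity for Hölder data. -/
lemma exists_holderNorm_le_of_holder (hs0 : 0 < s) (hs1 : s < 1) (hc : 0 < c) (hΛ : 0 < Λ) {α : ℝ} (hα : 0 < α)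
    (hint : ∀ m : ℤ, α + 2 * s ≠ m) :
    ∃ C : ℝ, 0 ≤ C ∧ ∀ (K : E → ℝ) (b : E), StableKer s c Λ K b →
      ∀ U F : bddMeas E, holderNorm α univ U.1 < ⊤ → holderNorm α (Metric.ball 0 1) F.1 < ⊤ →
      WeakEq s K b (Metric.ball 0 1) U.1 F.1 →
      holderNorm (α + 2 * s) (Metric.ball 0 (1 / 2)) U.1 ≤
        ENNReal.ofReal (C * ((holderNorm α univ U.1).toReal + (holderNorm α (Metric.ball 0 1) F.1).toReal)) := by
  -- The least order for which `(1 - avg r) ^ m` reaches the full rate `r ^ α` on functions of class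
  -- `C^α`.
  set m : ℕ := ⌊α⌋₊ + 1 with hm
  obtain ⟨C, r₀, hC, hr₀, h⟩ := exists_sub_avg_le_ball (E := E) hs0 hs1 hc hΛ (R := 9 / 10) (R' := 3 / 4) (by norm_num)
  have hr₁ : 0 < min r₀ (1 / (20 * m)) := by positivity
  obtain ⟨i₀, hi₀⟩ := exists_half_pow_le hr₁
  obtain ⟨D, hD, h2⟩ := exists_holderNorm_le_of_approx (E := E) (β := α + 2 * s) (by linarith) le_rfl
    (floor_lt_of_forall_ne_int (by linarith) hint) (m + 1) i₀ (R := 3 / 4) (R' := 1 / 2) (by norm_num) (by norm_num)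
  refine ⟨D * (1 + C * 2 ^ m), by positivity, fun K b hK U F hU hF hw => ?_⟩
  set NU := (holderNorm α univ U.1).toReal with hNU
  set NF := (holderNorm α (Metric.ball 0 1) F.1).toReal with hNF
  have hNU0 : 0 ≤ NU := ENNReal.toReal_nonneg
  have hNF0 : 0 ≤ NF := ENNReal.toReal_nonneg
  have hUc : Continuous U.1 := by
    have := (contDiffOn_of_holderNorm_lt_top hU).continuousOn
    rwa [continuousOn_univ] at this
  rw [mul_assoc]
  refine h2 U ((1 + C * 2 ^ m) * (NU + NF)) (fun x => ?_) fun i hi x hx => ?_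
  · refine (abs_le_holderNorm hU (mem_univ x)).trans ?_
    have : 0 ≤ C * 2 ^ m * (NU + NF) := by positivity
    linarith
  set r : ℝ := (1 / 2 : ℝ) ^ i with hr
  have hr0 : 0 < r := by positivity
  have hr1 : r ≤ 1 := pow_le_one₀ (by norm_num) (by norm_num)
  have hrr := hi₀ i hi
  have hrm : m * r ≤ 1 / 20 := by
    have h3 := hrr.trans (min_le_right _ _)
    have hmp : (0:ℝ) < m := by positivity
    rw [le_div_iff₀ (by positivity)] at h3
    linarith
  -- The function `(1 - avg r) ^ m U` and its right-hand side are both of size `r^α`; the basic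
  -- estimate for this solution at the same scale `r` adds `r^(2s)` through one more factor `1 - avg
  -- r`.
  have hV : ∀ x, |(((1 - avg r) ^ m) U : bddMeas E).1 x| ≤ 2 ^ m * NU * r ^ α := fun x =>
    abs_one_sub_avg_pow_le_holderNorm hα hr0 hr1 isOpen_univ hU (Nat.lt_succ_self _) (subset_univ _)
  have hG : ∀ x ∈ Metric.ball (0:E) (9 / 10), |(((1 - avg r) ^ m) F : bddMeas E).1 x| ≤ 2 ^ m * NF * r ^ α := fun x hx => by
    refine abs_one_sub_avg_pow_le_holderNorm hα hr0 hr1 Metric.isOpen_ball hF (Nat.lt_succ_self _) ?_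
    exact (Metric.closedBall_subset_ball (by linarith : m * r < 1 / 10)).trans (ball_subset_ball_zero hx (by norm_num))
  have hw' := (WeakEq.one_sub_avg_pow hs0 hs1 hΛ.le hK hr0.le hw m).mono (Ω' := Metric.ball 0 (9 / 10))
    (Metric.ball_subset_ball (by linarith))
  have h4 := h K b hK _ _ _ _ hV (by positivity) hG hw'
    (continuousOn_one_sub_avg_pow hr0 hUc.continuousOn m) x hx r hr0 (hrr.trans (min_le_left _ _))
  rw [pow_succ', Module.End.mul_apply]
  refine h4.trans ?_
  rw [Real.rpow_add hr0]
  have h5 : 0 ≤ r ^ α * r ^ (2 * s) := by positivity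
  calc _ = (C * 2 ^ m) * (NU + NF) * (r ^ α * r ^ (2 * s)) := by ring
    _ ≤ _ := by
      refine mul_le_mul_of_nonneg_right (mul_le_mul_of_nonneg_right ?_ (by positivity)) h5
      linarith

/-- A bounded function has a bounded measurable representative. -/
lemma exists_bddMeas_of_memLp {μ : Measure E} {u : E → ℝ} (hu : MemLp u ⊤ μ) :
    ∃ U : bddMeas E, U.1 =ᵐ[μ] u ∧ ∀ x, |U.1 x| ≤ (eLpNorm u ⊤ μ).toReal := by
  set M := (eLpNorm u ⊤ μ).toReal with hM
  have hM0 : 0 ≤ M := ENNReal.toReal_nonneg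
  have hb : ∀ x, |max (-M) (min M (hu.1.mk u x))| ≤ M := fun x =>
    abs_le.2 ⟨le_max_left _ _, max_le (by linarith) (min_le_left _ _)⟩
  refine ⟨⟨fun x => max (-M) (min M (hu.1.mk u x)), ?_, M, hb⟩, ?_, hb⟩
  · exact measurable_const.max (measurable_const.min hu.1.stronglyMeasurable_mk.measurable)
  · have h1 := ae_le_eLpNormEssSup (f := u) (μ := μ)
    filter_upwards [hu.1.ae_eq_mk, h1] with x hx h2
    rw [← eLpNorm_exponent_top, ← ofReal_norm] at h2
    have h3 := (ENNReal.ofReal_le_iff_le_toReal hu.2.ne).1 h2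
    rw [Real.norm_eq_abs, abs_le] at h3
    simp only [← hx]
    rw [min_eq_right h3.2, max_eq_right h3.1]

/-- The truncation to an open set of a function of finite Hölder norm. -/
lemma exists_bddMeas_of_holderNorm {α : ℝ} {S : Set E} (hS : IsOpen S) {f : E → ℝ} (hf : holderNorm α S f < ⊤) :
    ∃ F : bddMeas E, F.1 = S.indicator f := by
  refine ⟨⟨S.indicator f, ?_, (holderNorm α S f).toReal, fun x => ?_⟩, rfl⟩
  · classical
    have h := ContinuousOn.measurable_piecewise (f := f) (g := fun _ => (0:ℝ)) (s := S)
      (contDiffOn_of_holderNorm_lt_top hf).continuousOn continuousOn_const hS.measurableSet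
    convert h using 1
    exact piecewise_eq_indicator.symm
  · by_cases hx : x ∈ S
    · rw [indicator_of_mem hx]; exact abs_le_holderNorm hf hx
    · rw [indicator_of_notMem hx, abs_zero]; exact ENNReal.toReal_nonneg

end Estimates

/-! ### Translation of the given weak formulation. -/

section Wrapper

/-- The kernel of the adjoint operator. -/
def adjKer {n : ℕ} (K : EuclideanSpace ℝ (Fin n) → ℝ) : EuclideanSpace ℝ (Fin n) → ℝ :=
  fun y => ({0}ᶜ : Set (EuclideanSpace ℝ (Fin n))).indicator K (-y)

/-- On test functions the adjoint operator agrees with the Lévy form, since changing the kernel at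
the origin affects no integral; the right-hand side is extended by zero. -/
lemma IsWeakSolution.weakEq {n : ℕ} (hn : 1 ≤ n) {s lam Λ : ℝ} (hs0 : 0 < s) (hs1 : s < 1)
    (hl : 0 < lam) (hlΛ : lam ≤ Λ) {K : EuclideanSpace ℝ (Fin n) → ℝ}
    {b : EuclideanSpace ℝ (Fin n)} (h : IsStableData n s lam Λ K b) {u f U F : EuclideanSpace ℝ (Fin n) → ℝ}
    {Ω : Set (EuclideanSpace ℝ (Fin n))} (hΩ : MeasurableSet Ω)
    (hw : IsWeakSolution s K b Ω u f) (hU : U =ᵐ[volume] u) (hF : F =ᵐ[volume] Ω.indicator f) :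
    WeakEq s (adjKer K) (-b) Ω U F := by
  intro η hη hc hs
  have : Nontrivial (EuclideanSpace ℝ (Fin n)) := by
    have : Nonempty (Fin n) := ⟨⟨0, hn⟩⟩
    infer_instance
  have hΛ : 0 ≤ Λ := (hl.trans_le hlΛ).le
  have hK := (h.stableKer hn hs0 hs1 hl hlΛ).reflect
  obtain ⟨M, hM⟩ := exists_bddC2_of_hasCompactSupport (hη.of_le (WithTop.coe_le_coe.2 le_top)) hc
  have hae : (fun y => K (-y)) =ᵐ[volume] adjKer K := by
    have h0 : ∀ᵐ y : EuclideanSpace ℝ (Fin n), y ≠ 0 := by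
      rw [ae_iff]
      simp
    filter_upwards [h0] with y hy
    rw [adjKer, indicator_of_mem (by simpa using hy)]
  have e : ∀ x, stableOpAdjoint s K b η x = levyOp s (adjKer K) (-b) η x := fun x =>
    stableOp_eq_levyOp hs0 hs1 hΛ hK hae hM x
  have h1 := hw η hη hc hs
  simp only [e] at h1
  rw [← integral_indicator hΩ] at h1
  rw [integral_congr_ae (hU.mono fun x hx => by simp only [hx] : (fun x => U x * levyOp s (adjKer K) (-b) η x) =ᵐ[volume]
    fun x => u x * levyOp s (adjKer K) (-b) η x), h1]
  refine integral_congr_ae (hF.mono fun x hx => ?_)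
  simp only [hx]
  by_cases hx : x ∈ Ω
  · rw [indicator_of_mem hx, indicator_of_mem hx]
  · rw [indicator_of_notMem hx, indicator_of_notMem hx, zero_mul]

lemma le_toNNReal_mul_of_le_ofReal {C a b : ℝ} {x A B : ℝ≥0∞} (hC : 0 ≤ C) (ha : 0 ≤ a) (hb : 0 ≤ b)
    (hA : ENNReal.ofReal a ≤ A) (hB : ENNReal.ofReal b ≤ B) {D : ℝ} (hCD : C ≤ D)
    (h : x ≤ ENNReal.ofReal (C * (a + b))) : x ≤ ((D.toNNReal : ℝ≥0) : ℝ≥0∞) * (A + B) := by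
  refine h.trans ?_
  rw [ENNReal.ofReal_mul hC, ENNReal.ofReal_add ha hb]
  exact mul_le_mul' (ENNReal.ofReal_le_ofReal hCD) (add_le_add hA hB)

end Wrapper

/-! ### The kernel away from the origin, for angular parts of class `C^α`. -/

section FarKernel

open Module

variable {E : Type} [NormedAddCommGroup E] [InnerProductSpace ℝ E] [FiniteDimensional ℝ E]
  [MeasurableSpace E] [BorelSpace E]

variable {s c Λ : ℝ} {K : E → ℝ} {b : E}

lemma contDiffOn_norm_rpow (e : ℝ) : ContDiffOn ℝ ∞ (fun z : E => ‖z‖ ^ e) {0}ᶜ := fun z hz =>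
  ((contDiffAt_norm ℝ hz).rpow_const_of_ne (norm_ne_zero_iff.2 hz)).contDiffWithinAt

lemma exists_iteratedFDeriv_norm_rpow_le (e : ℝ) (n : ℕ) : ∃ P : ℝ, 0 ≤ P ∧ ∀ l ≤ n, ∀ z : E, 1 / 2 ≤ ‖z‖ → ‖z‖ ≤ 2 →
    ‖iteratedFDeriv ℝ l (fun z : E => ‖z‖ ^ e) z‖ ≤ P := by
  have hc : IsCompact ({z : E | 1 / 2 ≤ ‖z‖ ∧ ‖z‖ ≤ 2}) := by
    have h1 : IsClosed {z : E | 1 / 2 ≤ ‖z‖} := isClosed_le continuous_const continuous_norm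
    refine ((isCompact_closedBall (0:E) 2).inter_right h1).of_isClosed_subset
      (h1.inter (isClosed_le continuous_norm continuous_const)) fun z hz => ⟨by simpa using hz.2, hz.1⟩
  have h1 : ∀ l : ℕ, ∃ C, ∀ z ∈ ({z : E | 1 / 2 ≤ ‖z‖ ∧ ‖z‖ ≤ 2}), ‖iteratedFDeriv ℝ l (fun z : E => ‖z‖ ^ e) z‖ ≤ C := by
    intro l
    refine hc.exists_bound_of_continuousOn ?_
    have hop : IsOpen ({0}ᶜ : Set E) := isOpen_compl_singleton
    have h2 := (contDiffOn_norm_rpow (E := E) e).continuousOn_iteratedFDerivWithin (m := l) (by exact_mod_cast le_top) hop.uniqueDiffOn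
    refine (h2.congr fun z hz => (iteratedFDerivWithin_of_isOpen l hop hz).symm).mono fun z hz h0 => ?_
    rw [mem_singleton_iff] at h0
    have := hz.1
    rw [h0, norm_zero] at this
    norm_num at this
  choose C hC using h1
  refine ⟨∑ i ∈ Finset.range (n + 1), |C i|, Finset.sum_nonneg fun i _ => abs_nonneg _, fun l hl z h2 h3 => ?_⟩
  exact (hC l z ⟨h2, h3⟩).trans ((le_abs_self _).trans
    (Finset.single_le_sum (f := fun i => |C i|) (fun i _ => abs_nonneg _) (Finset.mem_range.2 (by omega))))

/-- The exponent of a kernel of order `2s`. -/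
def kerExp (E : Type) [NormedAddCommGroup E] [InnerProductSpace ℝ E] (s : ℝ) : ℝ := -(finrank ℝ E : ℝ) - 2 * s

lemma HomogKernel.eq_rpow_mul (hK : HomogKernel s K) {t : ℝ} (ht : 0 < t) (z : E) :
    K z = t ^ kerExp E s * K (t⁻¹ • z) := by
  have := hK t ht (t⁻¹ • z)
  rwa [smul_inv_smul₀ ht.ne'] at this

lemma norm_mem_of_mem_closedBall {v₀ z : E} {a : ℝ} (hz : z ∈ Metric.closedBall v₀ a) : ‖v₀‖ - a ≤ ‖z‖ ∧ ‖z‖ ≤ ‖v₀‖ + a := by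
  rw [mem_closedBall_iff_norm] at hz
  constructor
  · have : ‖v₀‖ ≤ ‖z‖ + ‖z - v₀‖ := by simpa using norm_sub_le z (z - v₀)
    linarith
  · have : ‖z‖ ≤ ‖z - v₀‖ + ‖v₀‖ := by simpa using norm_add_le (z - v₀) v₀
    linarith

lemma isOpen_annulus : IsOpen {y : E | 1 / 2 < ‖y‖ ∧ ‖y‖ < 2} :=
  (isOpen_lt continuous_const continuous_norm).inter (isOpen_lt continuous_norm continuous_const)

/-- Iterated differences of a homogeneous kernel on the unit sphere. -/
lemma exists_abs_fdiffs_kernel_le {α : ℝ} (hα : 0 < α) (s : ℝ) (n : ℕ) {M : ℝ} (hM : 0 ≤ M) : ∃ N : ℝ, 0 ≤ N ∧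
    ∀ K : E → ℝ, HomogKernel s K → sphereHolderNorm α K ≤ ENNReal.ofReal M → ∀ v₀ : E, ‖v₀‖ = 1 →
    ∀ r : ℝ, 0 < r → 8 * (n + 1) * r ≤ 1 → ∀ L : List E, L.length ≤ n → (∀ h ∈ L, ‖h‖ ≤ r) →
      |fdiffs L K v₀| ≤ N * r ^ min (L.length : ℝ) α := by
  obtain ⟨P, hP, hPb⟩ := exists_iteratedFDeriv_norm_rpow_le (E := E) (kerExp E s) n
  refine ⟨2 ^ n * (2 ^ n * M * P), by positivity, fun K hK hKM v₀ hv₀ r hr hnr L hL hLr => ?_⟩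
  have hr1 : r ≤ 1 := by nlinarith [Nat.cast_nonneg (α := ℝ) n]
  have hfin : holderNorm α {y : E | 1 / 2 < ‖y‖ ∧ ‖y‖ < 2} (fun y => K (‖y‖⁻¹ • y)) < ⊤ := hKM.trans_lt ENNReal.ofReal_lt_top
  have hM' : (holderNorm α {y : E | 1 / 2 < ‖y‖ ∧ ‖y‖ < 2} (fun y => K (‖y‖⁻¹ • y))).toReal ≤ M :=
    ENNReal.toReal_le_of_le_ofReal hM hKM
  have hLn : (L.length : ℝ) * r ≤ 1 / 8 := by
    have : (L.length : ℝ) ≤ n := by exact_mod_cast hL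
    nlinarith
  have hann : ∀ z ∈ Metric.closedBall v₀ (1 / 4), 1 / 2 < ‖z‖ ∧ ‖z‖ < 2 := fun z hz => by
    have := norm_mem_of_mem_closedBall hz
    rw [hv₀] at this
    constructor <;> linarith [this.1, this.2]
  have hsub : ∀ L' : List E, L'.length ≤ L.length → ∀ z ∈ Metric.closedBall v₀ ((L.length - L'.length) * r),
      Metric.closedBall z (L'.length * r) ⊆ Metric.closedBall v₀ (1 / 4) := by
    intro L' _ z hz w hw
    rw [mem_closedBall_iff_norm] at *
    have := norm_sub_le_norm_sub_add_norm_sub w z v₀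
    nlinarith
  -- The kernel is the product of its extension constant along rays, of class `C^α`, and a power of
  -- the norm, smooth near the sphere. Iterated differences of products then apply.
  rw [fdiffs_congr hr.le L hLr (g := fun z => K (‖z‖⁻¹ • z) * ‖z‖ ^ kerExp E s) fun z hz => by
    have h1 := hann z (Metric.closedBall_subset_closedBall (by linarith) hz)
    rw [mul_comm]
    exact hK.eq_rpow_mul (by linarith [h1.1]) z]
  have key := abs_fdiffs_mul_le hα.le hr hr1 L.length (p := 0) (q := 0) (A := 2 ^ n * M) (B := P)
    (f := fun z => K (‖z‖⁻¹ • z)) (g := fun z => ‖z‖ ^ kerExp E s) (x := v₀) le_rfl le_rfl (by positivity) hP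
    (fun L' hL' hLr' z hz => by
      rw [add_zero]
      refine (abs_fdiffs_le_holderNorm hα hr hr1 isOpen_annulus hfin L' hLr' fun w hw => hann w (hsub L' hL' z hz hw)).trans ?_
      have : (2:ℝ) ^ L'.length ≤ 2 ^ n := pow_le_pow_right₀ (by norm_num) (hL'.trans hL)
      gcongr)
    (fun L' hL' hLr' z hz => by
      rw [add_zero]
      have hop : IsOpen ({0}ᶜ : Set E) := isOpen_compl_singleton
      have h1 := norm_fdiffs_le hr.le hop L' hLr' (f := fun z : E => ‖z‖ ^ kerExp E s) (x := z) (A := P)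
        ((contDiffOn_norm_rpow _).of_le (by exact_mod_cast le_top)) (fun w hw h0 => by
          have := (hann w (hsub L' hL' z hz hw)).1
          rw [mem_singleton_iff] at h0
          rw [h0, norm_zero] at this
          norm_num at this) (fun w hw => hPb _ (hL'.trans hL) w (hann w (hsub L' hL' z hz hw)).1.le (hann w (hsub L' hL' z hz hw)).2.le)
      refine h1.trans (mul_le_mul_of_nonneg_left ?_ hP)
      rw [← Real.rpow_natCast]
      exact Real.rpow_le_rpow_of_exponent_ge hr hr1 (min_le_left _ _)) L rfl hLr
  refine key.trans ?_
  simp only [add_zero]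
  have : (2:ℝ) ^ L.length ≤ 2 ^ n := pow_le_pow_right₀ (by norm_num) hL
  gcongr

/-- Iterated differences of a homogeneous kernel. -/
lemma exists_abs_fdiffs_kernel_le' {α : ℝ} (hα : 0 < α) (s : ℝ) (n : ℕ) {M : ℝ} (hM : 0 ≤ M) : ∃ N : ℝ, 0 ≤ N ∧
    ∀ K : E → ℝ, HomogKernel s K → sphereHolderNorm α K ≤ ENNReal.ofReal M → ∀ y : E, 0 < ‖y‖ →
    ∀ r : ℝ, 0 < r → 8 * (n + 1) * r ≤ ‖y‖ → ∀ L : List E, L.length ≤ n → (∀ h ∈ L, ‖h‖ ≤ r) →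
      |fdiffs L K y| ≤ N * ‖y‖ ^ kerExp E s * (r / ‖y‖) ^ min (L.length : ℝ) α := by
  obtain ⟨N, hN, h⟩ := exists_abs_fdiffs_kernel_le (E := E) hα s n hM
  refine ⟨N, hN, fun K hK hKM y hy r hr hnr L hL hLr => ?_⟩
  -- Reduction to the unit sphere: dilation by `‖y‖⁻¹` turns steps of length `r` into steps of
  -- length `r / ‖y‖`.
  have e : K = fun z => ‖y‖ ^ kerExp E s * K (‖y‖⁻¹ • z) := funext fun z => hK.eq_rpow_mul hy z
  have hmap := h K hK hKM (‖y‖⁻¹ • y) (by rw [norm_smul, norm_inv, norm_norm, inv_mul_cancel₀ hy.ne']) (r / ‖y‖) (by positivity)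
    (by rw [← mul_div_assoc, div_le_one hy]; exact hnr) (L.map (‖y‖⁻¹ • ·)) (by simpa using hL) (by
      intro h hh
      obtain ⟨a, ha, rfl⟩ := List.mem_map.1 hh
      rw [norm_smul, norm_inv, norm_norm, div_eq_inv_mul]
      exact mul_le_mul_of_nonneg_left (hLr a ha) (by positivity))
  rw [List.length_map] at hmap
  rw [e, fdiffs_const_mul, fdiffs_comp_smul, abs_mul, abs_of_nonneg (by positivity)]
  calc _ ≤ ‖y‖ ^ kerExp E s * (N * (r / ‖y‖) ^ min (L.length : ℝ) α) := by gcongr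
    _ = _ := by ring

lemma continuousOn_kernel {α : ℝ} (hK : HomogKernel s K) (hKM : sphereHolderNorm α K < ⊤) : ContinuousOn K {0}ᶜ := by
  have h1 := (contDiffOn_of_holderNorm_lt_top hKM).continuousOn
  have hn : ContinuousOn (fun z : E => ‖z‖⁻¹ • z) {0}ᶜ :=
    (continuous_norm.continuousOn.inv₀ fun z hz => norm_ne_zero_iff.2 hz).smul continuousOn_id
  have hunit : ∀ z : E, z ∈ ({0}ᶜ : Set E) → ‖‖z‖⁻¹ • z‖ = 1 := fun z hz => by
    rw [norm_smul, norm_inv, norm_norm, inv_mul_cancel₀ (norm_ne_zero_iff.2 hz)]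
  have h2 : ContinuousOn (fun z : E => K (‖‖z‖⁻¹ • z‖⁻¹ • (‖z‖⁻¹ • z))) {0}ᶜ :=
    h1.comp hn fun z hz => by
      change 1 / 2 < ‖‖z‖⁻¹ • z‖ ∧ ‖‖z‖⁻¹ • z‖ < 2
      rw [hunit z hz]; norm_num
  have h3 : ContinuousOn (fun z : E => ‖z‖ ^ kerExp E s) {0}ᶜ := (contDiffOn_norm_rpow _).continuousOn
  refine (h3.mul h2).congr fun z hz => ?_
  simp only [Pi.mul_apply]
  rw [hunit z hz, inv_one, one_smul]
  exact hK.eq_rpow_mul (norm_pos_iff.2 hz) z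

/-- A kernel cut off near the origin, with a weight controlling its iterated differences. -/
structure CutoffKernel (α κ r₁ C : ℝ) (m : ℕ) (K : E → ℝ) (K₂ : bddMeas E) : Prop where
  eq : ∀ y, κ ≤ ‖y‖ → K₂.1 y = K y
  integrable : Integrable K₂.1
  bound : ∫ y, |K₂.1 y| ≤ C
  weight : ∃ W : E → ℝ, Integrable W ∧ ∫ y, W y ≤ C ∧ ∀ r, 0 < r → r ≤ r₁ → ∀ L : List E, L.length = m →
    (∀ h ∈ L, ‖h‖ ≤ r) → ∀ y, |fdiffs L K₂.1 y| ≤ r ^ α * W y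

lemma norm_iteratedFDeriv_one_le (l : ℕ) (z : E) : ‖iteratedFDeriv ℝ l (fun _ : E => (1:ℝ)) z‖ ≤ 1 := by
  rcases l with _ | l
  · rw [norm_iteratedFDeriv_zero]; simp
  · rw [iteratedFDeriv_const_of_ne (Nat.succ_ne_zero l)]; simp

lemma rpow_le_of_half_le {y z : E} {e : ℝ} (he : e ≤ 0) (hy : 0 < ‖y‖) (h : ‖y‖ / 2 ≤ ‖z‖) :
    ‖z‖ ^ e ≤ 2 ^ (-e) * ‖y‖ ^ e := by
  refine (Real.rpow_le_rpow_of_nonpos (by positivity) h he).trans (le_of_eq ?_)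
  rw [Real.div_rpow hy.le (by norm_num), Real.rpow_neg (by norm_num)]
  field_simp

/-- With a cutoff `1 - χ` vanishing near the origin, the kernel and its differences of order `m`,
divided by `r^α`, are dominated by a multiple of `‖y‖ ^ (-n - 2s)` away from the origin, which is
integrable at infinity because `s > 0`. The bounds depend on the kernel only through its norm on the
sphere. -/
lemma exists_cutoffKernel {α : ℝ} (hα : 0 < α) (hs0 : 0 < s) {κ : ℝ} (hκ : 0 < κ) (hκ1 : κ ≤ 1) {m : ℕ} (hm : α ≤ m)
    {M : ℝ} (hM : 0 ≤ M) : ∃ C r₁ : ℝ, 0 ≤ C ∧ 0 < r₁ ∧ ∀ K : E → ℝ, HomogKernel s K →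
      sphereHolderNorm α K ≤ ENNReal.ofReal M → ∃ K₂ : bddMeas E, CutoffKernel α κ r₁ C m K K₂ := by
  set e := kerExp E s with he
  have he0 : e ≤ 0 := by rw [he, kerExp]; have := Nat.cast_nonneg (α := ℝ) (finrank ℝ E); linarith
  obtain ⟨N, hN, hdiff⟩ := exists_abs_fdiffs_kernel_le' (E := E) hα s m hM
  let χ : ContDiffBump (0 : E) := ⟨κ / 2, κ, by positivity, half_lt_self hκ⟩
  obtain ⟨P, hP, hPb⟩ := exists_iteratedFDeriv_bound_of_hasCompactSupport (χ.contDiff (n := ⊤)) χ.hasCompactSupport m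
  -- the integrable weight
  set w : E → ℝ := (Metric.ball (0:E) (κ / 4))ᶜ.indicator fun y => ‖y‖ ^ e with hw
  have hw0 : ∀ y, 0 ≤ w y := fun y => indicator_nonneg (fun y _ => by positivity) y
  have hwi : Integrable w := by
    have h1 : Integrable fun y : E => (4 / κ + 1) ^ (-e) * (1 + ‖y‖) ^ (-(-e)) := by
      refine Integrable.const_mul (integrable_one_add_norm ?_) _
      rw [he, kerExp]; linarith
    refine h1.mono' ?_ (Eventually.of_forall fun y => ?_)
    · exact (Measurable.indicator (by fun_prop) Metric.isOpen_ball.measurableSet.compl).aestronglyMeasurable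
    · rw [Real.norm_of_nonneg (hw0 y)]
      by_cases hy : y ∈ (Metric.ball (0:E) (κ / 4))ᶜ
      · rw [hw, indicator_of_mem hy]
        have hy2 : κ / 4 ≤ ‖y‖ := by simpa using hy
        have hy0 : 0 < ‖y‖ := by linarith
        have h2 : (4 / κ + 1)⁻¹ * (1 + ‖y‖) ≤ ‖y‖ := by
          rw [inv_mul_le_iff₀ (by positivity)]
          have : 4 / κ * (κ / 4) ≤ 4 / κ * ‖y‖ := by gcongr
          have h3 : 4 / κ * (κ / 4) = 1 := by field_simp
          linarith
        have h3 := Real.rpow_le_rpow_of_nonpos (by positivity) h2 he0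
        rw [Real.mul_rpow (by positivity) (by positivity), Real.inv_rpow (by positivity), ← Real.rpow_neg (by positivity)] at h3
        rw [neg_neg]
        exact h3
      · rw [hw, indicator_of_notMem hy]; positivity
  set I : ℝ := ∫ y, w y with hI
  have hI0 : 0 ≤ I := integral_nonneg hw0
  set A : ℝ := 2 ^ m * (N * 2 ^ (-e) * (κ / 8) ^ (-α) * (1 + P)) with hA
  refine ⟨max (A * I) (N * 1 * I), κ / (64 * (m + 1)), by positivity, by positivity, fun K hK hKM => ?_⟩
  have hKc := continuousOn_kernel hK (hKM.trans_lt ENNReal.ofReal_lt_top)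
  set k₂ : E → ℝ := fun y => (1 - χ y) * K y with hk₂
  have hzero : ∀ y : E, ‖y‖ ≤ κ / 2 → k₂ y = 0 := fun y hy => by
    simp only [hk₂]
    rw [χ.one_of_mem_closedBall (by simpa using hy), sub_self, zero_mul]
  have hχ01 : ∀ y : E, |1 - χ y| ≤ 1 := fun y => by
    have := χ.nonneg (x := y); have := χ.le_one (x := y)
    rw [abs_le]; constructor <;> linarith
  -- The case of no differences gives the pointwise size of the kernel; the step size is then
  -- immaterial and is taken as large as allowed.
  have hKb : ∀ y : E, 0 < ‖y‖ → |K y| ≤ N * ‖y‖ ^ e := fun y hy => by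
    have h1 := hdiff K hK hKM y hy (‖y‖ / (8 * (m + 1))) (by positivity) (le_of_eq (by field_simp)) [] (by simp) (by simp)
    have h2 : min ((([] : List E).length : ℕ) : ℝ) α = 0 := by simp [hα.le]
    rwa [h2, Real.rpow_zero, mul_one, fdiffs_nil] at h1
  have hk₂w : ∀ y, |k₂ y| ≤ N * 1 * w y := fun y => by
    by_cases hy : ‖y‖ ≤ κ / 2
    · rw [hzero y hy, abs_zero]; exact mul_nonneg (by positivity) (hw0 y)
    · push Not at hy
      have h1 : y ∈ (Metric.ball (0:E) (κ / 4))ᶜ := by simp; linarith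
      simp only [hw, hk₂]
      rw [indicator_of_mem h1, abs_mul, mul_one]
      have := hKb y (by linarith)
      have h2 := hχ01 y
      calc _ ≤ 1 * (N * ‖y‖ ^ e) := by gcongr
        _ = _ := one_mul _
  have hk₂c : Continuous k₂ := by
    rw [continuous_iff_continuousAt]
    intro y
    by_cases hy : ‖y‖ < κ / 2
    · have : k₂ =ᶠ[𝓝 y] fun _ => 0 := by
        filter_upwards [(isOpen_lt continuous_norm continuous_const).mem_nhds hy] with z hz using hzero z (le_of_lt hz)
      exact this.continuousAt
    · have hy0 : y ∈ ({0}ᶜ : Set E) := fun h0 => hy (by rw [mem_singleton_iff.1 h0, norm_zero]; positivity)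
      exact (continuousAt_const.sub χ.continuous.continuousAt).mul (hKc.continuousAt (isOpen_compl_singleton.mem_nhds hy0))
  have hwb : ∀ y, w y ≤ (κ / 4) ^ e := fun y => by
    by_cases hy : y ∈ (Metric.ball (0:E) (κ / 4))ᶜ
    · rw [hw, indicator_of_mem hy]
      exact Real.rpow_le_rpow_of_nonpos (by positivity) (by simpa using hy) he0
    · rw [hw, indicator_of_notMem hy]; positivity
  refine ⟨⟨k₂, hk₂c.measurable, N * 1 * (κ / 4) ^ e, fun y => (hk₂w y).trans (mul_le_mul_of_nonneg_left (hwb y) (by positivity))⟩, ?_⟩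
  refine ⟨fun y hy => ?_, ?_, ?_, fun y => A * w y, hwi.const_mul A, ?_, ?_⟩
  · change (1 - χ y) * K y = K y
    rw [χ.zero_of_le_dist (by simpa using hy), sub_zero, one_mul]
  · exact (hwi.const_mul (N * 1)).mono' hk₂c.aestronglyMeasurable (Eventually.of_forall hk₂w)
  · refine le_trans ?_ (le_max_right _ _)
    rw [← integral_const_mul]
    exact integral_mono_of_nonneg (Eventually.of_forall fun y => abs_nonneg _) (hwi.const_mul _) (Eventually.of_forall hk₂w)
  · rw [integral_const_mul]; exact le_max_left _ _
  · intro r hr hr₁ L hL hLr y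
    change |fdiffs L k₂ y| ≤ r ^ α * (A * w y)
    have hmr : 64 * ((m + 1) * r) ≤ κ := by
      rw [le_div_iff₀ (by positivity)] at hr₁; linarith
    have hr1 : r ≤ 1 := by nlinarith [Nat.cast_nonneg (α := ℝ) m]
    have hm0 : (0:ℝ) ≤ m := Nat.cast_nonneg m
    by_cases hy : ‖y‖ < κ / 4
    · rw [fdiffs_congr hr.le L hLr (g := fun _ => (0:ℝ)) fun z hz => ?_]
      · have h0 : fdiffs L (fun _ : E => (0:ℝ)) y = 0 := by
          have := fdiffs_const_mul L 0 (fun _ : E => (0:ℝ)) y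
          simpa using this
        rw [h0, abs_zero]
        exact mul_nonneg (by positivity) (mul_nonneg (by positivity) (hw0 y))
      · refine hzero z ?_
        have := (norm_mem_of_mem_closedBall hz).2
        rw [hL] at this
        nlinarith
    · push Not at hy
      have hy0 : 0 < ‖y‖ := by linarith
      have hyw : w y = ‖y‖ ^ e := by rw [hw, indicator_of_mem (by simpa using hy)]
      -- All points met by the differences stay at distance at least `‖y‖ / 2` from the origin,
      -- because `m r` is small compared with `κ ≤ 4 ‖y‖`.
      have hz : ∀ L' : List E, ∀ z ∈ Metric.closedBall y ((m - L'.length) * r), ‖y‖ / 2 ≤ ‖z‖ := fun L' z hz => by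
        have h1 := (norm_mem_of_mem_closedBall hz).1
        have h2 : ((m:ℝ) - L'.length) * r ≤ m * r := by
          gcongr
          have : (0:ℝ) ≤ L'.length := Nat.cast_nonneg _
          linarith
        nlinarith
      have key := abs_fdiffs_mul_le hα.le hr hr1 m (p := 0) (q := 0) (A := 1 + P) (B := N * 2 ^ (-e) * (κ / 8) ^ (-α) * ‖y‖ ^ e)
        (f := fun z => 1 - χ z) (g := K) (x := y) le_rfl le_rfl (by positivity) (by positivity)
        (fun L' hL' hLr' z hz => by
          rw [add_zero]
          have h1 := norm_fdiffs_le hr.le isOpen_univ L' hLr' (f := fun z : E => 1 - χ z) (x := z) (A := 1 + P)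
            (contDiff_const.sub χ.contDiff).contDiffOn (subset_univ _) (fun v _ => by
              have e1 : iteratedFDeriv ℝ L'.length (fun z : E => 1 - χ z) v =
                iteratedFDeriv ℝ L'.length (fun _ : E => (1:ℝ)) v - iteratedFDeriv ℝ L'.length χ v :=
                iteratedFDeriv_sub_apply contDiff_const.contDiffAt χ.contDiff.contDiffAt
              rw [e1]
              exact (norm_sub_le _ _).trans (add_le_add (norm_iteratedFDeriv_one_le _ _) (hPb _ hL' v)))
          refine h1.trans (mul_le_mul_of_nonneg_left ?_ (by positivity))
          rw [← Real.rpow_natCast]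
          exact Real.rpow_le_rpow_of_exponent_ge hr hr1 (min_le_left _ _))
        (fun L' hL' hLr' z hzb => by
          rw [add_zero]
          have hz2 := hz L' z hzb
          have hz0 : 0 < ‖z‖ := by linarith
          have hz8 : κ / 8 ≤ ‖z‖ := by linarith
          have h1 := hdiff K hK hKM z hz0 r hr (by nlinarith) L' hL' hLr'
          refine h1.trans ?_
          set μ := min (L'.length : ℝ) α with hμ
          have hμ0 : 0 ≤ μ := le_min (Nat.cast_nonneg _) hα.le
          have h2 : (r / ‖z‖) ^ μ ≤ (κ / 8) ^ (-α) * r ^ μ := by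
            rw [Real.div_rpow hr.le hz0.le, div_eq_inv_mul]
            gcongr
            rw [← Real.rpow_neg hz0.le]
            calc ‖z‖ ^ (-μ) ≤ (κ / 8) ^ (-μ) := Real.rpow_le_rpow_of_nonpos (by positivity) hz8 (by linarith)
              _ ≤ (κ / 8) ^ (-α) := Real.rpow_le_rpow_of_exponent_ge (by positivity) (by linarith)
                (by have := min_le_right (L'.length : ℝ) α; linarith)
          have h3 := rpow_le_of_half_le he0 hy0 hz2
          calc _ ≤ N * (2 ^ (-e) * ‖y‖ ^ e) * ((κ / 8) ^ (-α) * r ^ μ) := by gcongr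
            _ = _ := by ring) L hL hLr
      simp only [add_zero, min_eq_right hm] at key
      refine key.trans (le_of_eq ?_)
      rw [hyw, hA]; ring

end FarKernel

/-! ### Improving the decay for solutions that are only bounded at infinity. -/

section FarPart

open Module

variable {E : Type} [NormedAddCommGroup E] [InnerProductSpace ℝ E] [FiniteDimensional ℝ E]
  [MeasurableSpace E] [BorelSpace E]

variable {s c Λ : ℝ} {K : E → ℝ} {b : E}

lemma integrable_avg {g : bddMeas E} (hg : Integrable g.1) {r : ℝ} (hr : 0 < r) : Integrable (avg r g).1 := by
  have h := hg.integrable_convolution (ContinuousLinearMap.lsmul ℝ ℝ)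
    ((avgKerScaled_contDiff (E := E) r).continuous.integrable_of_hasCompactSupport (μ := volume) (avgKerScaled_hasCompactSupport hr))
  rw [show (avg r g).1 = _ from funext fun x => avg_eq_integral g hr x]
  exact h

lemma integral_one_sub_avg_pow_mul_comm {r : ℝ} (hr : 0 < r) (m : ℕ) : ∀ (u g : bddMeas E), Integrable g.1 →
    ∫ x, (((1 - avg r) ^ m) u : bddMeas E).1 x * g.1 x = ∫ x, u.1 x * (((1 - avg r) ^ m) g : bddMeas E).1 x := by
  induction m with
  | zero => intro u g _; simp
  | succ m ih =>
    intro u g hg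
    have hg' : Integrable ((1 - avg r) g : bddMeas E).1 := hg.sub (integrable_avg hg hr)
    rw [pow_succ', Module.End.mul_apply, ← pow_succ', pow_succ, Module.End.mul_apply, ← ih u _ hg']
    set v : bddMeas E := ((1 - avg r) ^ m) u
    have e1 : ∫ x, ((1 - avg r) v : bddMeas E).1 x * g.1 x = (∫ x, v.1 x * g.1 x) - ∫ x, (avg r v).1 x * g.1 x := by
      rw [← integral_sub (bddMeas.integrable_mul v hg) (bddMeas.integrable_mul _ hg)]
      exact integral_congr_ae (Eventually.of_forall fun x => by simp only [coe_one_sub_avg, sub_mul])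
    have e2 : ∫ x, v.1 x * ((1 - avg r) g : bddMeas E).1 x = (∫ x, v.1 x * g.1 x) - ∫ x, v.1 x * (avg r g).1 x := by
      rw [← integral_sub (bddMeas.integrable_mul v hg) (bddMeas.integrable_mul v (integrable_avg hg hr))]
      exact integral_congr_ae (Eventually.of_forall fun x => by simp only [coe_one_sub_avg, mul_sub])
    rw [e1, e2, integral_avg_mul_comm v g r hg]

lemma abs_integral_mul_le {u k : E → ℝ} {M : ℝ} (hk : Integrable k) (h : ∀ x, |u x| ≤ M) :
    |∫ x, u x * k x| ≤ M * ∫ x, |k x| := by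
  have h1 := norm_integral_le_of_norm_le (f := fun x => u x * k x) (g := fun x => M * |k x|) (hk.abs.const_mul M)
    (Eventually.of_forall fun x => by
      rw [norm_mul, Real.norm_eq_abs, Real.norm_eq_abs]
      exact mul_le_mul_of_nonneg_right (h x) (abs_nonneg _))
  rwa [integral_const_mul, Real.norm_eq_abs] at h1

/-- The correlation of a bounded function with an integrable kernel. -/
def correlate (V K₂ : bddMeas E) (hK : Integrable K₂.1) : bddMeas E :=
  ⟨fun z => ∫ x, V.1 x * K₂.1 (x - z), by
    obtain ⟨hV, M, hM⟩ := V.2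
    refine ⟨?_, M * ∫ x, |K₂.1 x|, fun z => ?_⟩
    · have h : Measurable fun p : E × E => V.1 p.2 * K₂.1 (p.2 - p.1) :=
        (hV.comp measurable_snd).mul (K₂.2.1.comp (measurable_snd.sub measurable_fst))
      exact h.stronglyMeasurable.integral_prod_right.measurable
    · refine (abs_integral_mul_le (hK.comp_sub_right z) hM).trans (le_of_eq ?_)
      rw [integral_sub_right_eq_self (fun x => |K₂.1 x|) z]⟩

lemma correlate_apply (V K₂ : bddMeas E) (hK : Integrable K₂.1) (z : E) :
    (correlate V K₂ hK).1 z = ∫ x, V.1 x * K₂.1 (x - z) := rfl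

/-- The equation of a truncated solution. -/
lemma WeakEq.restr_ball (hs0 : 0 < s) (hs1 : s < 1) (hΛ : 0 ≤ Λ) (hK : StableKer s c Λ K b) {R₁ R₂ κ : ℝ}
    (hκ : 0 < κ) (hR : R₂ + κ ≤ R₁) {V F K₂ : bddMeas E} (hw : WeakEq s K b (Metric.ball 0 R₂) V.1 F.1)
    (hK₂ : Integrable K₂.1) (hK₂' : ∀ y, κ ≤ ‖y‖ → K₂.1 y = K (-y)) :
    WeakEq s K b (Metric.ball 0 R₂) (restr (Metric.isOpen_ball (x := (0:E)) (ε := R₁)).measurableSet V).1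
      (F + correlate (V - restr (Metric.isOpen_ball (x := (0:E)) (ε := R₁)).measurableSet V) K₂ hK₂).1 := by
  intro η hη hc hs
  set hS := (Metric.isOpen_ball (x := (0:E)) (ε := R₁)).measurableSet
  set T : bddMeas E := V - restr hS V with hT
  have hTx : ∀ x, T.1 x = V.1 x - (restr hS V).1 x := fun x => rfl
  have hL := integrable_levyOp_of_hasCompactSupport hs0 hs1 hΛ hK hη hc
  have hηi : Integrable η := hη.continuous.integrable_of_hasCompactSupport hc
  have e1 : ∫ x, (restr hS V).1 x * levyOp s K b η x =
      (∫ x, V.1 x * levyOp s K b η x) - ∫ x, T.1 x * levyOp s K b η x := by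
    rw [← integral_sub (bddMeas.integrable_mul V hL) (bddMeas.integrable_mul T hL)]
    refine integral_congr_ae (Eventually.of_forall fun x => ?_)
    simp only [hTx]; ring
  -- The tail `T` lives where `η` vanishes, so there the operator reduces to `-∫ η (x + y) K y`.
  -- Only `‖y‖ ≥ κ` contributes, and `K y` may be replaced by the cut-off reflected kernel at `-y`.
  have e2 : ∀ x, T.1 x * levyOp s K b η x = -∫ z, T.1 x * (η z * K₂.1 (x - z)) := by
    intro x
    by_cases hx : x ∈ Metric.ball (0:E) R₁
    · have : T.1 x = 0 := by rw [hTx, restr_of_mem hS V hx, sub_self]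
      simp [this]
    · have hxn : x ∉ tsupport η := fun h => hx (Metric.ball_subset_ball (by linarith) (hs h))
      rw [levyOp_eq_of_notMem_tsupport s K b hxn, integral_const_mul, mul_neg,
        ← integral_add_left_eq_self (fun z => η z * K₂.1 (x - z)) x]
      congr 2
      refine integral_congr_ae (Eventually.of_forall fun y => ?_)
      simp only [sub_add_cancel_left]
      by_cases hy : x + y ∈ tsupport η
      · have h1 := mem_ball_zero_iff.1 (hs hy)
        have h2 : ‖x‖ ≤ ‖x + y‖ + ‖y‖ := by simpa using norm_sub_le (x + y) y
        have h3 : R₁ ≤ ‖x‖ := by simpa using hx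
        rw [hK₂' (-y) (by rw [norm_neg]; linarith), neg_neg]
      · rw [image_eq_zero_of_notMem_tsupport hy, zero_mul, zero_mul]
  have hprod : Integrable (fun p : E × E => T.1 p.1 * (η p.2 * K₂.1 (p.1 - p.2))) (volume.prod volume) := by
    have h1 : Integrable (fun p : E × E => η p.2 * K₂.1 (p.1 - p.2)) (volume.prod volume) :=
      hηi.convolution_integrand (ContinuousLinearMap.mul ℝ ℝ) hK₂
    obtain ⟨hTm, M, hM⟩ := T.2
    exact h1.bdd_mul (c := M) (f := fun p : E × E => T.1 p.1) (hTm.comp measurable_fst).aestronglyMeasurable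
      (Eventually.of_forall fun y => hM _)
  have e3 : ∫ x, T.1 x * levyOp s K b η x = -∫ z, (correlate T K₂ hK₂).1 z * η z := by
    simp only [e2]
    rw [integral_neg, integral_integral_swap hprod]
    congr 1
    refine integral_congr_ae (Eventually.of_forall fun z => ?_)
    simp only [correlate_apply, ← integral_mul_const]
    refine integral_congr_ae (Eventually.of_forall fun x => ?_)
    simp only; ring
  rw [e1, e3, hw η hη hc hs, sub_neg_eq_add,
    ← integral_add (bddMeas.integrable_mul F hηi) (bddMeas.integrable_mul _ hηi)]
  refine integral_congr_ae (Eventually.of_forall fun x => ?_)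
  have : (F + correlate T K₂ hK₂).1 x = F.1 x + (correlate T K₂ hK₂).1 x := rfl
  simp only [this]; ring

/-- Averages are symmetric, so `(1 - avg r)^m` passes from `u` to the kernel, where iterated
differences gain `r^α` with an integrable weight. Nothing but boundedness of `u` is used. -/
lemma abs_correlate_one_sub_avg_pow_le {α κ r₁ C : ℝ} {m : ℕ} {K₂ : bddMeas E} (h : CutoffKernel α κ r₁ C m K K₂)
    {u : bddMeas E} {M : ℝ} (hu : ∀ x, |u.1 x| ≤ M) {r : ℝ} (hr : 0 < r) (hr₁ : r ≤ r₁) (z : E) :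
    |∫ x, (((1 - avg r) ^ m) u : bddMeas E).1 x * K₂.1 (x - z)| ≤ M * (r ^ α * C) := by
  obtain ⟨W, hW, hWC, hWb⟩ := h.weight
  have hM0 : 0 ≤ M := (abs_nonneg _).trans (hu 0)
  have e : ∀ x, K₂.1 (x - z) = (shift (-z) K₂).1 x := fun x => by rw [shift_apply, sub_eq_add_neg]
  have hi : Integrable (shift (-z) K₂).1 := by
    have := h.integrable.comp_sub_right z
    exact this.congr (Eventually.of_forall e)
  simp only [e]
  rw [integral_one_sub_avg_pow_mul_comm hr m u _ hi]
  have hpt : ∀ x, |(((1 - avg r) ^ m) (shift (-z) K₂) : bddMeas E).1 x| ≤ r ^ α * W (x - z) := fun x =>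
    abs_one_sub_avg_pow_le_of_fdiffs hr.le m fun L hL hLr => by
      have e2 : fdiffs L (shift (-z) K₂).1 x = fdiffs L K₂.1 (x + -z) := fdiffs_comp_add L (-z) K₂.1 x
      rw [e2, ← sub_eq_add_neg]
      exact hWb r hr hr₁ L hL hLr _
  have h1 := norm_integral_le_of_norm_le (f := fun x => u.1 x * (((1 - avg r) ^ m) (shift (-z) K₂) : bddMeas E).1 x)
    (g := fun x => M * (r ^ α * W (x - z))) (((hW.comp_sub_right z).const_mul _).const_mul _) (Eventually.of_forall fun x => by
      rw [norm_mul, Real.norm_eq_abs, Real.norm_eq_abs]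
      exact mul_le_mul (hu x) (hpt x) (abs_nonneg _) hM0)
  rw [integral_const_mul, integral_const_mul, integral_sub_right_eq_self W z, Real.norm_eq_abs] at h1
  exact h1.trans (by gcongr)

/-- The differences of order `m` of solutions decay of order `e`, for kernels which are Hölder continuous
on the sphere. -/
def DecayEstimate (E : Type) [NormedAddCommGroup E] [InnerProductSpace ℝ E] [FiniteDimensional ℝ E]
    [MeasurableSpace E] [BorelSpace E] (s c Λ α M : ℝ) (m : ℕ) (e : ℝ) : Prop :=
  ∀ ρ < (9 / 10 : ℝ), ∃ C r₁ : ℝ, 0 ≤ C ∧ 0 < r₁ ∧ ∀ (K : E → ℝ) (b : E), StableKer s c Λ K b →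
    sphereHolderNorm α (fun y => K (-y)) ≤ ENNReal.ofReal M →
    ∀ (U F : bddMeas E) (MU : ℝ), (∀ x, |U.1 x| ≤ MU) → holderNorm α (Metric.ball 0 1) F.1 < ⊤ →
    WeakEq s K b (Metric.ball 0 1) U.1 F.1 → ContinuousOn U.1 (Metric.ball 0 (9 / 10)) →
    ∀ r, 0 < r → r ≤ r₁ → ∀ x ∈ Metric.ball (0:E) ρ, |(((1 - avg r) ^ m) U : bddMeas E).1 x| ≤
      C * r ^ e * (MU + (holderNorm α (Metric.ball 0 1) F.1).toReal)

lemma decayEstimate_zero (s c Λ α M : ℝ) (m : ℕ) : DecayEstimate E s c Λ α M m 0 := by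
  refine fun ρ _ => ⟨2 ^ m, 1, by positivity, one_pos, fun K b _ _ U F MU hU _ _ _ r hr _ x _ => ?_⟩
  refine (abs_one_sub_avg_pow_le hr.le m fun z _ => hU z).trans ?_
  rw [Real.rpow_zero, mul_one]
  have : 0 ≤ (holderNorm α (Metric.ball 0 1) F.1).toReal := ENNReal.toReal_nonneg
  gcongr
  linarith

/-- The function `(1 - avg r)^m U` has size `r^e` in a ball only, so it is truncated there. The tail
enters the right-hand side as a correlation with the far kernel: the whole function contributes
`r^α` by symmetry, the truncated part `r^e`. The basic estimate for the truncated function then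
gives `r^(2s) (r^e + r^α)` for one more factor `1 - avg r`, on a smaller ball. -/
lemma DecayEstimate.succ (hs0 : 0 < s) (hs1 : s < 1) (hc : 0 < c) (hΛ : 0 < Λ) {α M : ℝ} (hα : 0 < α) (hM : 0 ≤ M)
    {m : ℕ} (hm : ⌊α⌋₊ < m) {e e' : ℝ} (he' : e' ≤ e + 2 * s) (hα' : e' ≤ α + 2 * s)
    (h : DecayEstimate E s c Λ α M m e) : DecayEstimate E s c Λ α M (m + 1) e' := by
  intro ρ hρ
  set δ : ℝ := (9 / 10 - ρ) / 3 with hδ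
  have hδ0 : 0 < δ := by rw [hδ]; linarith
  obtain ⟨C₁, r₁, hC₁, hr₁, h1⟩ := h (ρ + 2 * δ) (by rw [hδ]; linarith)
  obtain ⟨C₂, r₂, hC₂, hr₂, h2⟩ := exists_cutoffKernel (E := E) hα hs0 (κ := min δ 1) (by positivity) (min_le_right _ _)
    ((Nat.lt_of_floor_lt hm).le) hM
  obtain ⟨C₃, r₃, hC₃, hr₃, h3⟩ := exists_sub_avg_le_ball (E := E) hs0 hs1 hc hΛ (R := ρ + δ) (R' := ρ) (by linarith)
  have hm0 : (0:ℝ) < m := by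
    have : 0 < m := by omega
    exact_mod_cast this
  refine ⟨C₃ * ((1 + C₂) * C₁ + 2 ^ m + C₂), min (min r₁ r₂) (min (min r₃ δ) (min 1 (1 / (20 * m)))), by positivity,
    by positivity, fun K b hK hKM U F MU hU hF hw hcont r hr hrr x hx => ?_⟩
  simp only [le_min_iff] at hrr
  obtain ⟨⟨hrr₁, hrr₂⟩, ⟨hrr₃, hrδ⟩, hr1, hrm⟩ := hrr
  have hmr : m * r ≤ 1 / 20 := by
    rw [le_div_iff₀ (by positivity)] at hrm; linarith
  set NF := (holderNorm α (Metric.ball 0 1) F.1).toReal with hNF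
  have hNF0 : 0 ≤ NF := ENNReal.toReal_nonneg
  have hMU0 : 0 ≤ MU := (abs_nonneg _).trans (hU 0)
  obtain ⟨K₂, hK₂⟩ := h2 (fun y => K (-y)) hK.reflect.homog hKM
  have hS := (Metric.isOpen_ball (x := (0:E)) (ε := ρ + 2 * δ)).measurableSet
  set V : bddMeas E := ((1 - avg r) ^ m) U with hV
  set B := C₁ * r ^ e * (MU + NF) with hB
  have hB0 : 0 ≤ B := by positivity
  have hVB : ∀ x ∈ Metric.ball (0:E) (ρ + 2 * δ), |V.1 x| ≤ B := h1 K b hK hKM U F MU hU hF hw hcont r hr hrr₁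
  have hRV : ∀ x, |(restr hS V).1 x| ≤ B := abs_restr_le hS V hB0 hVB
  have hw1 := (WeakEq.one_sub_avg_pow hs0 hs1 hΛ.le hK hr.le hw m).mono (Ω' := Metric.ball 0 (ρ + δ))
    (Metric.ball_subset_ball (by rw [hδ]; linarith))
  have hw2 := WeakEq.restr_ball hs0 hs1 hΛ.le hK (R₁ := ρ + 2 * δ) (κ := min δ 1) (by positivity)
    (by have := min_le_left δ 1; linarith) hw1 hK₂.integrable hK₂.eq
  set MF := 2 ^ m * NF * r ^ α + (MU * (r ^ α * C₂) + B * C₂) with hMF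
  have hF1 : ∀ x ∈ Metric.ball (0:E) (ρ + δ), |(((1 - avg r) ^ m) F : bddMeas E).1 x| ≤ 2 ^ m * NF * r ^ α := fun x hx => by
    refine abs_one_sub_avg_pow_le_holderNorm hα hr hr1 Metric.isOpen_ball hF hm ?_
    exact (Metric.closedBall_subset_ball (by linarith : m * r < 1 / 10)).trans (ball_subset_ball_zero hx (by rw [hδ]; linarith))
  have hG : ∀ z, |(correlate (V - restr hS V) K₂ hK₂.integrable).1 z| ≤ MU * (r ^ α * C₂) + B * C₂ := by
    intro z
    have hi := hK₂.integrable.comp_sub_right z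
    have e1 : (correlate (V - restr hS V) K₂ hK₂.integrable).1 z =
        (∫ x, V.1 x * K₂.1 (x - z)) - ∫ x, (restr hS V).1 x * K₂.1 (x - z) := by
      rw [← integral_sub (bddMeas.integrable_mul V hi) (bddMeas.integrable_mul _ hi), correlate_apply]
      refine integral_congr_ae (Eventually.of_forall fun x => ?_)
      have : (V - restr hS V).1 x = V.1 x - (restr hS V).1 x := rfl
      simp only [this, sub_mul]
    rw [e1]
    refine (abs_sub _ _).trans (add_le_add (abs_correlate_one_sub_avg_pow_le hK₂ hU hr hrr₂ z) ?_)
    refine (abs_integral_mul_le hi hRV).trans (mul_le_mul_of_nonneg_left ?_ hB0)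
    rw [integral_sub_right_eq_self (fun x => |K₂.1 x|) z]
    exact hK₂.bound
  have hVc : ContinuousOn (restr hS V).1 (Metric.ball 0 (ρ + δ)) := by
    refine ((continuousOn_one_sub_avg_pow hr hcont m).mono (Metric.ball_subset_ball (by rw [hδ]; linarith))).congr fun x hx => ?_
    exact restr_of_mem hS V (Metric.ball_subset_ball (by linarith) hx)
  have h4 := h3 K b hK _ _ B MF hRV (by positivity) (fun x hx =>
    (abs_add_le _ _).trans (add_le_add (hF1 x hx) (hG x))) hw2 hVc x hx r hr hrr₃
  -- As `r ≤ δ`, the last factor `1 - avg r` at `x` does not see the truncation.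
  have e5 : ((1 - avg r) (restr hS V) : bddMeas E).1 x = (((1 - avg r) ^ (m + 1)) U : bddMeas E).1 x := by
    have h6 := one_sub_avg_pow_congr hr.le 1 (u := restr hS V) (v := V) (x := x) fun z hz => by
      refine restr_of_mem hS V (ball_subset_ball_zero hx (δ := 2 * δ) le_rfl (Metric.closedBall_subset_ball ?_ hz))
      push_cast; linarith
    rw [pow_one] at h6
    rw [h6, pow_succ', Module.End.mul_apply]
  rw [e5] at h4
  refine h4.trans ?_
  have p1 : r ^ (2 * s) * r ^ e ≤ r ^ e' := by
    rw [← Real.rpow_add hr]; exact Real.rpow_le_rpow_of_exponent_ge hr hr1 (by linarith)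
  have p2 : r ^ (2 * s) * r ^ α ≤ r ^ e' := by
    rw [← Real.rpow_add hr]; exact Real.rpow_le_rpow_of_exponent_ge hr hr1 (by linarith)
  calc C₃ * r ^ (2 * s) * (B + MF) = C₃ * ((1 + C₂) * C₁ * (MU + NF) * (r ^ (2 * s) * r ^ e) +
        (2 ^ m * NF + C₂ * MU) * (r ^ (2 * s) * r ^ α)) := by rw [hMF, hB]; ring
    _ ≤ C₃ * ((1 + C₂) * C₁ * (MU + NF) * r ^ e' + (2 ^ m * NF + C₂ * MU) * r ^ e') := by gcongr
    _ ≤ C₃ * ((1 + C₂) * C₁ * (MU + NF) * r ^ e' + (2 ^ m * (MU + NF) + C₂ * (MU + NF)) * r ^ e') := by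
      gcongr <;> linarith
    _ = _ := by ring

/-- Interior regularity for kernels which are Hölder continuous on the sphere. -/
lemma exists_holderNorm_le_of_sphereHolderNorm (hs0 : 0 < s) (hs1 : s < 1) (hc : 0 < c) (hΛ : 0 < Λ) {α : ℝ} (hα : 0 < α)
    (hint : ∀ m : ℤ, α + 2 * s ≠ m) {M : ℝ} (hM : 0 ≤ M) :
    ∃ C : ℝ, 0 ≤ C ∧ ∀ (K : E → ℝ) (b : E), StableKer s c Λ K b →
      sphereHolderNorm α (fun y => K (-y)) ≤ ENNReal.ofReal M →
      ∀ (U F : bddMeas E) (MU : ℝ), (∀ x, |U.1 x| ≤ MU) → holderNorm α (Metric.ball 0 1) F.1 < ⊤ →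
      WeakEq s K b (Metric.ball 0 1) U.1 F.1 → ContinuousOn U.1 (Metric.ball 0 (9 / 10)) →
      holderNorm (α + 2 * s) (Metric.ball 0 (1 / 2)) U.1 ≤
        ENNReal.ofReal (C * (MU + (holderNorm α (Metric.ball 0 1) F.1).toReal)) := by
  -- Start from boundedness, which is decay of order zero; each round costs one power of `1 - avg r`
  -- and gains `2s`, until `α + 2s` is reached.
  have key : ∀ j : ℕ, DecayEstimate E s c Λ α M (⌊α⌋₊ + 1 + j) (min (2 * s * j) (α + 2 * s)) := by
    intro j
    induction j with
    | zero =>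
      have : min (2 * s * ((0 : ℕ) : ℝ)) (α + 2 * s) = 0 := by
        rw [Nat.cast_zero, mul_zero, min_eq_left (by positivity)]
      rw [this]
      exact decayEstimate_zero _ _ _ _ _ _
    | succ j ih =>
      refine ih.succ hs0 hs1 hc hΛ hα hM (by lia) ?_ (min_le_right _ _)
      rw [← min_add_add_right]
      refine min_le_min (le_of_eq ?_) (by linarith)
      push_cast; ring
  obtain ⟨J, hJ⟩ := exists_nat_ge ((α + 2 * s) / (2 * s))
  rw [div_le_iff₀ (by positivity)] at hJ
  have h := key J
  rw [min_eq_right (by linarith)] at h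
  obtain ⟨C, r₁, hC, hr₁, h1⟩ := h (3 / 4) (by norm_num)
  obtain ⟨i₀, hi₀⟩ := exists_half_pow_le hr₁
  obtain ⟨D, hD, h2⟩ := exists_holderNorm_le_of_approx (E := E) (β := α + 2 * s) (by linarith) le_rfl
    (floor_lt_of_forall_ne_int (by linarith) hint) (⌊α⌋₊ + 1 + J) i₀ (R := 3 / 4) (R' := 1 / 2) (by norm_num) (by norm_num)
  refine ⟨D * (1 + C), by positivity, fun K b hK hKM U F MU hU hF hw hcont => ?_⟩
  have hNF0 : 0 ≤ (holderNorm α (Metric.ball 0 1) F.1).toReal := ENNReal.toReal_nonneg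
  have hMU0 : 0 ≤ MU := (abs_nonneg _).trans (hU 0)
  rw [mul_assoc]
  refine h2 U _ (fun x => (hU x).trans ?_) fun i hi x hx => ?_
  · have : 0 ≤ C * (MU + (holderNorm α (Metric.ball 0 1) F.1).toReal) := by positivity
    linarith
  · refine (h1 K b hK hKM U F MU hU hF hw hcont _ (by positivity) (hi₀ i hi) x hx).trans ?_
    rw [mul_right_comm]
    gcongr
    linarith

end FarPart

/-! ### The estimates in terms of the given data. -/

section Statements

variable {n : ℕ} {s lam Λ : ℝ} {K : EuclideanSpace ℝ (Fin n) → ℝ} {b : EuclideanSpace ℝ (Fin n)}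

lemma IsStableData.stableKer_adjKer (hn : 1 ≤ n) (hs0 : 0 < s) (hs1 : s < 1) (hl : 0 < lam) (hlΛ : lam ≤ Λ)
    (h : IsStableData n s lam Λ K b) : StableKer s (ellipConst s lam Λ) Λ (adjKer K) (-b) :=
  (h.stableKer hn hs0 hs1 hl hlΛ).reflect

lemma sphereHolderNorm_adjKer (α : ℝ) (K : EuclideanSpace ℝ (Fin n) → ℝ) :
    sphereHolderNorm α (fun y => adjKer K (-y)) = sphereHolderNorm α K :=
  holderNorm_congr isOpen_annulus fun y hy => by
    have h0 : 0 < ‖y‖ := by linarith [hy.1]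
    simp only [adjKer, neg_neg]
    refine indicator_of_mem (fun h => ?_) K
    rw [mem_singleton_iff, smul_eq_zero, inv_eq_zero, norm_eq_zero, or_self] at h
    rw [h, norm_zero] at h0
    exact lt_irrefl _ h0

/-- A weak solution coincides almost everywhere with a function which is continuous in a smaller ball. -/
lemma IsWeakSolution.exists_continuous (hn : 1 ≤ n) (hs0 : 0 < s) (hs1 : s < 1) (hl : 0 < lam) (hlΛ : lam ≤ Λ)
    (h : IsStableData n s lam Λ K b) {u f : EuclideanSpace ℝ (Fin n) → ℝ} (hu : MemLp u ⊤ volume)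
    (hw : IsWeakSolution s K b (Metric.ball 0 1) u f) {F : bddMeas (EuclideanSpace ℝ (Fin n))}
    (hF : F.1 =ᵐ[volume] (Metric.ball 0 1).indicator f) :
    ∃ V : bddMeas (EuclideanSpace ℝ (Fin n)), V.1 =ᵐ[volume.restrict (Metric.ball 0 (1 / 2))] u ∧
      (∀ x, |V.1 x| ≤ (eLpNorm u ⊤ volume).toReal) ∧ WeakEq s (adjKer K) (-b) (Metric.ball 0 1) V.1 F.1 ∧
      ContinuousOn V.1 (Metric.ball 0 (9 / 10)) := by
  obtain ⟨U, hUu, hUb⟩ := exists_bddMeas_of_memLp hu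
  have hW := hw.weakEq hn hs0 hs1 hl hlΛ h Metric.isOpen_ball.measurableSet hUu hF
  obtain ⟨V, hVU, hVb, hVc⟩ := exists_continuous_representative hs0 hs1 (ellipConst_pos hs1 hl hlΛ) (hl.trans_le hlΛ)
    (h.stableKer_adjKer hn hs0 hs1 hl hlΛ) hUb hW
  exact ⟨V, ae_restrict_of_ae (hVU.trans hUu), hVb, hW.congr_ae hVU.symm, hVc⟩

/-- Regularity for bounded right-hand sides. -/
lemma exists_regularity_of_bounded (hn : 1 ≤ n) (hs0 : 0 < s) (hs1 : s < 1) (hl : 0 < lam) (hlΛ : lam ≤ Λ) :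
    ∃ C : ℝ≥0, 0 < C ∧
      ∀ (K : EuclideanSpace ℝ (Fin n) → ℝ) (b : EuclideanSpace ℝ (Fin n)), IsStableData n s lam Λ K b →
      ∀ u f : EuclideanSpace ℝ (Fin n) → ℝ,
        MemLp u ⊤ volume → MemLp f ⊤ (volume.restrict (Metric.ball 0 1)) →
        IsWeakSolution s K b (Metric.ball 0 1) u f →
        ∃ v : EuclideanSpace ℝ (Fin n) → ℝ,
          v =ᵐ[volume.restrict (Metric.ball 0 (1 / 2))] u ∧
          (s ≠ 1 / 2 → holderNorm (2 * s) (Metric.ball 0 (1 / 2)) v ≤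
            C * (eLpNorm u ⊤ volume + eLpNorm f ⊤ (volume.restrict (Metric.ball 0 1)))) ∧
          (s = 1 / 2 → zygmundNorm (Metric.ball 0 (1 / 2)) v ≤
            C * (eLpNorm u ⊤ volume + eLpNorm f ⊤ (volume.restrict (Metric.ball 0 1)))) ∧
          ∀ ε : ℝ, 0 < ε → ε < 2 * s →
            holderNorm (2 * s - ε) (Metric.ball 0 (1 / 2)) v < ⊤ := by
  have hΛ := hl.trans_le hlΛ
  have hc := ellipConst_pos hs1 hl hlΛ
  -- As `0 < 2s < 2`, the order `2s` is an integer only for `s = 1/2`.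
  have hfl : s ≠ 1 / 2 → (⌊2 * s⌋₊ : ℝ) < 2 * s := fun hs => by
    refine lt_of_le_of_ne (Nat.floor_le (by positivity)) fun he => hs ?_
    have h2 : ⌊2 * s⌋₊ < 2 := by
      rw [Nat.floor_lt (by positivity)]; push_cast; linarith
    have h3 : ⌊2 * s⌋₊ ≠ 0 := fun h0 => by
      rw [h0, Nat.cast_zero] at he; linarith
    have h4 : ⌊2 * s⌋₊ = 1 := by omega
    rw [h4, Nat.cast_one] at he
    linarith
  -- One constant has to serve both alternatives for `s`; in the excluded one it is `0`.
  obtain ⟨C₁, hC₁, h1⟩ : ∃ C : ℝ, 0 ≤ C ∧ (s ≠ 1 / 2 → ∀ (K : EuclideanSpace ℝ (Fin n) → ℝ)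
      (b : EuclideanSpace ℝ (Fin n)), StableKer s (ellipConst s lam Λ) Λ K b →
      ∀ (U F : bddMeas (EuclideanSpace ℝ (Fin n))) (MU MF : ℝ), (∀ x, |U.1 x| ≤ MU) → (∀ x, |F.1 x| ≤ MF) →
      WeakEq s K b (Metric.ball 0 (9 / 10)) U.1 F.1 → ContinuousOn U.1 (Metric.ball 0 (9 / 10)) →
      holderNorm (2 * s) (Metric.ball 0 (1 / 2)) U.1 ≤ ENNReal.ofReal (C * (MU + MF))) := by
    by_cases hs : s = 1 / 2
    · exact ⟨0, le_rfl, fun h => absurd hs h⟩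
    · obtain ⟨C, hC, h⟩ := exists_holderNorm_le_of_bounded (E := EuclideanSpace ℝ (Fin n)) hs0 hs1 hc hΛ
        (by positivity) le_rfl (hfl hs)
      exact ⟨C, hC, fun _ => h⟩
  obtain ⟨C₂, hC₂, h2⟩ : ∃ C : ℝ, 0 ≤ C ∧ (s = 1 / 2 → ∀ (K : EuclideanSpace ℝ (Fin n) → ℝ)
      (b : EuclideanSpace ℝ (Fin n)), StableKer s (ellipConst s lam Λ) Λ K b →
      ∀ (U F : bddMeas (EuclideanSpace ℝ (Fin n))) (MU MF : ℝ), (∀ x, |U.1 x| ≤ MU) → (∀ x, |F.1 x| ≤ MF) →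
      WeakEq s K b (Metric.ball 0 (9 / 10)) U.1 F.1 → ContinuousOn U.1 (Metric.ball 0 (9 / 10)) →
      zygmundNorm (Metric.ball 0 (1 / 2)) U.1 ≤ ENNReal.ofReal (C * (MU + MF))) := by
    by_cases hs : s = 1 / 2
    · obtain ⟨C, hC, h⟩ := exists_zygmundNorm_le_of_bounded (E := EuclideanSpace ℝ (Fin n)) hs hc hΛ
      exact ⟨C, hC, fun _ => h⟩
    · exact ⟨0, le_rfl, fun h => absurd h hs⟩
  refine ⟨(C₁ + C₂ + 1).toNNReal, Real.toNNReal_pos.2 (by positivity), fun K b h u f hu hf hw => ?_⟩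
  obtain ⟨F, hFf, hFb⟩ := exists_bddMeas_of_memLp hf
  have hB := (Metric.isOpen_ball (x := (0 : EuclideanSpace ℝ (Fin n))) (ε := 1)).measurableSet
  have hF : (restr hB F).1 =ᵐ[volume] (Metric.ball 0 1).indicator f := by
    have h3 := (ae_restrict_iff' hB).1 hFf
    filter_upwards [h3] with x hx
    by_cases hxB : x ∈ Metric.ball (0 : EuclideanSpace ℝ (Fin n)) 1
    · rw [restr_of_mem hB F hxB, indicator_of_mem hxB, hx hxB]
    · rw [restr_of_notMem hB F hxB, indicator_of_notMem hxB]
  obtain ⟨V, hVu, hVb, hVw, hVc⟩ := hw.exists_continuous hn hs0 hs1 hl hlΛ h hu hF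
  have hVw' := hVw.mono (Ω' := Metric.ball 0 (9 / 10)) (Metric.ball_subset_ball (by norm_num))
  have hK := h.stableKer_adjKer hn hs0 hs1 hl hlΛ
  have hFb' := abs_restr_le hB F ENNReal.toReal_nonneg fun x _ => hFb x
  refine ⟨V.1, hVu, fun hs => ?_, fun hs => ?_, fun ε hε hε2 => ?_⟩
  · exact le_toNNReal_mul_of_le_ofReal hC₁ ENNReal.toReal_nonneg ENNReal.toReal_nonneg ENNReal.ofReal_toReal_le
      ENNReal.ofReal_toReal_le (by linarith) (h1 hs _ _ hK V _ _ _ hVb hFb' hVw' hVc)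
  · exact le_toNNReal_mul_of_le_ofReal hC₂ ENNReal.toReal_nonneg ENNReal.toReal_nonneg ENNReal.ofReal_toReal_le
      ENNReal.ofReal_toReal_le (by linarith) (h2 hs _ _ hK V _ _ _ hVb hFb' hVw' hVc)
  · have hpos : 0 < 2 * s - ε := by linarith
    obtain ⟨C, -, h4⟩ := exists_holderNorm_le_of_bounded (E := EuclideanSpace ℝ (Fin n)) hs0 hs1 hc hΛ
      hpos (by linarith) ((Nat.floor_le hpos.le).trans_lt (by linarith))
    exact (h4 _ _ hK V _ _ _ hVb hFb' hVw' hVc).trans_lt ENNReal.ofReal_lt_top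

lemma exists_bddMeas_of_holderNorm_ball {α : ℝ} {f : EuclideanSpace ℝ (Fin n) → ℝ}
    (hf : holderNorm α (Metric.ball 0 1) f < ⊤) : ∃ F : bddMeas (EuclideanSpace ℝ (Fin n)),
    F.1 = (Metric.ball 0 1).indicator f ∧ holderNorm α (Metric.ball 0 1) F.1 = holderNorm α (Metric.ball 0 1) f := by
  obtain ⟨F, hF⟩ := exists_bddMeas_of_holderNorm Metric.isOpen_ball hf
  exact ⟨F, hF, holderNorm_congr Metric.isOpen_ball fun x hx => by rw [hF, indicator_of_mem hx]⟩

/-- Regularity for globally Hölder continuous solutions. -/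
lemma exists_regularity_of_holder (hn : 1 ≤ n) (hs0 : 0 < s) (hs1 : s < 1) (hl : 0 < lam) (hlΛ : lam ≤ Λ)
    {α : ℝ} (hα : 0 < α) (hint : ∀ m : ℤ, α + 2 * s ≠ m) :
    ∃ C : ℝ≥0, 0 < C ∧
      ∀ (K : EuclideanSpace ℝ (Fin n) → ℝ) (b : EuclideanSpace ℝ (Fin n)), IsStableData n s lam Λ K b →
      ∀ u f : EuclideanSpace ℝ (Fin n) → ℝ, holderNorm α (Metric.ball 0 1) f < ⊤ →
        IsWeakSolution s K b (Metric.ball 0 1) u f →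
        holderNorm (α + 2 * s) (Metric.ball 0 (1 / 2)) u ≤
          C * (holderNorm α univ u + holderNorm α (Metric.ball 0 1) f) := by
  obtain ⟨C, hC, h1⟩ := exists_holderNorm_le_of_holder (E := EuclideanSpace ℝ (Fin n)) hs0 hs1
    (ellipConst_pos hs1 hl hlΛ) (hl.trans_le hlΛ) hα hint
  have hpos : 0 < (C + 1).toNNReal := Real.toNNReal_pos.2 (by positivity)
  refine ⟨(C + 1).toNNReal, hpos, fun K b h u f hf hw => ?_⟩
  -- An infinite norm on the right leaves nothing to prove, provided that the constant is positive:
  -- `0 * ⊤ = 0`.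
  by_cases hu : holderNorm α univ u = ⊤
  · rw [hu, top_add, ENNReal.mul_top (by exact_mod_cast hpos.ne')]
    exact le_top
  obtain ⟨F, hF, hFn⟩ := exists_bddMeas_of_holderNorm_ball hf
  obtain ⟨U, hU⟩ := exists_bddMeas_of_holderNorm isOpen_univ (lt_top_iff_ne_top.2 hu)
  rw [indicator_univ] at hU
  subst hU
  have hW := hw.weakEq hn hs0 hs1 hl hlΛ h Metric.isOpen_ball.measurableSet (EventuallyEq.refl _ _)
    (Eventually.of_forall fun x => congrFun hF x)
  have h2 := h1 _ _ (h.stableKer_adjKer hn hs0 hs1 hl hlΛ) U F (lt_top_iff_ne_top.2 hu) (hFn ▸ hf) hW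
  rw [hFn] at h2
  exact le_toNNReal_mul_of_le_ofReal hC ENNReal.toReal_nonneg ENNReal.toReal_nonneg ENNReal.ofReal_toReal_le
    ENNReal.ofReal_toReal_le (by linarith) h2

/-- Regularity for kernels which are Hölder continuous on the sphere. -/
lemma exists_regularity_of_sphereHolderNorm (hn : 1 ≤ n) (hs0 : 0 < s) (hs1 : s < 1) (hl : 0 < lam) (hlΛ : lam ≤ Λ)
    {α : ℝ} (hα : 0 < α) (hint : ∀ m : ℤ, α + 2 * s ≠ m) (M : ℝ≥0) :
    ∃ C : ℝ≥0, 0 < C ∧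
      ∀ (K : EuclideanSpace ℝ (Fin n) → ℝ) (b : EuclideanSpace ℝ (Fin n)),
        IsStableData n s lam Λ K b → sphereHolderNorm α K ≤ M →
      ∀ u f : EuclideanSpace ℝ (Fin n) → ℝ,
        MemLp u ⊤ volume → holderNorm α (Metric.ball 0 1) f < ⊤ →
        IsWeakSolution s K b (Metric.ball 0 1) u f →
        ∃ v : EuclideanSpace ℝ (Fin n) → ℝ,
          v =ᵐ[volume.restrict (Metric.ball 0 (1 / 2))] u ∧
          holderNorm (α + 2 * s) (Metric.ball 0 (1 / 2)) v ≤
            C * (eLpNorm u ⊤ volume + holderNorm α (Metric.ball 0 1) f) := by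
  obtain ⟨C, hC, h1⟩ := exists_holderNorm_le_of_sphereHolderNorm (E := EuclideanSpace ℝ (Fin n)) hs0 hs1
    (ellipConst_pos hs1 hl hlΛ) (hl.trans_le hlΛ) hα hint M.coe_nonneg
  refine ⟨(C + 1).toNNReal, Real.toNNReal_pos.2 (by positivity), fun K b h hKM u f hu hf hw => ?_⟩
  obtain ⟨F, hF, hFn⟩ := exists_bddMeas_of_holderNorm_ball hf
  obtain ⟨V, hVu, hVb, hVw, hVc⟩ := hw.exists_continuous hn hs0 hs1 hl hlΛ h hu
    (Eventually.of_forall fun x => congrFun hF x)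
  have h2 := h1 _ _ (h.stableKer_adjKer hn hs0 hs1 hl hlΛ) (by
    rw [sphereHolderNorm_adjKer, ENNReal.ofReal_coe_nnreal]; exact hKM) V F _ hVb (hFn ▸ hf) hVw hVc
  rw [hFn] at h2
  exact ⟨V.1, hVu, le_toNNReal_mul_of_le_ofReal hC ENNReal.toReal_nonneg ENNReal.toReal_nonneg ENNReal.ofReal_toReal_le
    ENNReal.ofReal_toReal_le (by linarith) h2⟩

end Statements

theorem theorem1p1 (n : ℕ) (hn : 1 ≤ n) (s : ℝ) (hs0 : 0 < s) (hs1 : s < 1)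
    (lam Lam : ℝ) (hlam : 0 < lam) (hLam : lam ≤ Lam) :
    -- (a)
    (∃ C : ℝ≥0, 0 < C ∧
      ∀ (K : EuclideanSpace ℝ (Fin n) → ℝ) (b : EuclideanSpace ℝ (Fin n)),
        IsStableData n s lam Lam K b →
      ∀ u f : EuclideanSpace ℝ (Fin n) → ℝ,
        MemLp u ⊤ volume → MemLp f ⊤ (volume.restrict (Metric.ball 0 1)) →
        IsWeakSolution s K b (Metric.ball 0 1) u f →
        ∃ v : EuclideanSpace ℝ (Fin n) → ℝ,
          v =ᵐ[volume.restrict (Metric.ball 0 (1 / 2))] u ∧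
          (s ≠ 1 / 2 → holderNorm (2 * s) (Metric.ball 0 (1 / 2)) v ≤
            C * (eLpNorm u ⊤ volume + eLpNorm f ⊤ (volume.restrict (Metric.ball 0 1)))) ∧
          (s = 1 / 2 → zygmundNorm (Metric.ball 0 (1 / 2)) v ≤
            C * (eLpNorm u ⊤ volume + eLpNorm f ⊤ (volume.restrict (Metric.ball 0 1)))) ∧
          ∀ ε : ℝ, 0 < ε → ε < 2 * s →
            holderNorm (2 * s - ε) (Metric.ball 0 (1 / 2)) v < ⊤) ∧
    -- (b)
    (∀ α : ℝ, 0 < α → (∀ m : ℤ, α + 2 * s ≠ m) →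
      ∃ C : ℝ≥0, 0 < C ∧
      ∀ (K : EuclideanSpace ℝ (Fin n) → ℝ) (b : EuclideanSpace ℝ (Fin n)),
        IsStableData n s lam Lam K b →
      ∀ u f : EuclideanSpace ℝ (Fin n) → ℝ,
        MemLp u ⊤ volume → holderNorm α (Metric.ball 0 1) f < ⊤ →
        IsWeakSolution s K b (Metric.ball 0 1) u f →
        holderNorm (α + 2 * s) (Metric.ball 0 (1 / 2)) u ≤
          C * (holderNorm α univ u + holderNorm α (Metric.ball 0 1) f)) ∧
    -- (c)
    (∀ α : ℝ, 0 < α → (∀ m : ℤ, α + 2 * s ≠ m) → ∀ M : ℝ≥0,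
      ∃ C : ℝ≥0, 0 < C ∧
      ∀ (K : EuclideanSpace ℝ (Fin n) → ℝ) (b : EuclideanSpace ℝ (Fin n)),
        IsStableData n s lam Lam K b → sphereHolderNorm α K ≤ M →
      ∀ u f : EuclideanSpace ℝ (Fin n) → ℝ,
        MemLp u ⊤ volume → holderNorm α (Metric.ball 0 1) f < ⊤ →
        IsWeakSolution s K b (Metric.ball 0 1) u f →
        ∃ v : EuclideanSpace ℝ (Fin n) → ℝ,
          v =ᵐ[volume.restrict (Metric.ball 0 (1 / 2))] u ∧
          holderNorm (α + 2 * s) (Metric.ball 0 (1 / 2)) v ≤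
            C * (eLpNorm u ⊤ volume + holderNorm α (Metric.ball 0 1) f)) :=
  ⟨exists_regularity_of_bounded hn hs0 hs1 hlam hLam,
    fun _ hα hint => by
      obtain ⟨C, hC, h⟩ := exists_regularity_of_holder hn hs0 hs1 hlam hLam hα hint
      exact ⟨C, hC, fun K b hK u f _ => h K b hK u f⟩,
    fun _ hα hint => exists_regularity_of_sphereHolderNorm hn hs0 hs1 hlam hLam hα hint⟩

end
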